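/- **Model.** Algorithms are randomized word-RAM algorithms: one program for all input sizes, run on inputs with $n$ vertices with words of $c(\lfloor\log_2 n\rfloor+1)$ bits for a constant $c$ of the algorithm. An algorithm solves a problem in time $O(T)$ if there are constants $A, n_0$ such that on every admissible input with $n\ge n_0$ vertices it halts with a correct output within $A\cdot T$ steps with probability at least $2/3$. **Exact-$k$-Clique hypothesis** (for a fixed $k\ge 3$). Exact-$k$-Clique is the problem to decide, given an $n$-vertex graph with integer edge weights in $\{-n^{100k},\dots,n^{100k}\}$, whether it contains a $k$-clique whose edge weights sum to $0$. The hypothesis says that for no $\varepsilon>0$ there is an algorithm that solves Exact-$k$-Clique in time $O(n^{k-\varepsilon})$. The arboricity $\alpha=\alpha(G)$ of a graph $G$ is the minimum number of edge-disjoint spanning forests into which $G$ can be decomposed; $n$ and $m$ denote the numbers of vertices and edges of $G$. **Theorem.** Let $k\ge 3$ and assume the Exact-$k$-Clique hypothesis for $k$. There is a constant $C>0$, depending only on $k$, such that for every $0<\delta<1$ there are a number $0\le\gamma\le C\delta$ and a function $f:\mathbb N\to\mathbb R$ with $f(n)\to 0$ such that for every $0<\tau<1$ the following hold. 1. No algorithm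 lists all $k$-cliques in time $O(m^{1-\gamma}\alpha^{k-2})$ on all graphs with arboricity $(1-\tau)\,n^{1-\delta}\le\alpha\le(1+\tau)\,n^{1-\delta}$. 2. This remains true on the graphs that have, in addition, at most $f(n)\cdot m^{1-\gamma}\alpha^{k-2}$ $k$-cliques: no algorithm lists all $k$-cliques in time $O(m^{1-\gamma}\alpha^{k-2})$ on all graphs with arboricity $(1-\tau)\,n^{1-\delta}\le\alpha\le(1+\tau)\,n^{1-\delta}$ and at most $f(n)\cdot m^{1-\gamma}\alpha^{k-2}$ $k$-cliques. In short: if $\alpha=n^{1-\delta}$, then listing all $k$-cliques requires $\Omega(m^{1-O(\delta)}\alpha^{k-2})$ time, even on graphs with $o(m^{1-O(\delta)}\alpha^{k-2})$ $k$-cliques. -/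

import Mathlib

open Filter Topology

noncomputable section

/-! ## The randomized word RAM

Registers and arrays hold words, i.e. natural numbers below `2 ^ w`. A program is a finite
piece of structured code; it mentions finitely many registers and finitely many arrays, and each
array is addressed by words. Every elementary instruction, every test and every unfolding of the
control structure costs one step. -/

namespace WordRAM

/-- The binary operations that the machine performs on words in one step. -/
inductive BinOp
  | add | sub | mul | div | mod | and | or | xor | shl | shr | eq | lt

/-- The value of an operation on `w`-bit words: arithmetic wraps around modulo `2 ^ w`, division
is integer division (with quotient `0` and remainder `a` on divisor `0`), and comparisons return
`1` or `0`. -/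
def BinOp.eval (w : ℕ) : BinOp → ℕ → ℕ → ℕ
  | .add, a, b => (a + b) % 2 ^ w
  | .sub, a, b => (a + (2 ^ w - b)) % 2 ^ w
  | .mul, a, b => (a * b) % 2 ^ w
  | .div, a, b => (a / b) % 2 ^ w
  | .mod, a, b => (a % b) % 2 ^ w
  | .and, a, b => (a &&& b) % 2 ^ w
  | .or, a, b => (a ||| b) % 2 ^ w
  | .xor, a, b => (a ^^^ b) % 2 ^ w
  | .shl, a, b => (a * 2 ^ b) % 2 ^ w
  | .shr, a, b => (a / 2 ^ b) % 2 ^ w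
  | .eq, a, b => (if a = b then 1 else 0) % 2 ^ w
  | .lt, a, b => (if a < b then 1 else 0) % 2 ^ w

/-- Programs. Registers and arrays are named by natural numbers. -/
inductive Cmd
  /-- do nothing -/
  | skip
  /-- `reg x := v` for a constant `v` -/
  | const (x v : ℕ)
  /-- `reg x := o (reg y) (reg z)` -/
  | op (o : BinOp) (x y z : ℕ)
  /-- `reg x := array a [reg i]` -/
  | load (x a i : ℕ)
  /-- `array a [reg i] := reg x` -/
  | store (a i x : ℕ)
  /-- `reg x :=` a fresh uniformly random word -/
  | rand (x : ℕ)
  /-- `c; d` -/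
  | seq (c d : Cmd)
  /-- `if reg x ≠ 0 then c else d` -/
  | ite (x : ℕ) (c d : Cmd)
  /-- `while reg x ≠ 0 do c` -/
  | loop (x : ℕ) (c : Cmd)

/-- The data of the machine: `reg x` is the content of register `x`, and `mem a i` is the content
of cell `i` of array `a`. -/
structure State where
  reg : ℕ → ℕ
  mem : ℕ → ℕ → ℕ

/-- Register `x` is overwritten by `v`. -/
def State.setReg (s : State) (x v : ℕ) : State :=
  { s with reg := Function.update s.reg x v }

/-- Cell `i` of array `a` is overwritten by `v`. -/
def State.setMem (s : State) (a i v : ℕ) : State :=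
  { s with mem := Function.update s.mem a (Function.update (s.mem a) i v) }

/-- A configuration: the commands that are still to be executed, and the data. The machine has
halted when no command is left. -/
abbrev Config := List Cmd × State

/-- One step of the machine with `w`-bit words, as a distribution over next configurations. -/
def step (w : ℕ) : Config → PMF Config
  | ([], s) => PMF.pure ([], s)
  | (.skip :: K, s) => PMF.pure (K, s)
  | (.const x v :: K, s) => PMF.pure (K, s.setReg x (v % 2 ^ w))
  | (.op o x y z :: K, s) => PMF.pure (K, s.setReg x (o.eval w (s.reg y) (s.reg z)))
  | (.load x a i :: K, s) => PMF.pure (K, s.setReg x (s.mem a (s.reg i)))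
  | (.store a i x :: K, s) => PMF.pure (K, s.setMem a (s.reg i) (s.reg x))
  | (.rand x :: K, s) =>
      (PMF.uniformOfFintype (Fin (2 ^ w))).map fun r => (K, s.setReg x (r : ℕ))
  | (.seq c d :: K, s) => PMF.pure (c :: d :: K, s)
  | (.ite x c d :: K, s) => PMF.pure ((if s.reg x ≠ 0 then c else d) :: K, s)
  | (.loop x c :: K, s) => PMF.pure (if s.reg x ≠ 0 then c :: .loop x c :: K else K, s)

/-- The distribution of the configuration after `t` steps. -/
def run (w : ℕ) : ℕ → Config → PMF Config
  | 0, c => PMF.pure c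
  | t + 1, c => (step w c).bind (run w t)

/-- Started on the data `s` with `w`-bit words, the program `P` halts within `T` steps in a state
satisfying `good`, with probability at least `2 / 3`. -/
def SucceedsWithin (w : ℕ) (P : Cmd) (s : State) (T : ℕ) (good : State → Prop) : Prop :=
  2 / 3 ≤ (run w T ([P], s)).toOuterMeasure {c | c.1 = [] ∧ good c.2}

/-- The word length `c * (⌊log₂ n⌋ + 1)` on inputs with `n` vertices. Algorithms may use any
constant `c`, so words have `O(log n)` bits. -/
def wordLength (c n : ℕ) : ℕ := c * (Nat.log 2 n + 1)

end WordRAM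

/-! ## Exact-`k`-Clique -/

/-- An input of Exact-`k`-Clique: a graph on `n` vertices whose edges carry integer weights
between `-n ^ (100 k)` and `n ^ (100 k)`. Weights of non-edges play no role. -/
structure WeightedGraph (k n : ℕ) where
  graph : SimpleGraph (Fin n)
  weight : Sym2 (Fin n) → ℤ
  abs_weight_le : ∀ e ∈ graph.edgeSet, |weight e| ≤ (n : ℤ) ^ (100 * k)

/-- Some `k`-clique has edge weights that sum to `0`. -/
def WeightedGraph.HasZeroClique {k n : ℕ} (I : WeightedGraph k n) : Prop :=
  ∃ S : Finset (Fin n), I.graph.IsNClique k S ∧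
    ∑ e ∈ S.sym2 with ¬ e.IsDiag, I.weight e = 0

open Classical in
/-- The input as initial data of the machine: the first cell of array `0` holds `n`, array `1`
holds the adjacency matrix (row by row, entries `0` and `1`), and array `2` holds the matrix of
the weights in two's complement (entry `0` at non-edges). All else is `0`. -/
def WeightedGraph.encode {k n : ℕ} (I : WeightedGraph k n) (w : ℕ) : WordRAM.State where
  reg := fun _ => 0
  mem := fun a i =>
    if a = 0 ∧ i = 0 then n % 2 ^ w
    else if h : i < n * n then
      let u : Fin n := Fin.divNat ⟨i, h⟩
      let v : Fin n := Fin.modNat ⟨i, h⟩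
      if I.graph.Adj u v then
        if a = 1 then 1 % 2 ^ w
        else if a = 2 then (I.weight s(u, v) % (2 ^ w : ℤ)).toNat
        else 0
      else 0
    else 0

/-- Exact-`k`-Clique is solved by a randomized word RAM algorithm, with words of `O(log n)` bits
and with error probability at most `1 / 3`, in time `O(bound n)`. The answer is yes if register
`0` is nonzero at the end. -/
def ExactCliqueInTime (k : ℕ) (bound : ℕ → ℝ) : Prop :=
  ∃ (P : WordRAM.Cmd) (c : ℕ) (A : ℝ) (n₀ : ℕ), ∀ n ≥ n₀, ∀ I : WeightedGraph k n,
    ∃ T : ℕ, (T : ℝ) ≤ A * bound n ∧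
      WordRAM.SucceedsWithin (WordRAM.wordLength c n) P (I.encode (WordRAM.wordLength c n)) T
        (fun s => s.reg 0 ≠ 0 ↔ I.HasZeroClique)

/-- The Exact-`k`-Clique hypothesis: for no `ε > 0` is there an `O(n ^ (k - ε))` algorithm. -/
def ExactCliqueHypothesis (k : ℕ) : Prop :=
  ∀ ε : ℝ, 0 < ε → ¬ ExactCliqueInTime k (fun n => (n : ℝ) ^ ((k : ℝ) - ε))

/-! ## Listing `k`-cliques -/

/-- The arboricity: the minimum number of edge-disjoint spanning forests into which the graph can
be decomposed. -/
def arboricity {V : Type*} (G : SimpleGraph V) : ℕ :=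
  sInf {a | ∃ F : Fin a → SimpleGraph V, (∀ i, (F i).IsAcyclic) ∧
    Pairwise (fun i j => Disjoint (F i) (F j)) ∧ ⨆ i, F i = G}

/-- The number of edges. -/
def edgeCount {n : ℕ} (G : SimpleGraph (Fin n)) : ℕ := G.edgeSet.ncard

/-- The number of `k`-cliques. -/
def cliqueCount (k : ℕ) {n : ℕ} (G : SimpleGraph (Fin n)) : ℕ :=
  {S : Finset (Fin n) | G.IsNClique k S}.ncard

open Classical in
/-- The edges `(u, v)` with `u < v`, in lexicographic order. -/
def edgeList {n : ℕ} (G : SimpleGraph (Fin n)) : List (Fin n × Fin n) :=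
  (List.finRange n ×ˢ List.finRange n).filter fun p => p.1 < p.2 ∧ G.Adj p.1 p.2

/-- The graph as initial data of the machine: array `0` holds `n`, the number of edges, and then
the two endpoints of every edge. All else is `0`. -/
def encodeGraph {n : ℕ} (G : SimpleGraph (Fin n)) (w : ℕ) : WordRAM.State where
  reg := fun _ => 0
  mem := fun a i =>
    if a = 0 then
      (n :: (edgeList G).length ::
        (edgeList G).flatMap fun p => [(p.1 : ℕ), (p.2 : ℕ)]).getD i 0 % 2 ^ w
    else 0

/-- In the final state, array `1` holds a number `t` and then `t` blocks of `k` vertices, such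
that the sets of vertices in these blocks are exactly the `k`-cliques. -/
def ListsAllCliques (k : ℕ) {n : ℕ} (G : SimpleGraph (Fin n)) (s : WordRAM.State) : Prop :=
  ∀ S : Finset ℕ,
    (∃ i < s.mem 1 0, S = (Finset.range k).image fun j => s.mem 1 (1 + i * k + j)) ↔
      ∃ Q : Finset (Fin n), G.IsNClique k Q ∧ S = Q.map Fin.valEmbedding

/-- Some randomized word RAM algorithm, with words of `O(log n)` bits and with error probability
at most `1 / 3`, lists all `k`-cliques of every graph of the class `cls` in time `O(bound)`.
Nothing is required of the algorithm on other graphs. -/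
def CliqueListingInTime (k : ℕ) (cls : (n : ℕ) → SimpleGraph (Fin n) → Prop)
    (bound : (n : ℕ) → SimpleGraph (Fin n) → ℝ) : Prop :=
  ∃ (P : WordRAM.Cmd) (c : ℕ) (A : ℝ) (n₀ : ℕ), ∀ n ≥ n₀, ∀ G : SimpleGraph (Fin n), cls n G →
    ∃ T : ℕ, (T : ℝ) ≤ A * bound n G ∧
      WordRAM.SucceedsWithin (WordRAM.wordLength c n) P (encodeGraph G (WordRAM.wordLength c n)) T
        (ListsAllCliques k G)

/-- The quantity `m ^ (1 - γ) * α ^ (k - 2)`, for `m` edges and arboricity `α`. -/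
def listingBound (k : ℕ) (γ : ℝ) (n : ℕ) (G : SimpleGraph (Fin n)) : ℝ :=
  (edgeCount G : ℝ) ^ (1 - γ) * (arboricity G : ℝ) ^ (k - 2)

/-- The arboricity is `n ^ (1 - δ)` up to a factor between `1 - τ` and `1 + τ`. -/
def ArboricityNear (δ τ : ℝ) (n : ℕ) (G : SimpleGraph (Fin n)) : Prop :=
  (1 - τ) * (n : ℝ) ^ (1 - δ) ≤ arboricity G ∧ (arboricity G : ℝ) ≤ (1 + τ) * (n : ℝ) ^ (1 - δ)

end

/-! Suppose that some program lists the k-cliques of the graphs of the second claim within the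
bound. Then zero cliques in weighted graphs on V vertices are found in time O(V^(k-ε)) for some ε >
0, against the hypothesis. The first claim follows, as a program for the larger class also serves
the smaller one.

Let E = `tri k` be the number of pairs of parts, and let Z = 2^x be least with V < Z^(p1+p2). The
vertices are cut into S = Z^p2 groups of N = Z^p1. Weights are multiplied by a random h modulo the
power of two R·BK, and only the bucket is kept, one of R = Z^8 buckets of size BK. If the weights of
a clique sum to zero, then its E buckets sum to -C modulo R with a rounding error C < E, whatever h
is (`Red.cong_of_wsum`). A clique of nonzero weight passes this test for at most a fraction 2E/R of
all h (`Red.card_cong_le`, `WeightedGraph.gcd_wsum_dvd`).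

For every choice of k groups and every sequence of E buckets with sum -C, C < E, there is an
instance: a k-partite graph on k·N vertices with the edges that have the prescribed buckets. These
are E·R^(E-1)·S^k instances, and every tuple that passes the test forms a clique in exactly one of
them (`Red.exists_inst`, `Red.IsSys.ext`). The graph consists of all instances and, on the rest of
the n = Z^q vertices, a complete bipartite graph with a vertices on the left. The bipartite part
contains no triangle, has almost all of the edges and fixes the arboricity: the graph splits into a
forests of stars, while its roughly n·a edges force nearly as many forests
(`Red.arboricity_graph_le`, `WordRAM.near_of_bounds`). So a is taken as a multiple of N just below t
= n^(1-δ).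

Put e = (p1+p2)·k, so that there are Z^e candidate tuples. The exponents leave room for all
instances, and γ is defined by (n·t)^(1-γ)·t^(k-2) = Z^(e-4); it is at most δ
(`WordRAM.exists_exponents`). If more than Z^(e-6) tuples are zero cliques, random sampling finds
one. Otherwise, by Markov's inequality, with probability 3/4 the graph has at most 2·Z^(e-6)
k-cliques. Then it lies in the class with f(n) = n^(-1/q) = 1/Z, and the list shows a copy of every
zero clique (`WordRAM.Pm.eventually_good`).

The program does not compute n^(1-δ): it tries the multiples i·N for all i < Z, each twice. On
graphs outside of the class the listing program may do anything, so it is simulated under a clock of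
Z^(e-3) ticks (`WordRAM.sim_spec`), and every listed clique is checked against the input. Hence the
error is one-sided (`WordRAM.Pm.main_spec`). The total time is O(Z^(e-1)), which is
O(V^(k-1/(p1+p2))). To prove this for actual word-RAM programs, `D` and `Rnd` serve as a small
program logic for deterministic and randomized fragments. -/

open scoped ENNReal

/-! ### A program logic for running time and success probability -/

namespace WordRAM

/-! ## Success probabilities -/

/-- The probability that the machine has halted after `T` steps with data satisfying `g`. -/
noncomputable def Val (w : ℕ) (g : State → Prop) (T : ℕ) (c : Config) : ℝ≥0∞ :=
  (run w T c).toOuterMeasure {c | c.1 = [] ∧ g c.2}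

variable {w : ℕ} {g : State → Prop}

theorem Val_succ (T : ℕ) (c : Config) :
    Val w g (T + 1) c = ∑' c', step w c c' * Val w g T c' := by
  simp only [Val, run, PMF.toOuterMeasure_bind_apply]

theorem Val_succ_of_pure {T : ℕ} {c c' : Config} (h : step w c = PMF.pure c') :
    Val w g (T + 1) c = Val w g T c' := by
  simp only [Val, run, h, PMF.pure_bind]

theorem Val_zero_cons (c : Cmd) (K : List Cmd) (s : State) : Val w g 0 (c :: K, s) = 0 := by
  simp [Val, run, PMF.toOuterMeasure_pure_apply]

theorem Val_nil_of {s : State} (T : ℕ) (h : g s) : Val w g T ([], s) = 1 := by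
  induction T with
  | zero => simp [Val, run, PMF.toOuterMeasure_pure_apply, h]
  | succ T ih => rw [Val_succ_of_pure (c' := ([], s)) (by simp [step]), ih]

theorem Val_nil_of_not {s : State} (T : ℕ) (h : ¬ g s) : Val w g T ([], s) = 0 := by
  induction T with
  | zero => simp [Val, run, PMF.toOuterMeasure_pure_apply, h]
  | succ T ih => rw [Val_succ_of_pure (c' := ([], s)) (by simp [step]), ih]

/-- A halted configuration is stationary, so success once reached is never lost. -/
theorem Val_le_succ (T : ℕ) (c : Config) : Val w g T c ≤ Val w g (T + 1) c := by
  induction T generalizing c with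
  | zero =>
    obtain ⟨K, s⟩ := c
    cases K with
    | nil => rw [Val_succ_of_pure (c' := ([], s)) (by simp [step])]
    | cons a K => rw [Val_zero_cons]; exact zero_le
  | succ T ih =>
    rw [Val_succ, Val_succ]
    exact ENNReal.tsum_le_tsum fun c' => by gcongr; exact ih c'

theorem Val_mono {T T' : ℕ} (h : T ≤ T') (c : Config) : Val w g T c ≤ Val w g T' c := by
  induction h with
  | refl => exact le_rfl
  | step _ ih => exact ih.trans (Val_le_succ _ _)

theorem Val_rand (x : ℕ) (K : List Cmd) (s : State) (T : ℕ) :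
    Val w g (T + 1) (.rand x :: K, s) =
      (2 ^ w : ℝ≥0∞)⁻¹ * ∑ r ∈ Finset.range (2 ^ w), Val w g T (K, s.setReg x r) := by
  have : Val w g (T + 1) (.rand x :: K, s) =
      ((PMF.uniformOfFintype (Fin (2 ^ w))).bind
        fun r => run w T (K, s.setReg x (r : ℕ))).toOuterMeasure {c | c.1 = [] ∧ g c.2} := by
    simp only [Val, run, step]
    rw [PMF.bind_map]
    change (((PMF.uniformOfFintype (Fin (2 ^ w))).bind fun a => PMF.pure (a : ℕ)).bind
      _).toOuterMeasure _ = _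
    rw [PMF.bind_bind]
    simp only [PMF.pure_bind, Function.comp]
  rw [this, PMF.toOuterMeasure_bind_apply, tsum_fintype, Finset.sum_range, Finset.mul_sum]
  refine Finset.sum_congr rfl fun r _ => ?_
  simp [Val, PMF.uniformOfFintype_apply]

/-! ## Deterministic fragments -/

/-- Registers `60`, …, `99` are scratch registers; the data agree outside of these. -/
def Eqv (s s' : State) : Prop :=
  s.mem = s'.mem ∧ ∀ y, y < 60 ∨ 100 ≤ y → s.reg y = s'.reg y

theorem Eqv.refl (s : State) : Eqv s s := ⟨rfl, fun _ _ => rfl⟩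

/-- The program does not write register `y`. -/
def Cmd.nwr (y : ℕ) : Cmd → Bool
  | .skip => true
  | .const x _ => y != x
  | .op _ x _ _ => y != x
  | .load x _ _ => y != x
  | .store _ _ _ => true
  | .rand x => y != x
  | .seq c d => c.nwr y && d.nwr y
  | .ite _ c d => c.nwr y && d.nwr y
  | .loop _ c => c.nwr y

/-- The program does not write array `a`. -/
def Cmd.nwa (a : ℕ) : Cmd → Bool
  | .store b _ _ => a != b
  | .seq c d => c.nwa a && d.nwa a
  | .ite _ c d => c.nwa a && d.nwa a
  | .loop _ c => c.nwa a
  | _ => true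

/-- Registers and arrays that `c` does not write are unchanged. -/
def Fr (c : Cmd) (s s' : State) : Prop :=
  (∀ y, c.nwr y = true → s'.reg y = s.reg y) ∧ ∀ a, c.nwa a = true → s'.mem a = s.mem a

theorem Fr.refl (c : Cmd) (s : State) : Fr c s s := ⟨fun _ _ => rfl, fun _ _ => rfl⟩

theorem Fr.trans {c : Cmd} {s s' s'' : State} (h : Fr c s s') (h' : Fr c s' s'') : Fr c s s'' :=
  ⟨fun y hy => (h'.1 y hy).trans (h.1 y hy), fun y hy => (h'.2 y hy).trans (h.2 y hy)⟩

theorem Fr.seq {c d : Cmd} {s s' s'' : State} (h : Fr c s s') (h' : Fr d s' s'') :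
    Fr (.seq c d) s s'' := by
  constructor
  · intro y hy
    simp only [Cmd.nwr, Bool.and_eq_true] at hy
    rw [h'.1 y hy.2, h.1 y hy.1]
  · intro y hy
    simp only [Cmd.nwa, Bool.and_eq_true] at hy
    rw [h'.2 y hy.2, h.2 y hy.1]

/-- Up to scratch registers, `c` turns `s` into `s'` within `T` steps. -/
structure D (w : ℕ) (c : Cmd) (s : State) (T : ℕ) (s' : State) : Prop where
  val : ∀ s0, Eqv s0 s → ∃ s1, Eqv s1 s' ∧
    ∀ K g T', Val w g T' (K, s1) ≤ Val w g (T + T') (c :: K, s0)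
  fr : Fr c s s'

theorem D.mono {c : Cmd} {s s' : State} {T T' : ℕ} (h : D w c s T s') (hT : T ≤ T') :
    D w c s T' s' := by
  refine ⟨fun s0 h0 => ?_, h.fr⟩
  obtain ⟨s1, h1, h2⟩ := h.val s0 h0
  exact ⟨s1, h1, fun K g T'' => (h2 K g T'').trans (Val_mono (by omega) _)⟩

/-- `D` quantifies over all continuations and goals; therefore the inequalities for the two
fragments simply chain, with `d :: K` as the continuation of `c`. -/
theorem D.seq {c d : Cmd} {s s' s'' : State} {T T' : ℕ} (h : D w c s T s') (h' : D w d s' T' s'') :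
    D w (.seq c d) s (T + T' + 1) s'' := by
  refine ⟨fun s0 h0 => ?_, h.fr.seq h'.fr⟩
  obtain ⟨s1, h1, h2⟩ := h.val s0 h0
  obtain ⟨s2, h3, h4⟩ := h'.val s1 h1
  refine ⟨s2, h3, fun K g T'' => ?_⟩
  rw [show T + T' + 1 + T'' = (T + (T' + T'')) + 1 by ring,
    Val_succ_of_pure (c' := (c :: d :: K, s0)) (by simp [step])]
  exact (h4 K g T'').trans (h2 _ g _)

theorem D.skip (s : State) : D w .skip s 1 s := by
  refine ⟨fun s0 h0 => ⟨s0, h0, fun K g T' => ?_⟩, Fr.refl _ _⟩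
  rw [Nat.add_comm, Val_succ_of_pure (c' := (K, s0)) (by simp [step])]

/-! ## Expressions -/

/-- Expressions over registers and arrays. In `rm x e` and `ldm a i e` the value of a register or
of an array cell is reduced modulo the value of `e`. -/
inductive Ex
  | v (x : ℕ)
  | n (c : ℕ)
  | o (op : BinOp) (e f : Ex)
  | ld (a : ℕ) (e : Ex)
  | rm (x : ℕ) (e : Ex)
  | ldm (a : ℕ) (e f : Ex)

namespace Ex

/-- The value of an operation on natural numbers. -/
def idl : BinOp → ℕ → ℕ → ℕ
  | .add, a, b => a + b
  | .sub, a, b => a - b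
  | .mul, a, b => a * b
  | .div, a, b => a / b
  | .mod, a, b => a % b
  | .shr, a, b => a / 2 ^ b
  | .eq, a, b => if a = b then 1 else 0
  | .lt, a, b => if a < b then 1 else 0
  | _, _, _ => 0

/-- The operation has its natural value, but for overflow. -/
def side : BinOp → ℕ → ℕ → Prop
  | .sub, a, b => b ≤ a
  | .and, _, _ => False
  | .or, _, _ => False
  | .xor, _, _ => False
  | .shl, _, _ => False
  | _, _, _ => True

/-- The value of an expression over the natural numbers. -/
def ev (s : State) : Ex → ℕ
  | v x => s.reg x
  | n c => c
  | o op e f => idl op (e.ev s) (f.ev s)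
  | ld a e => s.mem a (e.ev s)
  | rm x e => s.reg x % e.ev s
  | ldm a e f => s.mem a (e.ev s) % f.ev s

/-- All atoms are at most `2 ^ L`. -/
def ok (L : ℕ) (s : State) : Ex → Prop
  | v x => s.reg x ≤ 2 ^ L
  | n c => c ≤ 2 ^ L
  | o op e f => e.ok L s ∧ f.ok L s ∧ side op (e.ev s) (f.ev s)
  | ld a e => e.ok L s ∧ s.mem a (e.ev s) ≤ 2 ^ L
  | rm _ e => e.ok L s ∧ 0 < e.ev s
  | ldm _ e f => e.ok L s ∧ f.ok L s ∧ 0 < f.ev s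

/-- The number of atoms. -/
def size : Ex → ℕ
  | v _ => 1
  | n _ => 1
  | o _ e f => e.size + f.size
  | ld _ e => 1 + e.size
  | rm _ e => 1 + e.size
  | ldm _ e f => 1 + e.size + f.size

/-- The expression reads no scratch register and can be evaluated with scratch registers from
`d` on. -/
def wf : ℕ → Ex → Bool
  | _, v x => decide (x < 60 ∨ 100 ≤ x)
  | d, n _ => decide (d < 100)
  | d, o _ e f => e.wf d && f.wf (d + 1) && decide (d < 100)
  | d, ld _ e => e.wf d && decide (d < 100)
  | d, rm x e => e.wf d && decide (d < 100) && decide (x < 60 ∨ 100 ≤ x)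
  | d, ldm _ e f => e.wf d && f.wf (d + 1) && decide (d < 100)

/-- Code that evaluates an expression with scratch registers from `d` on, and the register that
holds the value. -/
def code : ℕ → Ex → Cmd × ℕ
  | _, v x => (.skip, x)
  | d, n c => (.const d c, d)
  | d, o op e f => (.seq (e.code d).1 (.seq (f.code (d + 1)).1
      (.op op d (e.code d).2 (f.code (d + 1)).2)), d)
  | d, ld a e => (.seq (e.code d).1 (.load d a (e.code d).2), d)
  | d, rm x e => (.seq (e.code d).1 (.op .mod d x (e.code d).2), d)
  | d, ldm a e f => (.seq (e.code d).1 (.seq (.load d a (e.code d).2)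
      (.seq (f.code (d + 1)).1 (.op .mod d d (f.code (d + 1)).2))), d)

/-- The number of steps to evaluate an expression. -/
def cost : Ex → ℕ
  | v _ => 1
  | n _ => 1
  | o _ e f => e.cost + f.cost + 3
  | ld _ e => e.cost + 2
  | rm _ e => e.cost + 2
  | ldm _ e f => e.cost + f.cost + 5

theorem one_le_size (e : Ex) : 1 ≤ e.size := by
  induction e <;> simp [size] <;> omega

theorem ev_congr {s s' : State} (h : Eqv s s') (e : Ex) : ∀ d, e.wf d = true → e.ev s = e.ev s' := by
  induction e with
  | v x => intro d hd; exact h.2 x (by simpa [wf] using hd)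
  | n c => intro d _; rfl
  | o op e f he hf =>
    intro d hd
    simp only [wf, Bool.and_eq_true] at hd
    simp only [ev, he _ hd.1.1, hf _ hd.1.2]
  | ld a e he =>
    intro d hd
    simp only [wf, Bool.and_eq_true] at hd
    simp only [ev, he _ hd.1, h.1]
  | rm x e he =>
    intro d hd
    simp only [wf, Bool.and_eq_true, decide_eq_true_eq] at hd
    simp only [ev, he _ hd.1.1, h.2 x hd.2]
  | ldm a e f he hf =>
    intro d hd
    simp only [wf, Bool.and_eq_true] at hd
    simp only [ev, he _ hd.1.1, hf _ hd.1.2, h.1]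

theorem ok_congr {L : ℕ} {s s' : State} (h : Eqv s s') (e : Ex) :
    ∀ d, e.wf d = true → (e.ok L s ↔ e.ok L s') := by
  induction e with
  | v x => intro d hd; simp only [ok, h.2 x (by simpa [wf] using hd)]
  | n c => intro d _; rfl
  | o op e f he hf =>
    intro d hd
    simp only [wf, Bool.and_eq_true] at hd
    simp only [ok, he _ hd.1.1, hf _ hd.1.2, ev_congr h e _ hd.1.1, ev_congr h f _ hd.1.2]
  | ld a e he =>
    intro d hd
    simp only [wf, Bool.and_eq_true] at hd
    simp only [ok, he _ hd.1, h.1, ev_congr h e _ hd.1]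
  | rm x e he =>
    intro d hd
    simp only [wf, Bool.and_eq_true] at hd
    simp only [ok, he _ hd.1.1, ev_congr h e _ hd.1.1]
  | ldm a e f he hf =>
    intro d hd
    simp only [wf, Bool.and_eq_true] at hd
    simp only [ok, he _ hd.1.1, hf _ hd.1.2, ev_congr h f _ hd.1.2]

theorem code_snd (e : Ex) (d : ℕ) (_hd : 60 ≤ d) (h : e.wf d = true) :
    (e.code d).2 = d ∨ (e.code d).2 < 60 ∨ 100 ≤ (e.code d).2 := by
  cases e <;> simp_all [code, wf]

/-- No operation exceeds the product of two bounds, each at least 2, for its arguments; so bit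
lengths at worst add up. Absence of overflow thereby becomes the single condition `L * size < w`. -/
theorem idl_le {L a b p q : ℕ} (op : BinOp) (hL : 1 ≤ L) (hp : 1 ≤ p) (hq : 1 ≤ q)
    (ha : a ≤ 2 ^ (L * p)) (hb : b ≤ 2 ^ (L * q)) : idl op a b ≤ 2 ^ (L * (p + q)) := by
  have h1 : 2 ≤ 2 ^ (L * p) := by
    calc 2 = 2 ^ 1 := rfl
      _ ≤ _ := Nat.pow_le_pow_right (by norm_num) (Nat.mul_pos hL hp)
  have h2 : 2 ≤ 2 ^ (L * q) := by
    calc 2 = 2 ^ 1 := rfl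
      _ ≤ _ := Nat.pow_le_pow_right (by norm_num) (Nat.mul_pos hL hq)
  have hab : 2 ^ (L * (p + q)) = 2 ^ (L * p) * 2 ^ (L * q) := by rw [mul_add, pow_add]
  rw [hab]
  have ha' : a ≤ 2 ^ (L * p) * 2 ^ (L * q) := ha.trans (Nat.le_mul_of_pos_right _ (by omega))
  cases op <;> simp only [idl]
  · nlinarith
  · omega
  · exact Nat.mul_le_mul ha hb
  · exact (Nat.div_le_self _ _).trans ha'
  · exact (Nat.mod_le _ _).trans ha'
  · omega
  · omega
  · omega
  · omega
  · exact (Nat.div_le_self _ _).trans ha'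
  · split_ifs <;> nlinarith
  · split_ifs <;> nlinarith

theorem eval_eq_idl {a b : ℕ} (op : BinOp) (hs : side op a b) (ha : a < 2 ^ w)
    (h : idl op a b < 2 ^ w) : op.eval w a b = idl op a b := by
  cases op <;> simp only [side, idl, BinOp.eval] at * <;> try exact Nat.mod_eq_of_lt h
  -- Only subtraction is left; as `b ≤ a` by `side`, the summand `2 ^ w` disappears in the
  -- reduction.
  rw [show a + (2 ^ w - b) = (a - b) + 2 ^ w by omega, Nat.add_mod_right]
  exact Nat.mod_eq_of_lt h

theorem ev_le {L : ℕ} (hL : 1 ≤ L) (e : Ex) (s : State) (h : e.ok L s) :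
    e.ev s ≤ 2 ^ (L * e.size) := by
  have mon : ∀ {a b : ℕ}, a ≤ b → 2 ^ (L * a) ≤ 2 ^ (L * b) := fun h =>
    Nat.pow_le_pow_right (by norm_num) (Nat.mul_le_mul_left _ h)
  induction e with
  | v x => simpa [ev, size, ok] using h
  | n c => simpa [ev, size, ok] using h
  | o op e f he hf =>
    exact idl_le op hL e.one_le_size f.one_le_size (he h.1) (hf h.2.1)
  | ld a e he => exact h.2.trans (by simpa [size] using mon (show 1 ≤ 1 + e.size by omega))
  | rm x e he =>
    exact (Nat.mod_lt _ h.2).le.trans ((he h.1).trans (mon (by simp [size])))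
  | ldm a e f he hf =>
    exact (Nat.mod_lt _ h.2.2).le.trans ((hf h.2.1).trans (mon (by simp [size])))

/-- The scratch registers act as a stack: the value of the left operand stays in register `d`, or
outside of the scratch range, while the right operand uses the registers from `d + 1` on. -/
theorem code_spec {L : ℕ} (hL : 1 ≤ L) (e : Ex) : ∀ (d : ℕ) (s : State), e.wf d = true → 60 ≤ d →
    e.ok L s → L * e.size < w →
    ∃ s1 : State, s1.mem = s.mem ∧ (∀ y, y < d ∨ 100 ≤ y → s1.reg y = s.reg y) ∧
      s1.reg (e.code d).2 = e.ev s ∧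
      ∀ K g T', Val w g T' (K, s1) ≤ Val w g (e.cost + T') ((e.code d).1 :: K, s) := by
  have lt_of : ∀ {m b : ℕ}, b ≤ 2 ^ (L * m) → L * m < w → b < 2 ^ w := fun h h' =>
    h.trans_lt (Nat.pow_lt_pow_right (by norm_num) h')
  induction e with
  | v x =>
    intro d s _ hd' hok hw
    refine ⟨s, rfl, fun _ _ => rfl, rfl, fun K g T' => ?_⟩
    rw [cost, Nat.add_comm]
    exact (Val_succ_of_pure (by simp [step, code])).ge
  | n c =>
    intro d s hd hd' hok hw
    have hd2 : d < 100 := by simpa [wf] using hd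
    refine ⟨s.setReg d (c % 2 ^ w), rfl, fun y hy => ?_, ?_, fun K g T' => ?_⟩
    · simp only [State.setReg]; rw [Function.update_of_ne]; omega
    · simp only [State.setReg, code, ev, Function.update_self]
      exact Nat.mod_eq_of_lt (lt_of (ev_le hL (.n c) s hok) hw)
    · rw [cost, Nat.add_comm]
      exact (Val_succ_of_pure (by simp [step, code])).ge
  | o op e f he hf =>
    intro d s hd hd' hok hw
    simp only [wf, Bool.and_eq_true, decide_eq_true_eq] at hd
    have hsz : L * (o op e f).size = L * e.size + L * f.size := by simp [size, mul_add]
    obtain ⟨s1, h1, h2, h3, h4⟩ := he d s hd.1.1 hd' hok.1 (by omega)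
    have hE : Eqv s s1 := ⟨h1.symm, fun y hy => (h2 y (by omega)).symm⟩
    obtain ⟨s2, h5, h6, h7, h8⟩ := hf (d + 1) s1 hd.1.2 (by omega)
      ((ok_congr hE f _ hd.1.2).1 hok.2.1) (by omega)
    have hr : s2.reg (e.code d).2 = e.ev s := by
      rw [h6 _ (by have := code_snd e d hd' hd.1.1; omega), h3]
    rw [← ev_congr hE f _ hd.1.2] at h7
    have hv := eval_eq_idl (w := w) op hok.2.2 (lt_of (ev_le hL e s hok.1) (by omega))
      (lt_of (ev_le hL _ s hok) hw)
    refine ⟨s2.setReg d (idl op (e.ev s) (f.ev s)), h5.trans h1, fun y hy => ?_, ?_,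
      fun K g T' => ?_⟩
    · simp only [State.setReg]
      rw [Function.update_of_ne (by omega), h6 y (by omega), h2 y hy]
    · simp [code, State.setReg, ev]
    · rw [show (o op e f).cost + T' = (e.cost + (f.cost + (T' + 1) + 1)) + 1 by
        simp only [cost]; ring]
      rw [code, Val_succ_of_pure (by simp only [step]; rfl)]
      refine le_trans ?_ (h4 _ g _)
      rw [Val_succ_of_pure (by simp only [step]; rfl)]
      refine le_trans ?_ (h8 _ g _)
      rw [Val_succ_of_pure (by simp only [step]; rfl), h7, hr, hv]
  | ld a e he =>
    intro d s hd hd' hok hw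
    simp only [wf, Bool.and_eq_true, decide_eq_true_eq] at hd
    have hsz : L * (ld a e).size = L + L * e.size := by simp [size, mul_add]
    obtain ⟨s1, h1, h2, h3, h4⟩ := he d s hd.1 hd' hok.1 (by omega)
    refine ⟨s1.setReg d (s1.mem a (e.ev s)), h1, fun y hy => ?_, ?_, fun K g T' => ?_⟩
    · simp only [State.setReg]
      rw [Function.update_of_ne (by omega), h2 y hy]
    · simp [code, State.setReg, ev, h1]
    · rw [show (ld a e).cost + T' = (e.cost + (T' + 1)) + 1 by simp only [cost]; ring]
      rw [code, Val_succ_of_pure (by simp only [step]; rfl)]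
      refine le_trans ?_ (h4 _ g _)
      rw [Val_succ_of_pure (by simp only [step]; rfl), h3]
  | rm x e he =>
    intro d s hd hd' hok hw
    simp only [wf, Bool.and_eq_true, decide_eq_true_eq] at hd
    have hsz : L * (rm x e).size = L + L * e.size := by simp [size, mul_add]
    obtain ⟨s1, h1, h2, h3, h4⟩ := he d s hd.1.1 hd' hok.1 (by omega)
    refine ⟨s1.setReg d (s.reg x % e.ev s), h1, fun y hy => ?_, ?_, fun K g T' => ?_⟩
    · simp only [State.setReg]
      rw [Function.update_of_ne (by omega), h2 y hy]
    · simp [code, State.setReg, ev]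
    · rw [show (rm x e).cost + T' = (e.cost + (T' + 1)) + 1 by simp only [cost]; ring]
      rw [code, Val_succ_of_pure (by simp only [step]; rfl)]
      refine le_trans ?_ (h4 _ g _)
      rw [Val_succ_of_pure (by simp only [step]; rfl), h3, h2 x (by omega), BinOp.eval,
        Nat.mod_eq_of_lt (a := _ % _)
          (lt_of ((Nat.mod_lt _ hok.2).le.trans (ev_le hL e s hok.1)) (by omega))]
  | ldm a e f he hf =>
    intro d s hd hd' hok hw
    simp only [wf, Bool.and_eq_true, decide_eq_true_eq] at hd
    have hsz : L * (ldm a e f).size = L + L * e.size + L * f.size := by simp [size, mul_add]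
    obtain ⟨s1, h1, h2, h3, h4⟩ := he d s hd.1.1 hd' hok.1 (by omega)
    have hE : Eqv s (s1.setReg d (s1.mem a (e.ev s))) := ⟨h1.symm, fun y hy => by
      simp only [State.setReg]
      rw [Function.update_of_ne (by omega), h2 y (by omega)]⟩
    obtain ⟨s2, h5, h6, h7, h8⟩ := hf (d + 1) (s1.setReg d (s1.mem a (e.ev s))) hd.1.2 (by omega)
      ((ok_congr hE f _ hd.1.2).1 hok.2.1) (by omega)
    rw [← ev_congr hE f _ hd.1.2] at h7
    have hr : s2.reg d = s.mem a (e.ev s) := by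
      rw [h6 _ (by omega)]; simp [State.setReg, h1]
    refine ⟨s2.setReg d (s.mem a (e.ev s) % f.ev s), h5.trans h1, fun y hy => ?_, ?_,
      fun K g T' => ?_⟩
    · simp only [State.setReg]
      rw [Function.update_of_ne (by omega), h6 y (by omega)]
      simp only [State.setReg]
      rw [Function.update_of_ne (by omega), h2 y hy]
    · simp [code, State.setReg, ev]
    · rw [show (ldm a e f).cost + T' = (e.cost + ((f.cost + (T' + 1) + 1) + 1 + 1)) + 1 by
        simp only [cost]; ring]
      rw [code, Val_succ_of_pure (by simp only [step]; rfl)]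
      refine le_trans ?_ (h4 _ g _)
      rw [Val_succ_of_pure (by simp only [step]; rfl),
        Val_succ_of_pure (by simp only [step]; rfl), h3, Val_succ_of_pure (by simp only [step]; rfl)]
      refine le_trans ?_ (h8 _ g _)
      rw [Val_succ_of_pure (by simp only [step]; rfl), h7, hr, BinOp.eval,
        Nat.mod_eq_of_lt (a := _ % _)
          (lt_of ((Nat.mod_lt _ hok.2.2).le.trans (ev_le hL f s hok.2.1)) (by omega))]

end Ex

end WordRAM

namespace WordRAM

variable {w : ℕ} {g : State → Prop}

/-! ## Straight-line code -/

/-- Straight-line code with branching. -/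
inductive HL
  | nop
  | asg (x : ℕ) (e : Ex)
  | st (a : ℕ) (i v : Ex)
  | sq (h h' : HL)
  | cond (e : Ex) (h h' : HL)

namespace HL

/-- The program for straight-line code. -/
def comp : HL → Cmd
  | nop => .skip
  | asg x e => .seq (e.code 61).1 (.op .or x (e.code 61).2 (e.code 61).2)
  | st a i v => .seq (i.code 61).1 (.seq (v.code 62).1 (.store a (i.code 61).2 (v.code 62).2))
  | sq h h' => .seq h.comp h'.comp
  | cond e h h' => .seq (e.code 61).1 (.ite (e.code 61).2 h.comp h'.comp)

/-- The effect of straight-line code when nothing overflows. -/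
def eff : HL → State → State
  | nop, s => s
  | asg x e, s => s.setReg x (e.ev s)
  | st a i v, s => s.setMem a (i.ev s) (v.ev s)
  | sq h h', s => h'.eff (h.eff s)
  | cond e h h', s => if e.ev s ≠ 0 then h.eff s else h'.eff s

/-- Atoms in evaluated expressions are at most `2 ^ L`. -/
def ok (L : ℕ) : HL → State → Prop
  | nop, _ => True
  | asg _ e, s => e.ok L s
  | st _ i v, s => i.ok L s ∧ v.ok L s
  | sq h h', s => h.ok L s ∧ h'.ok L (h.eff s)
  | cond e h h', s => e.ok L s ∧ (e.ev s ≠ 0 → h.ok L s) ∧ (e.ev s = 0 → h'.ok L s)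

/-- Scratch registers are not used. -/
def wf : HL → Bool
  | nop => true
  | asg x e => e.wf 61 && decide (x < 60 ∨ 100 ≤ x)
  | st _ i v => i.wf 61 && v.wf 62
  | sq h h' => h.wf && h'.wf
  | cond e h h' => e.wf 61 && h.wf && h'.wf

/-- The number of atoms. -/
def size : HL → ℕ
  | nop => 1
  | asg _ e => e.size
  | st _ i v => i.size + v.size
  | sq h h' => h.size + h'.size
  | cond e h h' => e.size + h.size + h'.size

/-- A bound for the number of steps. -/
def cost : HL → ℕ
  | nop => 1
  | asg _ e => e.cost + 2
  | st _ i v => i.cost + v.cost + 3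
  | sq h h' => h.cost + h'.cost + 1
  | cond e h h' => e.cost + h.cost + h'.cost + 2

/-- Every expression contributes to the total size, so one inequality excludes all overflows. A
branch is charged for both alternatives, which keeps the cost independent of the data. -/
theorem D_comp {L : ℕ} (hL : 1 ≤ L) (h : HL) : ∀ s : State, h.wf = true → h.ok L s → L * h.size < w →
    D w h.comp s h.cost (h.eff s) := by
  have lt_of : ∀ {m b : ℕ}, b ≤ 2 ^ (L * m) → L * m < w → b < 2 ^ w := fun h h' =>
    h.trans_lt (Nat.pow_lt_pow_right (by norm_num) h')
  induction h with
  | nop => intro s _ _ _; exact D.skip s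
  | asg x e =>
    intro s hwf hok hw
    simp only [wf, Bool.and_eq_true, decide_eq_true_eq] at hwf
    refine ⟨fun s0 h0 => ?_, ?_, ?_⟩
    · obtain ⟨s1, h1, h2, h3, h4⟩ := e.code_spec (w := w) hL 61 s0 hwf.1 (by norm_num)
        ((e.ok_congr h0 _ hwf.1).2 hok) hw
      rw [e.ev_congr h0 _ hwf.1] at h3
      refine ⟨s1.setReg x (e.ev s), ⟨h1.trans h0.1, fun y hy => ?_⟩, fun K g T' => ?_⟩
      · simp only [State.setReg, eff, Function.update_apply]
        split_ifs
        · rfl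
        · rw [h2 y (by omega), h0.2 y hy]
      · rw [comp, show (asg x e).cost + T' = (e.cost + (T' + 1)) + 1 by simp only [cost]; ring,
          Val_succ_of_pure (by simp only [step]; rfl)]
        refine le_trans ?_ (h4 _ g _)
        -- A register is copied as the bitwise or with itself, as there is no move instruction.
        rw [Val_succ_of_pure (by simp only [step]; rfl), h3, BinOp.eval, Nat.or_self,
          Nat.mod_eq_of_lt (lt_of (e.ev_le hL s hok) hw)]
    · intro y hy
      simp only [comp, Cmd.nwr, Bool.and_eq_true, bne_iff_ne] at hy
      simp [eff, State.setReg, Function.update_of_ne hy.2]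
    · intro a _; rfl
  | st a i v =>
    intro s hwf hok hw
    simp only [wf, Bool.and_eq_true] at hwf
    have hsz : L * (st a i v).size = L * i.size + L * v.size := by simp [size, mul_add]
    refine ⟨fun s0 h0 => ?_, ?_, ?_⟩
    · obtain ⟨s1, h1, h2, h3, h4⟩ := i.code_spec (w := w) hL 61 s0 hwf.1 (by norm_num)
        ((i.ok_congr h0 _ hwf.1).2 hok.1) (by omega)
      rw [i.ev_congr h0 _ hwf.1] at h3
      have hE : Eqv s1 s := ⟨h1.trans h0.1, fun y hy => (h2 y (by omega)).trans (h0.2 y hy)⟩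
      obtain ⟨s2, h5, h6, h7, h8⟩ := v.code_spec (w := w) hL 62 s1 hwf.2 (by norm_num)
        ((v.ok_congr hE _ hwf.2).2 hok.2) (by omega)
      rw [v.ev_congr hE _ hwf.2] at h7
      have hr : s2.reg (i.code 61).2 = i.ev s := by
        rw [h6 (i.code 61).2 (by have := i.code_snd 61 (by norm_num) hwf.1; omega), h3]
      refine ⟨s2.setMem a (i.ev s) (v.ev s), ⟨?_, fun y hy => ?_⟩, fun K g T' => ?_⟩
      · simp only [eff, State.setMem, h5, hE.1]
      · simp only [eff, State.setMem]
        rw [h6 y (by omega), hE.2 y hy]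
      · rw [comp, show (st a i v).cost + T' = (i.cost + (v.cost + (T' + 1) + 1)) + 1 by
          simp only [cost]; ring, Val_succ_of_pure (by simp only [step]; rfl)]
        refine le_trans ?_ (h4 _ g _)
        rw [Val_succ_of_pure (by simp only [step]; rfl)]
        refine le_trans ?_ (h8 _ g _)
        rw [Val_succ_of_pure (by simp only [step]; rfl), h7, hr]
    · intro y _; rfl
    · intro b hb
      simp only [comp, Cmd.nwa, Bool.and_eq_true, bne_iff_ne] at hb
      simp [eff, State.setMem, Function.update_of_ne hb.2.2]
  | sq h h' ih ih' =>
    intro s hwf hok hw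
    simp only [wf, Bool.and_eq_true] at hwf
    have hsz : L * (sq h h').size = L * h.size + L * h'.size := by simp [size, mul_add]
    exact (ih s hwf.1 hok.1 (by omega)).seq (ih' _ hwf.2 hok.2 (by omega))
  | cond e h h' ih ih' =>
    intro s hwf hok hw
    simp only [wf, Bool.and_eq_true] at hwf
    have hsz : L * (cond e h h').size = L * e.size + L * h.size + L * h'.size := by
      simp [size, mul_add]
    by_cases hc : e.ev s = 0
    · have hD := ih' s hwf.2 (hok.2.2 hc) (by omega)
      have heff : (cond e h h').eff s = h'.eff s := by simp [eff, hc]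
      rw [heff]
      refine ⟨fun s0 h0 => ?_, ?_, ?_⟩
      · obtain ⟨s1, h1, h2, h3, h4⟩ := e.code_spec (w := w) hL 61 s0 hwf.1.1 (by norm_num)
          ((e.ok_congr h0 _ hwf.1.1).2 hok.1) (by omega)
        rw [e.ev_congr h0 _ hwf.1.1] at h3
        have hE : Eqv s1 s := ⟨h1.trans h0.1, fun y hy => (h2 y (by omega)).trans (h0.2 y hy)⟩
        obtain ⟨s2, h5, h6⟩ := hD.val s1 hE
        refine ⟨s2, h5, fun K g T' => ?_⟩
        refine ((Val_mono (Nat.le_add_left T' h.cost) _).trans (h6 K g (h.cost + T'))).trans ?_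
        rw [comp, show (cond e h h').cost + T' = (e.cost + (h'.cost + (h.cost + T') + 1)) + 1 by
          simp only [cost]; ring, Val_succ_of_pure (by simp only [step]; rfl)]
        refine le_trans ?_ (h4 _ g _)
        rw [Val_succ_of_pure (by simp only [step]; rfl), h3]
        simp [hc]
      · intro y hy
        simp only [comp, Cmd.nwr, Bool.and_eq_true] at hy
        exact hD.fr.1 y hy.2.2
      · intro y hy
        simp only [comp, Cmd.nwa, Bool.and_eq_true] at hy
        exact hD.fr.2 y hy.2.2
    · have hD := ih s hwf.1.2 (hok.2.1 hc) (by omega)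
      have heff : (cond e h h').eff s = h.eff s := by simp [eff, hc]
      rw [heff]
      refine ⟨fun s0 h0 => ?_, ?_, ?_⟩
      · obtain ⟨s1, h1, h2, h3, h4⟩ := e.code_spec (w := w) hL 61 s0 hwf.1.1 (by norm_num)
          ((e.ok_congr h0 _ hwf.1.1).2 hok.1) (by omega)
        rw [e.ev_congr h0 _ hwf.1.1] at h3
        have hE : Eqv s1 s := ⟨h1.trans h0.1, fun y hy => (h2 y (by omega)).trans (h0.2 y hy)⟩
        obtain ⟨s2, h5, h6⟩ := hD.val s1 hE
        refine ⟨s2, h5, fun K g T' => ?_⟩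
        refine ((Val_mono (Nat.le_add_left T' h'.cost) _).trans (h6 K g (h'.cost + T'))).trans ?_
        rw [comp, show (cond e h h').cost + T' = (e.cost + (h.cost + (h'.cost + T') + 1)) + 1 by
          simp only [cost]; ring, Val_succ_of_pure (by simp only [step]; rfl)]
        refine le_trans ?_ (h4 _ g _)
        rw [Val_succ_of_pure (by simp only [step]; rfl), h3]
        simp [hc]
      · intro y hy
        simp only [comp, Cmd.nwr, Bool.and_eq_true] at hy
        exact hD.fr.1 y hy.2.1
      · intro y hy
        simp only [comp, Cmd.nwa, Bool.and_eq_true] at hy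
        exact hD.fr.2 y hy.2.1

end HL

/-! ## Loops -/

/-- Scratch register `60` receives the value of `e`. -/
def setT (e : Ex) : Cmd := .seq (e.code 61).1 (.op .or 60 (e.code 61).2 (e.code 61).2)

/-- `while e ≠ 0 do body` -/
def whl (e : Ex) (body : Cmd) : Cmd := .seq (setT e) (.loop 60 (.seq body (setT e)))

/-- `for x from 0 to reg y - 1 do body` -/
def forL (x y : ℕ) (body : Cmd) : Cmd :=
  .seq (HL.comp (.asg x (.n 0))) (whl (.o .lt (.v x) (.v y))
    (.seq body (HL.comp (.asg x (.o .add (.v x) (.n 1))))))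

theorem setT_spec {L : ℕ} (hL : 1 ≤ L) {e : Ex} {s s0 : State} (h0 : Eqv s0 s)
    (hwf : e.wf 61 = true) (hok : e.ok L s) (hw : L * e.size < w) :
    ∃ s1, Eqv s1 s ∧ s1.reg 60 = e.ev s ∧
      ∀ K g T', Val w g T' (K, s1) ≤ Val w g (e.cost + 2 + T') (setT e :: K, s0) := by
  obtain ⟨s1, h1, h2, h3, h4⟩ := e.code_spec (w := w) hL 61 s0 hwf (by norm_num)
    ((e.ok_congr h0 _ hwf).2 hok) hw
  rw [e.ev_congr h0 _ hwf] at h3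
  refine ⟨s1.setReg 60 (e.ev s), ⟨h1.trans h0.1, fun y hy => ?_⟩, by simp [State.setReg],
    fun K g T' => ?_⟩
  · simp only [State.setReg]
    rw [Function.update_of_ne (by omega), h2 y (by omega), h0.2 y hy]
  · rw [setT, show e.cost + 2 + T' = (e.cost + (T' + 1)) + 1 by ring,
      Val_succ_of_pure (by simp only [step]; rfl)]
    refine le_trans ?_ (h4 _ g _)
    rw [Val_succ_of_pure (by simp only [step]; rfl), h3, BinOp.eval, Nat.or_self,
      Nat.mod_eq_of_lt ((e.ev_le hL s hok).trans_lt (Nat.pow_lt_pow_right (by norm_num) hw))]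

/-- The guard is recomputed into register `60` after each execution of the body. Hence the body may
overwrite this register, and nested loops can share it. -/
theorem D.whl {L : ℕ} (hL : 1 ≤ L) {e : Ex} {body : Cmd} {m Tb : ℕ} {Inv : ℕ → State → Prop}
    (hwf : e.wf 61 = true) (hw : L * e.size < w)
    (hstep : ∀ i < m, ∀ s, Inv i s → e.ok L s ∧ e.ev s ≠ 0 ∧ ∃ s', D w body s Tb s' ∧ Inv (i + 1) s')
    (hend : ∀ s, Inv m s → e.ok L s ∧ e.ev s = 0) {s : State} (h0 : Inv 0 s) :
    ∃ s', D w (whl e body) s (m * (Tb + e.cost + 4) + e.cost + 4) s' ∧ Inv m s' := by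
  have key : ∀ j i s, i + j = m → Inv i s → ∃ s', Inv m s' ∧ Fr body s s' ∧
      ∀ s0, Eqv s0 s → s0.reg 60 = e.ev s → ∃ s1, Eqv s1 s' ∧
        ∀ K g T', Val w g T' (K, s1) ≤
          Val w g (j * (Tb + e.cost + 4) + 1 + T') (.loop 60 (.seq body (setT e)) :: K, s0) := by
    intro j
    induction j with
    | zero =>
      intro i s hi hs
      obtain rfl : i = m := by omega
      refine ⟨s, hs, Fr.refl _ _, fun s0 h1 h2 => ⟨s0, h1, fun K g T' => ?_⟩⟩
      rw [(hend s hs).2] at h2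
      rw [Nat.zero_mul, Nat.zero_add, Nat.add_comm, Val_succ_of_pure (by simp only [step]; rfl)]
      simp [h2]
    | succ j ih =>
      intro i s hi hs
      obtain ⟨hok, hne, s', hD, hI⟩ := hstep i (by omega) s hs
      obtain ⟨s'', hI', hFr, hrun⟩ := ih (i + 1) s' (by omega) hI
      refine ⟨s'', hI', hD.fr.trans hFr, fun s0 h1 h2 => ?_⟩
      obtain ⟨s1, h3, h4⟩ := hD.val s0 h1
      have hok' : e.ok L s' := by
        by_cases hj : i + 1 < m
        · exact (hstep (i + 1) hj s' hI).1
        · obtain rfl : i + 1 = m := by omega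
          exact (hend s' hI).1
      obtain ⟨s2, h5, h6, h7⟩ := setT_spec hL h3 hwf hok' hw
      obtain ⟨s3, h8, h9⟩ := hrun s2 h5 h6
      refine ⟨s3, h8, fun K g T' => (h9 K g T').trans ((h7 _ g _).trans ((h4 _ g _).trans ?_))⟩
      rw [show (j + 1) * (Tb + e.cost + 4) + 1 + T' =
        (Tb + (e.cost + 2 + (j * (Tb + e.cost + 4) + 1 + T')) + 1) + 1 by ring,
        Val_succ_of_pure (by simp only [step]; rfl), h2, if_pos hne]
      rw [Val_succ_of_pure (by simp only [step]; rfl)]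
  obtain ⟨s', hI, hFr, hrun⟩ := key m 0 s (by omega) h0
  have hok : e.ok L s := by
    by_cases hm : 0 < m
    · exact (hstep 0 hm s h0).1
    · obtain rfl : 0 = m := by omega
      exact (hend s h0).1
  refine ⟨s', ⟨fun s0 h1 => ?_, ?_, ?_⟩, hI⟩
  · obtain ⟨s2, h5, h6, h7⟩ := setT_spec hL h1 hwf hok hw
    obtain ⟨s3, h8, h9⟩ := hrun s2 h5 h6
    refine ⟨s3, h8, fun K g T' => (h9 K g T').trans ((h7 _ g _).trans ?_)⟩
    rw [WordRAM.whl, show m * (Tb + e.cost + 4) + e.cost + 4 + T' =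
      (e.cost + 2 + (m * (Tb + e.cost + 4) + 1 + T')) + 1 by ring,
      Val_succ_of_pure (by simp only [step]; rfl)]
  · intro y hy
    simp only [WordRAM.whl, Cmd.nwr, Bool.and_eq_true] at hy
    exact hFr.1 y hy.2.1
  · intro y hy
    simp only [WordRAM.whl, Cmd.nwa, Bool.and_eq_true] at hy
    exact hFr.2 y hy.2.1

/-- In each round `Fr` is available besides the invariant: the state differs from the initial one
only where the loop writes. So invariants need to mention only what changes. -/
theorem D.forL {L : ℕ} (hL : 1 ≤ L) {x y : ℕ} {body : Cmd} {m Tb : ℕ} {Inv : ℕ → State → Prop}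
    {s0 : State} (hw : L * 2 < w) (hx : x < 60) (hy : y < 60) (hxy : x ≠ y)
    (hbx : body.nwr x = true) (hby : body.nwr y = true) (hm : s0.reg y = m) (hmL : m ≤ 2 ^ L)
    (h0 : Inv 0 (s0.setReg x 0))
    (hstep : ∀ i < m, ∀ s, Fr (forL x y body) s0 s → s.reg x = i → Inv i s →
      ∃ s', D w body s Tb s' ∧ Inv (i + 1) (s'.setReg x (i + 1))) :
    ∃ s', D w (forL x y body) s0 (m * (Tb + 20) + 20) s' ∧ s'.reg x = m ∧ Inv m s' := by
  have hwx : ∀ e : Ex, (HL.asg x e).wf = e.wf 61 := fun e => by simp [HL.wf, hx]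
  have hD0 : D w (HL.comp (.asg x (.n 0))) s0 3 (s0.setReg x 0) :=
    HL.D_comp hL (.asg x (.n 0)) s0 (by simp [HL.wf, hx, Ex.wf]) (by simp [HL.ok, Ex.ok])
      (by simp [HL.size, Ex.size]; omega)
  set body' : Cmd := .seq body (HL.comp (.asg x (.o .add (.v x) (.n 1)))) with hbody
  have hFr' : ∀ s s', Fr body' s s' → s.reg y = m → Fr (WordRAM.forL x y body) s0 s →
      Fr (WordRAM.forL x y body) s0 s' := by
    intro s s' h _ h1
    constructor
    · intro z hz
      rw [← h1.1 z hz]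
      simp only [WordRAM.forL, WordRAM.whl, Cmd.nwr, Bool.and_eq_true] at hz
      exact h.1 z (by simp only [hbody, Cmd.nwr, Bool.and_eq_true]; exact hz.2.2.1)
    · intro z hz
      rw [← h1.2 z hz]
      simp only [WordRAM.forL, WordRAM.whl, Cmd.nwa, Bool.and_eq_true] at hz
      exact h.2 z (by simp only [hbody, Cmd.nwa, Bool.and_eq_true]; exact hz.2.2.1)
  have main := D.whl (w := w) hL (e := .o .lt (.v x) (.v y)) (body := body') (m := m) (Tb := Tb + 8)
    (Inv := fun i s => s.reg x = i ∧ s.reg y = m ∧ Fr (WordRAM.forL x y body) s0 s ∧ Inv i s)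
    (by simp [Ex.wf, hx, hy]) (by simp [Ex.size]; omega) ?_ ?_ (s := s0.setReg x 0) ?_
  · obtain ⟨s', hD, h1, h2, h3, h4⟩ := main
    refine ⟨s', (hD0.seq hD).mono ?_, h1, h4⟩
    have : (Ex.o .lt (.v x) (.v y)).cost = 5 := rfl
    rw [this]; ring_nf; omega
  · intro i hi s ⟨h1, h2, h3, h4⟩
    have hi2 : i ≤ 2 ^ L := hi.le.trans hmL
    refine ⟨by simp [Ex.ok, h1, h2, hi2, hmL, Ex.side], by simp [Ex.ev, Ex.idl, h1, h2, hi], ?_⟩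
    obtain ⟨s', hD, hI⟩ := hstep i hi s h3 h1 h4
    have hx' : s'.reg x = i := by rw [hD.fr.1 x hbx, h1]
    have hD1 : D w (HL.comp (.asg x (.o .add (.v x) (.n 1)))) s' 7 (s'.setReg x (i + 1)) := by
      have := HL.D_comp (w := w) hL (.asg x (.o .add (.v x) (.n 1))) s'
        (by simp [HL.wf, hx, Ex.wf])
        (by simp [HL.ok, Ex.ok, hx', hi2, Ex.side, Nat.one_le_two_pow])
        (by simp [HL.size, Ex.size]; omega)
      simp only [HL.eff, Ex.ev, Ex.idl, hx'] at this
      exact this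
    have hDD := hD.seq hD1
    refine ⟨_, hDD.mono (by omega), by simp [State.setReg], ?_, hFr' s _ hDD.fr h2 h3, hI⟩
    simp only [State.setReg]
    rw [Function.update_of_ne (Ne.symm hxy), hD.fr.1 y hby, h2]
  · intro s ⟨h1, h2, h3, h4⟩
    exact ⟨by simp [Ex.ok, h1, h2, hmL, Ex.side], by simp [Ex.ev, Ex.idl, h1, h2]⟩
  · refine ⟨by simp [State.setReg], ?_, ?_, h0⟩
    · simp only [State.setReg]
      rw [Function.update_of_ne (Ne.symm hxy), hm]
    · constructor
      · intro z hz
        simp only [WordRAM.forL, Cmd.nwr, Bool.and_eq_true] at hz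
        exact hD0.fr.1 z hz.1
      · intro z _; rfl

/-! ## Randomized fragments -/

/-- From `s`, the program `c` surely reaches within `T` steps data satisfying `I`, and with
probability at least `p` data that also satisfy `F`. -/
def Rnd (w : ℕ) (c : Cmd) (s : State) (T : ℕ) (I F : State → Prop) (p : ℝ≥0∞) : Prop :=
  ∀ s0, Eqv s0 s → ∀ (K : List Cmd) (g : State → Prop) (T' : ℕ) (a d : ℝ≥0∞),
    (∀ s' s1, I s' → Eqv s1 s' → a ≤ Val w g T' (K, s1)) →
    (∀ s' s1, I s' → F s' → Eqv s1 s' → a + d ≤ Val w g T' (K, s1)) →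
    a + p * d ≤ Val w g (T + T') (c :: K, s0)

variable {c c' : Cmd} {s s' : State} {T T' : ℕ} {I F I' F' : State → Prop} {p q : ℝ≥0∞}

theorem Rnd.mono (h : Rnd w c s T I F p) (hT : T ≤ T') (hI : ∀ s, I s → I' s)
    (hF : ∀ s, I s → F s → F' s) (hq : q ≤ p) : Rnd w c s T' I' F' q := by
  intro s0 h0 K g T'' a d ha hd
  refine le_trans ?_ ((h s0 h0 K g T'' a d (fun s' s1 h1 h2 => ha s' s1 (hI _ h1) h2)
    fun s' s1 h1 h3 h2 => hd s' s1 (hI _ h1) (hF _ h1 h3) h2).trans (Val_mono (by omega) _))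
  gcongr

theorem Rnd.of_D (h : D w c s T s') (hI : I s') : Rnd w c s T I F 0 := by
  intro s0 h0 K g T'' a d ha _
  obtain ⟨s1, h1, h2⟩ := h.val s0 h0
  simpa using (ha s' s1 hI h1).trans (h2 K g T'')

theorem Rnd.of_D_one (h : D w c s T s') (hI : I s') (hF : F s') : Rnd w c s T I F 1 := by
  intro s0 h0 K g T'' a d _ hd
  obtain ⟨s1, h1, h2⟩ := h.val s0 h0
  simpa using (hd s' s1 hI hF h1).trans (h2 K g T'')

theorem Rnd.seq_left (h : D w c s T s') (h' : Rnd w c' s' T' I F p) :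
    Rnd w (.seq c c') s (T + T' + 1) I F p := by
  intro s0 h0 K g T'' a d ha hd
  obtain ⟨s1, h1, h2⟩ := h.val s0 h0
  rw [show T + T' + 1 + T'' = (T + (T' + T'')) + 1 by ring,
    Val_succ_of_pure (by simp only [step]; rfl)]
  exact (h' s1 h1 K g T'' a d ha hd).trans (h2 _ g _)

/-- In `Rnd` the value `a` is guaranteed by every outcome, and `d` is the gain on success. The
second fragment turns the gain into `q * d`, the first into `p * (q * d)`; the clause with
probability zero protects `a` when `F'` fails. -/
theorem Rnd.seq (h : Rnd w c s T I' F' p) (h0 : ∀ s', I' s' → Rnd w c' s' T' I F 0)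
    (h1 : ∀ s', I' s' → F' s' → Rnd w c' s' T' I F q) :
    Rnd w (.seq c c') s (T + T' + 1) I F (p * q) := by
  intro s0 hs0 K g T'' a d ha hd
  rw [show T + T' + 1 + T'' = (T + (T' + T'')) + 1 by ring,
    Val_succ_of_pure (by simp only [step]; rfl), mul_assoc]
  refine h s0 hs0 _ g _ a (q * d) ?_ ?_
  · intro s' s1 hI hE
    simpa using h0 s' hI s1 hE K g T'' a d ha hd
  · intro s' s1 hI hF hE
    exact h1 s' hI hF s1 hE K g T'' a d ha hd

theorem Rnd.rand {x : ℕ} {S : Finset ℕ} (hS : S ⊆ Finset.range (2 ^ w))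
    (hI : ∀ r < 2 ^ w, I (s.setReg x r)) (hF : ∀ r ∈ S, F (s.setReg x r))
    (hp : p * 2 ^ w ≤ S.card) : Rnd w (.rand x) s 1 I F p := by
  intro s0 h0 K g T a d ha hd
  have hE : ∀ r, Eqv (s0.setReg x r) (s.setReg x r) := fun r => ⟨h0.1, fun y hy => by
    simp only [State.setReg, Function.update_apply]
    split_ifs
    · rfl
    · exact h0.2 y hy⟩
  rw [Nat.add_comm, Val_rand]
  have hpos : (2 ^ w : ℝ≥0∞) ≠ 0 := by positivity
  have htop : (2 ^ w : ℝ≥0∞) ≠ ⊤ := by finiteness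
  rw [mul_comm (2 ^ w : ℝ≥0∞)⁻¹, ← div_eq_mul_inv, ENNReal.le_div_iff_mul_le (Or.inl hpos) (Or.inl htop)]
  calc (a + p * d) * 2 ^ w = a * 2 ^ w + (p * 2 ^ w) * d := by ring
    _ ≤ a * 2 ^ w + S.card * d := by gcongr
    _ = ∑ r ∈ Finset.range (2 ^ w), (a + if r ∈ S then d else 0) := by
      rw [Finset.sum_add_distrib, Finset.sum_const, Finset.sum_ite_mem,
        Finset.inter_eq_right.2 hS, Finset.sum_const]
      simp [mul_comm]
    _ ≤ _ := by
      refine Finset.sum_le_sum fun r hr => ?_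
      rw [Finset.mem_range] at hr
      split_ifs with h
      · exact hd _ _ (hI r hr) (hF r h) (hE r)
      · simpa using ha _ _ (hI r hr) (hE r)

/-- Success is absorbing: a round that starts with `F` keeps it. `P i` bounds the success
probability from round `i` on, and the recursion `hP` says that round `i` succeeds or else the later
rounds decide. No independence is needed, since `p i` is available from every state that satisfies
the invariant. -/
theorem Rnd.whl {L : ℕ} (hL : 1 ≤ L) {e : Ex} {body : Cmd} {m Tb : ℕ} {Inv : ℕ → State → Prop}
    (hwf : e.wf 61 = true) (hw : L * e.size < w) {p P : ℕ → ℝ≥0∞} (hPm : P m = 0)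
    (hP1 : ∀ i, P i ≤ 1) (hP : ∀ i < m, P i ≤ P (i + 1) + p i * (1 - P (i + 1)))
    (hstep : ∀ i < m, ∀ s, Inv i s → e.ev s ≠ 0 ∧ Rnd w body s Tb (Inv (i + 1)) F (p i) ∧
      (F s → Rnd w body s Tb (Inv (i + 1)) F 1))
    (hok : ∀ i ≤ m, ∀ s, Inv i s → e.ok L s)
    (hend : ∀ s, Inv m s → e.ev s = 0) (h0 : Inv 0 s) :
    Rnd w (whl e body) s (m * (Tb + e.cost + 4) + e.cost + 4) (Inv m) F (P 0) ∧
      (F s → Rnd w (whl e body) s (m * (Tb + e.cost + 4) + e.cost + 4) (Inv m) F 1) := by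
  have key : ∀ (K : List Cmd) (g : State → Prop) (T' : ℕ) (a d : ℝ≥0∞),
      (∀ s' s1, Inv m s' → Eqv s1 s' → a ≤ Val w g T' (K, s1)) →
      (∀ s' s1, Inv m s' → F s' → Eqv s1 s' → a + d ≤ Val w g T' (K, s1)) →
      ∀ j i s s0, i + j = m → Inv i s → Eqv s0 s → s0.reg 60 = e.ev s →
      a + P i * d ≤ Val w g (j * (Tb + e.cost + 4) + 1 + T')
          (.loop 60 (.seq body (setT e)) :: K, s0) ∧
      (F s → a + d ≤ Val w g (j * (Tb + e.cost + 4) + 1 + T')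
          (.loop 60 (.seq body (setT e)) :: K, s0)) := by
    intro K g T' a d ha hd j
    induction j with
    | zero =>
      intro i s s0 hi hs h1 h2
      obtain rfl : i = m := by omega
      rw [hend s hs] at h2
      rw [Nat.zero_mul, Nat.zero_add, Nat.add_comm 1, Val_succ_of_pure (by simp only [step]; rfl)]
      simp only [h2, hPm]
      constructor
      · simpa using ha s s0 hs h1
      · intro hF
        simpa using hd s s0 hs hF h1
    | succ j ih =>
      intro i s s0 hi hs h1 h2
      obtain ⟨hne, hR, hR1⟩ := hstep i (by omega) s hs
      have e1 : (j + 1) * (Tb + e.cost + 4) + 1 + T' =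
        (Tb + (e.cost + 2 + (j * (Tb + e.cost + 4) + 1 + T')) + 1) + 1 := by ring
      rw [e1, Val_succ_of_pure (by simp only [step]; rfl), h2, if_pos hne,
        Val_succ_of_pure (by simp only [step]; rfl)]
      have hA : ∀ s' s1, Inv (i + 1) s' → Eqv s1 s' → a + P (i + 1) * d ≤
          Val w g (e.cost + 2 + (j * (Tb + e.cost + 4) + 1 + T'))
            (setT e :: .loop 60 (.seq body (setT e)) :: K, s1) := by
        intro s' s1 hI hE
        obtain ⟨s2, h5, h6, h7⟩ := setT_spec hL hE hwf (hok _ (by omega) s' hI) hw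
        exact (ih (i + 1) s' s2 (by omega) hI h5 h6).1.trans (h7 _ g _)
      have hB : ∀ s' s1, Inv (i + 1) s' → F s' → Eqv s1 s' → a + d ≤
          Val w g (e.cost + 2 + (j * (Tb + e.cost + 4) + 1 + T'))
            (setT e :: .loop 60 (.seq body (setT e)) :: K, s1) := by
        intro s' s1 hI hF hE
        obtain ⟨s2, h5, h6, h7⟩ := setT_spec hL hE hwf (hok _ (by omega) s' hI) hw
        exact ((ih (i + 1) s' s2 (by omega) hI h5 h6).2 hF).trans (h7 _ g _)
      -- The body is used with the base value that the later rounds guarantee anyway; its gain is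
      -- the rest up to `a + d`.
      have hsplit : a + P (i + 1) * d + (1 - P (i + 1)) * d = a + d := by
        rw [add_assoc, ← add_mul, add_tsub_cancel_of_le (hP1 _), one_mul]
      constructor
      · refine le_trans ?_ (hR s0 h1 _ g _ (a + P (i + 1) * d) ((1 - P (i + 1)) * d) hA ?_)
        · rw [add_assoc, ← mul_assoc, ← add_mul]
          gcongr
          exact hP i (by omega)
        · rw [hsplit]; exact hB
      · intro hF
        refine le_trans ?_ (hR1 hF s0 h1 _ g _ (a + P (i + 1) * d) ((1 - P (i + 1)) * d) hA ?_)
        · rw [one_mul, hsplit]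
        · rw [hsplit]; exact hB
  have e2 : ∀ T', m * (Tb + e.cost + 4) + e.cost + 4 + T' =
      (e.cost + 2 + (m * (Tb + e.cost + 4) + 1 + T')) + 1 := fun T' => by ring
  constructor
  · intro s0 hs0 K g T' a d ha hd
    obtain ⟨s2, h5, h6, h7⟩ := setT_spec hL hs0 hwf (hok 0 (by omega) s h0) hw
    rw [WordRAM.whl, e2, Val_succ_of_pure (by simp only [step]; rfl)]
    exact (key K g T' a d ha hd m 0 s s2 (by omega) h0 h5 h6).1.trans (h7 _ g _)
  · intro hF s0 hs0 K g T' a d ha hd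
    obtain ⟨s2, h5, h6, h7⟩ := setT_spec hL hs0 hwf (hok 0 (by omega) s h0) hw
    rw [WordRAM.whl, e2, Val_succ_of_pure (by simp only [step]; rfl), one_mul]
    exact ((key K g T' a d ha hd m 0 s s2 (by omega) h0 h5 h6).2 hF).trans (h7 _ g _)

theorem Rnd.forL {L : ℕ} (hL : 1 ≤ L) {x y : ℕ} {body : Cmd} {m Tb : ℕ} {Inv : ℕ → State → Prop}
    (hw : L * 2 < w) (hx : x < 60) (hy : y < 60) (hxy : x ≠ y) (hmL : m ≤ 2 ^ L)
    {p P : ℕ → ℝ≥0∞} (hPm : P m = 0) (hP1 : ∀ i, P i ≤ 1)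
    (hP : ∀ i < m, P i ≤ P (i + 1) + p i * (1 - P (i + 1)))
    (hFx : ∀ s v, F s → F (s.setReg x v)) (hm : s.reg y = m) (h0 : Inv 0 (s.setReg x 0))
    (hstep : ∀ i < m, ∀ s, s.reg x = i → s.reg y = m → Inv i s →
      Rnd w body s Tb
        (fun s' => s'.reg x = i ∧ s'.reg y = m ∧ Inv (i + 1) (s'.setReg x (i + 1))) F (p i) ∧
      (F s → Rnd w body s Tb
        (fun s' => s'.reg x = i ∧ s'.reg y = m ∧ Inv (i + 1) (s'.setReg x (i + 1))) F 1)) :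
    Rnd w (forL x y body) s (m * (Tb + 20) + 20) (Inv m) F (P 0) ∧
      (F s → Rnd w (forL x y body) s (m * (Tb + 20) + 20) (Inv m) F 1) := by
  have hD0 : D w (HL.comp (.asg x (.n 0))) s 3 (s.setReg x 0) :=
    HL.D_comp hL (.asg x (.n 0)) s (by simp [HL.wf, hx, Ex.wf]) (by simp [HL.ok, Ex.ok])
      (by simp [HL.size, Ex.size]; omega)
  have hD1 : ∀ i < m, ∀ s' : State, s'.reg x = i →
      D w (HL.comp (.asg x (.o .add (.v x) (.n 1)))) s' 7 (s'.setReg x (i + 1)) := by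
    intro i hi s' hx'
    have := HL.D_comp (w := w) hL (.asg x (.o .add (.v x) (.n 1))) s'
        (by simp [HL.wf, hx, Ex.wf])
        (by simp [HL.ok, Ex.ok, hx', hi.le.trans hmL, Ex.side, Nat.one_le_two_pow])
        (by simp [HL.size, Ex.size]; omega)
    simp only [HL.eff, Ex.ev, Ex.idl, hx'] at this
    exact this
  have hcost : (Ex.o .lt (.v x) (.v y)).cost = 5 := rfl
  have hT : 3 + (m * (Tb + 8 + 5 + 4) + 5 + 4) + 1 ≤ m * (Tb + 20) + 20 := by nlinarith
  have main := Rnd.whl (w := w) (F := F) hL (e := .o .lt (.v x) (.v y))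
    (body := .seq body (HL.comp (.asg x (.o .add (.v x) (.n 1))))) (m := m) (Tb := Tb + 8)
    (Inv := fun i s => s.reg x = i ∧ s.reg y = m ∧ Inv i s)
    (by simp [Ex.wf, hx, hy]) (by simp [Ex.size]; omega) hPm hP1 hP (s := s.setReg x 0) ?_ ?_ ?_ ?_
  · rw [hcost] at main
    constructor
    · exact (Rnd.seq_left hD0 main.1).mono hT (fun s h => h.2.2) (fun s _ h => h) le_rfl
    · intro hF
      exact (Rnd.seq_left hD0 (main.2 (hFx _ _ hF))).mono hT (fun s h => h.2.2)
        (fun s _ h => h) le_rfl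
  · intro i hi s ⟨h1, h2, h3⟩
    have hpost : ∀ s' : State, s'.reg x = i → s'.reg y = m → Inv (i + 1) (s'.setReg x (i + 1)) →
        (s'.setReg x (i + 1)).reg x = i + 1 ∧ (s'.setReg x (i + 1)).reg y = m ∧
        Inv (i + 1) (s'.setReg x (i + 1)) := by
      intro s' h4 h5 h6
      refine ⟨by simp [State.setReg], ?_, h6⟩
      simp only [State.setReg]
      rw [Function.update_of_ne (Ne.symm hxy), h5]
    refine ⟨by simp [Ex.ev, Ex.idl, h1, h2, hi], ?_, fun hF => ?_⟩
    · refine (Rnd.seq (q := 1) (hstep i hi s h1 h2 h3).1 (T' := 7) ?_ ?_).mono (by omega) (fun _ h => h)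
        (fun _ _ h => h) (by rw [mul_one])
      · intro s' ⟨h4, h5, h6⟩
        exact Rnd.of_D (hD1 i hi s' h4) (hpost s' h4 h5 h6)
      · intro s' ⟨h4, h5, h6⟩ hF
        exact Rnd.of_D_one (hD1 i hi s' h4) (hpost s' h4 h5 h6) (hFx _ _ hF)
    · refine (Rnd.seq (q := 1) ((hstep i hi s h1 h2 h3).2 hF) (T' := 7) ?_ ?_).mono (by omega)
        (fun _ h => h) (fun _ _ h => h) (by rw [mul_one])
      · intro s' ⟨h4, h5, h6⟩
        exact Rnd.of_D (hD1 i hi s' h4) (hpost s' h4 h5 h6)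
      · intro s' ⟨h4, h5, h6⟩ hF
        exact Rnd.of_D_one (hD1 i hi s' h4) (hpost s' h4 h5 h6) (hFx _ _ hF)
  · intro i hi s ⟨h1, h2, h3⟩
    simp [Ex.ok, h1, h2, hi.trans hmL, hmL, Ex.side]
  · intro s ⟨h1, h2, h3⟩
    simp [Ex.ev, Ex.idl, h1, h2]
  · refine ⟨by simp [State.setReg], ?_, h0⟩
    simp only [State.setReg]
    rw [Function.update_of_ne (Ne.symm hxy), hm]

end WordRAM

/-! ### The listing program as a subroutine -/

namespace WordRAM

/-! ## Simulation with smaller words and a clock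

The simulated program has its registers from `100` on and its arrays from `10` on, with the cells
from `reg 11` on. Its words are reduced modulo `reg 10`. Register `13` counts the rounds of loops,
and all loops are left when it reaches `reg 14`. -/

/-- All registers are below `B`. -/
def Cmd.bdd (B : ℕ) : Cmd → Prop
  | .skip => True
  | .const x _ => x < B
  | .op _ x y z => x < B ∧ y < B ∧ z < B
  | .load x _ i => x < B ∧ i < B
  | .store _ i x => i < B ∧ x < B
  | .rand x => x < B
  | .seq c d => c.bdd B ∧ d.bdd B
  | .ite x c d => x < B ∧ c.bdd B ∧ d.bdd B
  | .loop x c => x < B ∧ c.bdd B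

theorem Cmd.bdd.mono {B B' : ℕ} (h : B ≤ B') (c : Cmd) : c.bdd B → c.bdd B' := by
  induction c with
  | seq c d hc hd => exact fun h => ⟨hc h.1, hd h.2⟩
  | ite x c d hc hd => exact fun h => ⟨by have := h.1; omega, hc h.2.1, hd h.2.2⟩
  | loop x c hc => exact fun h => ⟨by have := h.1; omega, hc h.2⟩
  | skip => exact fun h => h
  | _ => intro h; simp only [Cmd.bdd] at *; omega

theorem Cmd.exists_bdd (c : Cmd) : ∃ B, c.bdd B := by
  induction c with
  | skip => exact ⟨0, trivial⟩
  | const x v => exact ⟨x + 1, by simp only [Cmd.bdd]; omega⟩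
  | op o x y z => exact ⟨x + y + z + 1, by simp only [Cmd.bdd]; omega⟩
  | load x a i => exact ⟨x + i + 1, by simp only [Cmd.bdd]; omega⟩
  | store a i x => exact ⟨x + i + 1, by simp only [Cmd.bdd]; omega⟩
  | rand x => exact ⟨x + 1, by simp only [Cmd.bdd]; omega⟩
  | seq c d hc hd =>
    obtain ⟨B, hB⟩ := hc
    obtain ⟨B', hB'⟩ := hd
    exact ⟨B + B', Cmd.bdd.mono (by omega) _ hB, Cmd.bdd.mono (by omega) _ hB'⟩
  | ite x c d hc hd =>
    obtain ⟨B, hB⟩ := hc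
    obtain ⟨B', hB'⟩ := hd
    exact ⟨B + B' + x + 1, by omega, Cmd.bdd.mono (by omega) _ hB, Cmd.bdd.mono (by omega) _ hB'⟩
  | loop x c hc =>
    obtain ⟨B, hB⟩ := hc
    exact ⟨B + x + 1, by omega, Cmd.bdd.mono (by omega) _ hB⟩

/-- Register `60` tells whether simulated register `x` is nonzero and the clock has not expired. -/
def guard (x : ℕ) : Cmd :=
  .seq (.const 61 0) (.seq (.op .lt 60 61 (100 + x)) (.seq (.op .lt 61 13 14) (.op .mul 60 60 61)))

/-- The clock advances. -/
def tick : Cmd := .seq (.const 60 1) (.op .add 13 13 60)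

/-- The simulating program. -/
def Cmd.sim : Cmd → Cmd
  | .skip => .skip
  | .const x v => .seq (.const (100 + x) v) (.op .mod (100 + x) (100 + x) 10)
  | .op o x y z => .seq (.op o (100 + x) (100 + y) (100 + z)) (.op .mod (100 + x) (100 + x) 10)
  | .load x a i => .seq (.op .add 60 11 (100 + i)) (.load (100 + x) (10 + a) 60)
  | .store a i x => .seq (.op .add 60 11 (100 + i)) (.store (10 + a) 60 (100 + x))
  | .rand x => .seq (.rand (100 + x)) (.op .mod (100 + x) (100 + x) 10)
  | .seq c d => .seq c.sim d.sim
  | .ite x c d => .ite (100 + x) c.sim d.sim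
  | .loop x c => .seq (guard x) (.loop 60 (.seq tick (.seq c.sim (guard x))))

/-- A bound for the number of simulating steps between two clock ticks. -/
def Cmd.lag : Cmd → ℕ
  | .seq c d => c.lag + d.lag + 1
  | .ite _ c d => c.lag + d.lag + 1
  | .loop _ c => c.lag + 20
  | .skip => 3
  | .const _ _ => 3
  | .op _ _ _ _ => 3
  | .load _ _ _ => 3
  | .store _ _ _ => 3
  | .rand _ => 3

/-- The data `s` represent the data `t` of the simulated machine with `v`-bit words. -/
structure Rel (v slot b B : ℕ) (t s : State) : Prop where
  reg : ∀ x < B, s.reg (100 + x) = t.reg x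
  reg_lt : ∀ x < B, t.reg x < 2 ^ v
  mem : ∀ a, ∀ i < slot, s.mem (10 + a) (b + i) = t.mem a i
  mem_lt : ∀ a i, t.mem a i < 2 ^ v

/-- What the simulation leaves unchanged. -/
structure SFr (slot b CK : ℕ) (s s' : State) : Prop where
  reg : ∀ y < 60, y ≠ 13 → s'.reg y = s.reg y
  low : ∀ a < 10, s'.mem a = s.mem a
  mem : ∀ a i, i < b ∨ b + slot ≤ i → s'.mem a i = s.mem a i
  clk : s.reg 13 ≤ s'.reg 13
  clk_le : s'.reg 13 ≤ CK

theorem SFr.trans {slot b CK : ℕ} {s s' s'' : State} (h : SFr slot b CK s s')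
    (h' : SFr slot b CK s' s'') : SFr slot b CK s s'' where
  reg y hy hy' := (h'.reg y hy hy').trans (h.reg y hy hy')
  low a ha := (h'.low a ha).trans (h.low a ha)
  mem a i hi := (h'.mem a i hi).trans (h.mem a i hi)
  clk := h.clk.trans h'.clk
  clk_le := h'.clk_le

variable {w v slot b B CK : ℕ} {g gP : State → Prop} {s t : State}

theorem Rel.setReg (h : Rel v slot b B t s) {x z : ℕ} (hz : z < 2 ^ v) :
    Rel v slot b B (t.setReg x z) (s.setReg (100 + x) z) where
  reg y hy := by
    simp only [State.setReg, Function.update_apply, Nat.add_left_cancel_iff]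
    split_ifs
    · rfl
    · exact h.reg y hy
  reg_lt y hy := by
    simp only [State.setReg, Function.update_apply]
    split_ifs
    · exact hz
    · exact h.reg_lt y hy
  mem := h.mem
  mem_lt := h.mem_lt

theorem Rel.scratch (h : Rel v slot b B t s) {x z : ℕ} (hx : x < 100) :
    Rel v slot b B t (s.setReg x z) where
  reg y hy := by
    simp only [State.setReg]
    rw [Function.update_of_ne (by omega), h.reg y hy]
  reg_lt := h.reg_lt
  mem := h.mem
  mem_lt := h.mem_lt

theorem Rel.setMem (h : Rel v slot b B t s) {a i z : ℕ} (hz : z < 2 ^ v) :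
    Rel v slot b B (t.setMem a i z) (s.setMem (10 + a) (b + i) z) where
  reg := h.reg
  reg_lt := h.reg_lt
  mem a' i' hi' := by
    simp only [State.setMem, Function.update_apply, Nat.add_left_cancel_iff]
    split_ifs with h1
    · simp only [Function.update_apply, Nat.add_left_cancel_iff]
      split_ifs
      · rfl
      · subst h1; exact h.mem a' i' hi'
    · exact h.mem a' i' hi'
  mem_lt a' i' := by
    simp only [State.setMem, Function.update_apply]
    split_ifs with h1
    · simp only [Function.update_apply]
      split_ifs
      · exact hz
      · exact h.mem_lt _ _
    · exact h.mem_lt _ _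

theorem SFr.setReg (h : s.reg 13 ≤ CK) {x z : ℕ} (hx : 60 ≤ x) :
    SFr slot b CK s (s.setReg x z) where
  reg y hy _ := by simp only [State.setReg]; rw [Function.update_of_ne (by omega)]
  low _ _ := rfl
  mem _ _ _ := rfl
  clk := by simp only [State.setReg]; rw [Function.update_of_ne (by omega)]
  clk_le := by simp only [State.setReg]; rw [Function.update_of_ne (by omega)]; exact h

theorem SFr.setMem (h : s.reg 13 ≤ CK) {a i z : ℕ} (hi : i < slot) :
    SFr slot b CK s (s.setMem (10 + a) (b + i) z) where
  reg _ _ _ := rfl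
  low a' ha' := by simp only [State.setMem]; rw [Function.update_of_ne (by omega)]
  mem a' i' hi' := by
    simp only [State.setMem, Function.update_apply]
    split_ifs with h1
    · subst h1; rw [Function.update_of_ne (by omega)]
    · rfl
  clk := le_rfl
  clk_le := h

theorem Val_le_of_pure {T : ℕ} {a : Cmd} {K : List Cmd} {s : State} {c' : Config}
    (h : step w (a :: K, s) = PMF.pure c') : Val w g T (a :: K, s) ≤ Val w g T c' := by
  cases T with
  | zero => rw [Val_zero_cons]; exact zero_le
  | succ T => rw [Val_succ_of_pure h]; exact Val_le_succ _ _

/-- As `2 ^ v` divides `2 ^ w`, a final reduction suffices. Only subtraction involves the word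
length otherwise, and there `2 ^ w - y` and `2 ^ v - y` differ by a multiple of `2 ^ v`. -/
theorem BinOp.eval_mod (hvw : v ≤ w) (o : BinOp) (x y : ℕ) (hy : y < 2 ^ v) :
    o.eval w x y % 2 ^ v = o.eval v x y := by
  have hd : 2 ^ v ∣ 2 ^ w := Nat.pow_dvd_pow 2 hvw
  cases o <;> simp only [BinOp.eval, Nat.mod_mod_of_dvd _ hd]
  obtain ⟨m, hm⟩ := hd
  have hle : 2 ^ v ≤ 2 ^ w := Nat.pow_le_pow_right (by norm_num) hvw
  have hm1 : 1 ≤ m := by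
    rcases Nat.eq_zero_or_pos m with h | h
    · simp [h] at hm
    · exact h
  obtain ⟨r, rfl⟩ := Nat.exists_eq_add_of_le hm1
  rw [show x + (2 ^ w - y) = (x + (2 ^ v - y)) + 2 ^ v * r by rw [hm, mul_add, mul_one]; omega,
    Nat.add_mul_mod_self_left]

theorem BinOp.eval_lt (o : BinOp) (x y : ℕ) : o.eval v x y < 2 ^ v := by
  cases o <;> exact Nat.mod_lt _ (by positivity)

/-- Reduction modulo a divisor turns uniform words into uniform residues; this serves for the random
words of the simulated machine and for the hash multiplier. -/
theorem sum_range_mod {f : ℕ → ℝ≥0∞} (m r : ℕ) :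
    ∑ i ∈ Finset.range (m * r), f (i % m) = r * ∑ i ∈ Finset.range m, f i := by
  induction r with
  | zero => simp
  | succ r ih =>
    rw [mul_add, mul_one, Finset.sum_range_add, ih, Nat.cast_add, add_mul, Nat.cast_one, one_mul]
    congr 1
    refine Finset.sum_congr rfl fun i hi => ?_
    rw [Nat.mul_add_mod, Nat.mod_eq_of_lt (Finset.mem_range.1 hi)]

/-- The environment of a simulation. -/
structure SimEnv (w v slot b CK : ℕ) (s : State) : Prop where
  hvw : v ≤ w
  hw : 1 ≤ w
  hslot : 2 ^ v ≤ slot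
  hb : b + slot ≤ 2 ^ w
  hCK : CK < 2 ^ w
  modulus : s.reg 10 = 2 ^ v
  base : s.reg 11 = b
  limit : s.reg 14 = CK
  clk_le : s.reg 13 ≤ CK

theorem SimEnv.of_SFr {s' : State} (h : SimEnv w v slot b CK s) (h' : SFr slot b CK s s') :
    SimEnv w v slot b CK s' :=
  ⟨h.hvw, h.hw, h.hslot, h.hb, h.hCK, by rw [h'.reg 10 (by norm_num) (by norm_num), h.modulus],
    by rw [h'.reg 11 (by norm_num) (by norm_num), h.base],
    by rw [h'.reg 14 (by norm_num) (by norm_num), h.limit], h'.clk_le⟩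

theorem SimEnv.mod_eval {s : State} (h : SimEnv w v slot b CK s) (x : ℕ) :
    BinOp.mod.eval w x (2 ^ v) = x % 2 ^ v := by
  rw [BinOp.eval, Nat.mod_eq_of_lt]
  exact (Nat.mod_lt _ (by positivity)).trans_le (Nat.pow_le_pow_right (by norm_num) h.hvw)

/-- One command of the simulated program that turns `t` into `t'` is simulated. -/
theorem sim_atom {κ l T' Tp : ℕ} {c c' : Cmd} {K' K : List Cmd} {a d : ℝ≥0∞} {t' s' : State}
    (hP : step v (c :: K', t) = PMF.pure (K', t'))
    (hR : Rel v slot b B t' s') (hS : SFr slot b CK s s') (hclk : s'.reg 13 = s.reg 13)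
    (hrun : ∀ T, Val w g T (K, s') ≤ Val w g (T + l) (c' :: K, s))
    (H : ∀ t1 s1 Tp1, Rel v slot b B t1 s1 → SFr slot b CK s s1 → Tp1 ≤ CK - s1.reg 13 →
      a + d * Val v gP Tp1 (K', t1) ≤ Val w g (T' + κ * (CK - s1.reg 13)) (K, s1))
    (hTp : Tp ≤ CK - s.reg 13) :
    a + d * Val v gP Tp (c :: K', t) ≤ Val w g (T' + κ * (CK - s.reg 13) + l) (c' :: K, s) := by
  refine le_trans ?_ (hrun _)
  rw [← hclk] at hTp ⊢
  refine le_trans ?_ (H t' s' Tp hR hS hTp)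
  gcongr
  exact Val_le_of_pure hP

theorem guard_run (hE : SimEnv w v slot b CK s) {x : ℕ} (K : List Cmd) (T : ℕ) :
    Val w g (T + 7) (guard x :: K, s) = Val w g T (K, ((s.setReg 61 0).setReg 60
      (if 0 < s.reg (100 + x) then 1 else 0)).setReg 61 (if s.reg 13 < CK then 1 else 0) |>.setReg 60
        (if 0 < s.reg (100 + x) ∧ s.reg 13 < CK then 1 else 0)) := by
  have h1 : (1 : ℕ) % 2 ^ w = 1 := Nat.mod_eq_of_lt (Nat.one_lt_two_pow (by have := hE.hw; omega))
  have hif : ∀ p : Prop, ∀ [Decidable p], (if p then 1 else 0) % 2 ^ w = if p then 1 else 0 := by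
    intro p _; split_ifs
    · exact h1
    · simp
  rw [guard]
  iterate 7 rw [Val_succ_of_pure (by simp only [step] ; rfl)]
  have e1 : (100 + x) ≠ 61 := by omega
  have e2 : (100 + x) ≠ 60 := by omega
  simp only [State.setReg, BinOp.eval, Nat.zero_mod, Function.update_self, hif, ne_eq, e1,
    not_false_eq_true, Function.update_of_ne, hE.limit, Nat.reduceEqDiff]
  congr 5
  split_ifs <;> simp_all

/-- The simulation theorem: the success probability of the simulated program, with as many steps
as the clock still permits, is a lower bound for that of the simulating program. -/
theorem sim_spec (c : Cmd) (hc : c.bdd B) : ∀ κ, c.lag ≤ κ → ∀ (K' K : List Cmd) (g gP : State → Prop)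
    (T' Tp : ℕ) (a d : ℝ≥0∞) (t s : State), SimEnv w v slot b CK s →
    (∀ t1 s1 Tp1, Rel v slot b B t1 s1 → SFr slot b CK s s1 → Tp1 ≤ CK - s1.reg 13 →
      a + d * Val v gP Tp1 (K', t1) ≤ Val w g (T' + κ * (CK - s1.reg 13)) (K, s1)) →
    Rel v slot b B t s → Tp ≤ CK - s.reg 13 →
    a + d * Val v gP Tp (c :: K', t) ≤
      Val w g (T' + κ * (CK - s.reg 13) + c.lag) (c.sim :: K, s) := by
  induction c with
  | skip =>
    intro κ _ K' K g gP T' Tp a d t s hE H hR hTp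
    refine sim_atom (by simp [step]) hR
      ⟨fun _ _ _ => rfl, fun _ _ => rfl, fun _ _ _ => rfl, le_rfl, hE.clk_le⟩ rfl ?_ H hTp
    intro T
    exact (Val_succ_of_pure (by simp [step, Cmd.sim])).ge.trans
      (Val_mono (by simp [Cmd.lag]) _)
  | const x z =>
    intro κ _ K' K g gP T' Tp a d t s hE H hR hTp
    refine sim_atom (by simp only [step]) (hR.setReg (x := x) (Nat.mod_lt z (by positivity)))
      (SFr.setReg hE.clk_le (by omega))
      (by simp only [State.setReg]; rw [Function.update_of_ne (by omega)]) ?_ H hTp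
    intro T
    rw [Cmd.lag, Cmd.sim]
    iterate 3 rw [Val_succ_of_pure (by simp only [step]; rfl)]
    apply le_of_eq
    simp only [State.setReg, Function.update_self, Function.update_idem]
    rw [Function.update_of_ne (by omega), hE.modulus, hE.mod_eval,
      Nat.mod_mod_of_dvd _ (Nat.pow_dvd_pow 2 hE.hvw)]
  | op o x y z =>
    intro κ _ K' K g gP T' Tp a d t s hE H hR hTp
    refine sim_atom (by simp only [step]; rfl) (hR.setReg (x := x) (BinOp.eval_lt o _ _))
      (SFr.setReg hE.clk_le (by omega))
      (by simp only [State.setReg]; rw [Function.update_of_ne (by omega)]) ?_ H hTp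
    intro T
    rw [Cmd.lag, Cmd.sim]
    iterate 3 rw [Val_succ_of_pure (by simp only [step]; rfl)]
    apply le_of_eq
    simp only [State.setReg, Function.update_self, Function.update_idem]
    rw [Function.update_of_ne (by omega), hE.modulus, hE.mod_eval, hR.reg y hc.2.1,
      hR.reg z hc.2.2, BinOp.eval_mod hE.hvw _ _ _ (hR.reg_lt z hc.2.2)]
  | load x a' i =>
    intro κ _ K' K g gP T' Tp a d t s hE H hR hTp
    have hi := hR.reg_lt i hc.2
    have hslot := hE.hslot
    have hb := hE.hb
    refine sim_atom (s' := (s.setReg 60 (b + t.reg i)).setReg (100 + x) (t.mem a' (t.reg i)))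
      (by simp only [step]) ((hR.scratch (by norm_num)).setReg (hR.mem_lt _ _))
      ((SFr.setReg hE.clk_le (by norm_num)).trans (SFr.setReg ?_ (by omega)))
      (by simp only [State.setReg]; rw [Function.update_of_ne (by omega),
        Function.update_of_ne (by omega)]) ?_ H hTp
    · simp only [State.setReg]; rw [Function.update_of_ne (by omega)]; exact hE.clk_le
    intro T
    rw [Cmd.lag, Cmd.sim]
    iterate 3 rw [Val_succ_of_pure (by simp only [step]; rfl)]
    · apply le_of_eq
      have : BinOp.add.eval w b (t.reg i) = b + t.reg i := Nat.mod_eq_of_lt (by omega)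
      simp only [State.setReg, Function.update_self, hE.base, hR.reg i hc.2, this]
      rw [hR.mem a' _ (by omega)]
  | store a' i x =>
    intro κ _ K' K g gP T' Tp a d t s hE H hR hTp
    have hi := hR.reg_lt i hc.1
    have hslot := hE.hslot
    have hb := hE.hb
    refine sim_atom (s' := (s.setReg 60 (b + t.reg i)).setMem (10 + a') (b + t.reg i) (t.reg x))
      (by simp only [step]) ((hR.scratch (by norm_num)).setMem (hR.reg_lt x hc.2))
      ((SFr.setReg hE.clk_le (by norm_num)).trans (SFr.setMem ?_ (by omega)))
      (by simp only [State.setReg, State.setMem]; rw [Function.update_of_ne (by omega)]) ?_ H hTp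
    · simp only [State.setReg]; rw [Function.update_of_ne (by omega)]; exact hE.clk_le
    intro T
    rw [Cmd.lag, Cmd.sim]
    iterate 3 rw [Val_succ_of_pure (by simp only [step]; rfl)]
    · apply le_of_eq
      have : BinOp.add.eval w b (t.reg i) = b + t.reg i := Nat.mod_eq_of_lt (by omega)
      simp only [State.setReg, Function.update_self, hE.base, hR.reg i hc.1, this]
      rw [Function.update_of_ne (by omega), hR.reg x hc.2]
  | rand x =>
    intro κ _ K' K g gP T' Tp a d t s hE H hR hTp
    obtain ⟨m, hm⟩ := Nat.pow_dvd_pow 2 hE.hvw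
    rw [Cmd.lag, Cmd.sim, Val_succ_of_pure (by simp only [step]; rfl), Val_rand]
    have hstep : ∀ r ∈ Finset.range (2 ^ w), (fun z => a + d * Val v gP (Tp - 1)
        (K', t.setReg x z)) (r % 2 ^ v) ≤ Val w g (T' + κ * (CK - s.reg 13) + 1)
        (.op .mod (100 + x) (100 + x) 10 :: K, s.setReg (100 + x) r) := by
      intro r _
      rw [Val_succ_of_pure (by simp only [step]; rfl)]
      have e13 : (s.setReg (100 + x) (r % 2 ^ v)).reg 13 = s.reg 13 := by
        simp only [State.setReg]; rw [Function.update_of_ne (by omega)]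
      have := H _ _ (Tp - 1) (hR.setReg (x := x) (Nat.mod_lt r (by positivity)))
        (SFr.setReg hE.clk_le (by omega)) (by rw [e13]; omega)
      rw [e13] at this
      refine this.trans (le_of_eq ?_)
      simp only [State.setReg, Function.update_self, Function.update_idem]
      rw [Function.update_of_ne (by omega), hE.modulus, hE.mod_eval]
    refine le_trans ?_ (mul_le_mul_right (Finset.sum_le_sum hstep) _)
    have hv0 : (2 ^ v : ℝ≥0∞) ≠ 0 := by positivity
    have hw0 : (2 ^ w : ℝ≥0∞) ≠ 0 := by positivity
    have hmE : (2 ^ w : ℝ≥0∞) = 2 ^ v * m := by exact_mod_cast hm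
    have hm0 : (m : ℝ≥0∞) ≠ 0 := by
      rintro h; rw [h, mul_zero] at hmE; exact hw0 hmE
    rw [hm, sum_range_mod (f := fun z => a + d * Val v gP (Tp - 1) (K', t.setReg x z)), hmE,
      ENNReal.mul_inv (Or.inl hv0) (Or.inl (by finiteness)), mul_assoc,
      ← mul_assoc (m : ℝ≥0∞)⁻¹, ENNReal.inv_mul_cancel hm0 (by finiteness), one_mul,
      Finset.sum_add_distrib, Finset.sum_const, Finset.card_range, nsmul_eq_mul, Nat.cast_pow,
      Nat.cast_ofNat, mul_add, ← mul_assoc, ENNReal.inv_mul_cancel hv0 (by finiteness), one_mul,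
      ← Finset.mul_sum]
    rw [mul_left_comm]
    refine add_le_add_right (mul_le_mul_right ?_ _) _
    cases Tp with
    | zero => rw [Val_zero_cons]; exact zero_le
    | succ Tp => rw [Val_rand, Nat.add_sub_cancel]
  | seq c1 c2 ih1 ih2 =>
    intro κ hκ K' K g gP T' Tp a d t s hE H hR hTp
    simp only [Cmd.lag] at hκ
    rw [Cmd.lag, Cmd.sim, show T' + κ * (CK - s.reg 13) + (c1.lag + c2.lag + 1) =
      ((T' + c2.lag) + κ * (CK - s.reg 13) + c1.lag) + 1 by ring,
      Val_succ_of_pure (by simp only [step]; rfl)]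
    refine le_trans ?_ (ih1 hc.1 κ (by omega) (c2 :: K') (c2.sim :: K) g gP (T' + c2.lag) Tp a d t s
      hE ?_ hR hTp)
    · gcongr; exact Val_le_of_pure (by simp only [step])
    · intro t1 s1 Tp1 hR1 hS1 hT1
      refine (ih2 hc.2 κ (by omega) K' K g gP T' Tp1 a d t1 s1 (hE.of_SFr hS1)
        (fun t2 s2 Tp2 h1 h2 h3 => H t2 s2 Tp2 h1 (hS1.trans h2) h3) hR1 hT1).trans (le_of_eq ?_)
      congr 1; ring
  | ite x c1 c2 ih1 ih2 =>
    intro κ hκ K' K g gP T' Tp a d t s hE H hR hTp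
    simp only [Cmd.lag] at hκ
    rw [Cmd.lag, Cmd.sim, ← add_assoc, Val_succ_of_pure (by simp only [step]; rfl),
      hR.reg x hc.1]
    have h1 : Val v gP Tp (.ite x c1 c2 :: K', t) ≤
        Val v gP Tp ((if t.reg x ≠ 0 then c1 else c2) :: K', t) := Val_le_of_pure (by simp only [step])
    refine le_trans (add_le_add_right (mul_le_mul_right h1 d) a) ?_
    by_cases hx : t.reg x = 0
    · simp only [hx, ne_eq, not_true_eq_false, if_false]
      exact (ih2 hc.2.2 κ (by omega) K' K g gP T' Tp a d t s hE H hR hTp).trans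
        (Val_mono (by omega) _)
    · simp only [hx, ne_eq, not_false_eq_true, if_true]
      exact (ih1 hc.2.1 κ (by omega) K' K g gP T' Tp a d t s hE H hR hTp).trans
        (Val_mono (by omega) _)
  | loop x c ih =>
    intro κ hκ K' K g gP T' Tp a d t s hE H hR hTp
    simp only [Cmd.lag] at hκ
    -- Strong induction on the number `q` of ticks left, since loops inside the body consume ticks
    -- too. Entering the body costs the simulated program a step and the clock a tick, so `Tp ≤ q`
    -- persists, and the `κ` steps released by the tick pay for the body.
    have main : ∀ q s t Tp, CK - s.reg 13 = q → SimEnv w v slot b CK s →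
        (∀ t1 s1 Tp1, Rel v slot b B t1 s1 → SFr slot b CK s s1 → Tp1 ≤ CK - s1.reg 13 →
          a + d * Val v gP Tp1 (K', t1) ≤ Val w g (T' + κ * (CK - s1.reg 13)) (K, s1)) →
        Rel v slot b B t s → Tp ≤ q → a + d * Val v gP Tp (.loop x c :: K', t) ≤
          Val w g ((T' + 1) + κ * q + 7) (guard x :: .loop 60 (.seq tick (.seq c.sim (guard x))) :: K, s) := by
      intro q
      induction q using Nat.strong_induction_on with
      | _ q ihq =>
        intro s t Tp hq hE H hR hTp
        rw [guard_run hE]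
        set G : ℕ := if 0 < s.reg (100 + x) ∧ s.reg 13 < CK then 1 else 0 with hG
        set s1 : State := (((s.setReg 61 0).setReg 60
          (if 0 < s.reg (100 + x) then 1 else 0)).setReg 61
          (if s.reg 13 < CK then 1 else 0)).setReg 60 G with hs1
        have h13 : s1.reg 13 = s.reg 13 := by
          simp [hs1, State.setReg]
        have h60 : s1.reg 60 = G := by simp [hs1, State.setReg]
        have hR1 : Rel v slot b B t s1 :=
          (((hR.scratch (by norm_num)).scratch (by norm_num)).scratch (by norm_num)).scratch
            (by norm_num)
        have hS1 : SFr slot b CK s s1 := by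
          refine ⟨fun y hy hy' => ?_, fun _ _ => rfl, fun _ _ _ => rfl, h13.ge, h13.le.trans hE.clk_le⟩
          simp only [hs1, State.setReg]
          rw [Function.update_of_ne (by omega), Function.update_of_ne (by omega),
            Function.update_of_ne (by omega), Function.update_of_ne (by omega)]
        rw [show (T' + 1) + κ * q = (T' + κ * q) + 1 by ring,
          Val_succ_of_pure (by simp only [step]; rfl), h60]
        have hx := hR.reg x hc.1
        by_cases hg : 0 < s.reg (100 + x) ∧ s.reg 13 < CK
        · have hG1 : G = 1 := by rw [hG, if_pos hg]
          simp only [hG1, ne_eq, one_ne_zero, not_false_eq_true, if_true]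
          obtain ⟨q', rfl⟩ : ∃ q', q = q' + 1 := ⟨q - 1, by omega⟩
          have hCK := hE.hCK
          set s2 : State := (s1.setReg 60 1).setReg 13 (s.reg 13 + 1) with hs2
          have h132 : s2.reg 13 = s.reg 13 + 1 := by simp [hs2, State.setReg]
          have hR2 : Rel v slot b B t s2 := (hR1.scratch (by norm_num)).scratch (by norm_num)
          have hS2 : SFr slot b CK s s2 := by
            refine hS1.trans ⟨fun y hy hy' => ?_, fun _ _ => rfl, fun _ _ _ => rfl, by omega, by omega⟩
            simp only [hs2, State.setReg]
            rw [Function.update_of_ne (by omega), Function.update_of_ne (by omega)]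
          have hrun : ∀ T K, Val w g (T + 5) (.seq tick (.seq c.sim (guard x)) :: K, s1) =
              Val w g T (c.sim :: guard x :: K, s2) := by
            intro T K
            rw [tick]
            iterate 5 rw [Val_succ_of_pure (by simp only [step]; rfl)]
            have e1 : (1 : ℕ) % 2 ^ w = 1 :=
              Nat.mod_eq_of_lt (Nat.one_lt_two_pow (by have := hE.hw; omega))
            have e2 : (s1.reg 13 + 1) % 2 ^ w = s.reg 13 + 1 := by
              rw [h13]; exact Nat.mod_eq_of_lt (by omega)
            simp only [State.setReg, BinOp.eval, e1, Function.update_self, hs2]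
            rw [Function.update_of_ne (by norm_num), e2]
          have hloop : a + d * Val v gP Tp (.loop x c :: K', t) ≤
              a + d * Val v gP (Tp - 1) (c :: .loop x c :: K', t) := by
            gcongr
            cases Tp with
            | zero => rw [Val_zero_cons]; exact zero_le
            | succ Tp =>
              rw [Val_succ_of_pure (by simp only [step]; rfl), if_pos (by omega),
                Nat.add_sub_cancel]
          refine hloop.trans ?_
          have hκ2 : T' + κ * (q' + 1) = (T' + κ * q' + (κ - 5)) + 5 := by
            rw [mul_add, mul_one]; omega
          rw [hκ2, hrun]
          refine (ih hc.2 κ (by omega) (.loop x c :: K')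
            (guard x :: .loop 60 (.seq tick (.seq c.sim (guard x))) :: K) g gP (T' + 8) (Tp - 1) a d
            t s2 (hE.of_SFr hS2) ?_ hR2 (by omega)).trans (Val_mono ?_ _)
          · intro t3 s3 Tp3 hR3 hS3 hT3
            have hc3 := hS3.clk
            refine (ihq (CK - s3.reg 13) (by omega) s3 t3 Tp3 rfl ((hE.of_SFr hS2).of_SFr hS3)
              (fun t4 s4 Tp4 h1 h2 h3 => H t4 s4 Tp4 h1 (hS2.trans (hS3.trans h2)) h3) hR3
              hT3).trans (le_of_eq ?_)
            congr 1; ring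
          · have : CK - s2.reg 13 = q' := by omega
            rw [this]; omega
        · have hG0 : G = 0 := by rw [hG, if_neg hg]
          simp only [hG0, ne_eq, not_true_eq_false, if_false]
          rw [← hq, ← h13]
          refine le_trans ?_ (H t s1 Tp hR1 hS1 (by omega))
          gcongr
          -- If the loop is left because of the clock, then `Tp = 0`: the simulated program has no
          -- steps left and has not halted, so nothing is lost.
          by_cases hTp0 : Tp = 0
          · rw [hTp0, Val_zero_cons]; exact zero_le
          · have : t.reg x = 0 := by
              by_contra h
              exact hg ⟨by omega, by omega⟩
            exact Val_le_of_pure (by simp [step, this])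
    rw [Cmd.lag, Cmd.sim]
    refine (main _ s t Tp rfl hE H hR hTp).trans ?_
    rw [show T' + κ * (CK - s.reg 13) + (c.lag + 20) =
      (T' + κ * (CK - s.reg 13) + (c.lag + 19)) + 1 by ring]
    refine le_trans ?_ (Val_succ_of_pure (by simp only [step]; rfl)).ge
    exact Val_mono (by omega) _

/-- The simulation as a randomized fragment. -/
theorem Rnd.sim {P : Cmd} (hP : P.bdd B) (hE : SimEnv w v slot b CK s)
    (hR : Rel v slot b B t s) (hclk : s.reg 13 = 0) {Tp : ℕ} (hTp : Tp ≤ CK) :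
    Rnd w P.sim s (P.lag * CK + P.lag)
      (fun s' => SFr slot b CK s s' ∧ ∃ t', Rel v slot b B t' s')
      (fun s' => ∃ t', Rel v slot b B t' s' ∧ gP t') (Val v gP Tp ([P], t)) := by
  intro s0 h0 K g T' a d ha hd
  have hE0 : SimEnv w v slot b CK s0 := ⟨hE.hvw, hE.hw, hE.hslot, hE.hb, hE.hCK,
    by rw [h0.2 10 (by norm_num), hE.modulus], by rw [h0.2 11 (by norm_num), hE.base],
    by rw [h0.2 14 (by norm_num), hE.limit], by rw [h0.2 13 (by norm_num)]; exact hE.clk_le⟩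
  have hR0 : Rel v slot b B t s0 := ⟨fun x hx => by rw [h0.2 _ (by omega), hR.reg x hx], hR.reg_lt,
    fun a i hi => by rw [h0.1, hR.mem a i hi], hR.mem_lt⟩
  have hS0 : ∀ s1, SFr slot b CK s0 s1 → SFr slot b CK s s1 := fun s1 h =>
    ⟨fun y hy hy' => by rw [h.reg y hy hy', h0.2 y (by omega)],
      fun a ha => by rw [h.low a ha, h0.1], fun a i hi => by rw [h.mem a i hi, h0.1],
      by rw [← h0.2 13 (by norm_num)]; exact h.clk, h.clk_le⟩
  have hc0 : s0.reg 13 = 0 := by rw [h0.2 13 (by norm_num), hclk]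
  have := sim_spec (w := w) P hP P.lag le_rfl [] K g gP T' Tp a d t s0 hE0 ?_ hR0
    (by rw [hc0]; exact hTp)
  · rw [hc0, Nat.sub_zero] at this
    rw [mul_comm, show P.lag * CK + P.lag + T' = T' + P.lag * CK + P.lag by ring]
    exact this
  · intro t1 s1 Tp1 hR1 hS1 _
    refine le_trans ?_ (Val_mono (Nat.le_add_right T' _) _)
    by_cases hg : gP t1
    · rw [Val_nil_of _ hg, mul_one]
      exact hd s1 s1 ⟨hS0 s1 hS1, t1, hR1⟩ ⟨t1, hR1, hg⟩ (Eqv.refl _)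
    · rw [Val_nil_of_not _ hg, mul_zero, add_zero]
      exact ha s1 s1 ⟨hS0 s1 hS1, t1, hR1⟩ (Eqv.refl _)

end WordRAM

/-! ### Combinatorics of the reduction: instances, cliques, hashing and arboricity -/

/-! ## Digits -/

theorem sum_digits_lt {b : ℕ} (d : ℕ → ℕ) (hd : ∀ i, d i < b) (m : ℕ) :
    ∑ i ∈ Finset.range m, d i * b ^ i < b ^ m := by
  induction m with
  | zero => simp
  | succ m ih =>
    rw [Finset.sum_range_succ, pow_succ]
    have := Nat.mul_le_mul_right (b ^ m) (Nat.succ_le_of_lt (hd m))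
    rw [Nat.succ_mul] at this
    linarith [mul_comm (b ^ m) b]

theorem sum_digits_div_mod {b : ℕ} (d : ℕ → ℕ) (hd : ∀ i, d i < b) {m j : ℕ} (hj : j < m) :
    (∑ i ∈ Finset.range m, d i * b ^ i) / b ^ j % b = d j := by
  have hb : 0 < b := (Nat.zero_le _).trans_lt (hd 0)
  induction m with
  | zero => omega
  | succ m ih =>
    rw [Finset.sum_range_succ]
    rcases Nat.lt_succ_iff_lt_or_eq.1 hj with h | rfl
    · obtain ⟨r, rfl⟩ := Nat.exists_eq_add_of_lt h
      rw [show d (j + r + 1) * b ^ (j + r + 1) = b ^ j * (b * (d (j + r + 1) * b ^ r)) by ring,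
        Nat.add_mul_div_left _ _ (by positivity), Nat.add_mul_mod_self_left, ih h]
    · rw [mul_comm, Nat.add_mul_div_left _ _ (by positivity),
        Nat.div_eq_of_lt (sum_digits_lt d hd j), zero_add, Nat.mod_eq_of_lt (hd j)]

theorem mod_pow_eq_sum_digits (b n m : ℕ) :
    n % b ^ m = ∑ i ∈ Finset.range m, (n / b ^ i % b) * b ^ i := by
  induction m with
  | zero => simp [Nat.mod_one]
  | succ m ih => rw [Finset.sum_range_succ, ← ih, Nat.mod_pow_succ]; ring

theorem eq_of_digits_eq {b m n n' : ℕ} (hn : n < b ^ m) (hn' : n' < b ^ m)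
    (h : ∀ i < m, n / b ^ i % b = n' / b ^ i % b) : n = n' := by
  rw [← Nat.mod_eq_of_lt hn, ← Nat.mod_eq_of_lt hn', mod_pow_eq_sum_digits, mod_pow_eq_sum_digits]
  exact Finset.sum_congr rfl fun i hi => by rw [h i (Finset.mem_range.1 hi)]

/-! ## Numbering pairs -/

/-- The number of pairs below `j`. -/
def tri (j : ℕ) : ℕ := j * (j - 1) / 2

theorem tri_succ (j : ℕ) : tri (j + 1) = tri j + j := by
  have := Nat.triangle_succ j
  simpa [tri] using this

theorem tri_mono : Monotone tri := monotone_nat_of_le_succ fun j => by rw [tri_succ]; omega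

/-- Pairs are numbered by their larger element first, so the numbering does not depend on `k`. -/
theorem exists_eq_tri_add {k π : ℕ} (h : π < tri k) : ∃ i j, i < j ∧ j < k ∧ π = tri j + i := by
  induction k with
  | zero => simp [tri] at h
  | succ k ih =>
    rw [tri_succ] at h
    by_cases hp : π < tri k
    · obtain ⟨i, j, h1, h2, h3⟩ := ih hp
      exact ⟨i, j, h1, by omega, h3⟩
    · exact ⟨π - tri k, k, by omega, by omega, by omega⟩

theorem tri_add_lt {i j k : ℕ} (hij : i < j) (hjk : j < k) : tri j + i < tri k := by
  have := tri_mono (show j + 1 ≤ k by omega)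
  rw [tri_succ] at this
  omega

theorem tri_add_inj {i j i' j' : ℕ} (h : i < j) (h' : i' < j') (he : tri j + i = tri j' + i') :
    i = i' ∧ j = j' := by
  rcases lt_trichotomy j j' with hj | hj | hj
  · have := tri_add_lt h hj; omega
  · subst hj; omega
  · have := tri_add_lt h' hj; omega

/-! ## The graph of a hash function -/

/-- The parameters of the reduction: `k`-cliques in a graph on `V` vertices, with weights modulo
`R * BK`; `S` groups of `N` vertices; `R` buckets of size `BK`. -/
structure Red where
  k : ℕ
  V : ℕ
  N : ℕ
  S : ℕ
  R : ℕ
  BK : ℕ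
  adj : ℕ → ℕ → Prop
  wt : ℕ → ℕ → ℕ

namespace Red

variable (D : Red)

/-- The number of pairs of parts. -/
def E : ℕ := tri D.k

/-- The instance of a vertex. -/
def inst (u : ℕ) : ℕ := u / (D.k * D.N)

/-- The part of a vertex. -/
def part (u : ℕ) : ℕ := u / D.N % D.k

/-- The vertex of the given graph that `u` is a copy of. -/
def orig (u : ℕ) : ℕ := D.inst u / D.S ^ D.part u % D.S * D.N + u % D.N

/-- The digits that encode the buckets of an instance: the bucket of the pair with number `π` is
the difference of the digits `π` and `π + 1`. -/
def dig (id π : ℕ) : ℕ := D.R * (id / D.S ^ D.k) / D.R ^ π % D.R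

/-- The bucket of a pair of vertices under the hash function with multiplier `h`. -/
def bkt (h a b : ℕ) : ℕ := h * D.wt a b % (D.R * D.BK) / D.BK

/-- The edges within instances, from the lower to the upper part. -/
def link (h u v : ℕ) : Prop :=
  D.inst u = D.inst v ∧ D.part u < D.part v ∧ D.orig u < D.V ∧ D.orig v < D.V ∧
    D.adj (D.orig u) (D.orig v) ∧
    (D.dig (D.inst u) (tri (D.part v) + D.part u + 1) + D.bkt h (D.orig u) (D.orig v)) % D.R =
      D.dig (D.inst u) (tri (D.part v) + D.part u)

/-- The number of instances. -/
def num : ℕ := D.E * D.R ^ (D.E - 1) * D.S ^ D.k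

/-- The number of vertices in instances. -/
def U : ℕ := D.num * (D.k * D.N)

/-- The pairs of parts. -/
def pairs : Finset (Fin D.k × Fin D.k) := Finset.univ.filter fun P => P.1 < P.2

/-- The vertex in part `i` of an instance that is a copy of `a`. -/
def vtx (id i a : ℕ) : ℕ := id * (D.k * D.N) + i * D.N + a % D.N

/-- The buckets of the tuple sum to zero up to a rounding error. -/
def Cong (h : ℕ) (t : Fin D.k → ℕ) : Prop :=
  ∃ C < D.E, D.R ∣ ∑ P ∈ D.pairs, D.bkt h (t P.1) (t P.2) + C

/-- The tuple forms a clique. -/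
def AdjT (t : Fin D.k → ℕ) : Prop := (∀ i, t i < D.V) ∧ ∀ i j, i < j → D.adj (t i) (t j)

/-- The standing assumptions on the parameters. -/
structure Valid : Prop where
  hk : 2 ≤ D.k
  hN : 0 < D.N
  hS : 0 < D.S
  hBK : 0 < D.BK
  hE : D.E ≤ D.R
  hV : D.V ≤ D.S * D.N

variable {D}

theorem Valid.E_pos (hD : D.Valid) : 0 < D.E := by
  have := tri_mono hD.hk
  have h2 : tri 2 = 1 := rfl
  unfold E; omega

theorem Valid.R_pos (hD : D.Valid) : 0 < D.R := hD.E_pos.trans_le hD.hE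

theorem vtx_spec (hD : D.Valid) {id i a : ℕ} (hi : i < D.k) :
    D.inst (D.vtx id i a) = id ∧ D.part (D.vtx id i a) = i ∧ D.vtx id i a % D.N = a % D.N := by
  have hN := hD.hN
  have hk := hD.hk
  have ha := Nat.mod_lt a hN
  have h1 : i * D.N + a % D.N < D.k * D.N := by
    have := Nat.mul_le_mul_right D.N (Nat.succ_le_of_lt hi)
    rw [Nat.succ_mul] at this
    omega
  have h2 : D.vtx id i a / D.N = id * D.k + i := by
    rw [vtx, show id * (D.k * D.N) + i * D.N + a % D.N = a % D.N + D.N * (id * D.k + i) by ring,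
      Nat.add_mul_div_left _ _ hN, Nat.div_eq_of_lt ha, zero_add]
  refine ⟨?_, ?_, ?_⟩
  · rw [inst, vtx, show id * (D.k * D.N) + i * D.N + a % D.N =
      (i * D.N + a % D.N) + (D.k * D.N) * id by ring,
      Nat.add_mul_div_left _ _ (by positivity), Nat.div_eq_of_lt h1, zero_add]
  · rw [part, h2, mul_comm, Nat.mul_add_mod, Nat.mod_eq_of_lt hi]
  · rw [vtx, show id * (D.k * D.N) + i * D.N + a % D.N = a % D.N + D.N * (id * D.k + i) by ring,
      Nat.add_mul_mod_self_left, Nat.mod_mod]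

/-- The sum of the buckets of the pairs with number `π`. -/
def bseq (D : Red) (h : ℕ) (t : Fin D.k → ℕ) (π : ℕ) : ℕ :=
  ∑ P ∈ D.pairs with tri P.2 + P.1 = π, D.bkt h (t P.1) (t P.2)

theorem bseq_idx {h : ℕ} {t : Fin D.k → ℕ} {i j : Fin D.k} (hij : i < j) :
    D.bseq h t (tri j + i) = D.bkt h (t i) (t j) := by
  rw [bseq, Finset.sum_eq_single (i, j)]
  · rintro ⟨i', j'⟩ hP hne
    simp only [pairs, Finset.mem_filter, Finset.mem_univ, true_and] at hP
    have := tri_add_inj hP.1 hij hP.2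
    exact absurd (Prod.ext (Fin.ext this.1) (Fin.ext this.2)) hne
  · intro hP
    simp [pairs, hij] at hP

theorem sum_bseq (h : ℕ) (t : Fin D.k → ℕ) :
    ∑ π ∈ Finset.range D.E, D.bseq h t π = ∑ P ∈ D.pairs, D.bkt h (t P.1) (t P.2) := by
  refine Finset.sum_fiberwise_of_maps_to (fun P hP => ?_) _
  simp only [pairs, Finset.mem_filter, Finset.mem_univ, true_and] at hP
  exact Finset.mem_range.2 (tri_add_lt hP P.2.2)

/-- The code of the instance stores partial sums: digit `π` is minus the sum of the first `π`
buckets modulo `R`. Consecutive digits then differ by the bucket in question, digit 0 is zero, and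
the last digit is the rounding error `C < E`. So `E * R ^ (E - 1)` codes suffice instead of `R ^ E`.
-/
theorem exists_inst (hD : D.Valid) {h : ℕ} {t : Fin D.k → ℕ} (ht : D.AdjT t) (hC : D.Cong h t) :
    ∃ id < D.num, (∀ i : Fin D.k, D.orig (D.vtx id i (t i)) = t i) ∧
      ∀ i j : Fin D.k, i < j → D.link h (D.vtx id i (t i)) (D.vtx id j (t j)) := by
  have hR := hD.R_pos
  have hE := hD.E_pos
  obtain ⟨C, hCE, hdvd⟩ := hC
  have hR' : (0 : ℤ) < D.R := by exact_mod_cast hR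
  set A : ℕ → ℕ := fun π => ((-(∑ x ∈ Finset.range π, D.bseq h t x : ℕ) : ℤ) % D.R).toNat with hA
  have hAZ : ∀ π, (A π : ℤ) = (-(∑ x ∈ Finset.range π, D.bseq h t x : ℕ) : ℤ) % D.R := fun π => by
    rw [hA]; exact Int.toNat_of_nonneg (Int.emod_nonneg _ hR'.ne')
  have hAlt : ∀ π, A π < D.R := fun π => by
    have : (A π : ℤ) < D.R := by rw [hAZ]; exact Int.emod_lt_of_pos _ hR'
    exact_mod_cast this
  have hA0 : A 0 = 0 := by simp [hA]
  have hAs : ∀ π, (A (π + 1) + D.bseq h t π) % D.R = A π := fun π => by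
    zify
    rw [hAZ, hAZ, Finset.sum_range_succ, Int.emod_add_emod]
    congr 1
    push_cast; ring
  have hAE : A D.E = C := by
    zify
    rw [hAZ, sum_bseq]
    obtain ⟨r, hr⟩ := hdvd
    have : (-(∑ P ∈ D.pairs, D.bkt h (t P.1) (t P.2) : ℕ) : ℤ) = C + D.R * (-r) := by
      have : ((∑ P ∈ D.pairs, D.bkt h (t P.1) (t P.2) + C : ℕ) : ℤ) = D.R * r := by exact_mod_cast hr
      push_cast at this ⊢
      linarith
    rw [this, Int.add_mul_emod_self_left]
    exact Int.emod_eq_of_lt (by positivity) (by exact_mod_cast hCE.trans_le hD.hE)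
  -- Digit 0 vanishes and is not stored; the factor `R` in `dig` restores it.
  set Y : ℕ := ∑ π ∈ Finset.range D.E, A (π + 1) * D.R ^ π with hY
  have hRY : D.R * Y = ∑ π ∈ Finset.range (D.E + 1), A π * D.R ^ π := by
    rw [Finset.sum_range_succ', hA0, zero_mul, add_zero, hY, Finset.mul_sum]
    exact Finset.sum_congr rfl fun π _ => by rw [pow_succ]; ring
  have hYlt : Y < D.E * D.R ^ (D.E - 1) := by
    obtain ⟨e, he⟩ : ∃ e, D.E = e + 1 := ⟨D.E - 1, by omega⟩
    rw [hY, he, Finset.sum_range_succ, ← he, hAE, he, Nat.add_sub_cancel]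
    have h1 := sum_digits_lt (fun π => A (π + 1)) (fun π => hAlt _) e
    have h2 : (C + 1) * D.R ^ e ≤ (e + 1) * D.R ^ e := Nat.mul_le_mul_right _ (by omega)
    rw [add_mul, one_mul] at h2
    omega
  -- The groups of the `k` vertices become the low digits of the code in base `S`; the value beyond
  -- `k` is filler.
  set gd : ℕ → ℕ := fun i => if hi : i < D.k then t ⟨i, hi⟩ / D.N else 0 with hgd
  have hglt : ∀ i, gd i < D.S := fun i => by
    simp only [hgd]
    split_ifs with hi
    · exact Nat.div_lt_of_lt_mul (((ht.1 _).trans_le hD.hV).trans_eq (mul_comm _ _))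
    · exact hD.hS
  set Z : ℕ := ∑ i ∈ Finset.range D.k, gd i * D.S ^ i with hZ
  have hZlt : Z < D.S ^ D.k := sum_digits_lt gd hglt D.k
  have hSk : 0 < D.S ^ D.k := pow_pos hD.hS _
  set id : ℕ := Z + D.S ^ D.k * Y with hid
  have hidY : id / D.S ^ D.k = Y := by
    rw [hid, Nat.add_mul_div_left _ _ hSk, Nat.div_eq_of_lt hZlt, zero_add]
  have hidg : ∀ i < D.k, id / D.S ^ i % D.S = gd i := fun i hi => by
    obtain ⟨r, hr⟩ := Nat.exists_eq_add_of_lt hi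
    rw [hid, hr, show D.S ^ (i + r + 1) * Y = D.S ^ i * (D.S * (D.S ^ r * Y)) by ring,
      Nat.add_mul_div_left _ _ (pow_pos hD.hS _), Nat.add_mul_mod_self_left]
    exact sum_digits_div_mod gd hglt hi
  have hdig : ∀ π ≤ D.E, D.dig id π = A π := fun π hπ => by
    rw [dig, hidY, hRY]
    exact sum_digits_div_mod A hAlt (by omega)
  have horig : ∀ i : Fin D.k, D.orig (D.vtx id i (t i)) = t i := fun i => by
    obtain ⟨h1, h2, h3⟩ := vtx_spec hD (id := id) (a := t i) i.2
    rw [orig, h1, h2, h3, hidg i i.2, hgd]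
    simp only [i.2, dif_pos]
    exact Nat.div_add_mod' _ _
  refine ⟨id, ?_, horig, fun i j hij => ?_⟩
  · calc id < D.S ^ D.k + D.S ^ D.k * Y := by omega
      _ = (Y + 1) * D.S ^ D.k := by ring
      _ ≤ D.num := Nat.mul_le_mul_right _ hYlt
  · obtain ⟨h1, h2, h3⟩ := vtx_spec hD (id := id) (a := t i) i.2
    obtain ⟨h1', h2', h3'⟩ := vtx_spec hD (id := id) (a := t j) j.2
    have hlt : tri j + i < D.E := tri_add_lt hij j.2
    refine ⟨by rw [h1, h1'], by rw [h2, h2']; exact hij, by rw [horig]; exact ht.1 i,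
      by rw [horig]; exact ht.1 j, by rw [horig, horig]; exact ht.2 i j hij, ?_⟩
    rw [h1, h2, h2', horig, horig, hdig _ (by omega), hdig _ (by omega), ← bseq_idx hij]
    exact hAs _

/-- The vertices `u i` form a clique in instance `id`. -/
structure IsSys (D : Red) (h id : ℕ) (u : Fin D.k → ℕ) : Prop where
  lt : id < D.num
  inst : ∀ i, D.inst (u i) = id
  part : ∀ i, D.part (u i) = i
  link : ∀ i j : Fin D.k, i < j → D.link h (u i) (u j)

variable {h id id' : ℕ} {u u' : Fin D.k → ℕ}

theorem dig_zero (D : Red) (id : ℕ) : D.dig id 0 = 0 := by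
  rw [dig, pow_zero, Nat.div_one, Nat.mul_mod_right]

theorem IsSys.dig_succ (H : D.IsSys h id u) {π : ℕ} (hπ : π < D.E) :
    (D.dig id (π + 1) + D.bseq h (fun i => D.orig (u i)) π) % D.R = D.dig id π := by
  obtain ⟨i, j, hij, hj, rfl⟩ := exists_eq_tri_add hπ
  have := (H.link ⟨i, hij.trans hj⟩ ⟨j, hj⟩ hij).2.2.2.2.2
  rw [H.inst, H.part, H.part] at this
  have hb := bseq_idx (h := h) (t := fun i => D.orig (u i)) (i := ⟨i, hij.trans hj⟩) (j := ⟨j, hj⟩) hij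
  simp only at hb this
  rw [hb, this]

theorem IsSys.div_lt (H : D.IsSys h id u) : id / D.S ^ D.k < D.E * D.R ^ (D.E - 1) :=
  Nat.div_lt_of_lt_mul (H.lt.trans_eq (mul_comm _ _))

/-- The link conditions telescope: `R` divides the sum of the first `m` buckets plus digit `m`. For
`m = E` this is the leading digit, and `id < num` makes it less than `E`. -/
theorem IsSys.cong (hD : D.Valid) (H : D.IsSys h id u) : D.Cong h fun i => D.orig (u i) := by
  have hR := hD.R_pos
  have key : ∀ m ≤ D.E, D.R ∣ ∑ π ∈ Finset.range m, D.bseq h (fun i => D.orig (u i)) π + D.dig id m := by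
    intro m
    induction m with
    | zero => intro _; simp [dig_zero]
    | succ m ih =>
      intro hm
      have h1 := ih (by omega)
      rw [← H.dig_succ (by omega)] at h1
      rw [Finset.sum_range_succ]
      have h2 := Nat.div_add_mod (D.dig id (m + 1) + D.bseq h (fun i => D.orig (u i)) m) D.R
      have h3 := (Nat.dvd_add_right (a := D.R) (b := D.R *
        ((D.dig id (m + 1) + D.bseq h (fun i => D.orig (u i)) m) / D.R)) (Nat.dvd_mul_right _ _)).2 h1
      convert h3 using 1
      omega
  refine ⟨D.dig id D.E, ?_, ?_⟩
  · have hE := hD.E_pos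
    refine (Nat.mod_le _ _).trans_lt ?_
    have : D.R ^ D.E = D.R * D.R ^ (D.E - 1) := by rw [← pow_succ']; congr 1; omega
    rw [this, Nat.mul_div_mul_left _ _ hR]
    exact Nat.div_lt_of_lt_mul (H.div_lt.trans_eq (mul_comm _ _))
  · have := key D.E le_rfl
    rwa [sum_bseq] at this

theorem IsSys.adjT (hk : 2 ≤ D.k) (H : D.IsSys h id u) : D.AdjT fun i => D.orig (u i) := by
  refine ⟨fun i => ?_, fun i j hij => (H.link i j hij).2.2.2.2.1⟩
  by_cases hi : (i : ℕ) = 0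
  · exact (H.link i ⟨1, by omega⟩ (by simp [Fin.lt_def, hi])).2.2.1
  · exact (H.link ⟨0, by omega⟩ i (by simp only [Fin.lt_def]; omega)).2.2.2.1

/-- The original vertices determine the buckets, and these determine the digits one after the other
from digit 0, which is zero. Together with the groups this fixes the instance. So at most one clique
lies over a tuple, and counting tuples bounds the number of cliques. -/
theorem IsSys.ext (hD : D.Valid) (H : D.IsSys h id u) (H' : D.IsSys h id' u')
    (ho : ∀ i, D.orig (u i) = D.orig (u' i)) : u = u' := by
  have hR := hD.R_pos
  have hmod : ∀ (i : Fin D.k), u i % D.N = u' i % D.N ∧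
      id / D.S ^ (i : ℕ) % D.S = id' / D.S ^ (i : ℕ) % D.S := fun i => by
    have h1 := ho i
    rw [orig, orig, H.inst, H'.inst, H.part, H'.part] at h1
    have h2 := congrArg (· % D.N) h1
    have h3 := congrArg (· / D.N) h1
    simp only [Nat.mul_add_mod', Nat.mod_mod] at h2
    simp only [mul_comm _ D.N, Nat.mul_add_div hD.hN, Nat.div_eq_of_lt (Nat.mod_lt _ hD.hN),
      add_zero] at h3
    exact ⟨h2, h3⟩
  have hdig : ∀ π ≤ D.E, D.dig id π = D.dig id' π := by
    intro π
    induction π with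
    | zero => intro _; rw [dig_zero, dig_zero]
    | succ π ih =>
      intro hπ
      have h1 := H.dig_succ (π := π) (by omega)
      have h2 := H'.dig_succ (π := π) (by omega)
      rw [ih (by omega), ← h2, show (fun i => D.orig (u i)) = fun i => D.orig (u' i) from
        funext ho] at h1
      have h3 : D.dig id (π + 1) % D.R = D.dig id' (π + 1) % D.R :=
        Nat.ModEq.add_right_cancel' _ h1
      rwa [dig, Nat.mod_mod, dig, Nat.mod_mod] at h3
  have hpow : D.R * (D.E * D.R ^ (D.E - 1)) ≤ D.R ^ (D.E + 1) := by
    have hE := hD.E_pos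
    calc D.R * (D.E * D.R ^ (D.E - 1)) ≤ D.R * (D.R * D.R ^ (D.E - 1)) := by
          gcongr; exact hD.hE
      _ = D.R ^ (D.E + 1) := by rw [← pow_succ', ← pow_succ']; congr 1; omega
  have hY : D.R * (id / D.S ^ D.k) = D.R * (id' / D.S ^ D.k) :=
    eq_of_digits_eq ((Nat.mul_lt_mul_of_pos_left H.div_lt hR).trans_le hpow)
      ((Nat.mul_lt_mul_of_pos_left H'.div_lt hR).trans_le hpow)
      (fun π hπ => hdig π (by omega))
  have hid : id = id' := by
    rw [← Nat.div_add_mod id (D.S ^ D.k), ← Nat.div_add_mod id' (D.S ^ D.k),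
      Nat.eq_of_mul_eq_mul_left hR hY, mod_pow_eq_sum_digits, mod_pow_eq_sum_digits]
    congr 1
    exact Finset.sum_congr rfl fun i hi => by rw [(hmod ⟨i, Finset.mem_range.1 hi⟩).2]
  funext i
  have hrec : ∀ n, n = D.inst n * (D.k * D.N) + D.part n * D.N + n % D.N := fun n => by
    have h1 := Nat.div_add_mod' n D.N
    have h2 := Nat.div_add_mod' (n / D.N) D.k
    rw [Red.inst, Red.part, mul_comm D.k D.N, ← Nat.div_div_eq_div_mul]
    calc n = (n / D.N) * D.N + n % D.N := h1.symm
      _ = (n / D.N / D.k * D.k + n / D.N % D.k) * D.N + n % D.N := by rw [h2]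
      _ = _ := by ring
  rw [hrec (u i), hrec (u' i), H.inst, H'.inst, H.part, H'.part, (hmod i).1, hid]

end Red

namespace Red

variable {D : Red} {h : ℕ}

/-! ## The hash function -/

theorem card_pairs_le (D : Red) : D.pairs.card ≤ D.E := by
  rw [← Finset.card_range D.E]
  refine Finset.card_le_card_of_injOn (fun P => tri P.2 + P.1) (fun P hP => ?_) ?_
  · simp only [pairs, Finset.mem_coe, Finset.mem_filter, Finset.mem_univ, true_and] at hP
    exact Finset.mem_coe.2 (Finset.mem_range.2 (tri_add_lt hP P.2.2))
  · rintro ⟨i, j⟩ hP ⟨i', j'⟩ hP' he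
    simp only [pairs, Finset.mem_coe, Finset.mem_filter, Finset.mem_univ, true_and] at hP hP'
    have := tri_add_inj hP hP' he
    exact Prod.ext (Fin.ext this.1) (Fin.ext this.2)

/-- The sum of the weights of a tuple. -/
def wsum (D : Red) (t : Fin D.k → ℕ) : ℕ := ∑ P ∈ D.pairs, D.wt (t P.1) (t P.2)

/-- The sum of the remainders within the buckets. -/
def low (D : Red) (h : ℕ) (t : Fin D.k → ℕ) : ℕ :=
  ∑ P ∈ D.pairs, h * D.wt (t P.1) (t P.2) % (D.R * D.BK) % D.BK

theorem low_lt (hD : D.Valid) (t : Fin D.k → ℕ) : D.low h t < D.E * D.BK := by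
  have h1 : D.low h t ≤ D.pairs.card * (D.BK - 1) := by
    rw [low, ← smul_eq_mul]
    refine Finset.sum_le_card_nsmul _ _ _ fun P _ => ?_
    exact Nat.le_sub_one_of_lt (Nat.mod_lt _ hD.hBK)
  have h2 := Nat.mul_le_mul_right (D.BK - 1) D.card_pairs_le
  have h3 : D.E * (D.BK - 1) < D.E * D.BK :=
    Nat.mul_lt_mul_of_pos_left (Nat.sub_lt hD.hBK one_pos) hD.E_pos
  omega

theorem modEq_bkt_add_low (h : ℕ) (t : Fin D.k → ℕ) :
    h * D.wsum t ≡ D.BK * ∑ P ∈ D.pairs, D.bkt h (t P.1) (t P.2) + D.low h t [MOD D.R * D.BK] := by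
  have : D.BK * ∑ P ∈ D.pairs, D.bkt h (t P.1) (t P.2) + D.low h t =
      ∑ P ∈ D.pairs, h * D.wt (t P.1) (t P.2) % (D.R * D.BK) := by
    rw [low, Finset.mul_sum, ← Finset.sum_add_distrib]
    exact Finset.sum_congr rfl fun P _ => Nat.div_add_mod _ _
  rw [this, wsum, Finset.mul_sum, Nat.ModEq, Finset.sum_nat_mod]

/-- `BK` times the sum of the buckets plus the sum of the remainders is a multiple of `R * BK`. So
the remainders sum to some `C * BK`, and `C < E` because each is below `BK`. This holds for every
multiplier: zero cliques are never lost. -/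
theorem cong_of_wsum (hD : D.Valid) {t : Fin D.k → ℕ} (ht : D.wsum t % (D.R * D.BK) = 0) :
    D.Cong h t := by
  have h1 := modEq_bkt_add_low (D := D) h t
  have h2 : h * D.wsum t ≡ 0 [MOD D.R * D.BK] :=
    (Nat.modEq_zero_iff_dvd.2 ((Nat.dvd_of_mod_eq_zero ht).mul_left h))
  obtain ⟨τ, hτ⟩ := Nat.modEq_zero_iff_dvd.1 (h1.symm.trans h2)
  have hlow := low_lt hD (h := h) t
  have hBK := hD.hBK
  set s := ∑ P ∈ D.pairs, D.bkt h (t P.1) (t P.2)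
  have hle : s ≤ D.R * τ := by
    by_contra hlt
    push Not at hlt
    have : D.BK * (D.R * τ) < D.BK * s := Nat.mul_lt_mul_of_pos_left hlt hBK
    nlinarith
  obtain ⟨C, hC⟩ := Nat.exists_eq_add_of_le hle
  refine ⟨C, ?_, τ, hC.symm⟩
  have h3 : D.low h t = C * D.BK := by
    have : D.R * D.BK * τ = D.BK * (s + C) := by rw [← hC]; ring
    rw [this] at hτ
    nlinarith
  rw [h3] at hlow
  exact lt_of_mul_lt_mul_right hlow (Nat.zero_le _)

/-- If the buckets sum to `-C`, then `h * wsum` is within `E * BK` of zero modulo `R * BK`; adding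
`E * BK` moves this window to the nonnegative residues. -/
theorem residue_lt_of_cong (hD : D.Valid) {t : Fin D.k → ℕ} (hC : D.Cong h t) :
    (h * D.wsum t + D.E * D.BK) % (D.R * D.BK) < 2 * D.E * D.BK := by
  obtain ⟨C, hCE, τ, hτ⟩ := hC
  have h1 := modEq_bkt_add_low (D := D) h t
  have hlow := low_lt hD (h := h) t
  set s := ∑ P ∈ D.pairs, D.bkt h (t P.1) (t P.2)
  obtain ⟨r, hr⟩ := Nat.exists_eq_add_of_le hCE.le
  have h2 : h * D.wsum t + D.E * D.BK ≡ D.low h t + r * D.BK [MOD D.R * D.BK] := by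
    refine (h1.add_right _).trans ?_
    have : D.BK * s + D.low h t + D.E * D.BK = D.R * D.BK * τ + (D.low h t + r * D.BK) := by
      rw [hr]
      calc D.BK * s + D.low h t + (C + r) * D.BK = D.BK * (s + C) + (D.low h t + r * D.BK) := by ring
        _ = _ := by rw [hτ]; ring
    rw [this, Nat.ModEq, Nat.mul_add_mod]
  rw [h2]
  refine (Nat.mod_le _ _).trans_lt ?_
  have : r * D.BK ≤ D.E * D.BK := Nat.mul_le_mul_right _ (by omega)
  linarith [mul_assoc 2 D.E D.BK]

open Classical in
-- With `d` the gcd, multiplication by `wsum` modulo `M` is `d` to one onto the multiples of `d`. As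
-- `d` divides `BK`, the window of length `2 * E * BK` contains `2 * E * BK / d` multiples of `d`,
-- and the factors `d` cancel. Thus the modulus need not be prime.
theorem card_cong_le (hD : D.Valid) {t : Fin D.k → ℕ}
    (hg : Nat.gcd (D.R * D.BK) (D.wsum t) ∣ D.BK) :
    ((Finset.range (D.R * D.BK)).filter fun h => D.Cong h t).card ≤ 2 * D.E * D.BK := by
  set M := D.R * D.BK with hM
  set d := Nat.gcd M (D.wsum t) with hd
  have hMpos : 0 < M := Nat.mul_pos hD.R_pos hD.hBK
  have hdpos : 0 < d := Nat.gcd_pos_of_pos_left _ hMpos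
  have hdM : d ∣ M := Nat.gcd_dvd_left _ _
  have hdw : d ∣ D.wsum t := Nat.gcd_dvd_right _ _
  have hinj : ((Finset.range M).filter fun h => D.Cong h t).card ≤
      (Finset.range (2 * D.E * D.BK / d) ×ˢ Finset.range d).card := by
    refine Finset.card_le_card_of_injOn
      -- The first component determines `h` modulo `M / d`, the second one supplies the rest.
      (fun h => ((h * D.wsum t + D.E * D.BK) % M / d, h / (M / d))) ?_ ?_
    · intro h hh
      simp only [Finset.mem_coe, Finset.mem_filter, Finset.mem_range] at hh
      simp only [Finset.mem_coe, Finset.mem_product, Finset.mem_range]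
      constructor
      · have h1 := residue_lt_of_cong hD hh.2
        exact Nat.div_lt_div_of_lt_of_dvd (hg.mul_left _) h1
      · rw [Nat.div_lt_iff_lt_mul (Nat.div_pos (Nat.le_of_dvd hMpos hdM) hdpos),
          Nat.mul_div_cancel' hdM]
        exact hh.1
    · intro h hh h' hh' he
      simp only [Prod.mk.injEq] at he
      have hdvd : ∀ x : ℕ, d ∣ (x * D.wsum t + D.E * D.BK) % M := fun x =>
        (Nat.dvd_mod_iff hdM).2 (dvd_add (hdw.mul_left _) (hg.mul_left _))
      have h1 : h * D.wsum t + D.E * D.BK ≡ h' * D.wsum t + D.E * D.BK [MOD M] := by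
        have := he.1
        rw [Nat.ModEq, ← Nat.div_mul_cancel (hdvd h), this, Nat.div_mul_cancel (hdvd h')]
      have h2 := Nat.ModEq.add_right_cancel' _ h1
      rw [mul_comm, mul_comm h'] at h2
      have h3 : h % (M / d) = h' % (M / d) := Nat.ModEq.cancel_left_div_gcd hMpos h2
      rw [← Nat.div_add_mod h (M / d), ← Nat.div_add_mod h' (M / d), he.2, h3]
  rw [Finset.card_product, Finset.card_range, Finset.card_range] at hinj
  exact hinj.trans (Nat.div_mul_le_self _ _)

/-! ## The graph -/

/-- The edges of the graph, from the smaller to the larger vertex: those within the instances and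
those of a complete bipartite graph on the remaining vertices, with `a` vertices on the left. -/
def lk (D : Red) (h a u v : ℕ) : Prop :=
  (u < D.U ∧ v < D.U ∧ D.link h u v) ∨ (D.U ≤ u ∧ u < D.U + a ∧ D.U + a ≤ v)

theorem div_eq (D : Red) (u : ℕ) : u / D.N = D.inst u * D.k + D.part u := by
  rw [inst, part, mul_comm D.k D.N, ← Nat.div_div_eq_div_mul, Nat.div_add_mod']

theorem lt_of_link {u v : ℕ} (hl : D.link h u v) : u < v := by
  by_contra hle
  have h1 := Nat.div_le_div_right (c := D.N) (not_lt.1 hle)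
  rw [div_eq, div_eq, hl.1] at h1
  have := hl.2.1
  omega

theorem lt_of_lk {a u v : ℕ} (hl : D.lk h a u v) : u < v := by
  rcases hl with h | h
  · exact lt_of_link h.2.2
  · omega

/-- The graph of the reduction. -/
def graph (D : Red) (h a n : ℕ) : SimpleGraph (Fin n) where
  Adj x y := D.lk h a x y ∨ D.lk h a y x
  symm := ⟨fun _ _ h => h.symm⟩
  loopless := ⟨fun x hx => by rcases hx with h | h <;> exact absurd (lt_of_lk h) (lt_irrefl _)⟩

theorem exists_clique (hD : D.Valid) {t : Fin D.k → ℕ} (ht : D.AdjT t) (hC : D.Cong h t) {a n : ℕ}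
    (hn : D.U ≤ n) : ∃ u : Fin D.k → Fin n, (D.graph h a n).IsNClique D.k (Finset.univ.image u) ∧
      ∀ i, D.orig (u i) = t i := by
  obtain ⟨id, hid, ho, hl⟩ := exists_inst hD ht hC
  have hkN : 0 < D.k * D.N := Nat.mul_pos (by have := hD.hk; omega) hD.hN
  have hlt : ∀ i : Fin D.k, D.vtx id i (t i) < D.U := fun i => by
    have h1 := (vtx_spec hD (id := id) (a := t i) i.2).1
    rw [inst] at h1
    rw [U, ← Nat.div_lt_iff_lt_mul hkN, h1]
    exact hid
  have hinj : Function.Injective fun i : Fin D.k => (⟨D.vtx id i (t i), (hlt i).trans_le hn⟩ : Fin n) := by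
    intro i j hij
    have h1 := (vtx_spec hD (id := id) (a := t i) i.2).2.1
    have h2 := (vtx_spec hD (id := id) (a := t j) j.2).2.1
    simp only [Fin.mk.injEq] at hij
    exact Fin.ext (by rw [← h1, ← h2, hij])
  refine ⟨fun i => ⟨D.vtx id i (t i), (hlt i).trans_le hn⟩, ⟨?_, ?_⟩, ho⟩
  · rintro x hx y hy hne
    simp only [Finset.coe_image, Finset.coe_univ, Set.image_univ, Set.mem_range] at hx hy
    obtain ⟨i, rfl⟩ := hx
    obtain ⟨j, rfl⟩ := hy
    rcases lt_trichotomy i j with h | h | h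
    · exact Or.inl (Or.inl ⟨hlt i, hlt j, hl i j h⟩)
    · exact absurd (by rw [h]) hne
    · exact Or.inr (Or.inl ⟨hlt j, hlt i, hl j i h⟩)
  · rw [Finset.card_image_of_injective _ hinj, Finset.card_univ, Fintype.card_fin]

/-- The bipartite part is triangle-free and not joined to the instances, so a clique on at least
three vertices avoids it. Elsewhere adjacent vertices share the instance and differ in their part,
so `k` of them use every part once. -/
theorem exists_isSys (hk : 3 ≤ D.k) (hN : 0 < D.N) {a n : ℕ} {Q : Finset (Fin n)}
    (hQ : (D.graph h a n).IsNClique D.k Q) : ∃ id, ∃ u : Fin D.k → Fin n,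
      D.IsSys h id (fun i => u i) ∧ Q = Finset.univ.image u := by
  have hadj : ∀ x ∈ Q, ∀ y ∈ Q, x ≠ y → D.lk h a x y ∨ D.lk h a y x := fun x hx y hy hne =>
    hQ.1 hx hy hne
  have hU : ∀ x ∈ Q, (x : ℕ) < D.U := by
    intro x hx
    by_contra hxU
    obtain ⟨y, hy, hyx⟩ : ∃ y ∈ Q, y ≠ x :=
      Finset.exists_mem_ne (by have := hQ.2; omega) x
    have hcard : 0 < ((Q.erase x).erase y).card := by
      rw [Finset.card_erase_of_mem (Finset.mem_erase.2 ⟨hyx, hy⟩), Finset.card_erase_of_mem hx, hQ.2]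
      omega
    obtain ⟨z, hz⟩ := Finset.card_pos.1 hcard
    simp only [Finset.mem_erase] at hz
    have h1 := hadj x hx y hy hyx.symm
    have h2 := hadj x hx z hz.2.2 hz.2.1.symm
    have h3 := hadj y hy z hz.2.2 hz.1.symm
    simp only [lk] at h1 h2 h3
    omega
  have hlink : ∀ x ∈ Q, ∀ y ∈ Q, x ≠ y → D.link h x y ∨ D.link h y x := by
    intro x hx y hy hne
    have := hU x hx
    have := hU y hy
    rcases hadj x hx y hy hne with h | h
    · rcases h with h | h
      · exact Or.inl h.2.2
      · omega
    · rcases h with h | h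
      · exact Or.inr h.2.2
      · omega
  have hpart : Set.InjOn (fun x : Fin n => D.part x) Q := by
    intro x hx y hy he
    by_contra hne
    simp only at he
    rcases hlink x hx y hy hne with h | h <;> have := h.2.1 <;> omega
  have himg : Q.image (fun x : Fin n => D.part x) = Finset.range D.k := by
    refine Finset.eq_of_subset_of_card_le (fun i hi => ?_) ?_
    · obtain ⟨x, _, rfl⟩ := Finset.mem_image.1 hi
      exact Finset.mem_range.2 (Nat.mod_lt _ (by omega))
    · rw [Finset.card_image_of_injOn hpart, hQ.2, Finset.card_range]
  have hex : ∀ i : Fin D.k, ∃ x ∈ Q, D.part x = i := fun i => by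
    have : (i : ℕ) ∈ Q.image (fun x : Fin n => D.part x) := by
      rw [himg]; exact Finset.mem_range.2 i.2
    obtain ⟨x, hx, h⟩ := Finset.mem_image.1 this
    exact ⟨x, hx, h⟩
  choose u huQ hup using hex
  have hne : ∀ i j : Fin D.k, i ≠ j → u i ≠ u j := fun i j hij he => hij (Fin.ext (by
    rw [← hup i, ← hup j, he]))
  have h0 : (0 : ℕ) < D.k := by omega
  refine ⟨D.inst (u ⟨0, h0⟩), u, ⟨?_, fun i => ?_, hup, fun i j hij => ?_⟩, ?_⟩
  · have := hU _ (huQ ⟨0, h0⟩)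
    rw [U] at this
    exact (Nat.div_lt_iff_lt_mul (Nat.mul_pos h0 hN)).2 this
  · by_cases hi : i = ⟨0, h0⟩
    · rw [hi]
    · rcases hlink _ (huQ i) _ (huQ ⟨0, h0⟩) (hne _ _ hi) with h | h
      · exact h.1
      · exact h.1.symm
  · rcases hlink _ (huQ i) _ (huQ j) (hne _ _ hij.ne) with h | h
    · exact h
    · have := h.2.1
      rw [hup, hup] at this
      have hij' : (i : ℕ) < j := hij
      omega
  · symm
    refine Finset.eq_of_subset_of_card_le (fun x hx => ?_) ?_
    · obtain ⟨i, _, rfl⟩ := Finset.mem_image.1 hx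
      exact huQ i
    · rw [Finset.card_image_of_injective _ (fun i j h => by_contra fun hc => hne i j hc h), hQ.2,
        Finset.card_univ, Fintype.card_fin]

open Classical in
/-- The tuples of numbers below `Y` that form cliques and satisfy the hashed condition. -/
noncomputable def hashed (D : Red) (h Y : ℕ) : Finset (Fin D.k → ℕ) :=
  (Fintype.piFinset fun _ => Finset.range Y).filter fun t => D.AdjT t ∧ D.Cong h t

/-- A clique is sent to the tuple of its original vertices; this is injective by `IsSys.ext`. -/
theorem cliqueCount_le (hD : D.Valid) (hk : 3 ≤ D.k) {a n Y : ℕ} (hY : D.V ≤ Y) :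
    cliqueCount D.k (D.graph h a n) ≤ (D.hashed h Y).card := by
  classical
  rw [cliqueCount, ← Set.ncard_coe_finset]
  have hex : ∀ Q : Finset (Fin n), (D.graph h a n).IsNClique D.k Q →
      ∃ p : ℕ × (Fin D.k → Fin n), D.IsSys h p.1 (fun i => p.2 i) ∧ Q = Finset.univ.image p.2 :=
    fun Q hQ => by
      obtain ⟨id, u, h1, h2⟩ := exists_isSys hk hD.hN hQ
      exact ⟨(id, u), h1, h2⟩
  choose p hp using hex
  refine Set.ncard_le_ncard_of_injOn
    (fun Q i => if hQ : (D.graph h a n).IsNClique D.k Q then D.orig ((p Q hQ).2 i) else 0) ?_ ?_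
    (Finset.finite_toSet _)
  · intro Q hQ
    have hQ : (D.graph h a n).IsNClique D.k Q := hQ
    have h1 := (hp Q hQ).1
    have h2 := h1.adjT hD.hk
    simp only [hashed, Finset.mem_coe, Finset.mem_filter, Fintype.mem_piFinset, Finset.mem_range,
      hQ, dif_pos]
    exact ⟨fun i => (h2.1 i).trans_le hY, h2, h1.cong hD⟩
  · intro Q hQ Q' hQ' he
    have hQ : (D.graph h a n).IsNClique D.k Q := hQ
    have hQ' : (D.graph h a n).IsNClique D.k Q' := hQ'
    simp only [hQ, hQ', dif_pos] at he
    have := IsSys.ext hD (hp Q hQ).1 (hp Q' hQ').1 (fun i => congrFun he i)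
    have h2 : (p Q hQ).2 = (p Q' hQ').2 := funext fun i => Fin.ext (congrFun this i)
    rw [(hp Q hQ).2, (hp Q' hQ').2, h2]

end Red

namespace Red

variable {D : Red}

open Classical in
/-- The tuples of numbers below `Y` that form cliques of weight zero. -/
noncomputable def zeroTuples (D : Red) (Y : ℕ) : Finset (Fin D.k → ℕ) :=
  (Fintype.piFinset fun _ => Finset.range Y).filter fun t =>
    D.AdjT t ∧ D.wsum t % (D.R * D.BK) = 0

open Classical in
-- Markov's inequality: the pairs of a multiplier and a clique tuple of nonzero weight that passes
-- the hashed test are counted in two ways.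
theorem card_bad_hash (hD : D.Valid) {Y B : ℕ}
    (hg : ∀ t, D.AdjT t → D.wsum t % (D.R * D.BK) ≠ 0 → Nat.gcd (D.R * D.BK) (D.wsum t) ∣ D.BK) :
    ((Finset.range (D.R * D.BK)).filter fun h =>
      ¬ (D.hashed h Y).card ≤ (D.zeroTuples Y).card + B).card * B ≤
        Y ^ D.k * (2 * D.E * D.BK) := by
  set NZ := (Fintype.piFinset fun _ : Fin D.k => Finset.range Y).filter fun t =>
    D.AdjT t ∧ D.wsum t % (D.R * D.BK) ≠ 0 with hNZ
  have hsub : ∀ h, (D.hashed h Y).card ≤ (D.zeroTuples Y).card +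
      (NZ.filter fun t => D.Cong h t).card := by
    intro h
    refine (Finset.card_le_card (t := D.zeroTuples Y ∪ NZ.filter fun t => D.Cong h t) ?_).trans
      (Finset.card_union_le _ _)
    intro t ht
    simp only [hashed, Finset.mem_filter] at ht
    by_cases hz : D.wsum t % (D.R * D.BK) = 0
    · exact Finset.mem_union_left _ (by simp [zeroTuples, ht.1, ht.2.1, hz])
    · exact Finset.mem_union_right _ (by simp only [hNZ, Finset.mem_filter]; exact ⟨⟨ht.1, ht.2.1, hz⟩, ht.2.2⟩)
  calc _ = ∑ h ∈ (Finset.range (D.R * D.BK)).filter fun h =>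
        ¬ (D.hashed h Y).card ≤ (D.zeroTuples Y).card + B, B := by
        rw [Finset.sum_const, smul_eq_mul]
    _ ≤ ∑ h ∈ (Finset.range (D.R * D.BK)).filter fun h =>
        ¬ (D.hashed h Y).card ≤ (D.zeroTuples Y).card + B, (NZ.filter fun t => D.Cong h t).card := by
        refine Finset.sum_le_sum fun h hh => ?_
        have h1 := (Finset.mem_filter.1 hh).2
        have h2 := hsub h
        omega
    _ ≤ ∑ h ∈ Finset.range (D.R * D.BK), (NZ.filter fun t => D.Cong h t).card :=
        Finset.sum_le_sum_of_subset (Finset.filter_subset _ _)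
    _ = ∑ t ∈ NZ, ((Finset.range (D.R * D.BK)).filter fun h => D.Cong h t).card := by
        simp only [Finset.card_filter]
        exact Finset.sum_comm
    _ ≤ NZ.card • (2 * D.E * D.BK) := by
        refine Finset.sum_le_card_nsmul _ _ _ fun t ht => ?_
        simp only [hNZ, Finset.mem_filter] at ht
        exact card_cong_le hD (hg t ht.2.1 ht.2.2)
    _ ≤ Y ^ D.k * (2 * D.E * D.BK) := by
        rw [smul_eq_mul]
        refine Nat.mul_le_mul_right _ ((Finset.card_le_card (Finset.filter_subset _ _)).trans ?_)
        simp

open Classical in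
-- By `hB` at most a quarter of the multipliers is bad, and the modulus divides `2 ^ w`, so the same
-- fraction is valid for random words.
theorem good_hash (hD : D.Valid) {Y B w : ℕ} (hB : 8 * D.E * Y ^ D.k ≤ B * D.R) (hB0 : 0 < B)
    (hM : D.R * D.BK ∣ 2 ^ w)
    (hg : ∀ t, D.AdjT t → D.wsum t % (D.R * D.BK) ≠ 0 → Nat.gcd (D.R * D.BK) (D.wsum t) ∣ D.BK) :
    (3 / 4 : ℝ≥0∞) * 2 ^ w ≤ ((Finset.range (2 ^ w)).filter fun r =>
      (D.hashed (r % (D.R * D.BK)) Y).card ≤ (D.zeroTuples Y).card + B).card := by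
  set M := D.R * D.BK with hMdef
  have hbad := card_bad_hash hD (Y := Y) (B := B) hg
  rw [← hMdef] at hbad
  set bad := ((Finset.range M).filter fun h => ¬ (D.hashed h Y).card ≤ (D.zeroTuples Y).card + B).card
  set good := ((Finset.range M).filter fun h => (D.hashed h Y).card ≤ (D.zeroTuples Y).card + B).card
    with hgood
  have hsum : good + bad = M := by
    rw [← Finset.card_range M]; exact Finset.card_filter_add_card_filter_not _
  have hbad4 : 4 * bad ≤ M := by
    refine le_of_mul_le_mul_right ?_ hB0
    calc 4 * bad * B = 4 * (bad * B) := by ring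
      _ ≤ 4 * (Y ^ D.k * (2 * D.E * D.BK)) := by gcongr
      _ = (8 * D.E * Y ^ D.k) * D.BK := by ring
      _ ≤ (B * D.R) * D.BK := by gcongr
      _ = M * B := by rw [hMdef]; ring
  have h3 : 3 * M ≤ 4 * good := by omega
  obtain ⟨r, hr⟩ := hM
  have hcard : (((Finset.range (2 ^ w)).filter fun r =>
      (D.hashed (r % M) Y).card ≤ (D.zeroTuples Y).card + B).card : ℝ≥0∞) = r * good := by
    rw [hgood, Finset.card_filter, Finset.card_filter, hr]
    push_cast
    exact WordRAM.sum_range_mod (f := fun h => if (D.hashed h Y).card ≤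
      (D.zeroTuples Y).card + B then 1 else 0) M r
  rw [hcard]
  have h4 : (2 ^ w : ℝ≥0∞) = M * r := by exact_mod_cast hr
  rw [h4, ENNReal.div_eq_inv_mul, mul_assoc, ← ENNReal.div_eq_inv_mul]
  refine ENNReal.div_le_of_le_mul ?_
  have h5 : (3 * M * r : ℕ) ≤ r * good * 4 := by nlinarith
  calc (3 : ℝ≥0∞) * (M * r) = ((3 * M * r : ℕ) : ℝ≥0∞) := by push_cast; ring
    _ ≤ ((r * good * 4 : ℕ) : ℝ≥0∞) := by exact_mod_cast h5
    _ = r * good * 4 := by push_cast; ring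

end Red

/-! ## Arboricity -/

/-- An edge at a leaf is a bridge: without it no walk leaves the leaf. -/
theorem isAcyclic_of_leaf {V : Type*} {G : SimpleGraph V}
    (h : ∀ u v, G.Adj u v → (∀ z, G.Adj v z → z = u) ∨ ∀ z, G.Adj u z → z = v) : G.IsAcyclic := by
  have key : ∀ u v, G.Adj u v → (∀ z, G.Adj v z → z = u) → G.IsBridge s(u, v) := by
    intro u v huv hz
    rw [SimpleGraph.isBridge_iff]
    refine fun hr => ?_
    obtain ⟨p⟩ := hr.symm
    cases p with
    | nil => exact G.loopless.irrefl _ huv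
    | cons hadj _ =>
      rw [SimpleGraph.deleteEdges_adj] at hadj
      have := hz _ hadj.1
      subst this
      exact hadj.2 (by simp [Sym2.eq_swap])
  rw [SimpleGraph.isAcyclic_iff_forall_adj_isBridge]
  intro u v huv
  rcases h u v huv with hz | hz
  · exact key u v huv hz
  · rw [Sym2.eq_swap]; exact key v u huv.symm hz

/-- A forest on a nonempty vertex set extends to a spanning tree of the complete graph, with `n - 1`
edges. -/
theorem ncard_edgeSet_le_of_isAcyclic {n : ℕ} {G : SimpleGraph (Fin n)} (h : G.IsAcyclic) :
    G.edgeSet.ncard ≤ n := by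
  classical
  rcases Nat.eq_zero_or_pos n with rfl | hn
  · have : G.edgeSet = ∅ := by
      ext e; induction e with | _ u v => exact u.elim0
    simp [this]
  have : Nonempty (Fin n) := ⟨⟨0, hn⟩⟩
  obtain ⟨F, hGF, hF⟩ := SimpleGraph.exists_maximal_isAcyclic_of_le_isAcyclic
    (G := ⊤) (le_top : G ≤ ⊤) h
  have hT : F.IsTree := SimpleGraph.isTree_iff_maximal_isAcyclic.2
    ⟨inferInstance, ⟨hF.1.2, fun F' hF' hle => hF.2 ⟨le_top, hF'⟩ hle⟩⟩
  have h1 := hT.card_edgeFinset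
  rw [Fintype.card_fin] at h1
  calc G.edgeSet.ncard ≤ F.edgeSet.ncard :=
        Set.ncard_le_ncard (SimpleGraph.edgeSet_mono hGF) (Set.toFinite _)
    _ = F.edgeFinset.card := by rw [← SimpleGraph.coe_edgeFinset, Set.ncard_coe_finset]
    _ ≤ n := by omega

theorem edgeCount_le_of_decomposition {n a : ℕ} {G : SimpleGraph (Fin n)}
    (F : Fin a → SimpleGraph (Fin n)) (h1 : ∀ i, (F i).IsAcyclic) (h3 : ⨆ i, F i = G) :
    edgeCount G ≤ n * a := by
  have hset : G.edgeSet ⊆ ⋃ i ∈ (Finset.univ : Finset (Fin a)), (F i).edgeSet := by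
    rw [← h3]
    intro e he
    induction e with
    | _ u v =>
      rw [SimpleGraph.mem_edgeSet, SimpleGraph.iSup_adj] at he
      obtain ⟨i, hi⟩ := he
      simp only [Set.mem_iUnion]
      exact ⟨i, Finset.mem_univ _, hi⟩
  calc edgeCount G ≤ (⋃ i ∈ (Finset.univ : Finset (Fin a)), (F i).edgeSet).ncard :=
        Set.ncard_le_ncard hset (Set.toFinite _)
    _ ≤ ∑ i, (F i).edgeSet.ncard := Finset.set_ncard_biUnion_le _ _
    _ ≤ ∑ _i : Fin a, n := Finset.sum_le_sum fun i _ => ncard_edgeSet_le_of_isAcyclic (h1 i)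
    _ = n * a := by simp [mul_comm]

namespace Red

variable {D : Red} {h a n : ℕ}

/-- The label of a vertex: its number within its instance, or among the left vertices of the
bipartite graph. -/
def lab (D : Red) (u : ℕ) : ℕ := if u < D.U then u % (D.k * D.N) else u - D.U

/-- The edges whose smaller endpoint has label `i`. -/
def star (D : Red) (h a n i : ℕ) : SimpleGraph (Fin n) where
  Adj x y := (D.lk h a x y ∧ D.lab x = i) ∨ (D.lk h a y x ∧ D.lab y = i)
  symm := ⟨fun _ _ h => h.symm⟩
  loopless := ⟨fun x hx => by rcases hx with h | h <;> exact absurd (lt_of_lk h.1) (lt_irrefl _)⟩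

theorem lk_source_unique {x x' y : ℕ} (h1 : D.lk h a x y) (h2 : D.lk h a x' y)
    (hl : D.lab x = D.lab x') : x = x' := by
  simp only [lk, lab] at h1 h2 hl
  rcases h1 with h1 | h1 <;> rcases h2 with h2 | h2
  · rw [if_pos h1.1, if_pos h2.1] at hl
    have : D.inst x = D.inst x' := h1.2.2.1.trans h2.2.2.1.symm
    rw [← Nat.div_add_mod x (D.k * D.N), ← Nat.div_add_mod x' (D.k * D.N), hl]
    unfold inst at this
    rw [this]
  · omega
  · omega
  · rw [if_neg (by omega), if_neg (by omega)] at hl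
    omega

theorem not_lk_lk_of_lab {x y z : ℕ} (h1 : D.lk h a x y) (h2 : D.lk h a y z)
    (hl : D.lab x = D.lab y) : False := by
  have hlt := lt_of_lk h1
  simp only [lk, lab] at h1 h2 hl
  rcases h1 with h1 | h1 <;> rcases h2 with h2 | h2
  · rw [if_pos h1.1, if_pos h2.1] at hl
    have h3 : D.inst x = D.inst y := h1.2.2.1
    have := Nat.div_add_mod x (D.k * D.N)
    rw [hl] at this
    unfold inst at h3
    rw [h3, Nat.div_add_mod] at this
    omega
  all_goals omega

/-- Edges sorted by the label of their smaller endpoint form stars. The larger endpoint of an edge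
of this label is a leaf: it has no second smaller neighbour with the label, and it does not have the
label itself. -/
theorem star_isAcyclic (D : Red) (h a n i : ℕ) : (D.star h a n i).IsAcyclic := by
  apply isAcyclic_of_leaf
  have key : ∀ u v z : Fin n, D.lk h a u v → D.lab u = i → (D.star h a n i).Adj v z → z = u := by
    intro u v z h1 h2 h3
    rcases h3 with h3 | h3
    · exact (not_lk_lk_of_lab h1 h3.1 (h2.trans h3.2.symm)).elim
    · exact Fin.ext (lk_source_unique h3.1 h1 (h3.2.trans h2.symm))
  rintro u v (huv | huv)
  · exact Or.inl fun z hz => key u v z huv.1 huv.2 hz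
  · exact Or.inr fun z hz => key v u z huv.1 huv.2 hz

theorem lab_lt {x y : ℕ} (ha : D.k * D.N ≤ a) (hpos : 0 < D.k * D.N) (h1 : D.lk h a x y) :
    D.lab x < a := by
  simp only [lk, lab] at *
  rcases h1 with h1 | h1
  · rw [if_pos h1.1]; exact (Nat.mod_lt _ hpos).trans_le ha
  · rw [if_neg (by omega)]; omega

/-- As `k * N ≤ a`, the labels in the instances are among the `a` labels of the left vertices, so
there are `a` star forests. The second part counts the edges of an optimal decomposition; with the
many edges of the bipartite graph it bounds the arboricity from below. -/
theorem arboricity_graph_le (ha : D.k * D.N ≤ a) (hpos : 0 < D.k * D.N) :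
    arboricity (D.graph h a n) ≤ a ∧ edgeCount (D.graph h a n) ≤ n * arboricity (D.graph h a n) := by
  have h1 : ∃ F : Fin a → SimpleGraph (Fin n), (∀ i, (F i).IsAcyclic) ∧
      Pairwise (fun i j => Disjoint (F i) (F j)) ∧ ⨆ i, F i = D.graph h a n := by
    refine ⟨fun i => D.star h a n i, fun i => star_isAcyclic D h a n i, fun i j hij => ?_, ?_⟩
    · change Disjoint (D.star h a n i) (D.star h a n j)
      rw [SimpleGraph.disjoint_left]
      rintro x y (h1 | h1) (h2 | h2)
      · exact hij (Fin.ext (h1.2.symm.trans h2.2))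
      · have := lt_of_lk h1.1; have := lt_of_lk h2.1; omega
      · have := lt_of_lk h1.1; have := lt_of_lk h2.1; omega
      · exact hij (Fin.ext (h1.2.symm.trans h2.2))
    · ext x y
      rw [SimpleGraph.iSup_adj]
      constructor
      · rintro ⟨i, hi | hi⟩
        · exact Or.inl hi.1
        · exact Or.inr hi.1
      · rintro (h1 | h1)
        · exact ⟨⟨D.lab x, lab_lt ha hpos h1⟩, Or.inl ⟨h1, rfl⟩⟩
        · exact ⟨⟨D.lab y, lab_lt ha hpos h1⟩, Or.inr ⟨h1, rfl⟩⟩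
  refine ⟨Nat.sInf_le h1, ?_⟩
  rw [arboricity]
  obtain ⟨F, h2, h3, h4⟩ := Nat.sInf_mem (s := {b | ∃ F : Fin b → SimpleGraph (Fin n),
    (∀ i, (F i).IsAcyclic) ∧ Pairwise (fun i j => Disjoint (F i) (F j)) ∧
      ⨆ i, F i = D.graph h a n}) ⟨a, h1⟩
  exact edgeCount_le_of_decomposition F h2 h4

theorem le_edgeCount_graph (hn : D.U + a ≤ n) :
    a * (n - D.U - a) ≤ edgeCount (D.graph h a n) := by
  classical
  have h1 : ((Finset.univ : Finset (Fin a × Fin (n - D.U - a))).image fun p =>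
      s((⟨D.U + p.1, by omega⟩ : Fin n), (⟨D.U + a + p.2, by omega⟩ : Fin n))).card =
      a * (n - D.U - a) := by
    rw [Finset.card_image_of_injective, Finset.card_univ, Fintype.card_prod, Fintype.card_fin,
      Fintype.card_fin]
    rintro ⟨i, j⟩ ⟨i', j'⟩ he
    simp only [Sym2.eq_iff, Fin.mk.injEq] at he
    rcases he with he | he
    · exact Prod.ext (Fin.ext (by simp only; omega)) (Fin.ext (by simp only; omega))
    · exfalso; omega
  rw [← h1, ← Set.ncard_coe_finset]
  refine Set.ncard_le_ncard ?_ (Set.toFinite _)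
  intro e he
  simp only [Finset.coe_image, Finset.coe_univ, Set.image_univ, Set.mem_range] at he
  obtain ⟨p, rfl⟩ := he
  rw [SimpleGraph.mem_edgeSet]
  refine Or.inl (Or.inr ⟨?_, ?_, ?_⟩) <;> simp only <;> omega

end Red

/-! ## The edge list of the graph -/

/-- The cells that hold a list of pairs. -/
def cells (L : List (ℕ × ℕ)) (i : ℕ) : ℕ := (L.flatMap fun p => [p.1, p.2]).getD i 0

theorem length_flatMap_pair (L : List (ℕ × ℕ)) :
    (L.flatMap fun p => [p.1, p.2]).length = 2 * L.length := by
  induction L with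
  | nil => rfl
  | cons p L ih => simp only [List.flatMap_cons, List.length_append, ih, List.length_cons,
      List.length_nil]; omega

theorem cells_nil (i : ℕ) : cells [] i = 0 := by simp [cells]

theorem cells_append (L : List (ℕ × ℕ)) (p : ℕ × ℕ) :
    cells (L ++ [p]) = Function.update (Function.update (cells L) (2 * L.length) p.1)
      (2 * L.length + 1) p.2 := by
  funext i
  have hl := length_flatMap_pair L
  simp only [cells, List.flatMap_append, List.flatMap_cons, List.flatMap_nil, List.append_nil,
    List.getD_eq_getElem?_getD, Function.update_apply]
  split_ifs with h1 h2
  · rw [List.getElem?_append_right (by omega), hl, h1]; simp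
  · rw [List.getElem?_append_right (by omega), hl, h2]; simp
  · rcases lt_or_ge i (2 * L.length) with h | h
    · rw [List.getElem?_append_left (by omega)]
    · rw [List.getElem?_eq_none, List.getElem?_eq_none]
      · omega
      · simp only [List.length_append, hl, List.length_cons, List.length_nil]
        omega

theorem cells_eq_zero {L : List (ℕ × ℕ)} {i : ℕ} (h : 2 * L.length ≤ i) : cells L i = 0 := by
  rw [cells, List.getD_eq_getElem?_getD, List.getElem?_eq_none (by rw [length_flatMap_pair]; exact h)]
  rfl

theorem encodeGraph_mem_zero {n : ℕ} (G : SimpleGraph (Fin n)) (w i : ℕ) :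
    (encodeGraph G w).mem 0 i = (if i = 0 then n else if i = 1 then (edgeList G).length
      else cells ((edgeList G).map fun p => ((p.1 : ℕ), (p.2 : ℕ))) (i - 2)) % 2 ^ w := by
  simp only [encodeGraph, if_true]
  congr 1
  obtain _ | _ | i := i
  · rfl
  · rfl
  · simp [cells, List.flatMap_map]

namespace Red

variable {D : Red} {h a n : ℕ}

/-- The first vertex of the pair with number `z` in the instances. -/
def fstU (D : Red) (z : ℕ) : ℕ := z / (D.k * D.N)

/-- The second vertex of the pair with number `z` in the instances. -/
def sndU (D : Red) (z : ℕ) : ℕ := z / (D.k * D.N) / (D.k * D.N) * (D.k * D.N) + z % (D.k * D.N)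

open Classical in
/-- The edges among the first `z` pairs in the instances. -/
noncomputable def innerList (D : Red) (h z : ℕ) : List (ℕ × ℕ) :=
  ((List.range z).filter fun y => D.link h (D.fstU y) (D.sndU y)).map fun y => (D.fstU y, D.sndU y)

/-- The first `z` edges outside of the instances. -/
def outerList (D : Red) (a b z : ℕ) : List (ℕ × ℕ) :=
  (List.range z).map fun y => (D.U + y / b, D.U + a + y % b)

theorem innerList_succ (D : Red) (h z : ℕ) [Decidable (D.link h (D.fstU z) (D.sndU z))] :
    D.innerList h (z + 1) = D.innerList h z ++
      if D.link h (D.fstU z) (D.sndU z) then [(D.fstU z, D.sndU z)] else [] := by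
  rw [innerList, innerList, List.range_succ, List.filter_append, List.map_append]
  congr 1
  split_ifs with h1 <;> simp [h1]

theorem outerList_succ (D : Red) (a b z : ℕ) :
    D.outerList a b (z + 1) = D.outerList a b z ++ [(D.U + z / b, D.U + a + z % b)] := by
  rw [outerList, outerList, List.range_succ, List.map_append]
  rfl

theorem length_innerList_le (D : Red) (h z : ℕ) : (D.innerList h z).length ≤ z := by
  rw [innerList, List.length_map]
  exact (List.length_filter_le _ _).trans_eq List.length_range

theorem length_outerList (D : Red) (a b z : ℕ) : (D.outerList a b z).length = z := by
  rw [outerList, List.length_map, List.length_range]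

/-- The lexicographic order on pairs. -/
def lex (p q : ℕ × ℕ) : Prop := p.1 < q.1 ∨ p.1 = q.1 ∧ p.2 < q.2

theorem lex_fst_snd {y z : ℕ} (hyz : y < z) :
    lex (D.fstU y, D.sndU y) (D.fstU z, D.sndU z) := by
  rcases (Nat.div_le_div_right (c := D.k * D.N) hyz.le).lt_or_eq with h1 | h1
  · exact Or.inl h1
  · refine Or.inr ⟨h1, ?_⟩
    simp only [sndU, h1]
    have h2 := Nat.div_add_mod y (D.k * D.N)
    have h3 := Nat.div_add_mod z (D.k * D.N)
    rw [h1] at h2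
    omega

/-- The pair with number `u * (k * N) + r` consists of `u` and the vertex at position `r` in the
instance of `u`. Enumerating only such pairs takes `U * (k * N)` rounds instead of `U ^ 2`. -/
theorem fstU_sndU {u v : ℕ} (hkN : 0 < D.k * D.N) (huv : D.inst u = D.inst v) :
    D.fstU (u * (D.k * D.N) + v % (D.k * D.N)) = u ∧
      D.sndU (u * (D.k * D.N) + v % (D.k * D.N)) = v := by
  have h1 : (u * (D.k * D.N) + v % (D.k * D.N)) / (D.k * D.N) = u := by
    rw [mul_comm, Nat.mul_add_div hkN, Nat.div_eq_of_lt (Nat.mod_lt _ hkN), add_zero]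
  refine ⟨h1, ?_⟩
  rw [sndU, h1, Nat.mul_add_mod', Nat.mod_mod]
  rw [inst, inst] at huv
  rw [huv, Nat.div_add_mod']

/-- Both lists increase strictly in the lexicographic order and have the same members. So the
program obtains the required order without sorting. -/
theorem edgeList_graph (hk : 0 < D.k) (hN : 0 < D.N) (hn : D.U + a ≤ n) :
    (edgeList (D.graph h a n)).map (fun p => ((p.1 : ℕ), (p.2 : ℕ))) =
      D.innerList h (D.U * (D.k * D.N)) ++ D.outerList a (n - D.U - a) (a * (n - D.U - a)) := by
  classical
  have hkN : 0 < D.k * D.N := Nat.mul_pos hk hN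
  have hirr : Std.Irrefl lex := ⟨fun p hp => by rcases hp with hp | hp <;> omega⟩
  have hasy : Std.Antisymm lex := ⟨fun p q h1 h2 => by
    simp only [lex] at h1 h2; omega⟩
  have hinner : ∀ u v, (u, v) ∈ D.innerList h (D.U * (D.k * D.N)) ↔ u < D.U ∧ D.link h u v := by
    intro u v
    simp only [innerList, List.mem_map, List.mem_filter, List.mem_range, decide_eq_true_eq,
      Prod.mk.injEq]
    constructor
    · rintro ⟨z, ⟨h1, h2⟩, rfl, rfl⟩
      exact ⟨(Nat.div_lt_iff_lt_mul hkN).2 h1, h2⟩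
    · rintro ⟨h1, h2⟩
      obtain ⟨h3, h4⟩ := fstU_sndU hkN h2.1
      refine ⟨u * (D.k * D.N) + v % (D.k * D.N), ⟨?_, by rw [h3, h4]; exact h2⟩, h3, h4⟩
      rw [← Nat.div_lt_iff_lt_mul hkN]
      exact h3.trans_lt h1
  have houter : ∀ u v, (u, v) ∈ D.outerList a (n - D.U - a) (a * (n - D.U - a)) ↔
      D.U ≤ u ∧ u < D.U + a ∧ D.U + a ≤ v ∧ v < n := by
    intro u v
    simp only [outerList, List.mem_map, List.mem_range, Prod.mk.injEq]
    constructor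
    · rintro ⟨z, h1, rfl, rfl⟩
      have hb : 0 < n - D.U - a := Nat.pos_of_ne_zero fun h0 => by simp [h0] at h1
      have h2 := (Nat.div_lt_iff_lt_mul hb).2 h1
      have h3 := Nat.mod_lt z hb
      have h4 : 0 ≤ z / (n - D.U - a) := Nat.zero_le _
      generalize z / (n - D.U - a) = e at *
      omega
    · rintro ⟨h1, h2, h3, h4⟩
      have hb : 0 < n - D.U - a := by omega
      refine ⟨(n - D.U - a) * (u - D.U) + (v - D.U - a), ?_, ?_, ?_⟩
      · calc _ < (n - D.U - a) * (u - D.U) + (n - D.U - a) := by omega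
          _ = (n - D.U - a) * (u - D.U + 1) := by ring
          _ ≤ (n - D.U - a) * a := Nat.mul_le_mul_left _ (by omega)
          _ = _ := mul_comm _ _
      · rw [Nat.mul_add_div hb, Nat.div_eq_of_lt (by omega)]; omega
      · rw [Nat.mul_add_mod, Nat.mod_eq_of_lt (by omega)]; omega
  refine List.Pairwise.eq_of_mem_iff (r := lex) ?_ ?_ ?_
  · rw [List.pairwise_map, edgeList]
    refine List.Pairwise.filter _ ?_
    have : (List.finRange n ×ˢ List.finRange n) =
        (List.finRange n).flatMap fun x => (List.finRange n).map (Prod.mk x) := rfl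
    rw [this, List.pairwise_flatMap]
    refine ⟨fun x _ => ?_, ?_⟩
    · rw [List.pairwise_map]
      exact (List.pairwise_lt_finRange n).imp fun hlt => Or.inr ⟨rfl, hlt⟩
    · refine (List.pairwise_lt_finRange n).imp fun hlt => ?_
      intro p hp q hq
      simp only [List.mem_map] at hp hq
      obtain ⟨_, _, rfl⟩ := hp
      obtain ⟨_, _, rfl⟩ := hq
      exact Or.inl hlt
  · rw [List.pairwise_append]
    refine ⟨?_, ?_, ?_⟩
    · rw [innerList, List.pairwise_map]
      exact (List.pairwise_lt_range.filter _).imp fun hlt => lex_fst_snd hlt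
    · rw [outerList, List.pairwise_map]
      refine List.pairwise_lt_range.imp fun {y z} hlt => ?_
      rcases (Nat.div_le_div_right (c := n - D.U - a) hlt.le).lt_or_eq with h1 | h1
      · exact Or.inl (by simpa using h1)
      · refine Or.inr ⟨by simp only [h1], ?_⟩
        have h2 := Nat.div_add_mod y (n - D.U - a)
        have h3 := Nat.div_add_mod z (n - D.U - a)
        rw [h1] at h2
        simp only
        omega
    · rintro ⟨u, v⟩ hp ⟨u', v'⟩ hq
      exact Or.inl (((hinner u v).1 hp).1.trans_le ((houter u' v').1 hq).1)
  · rintro ⟨u, v⟩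
    have hprod : ∀ x y : Fin n, (x, y) ∈ List.finRange n ×ˢ List.finRange n := fun x y =>
      List.mem_product.2 ⟨List.mem_finRange _, List.mem_finRange _⟩
    rw [List.mem_append, hinner, houter]
    simp only [edgeList, List.mem_map, List.mem_filter, decide_eq_true_eq, Prod.exists,
      Prod.mk.injEq, hprod, true_and]
    constructor
    · rintro ⟨x, y, ⟨hxy, hadj⟩, rfl, rfl⟩
      have h1 : D.lk h a x y := by
        exact hadj.resolve_right fun h1 => absurd (lt_of_lk h1) (not_lt.2 (le_of_lt hxy))
      rcases h1 with h1 | h1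
      · exact Or.inl ⟨h1.1, h1.2.2⟩
      · exact Or.inr ⟨h1.1, h1.2.1, h1.2.2, y.2⟩
    · intro h1
      have h2 : D.lk h a u v ∧ v < n := by
        rcases h1 with ⟨h1, h2⟩ | h1
        · have h3 : v < D.U := by
            have h4 := h2.1
            rw [inst, inst] at h4
            rw [U, ← Nat.div_lt_iff_lt_mul hkN, ← h4, Nat.div_lt_iff_lt_mul hkN]
            exact h1
          exact ⟨Or.inl ⟨h1, h3, h2⟩, by omega⟩
        · exact ⟨Or.inr ⟨h1.1, h1.2.1, h1.2.2.1⟩, h1.2.2.2⟩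
      have h3 := lt_of_lk h2.1
      exact ⟨⟨u, by omega⟩, ⟨v, h2.2⟩, ⟨h3, Or.inl h2.1⟩, rfl, rfl⟩

end Red

/-! ### Integer weights modulo a power of two; the size of a list of cliques -/

/-! ## The tuples of a weighted graph -/

namespace WeightedGraph

open Classical in
/-- The reduction for the weighted graph `I`. -/
noncomputable def red {k V : ℕ} (I : WeightedGraph k V) (N S R BK : ℕ) : Red where
  k := k
  V := V
  N := N
  S := S
  R := R
  BK := BK
  adj a b := ∃ (ha : a < V) (hb : b < V), I.graph.Adj ⟨a, ha⟩ ⟨b, hb⟩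
  wt a b := if h : ∃ (ha : a < V) (hb : b < V), I.graph.Adj ⟨a, ha⟩ ⟨b, hb⟩ then
    (I.weight s(⟨a, h.1⟩, ⟨b, h.2.1⟩) % (R * BK : ℕ)).toNat else 0

variable {k V N S R BK : ℕ} {I : WeightedGraph k V}

theorem encode_mem_zero (I : WeightedGraph k V) (w : ℕ) : (I.encode w).mem 0 0 = V % 2 ^ w := by
  simp [encode]

open Classical in
theorem encode_mem (I : WeightedGraph k V) (w : ℕ) {a b x : ℕ} (ha : a < V) (hb : b < V)
    (hx : x ≠ 0) : (I.encode w).mem x (a * V + b) =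
      if I.graph.Adj ⟨a, ha⟩ ⟨b, hb⟩ then
        if x = 1 then 1 % 2 ^ w
        else if x = 2 then (I.weight s(⟨a, ha⟩, ⟨b, hb⟩) % (2 ^ w : ℤ)).toNat else 0
      else 0 := by
  have hV : 0 < V := by omega
  have hlt : a * V + b < V * V := by
    have := Nat.mul_le_mul_right V (Nat.succ_le_of_lt ha)
    rw [Nat.succ_mul] at this
    omega
  have hdiv : (Fin.divNat ⟨a * V + b, hlt⟩ : Fin V) = ⟨a, ha⟩ := by
    ext
    simp only [Fin.divNat]
    rw [mul_comm, Nat.mul_add_div hV, Nat.div_eq_of_lt hb, add_zero]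
  have hmod : (Fin.modNat ⟨a * V + b, hlt⟩ : Fin V) = ⟨b, hb⟩ := by
    ext
    simp only [Fin.modNat]
    rw [mul_comm, Nat.mul_add_mod, Nat.mod_eq_of_lt hb]
  rw [← hdiv, ← hmod]
  simp only [encode]
  rw [if_neg (fun h => hx h.1), dif_pos hlt]

open Classical in
theorem encode_mem_one (I : WeightedGraph k V) {w : ℕ} (hw : w ≠ 0) {a b : ℕ} (ha : a < V)
    (hb : b < V) : (I.encode w).mem 1 (a * V + b) =
      if (I.red N S R BK).adj a b then 1 else 0 := by
  rw [encode_mem I w ha hb one_ne_zero, Nat.mod_eq_of_lt (Nat.one_lt_two_pow hw)]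
  by_cases h : I.graph.Adj ⟨a, ha⟩ ⟨b, hb⟩
  · rw [if_pos h, if_pos rfl, if_pos (show (I.red N S R BK).adj a b from ⟨ha, hb, h⟩)]
  · rw [if_neg h, if_neg (show ¬ (I.red N S R BK).adj a b from fun ⟨_, _, h'⟩ => h h')]

/-- The modulus divides `2 ^ w`, so a weight and its two's complement word agree modulo `R * BK`,
whatever the sign. -/
theorem encode_mem_two (I : WeightedGraph k V) {w : ℕ} (hdvd : R * BK ∣ 2 ^ w) {a b : ℕ}
    (ha : a < V) (hb : b < V) :
    (I.encode w).mem 2 (a * V + b) % (R * BK) = (I.red N S R BK).wt a b := by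
  classical
  rw [encode_mem I w ha hb two_ne_zero]
  by_cases h : I.graph.Adj ⟨a, ha⟩ ⟨b, hb⟩
  · have hex : ∃ (ha : a < V) (hb : b < V), I.graph.Adj ⟨a, ha⟩ ⟨b, hb⟩ := ⟨ha, hb, h⟩
    rw [if_pos h, if_neg (by norm_num), if_pos rfl]
    simp only [red]
    rw [dif_pos hex]
    have h2 : (2 ^ w : ℤ) ≠ 0 := by positivity
    have hM : ((R * BK : ℕ) : ℤ) ≠ 0 := fun h0 => by
      rw [Nat.cast_eq_zero] at h0
      rw [h0, zero_dvd_iff] at hdvd; exact absurd hdvd (by positivity)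
    zify
    rw [Int.toNat_of_nonneg (Int.emod_nonneg _ h2), ← Nat.cast_mul,
      Int.toNat_of_nonneg (Int.emod_nonneg _ hM)]
    exact Int.emod_emod_of_dvd _ (by exact_mod_cast hdvd)
  · have hex : ¬ ∃ (ha : a < V) (hb : b < V), I.graph.Adj ⟨a, ha⟩ ⟨b, hb⟩ := fun ⟨_, _, h'⟩ => h h'
    simp only [red]
    rw [if_neg h, dif_neg hex, Nat.zero_mod]

/-- The weight of a tuple of vertices. -/
def tsum (I : WeightedGraph k V) (u : Fin k → Fin V) : ℤ :=
  ∑ P ∈ Finset.univ.filter (fun P : Fin k × Fin k => P.1 < P.2), I.weight s(u P.1, u P.2)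

theorem sum_sym2_image (I : WeightedGraph k V) {u : Fin k → Fin V} (hu : Function.Injective u) :
    ∑ e ∈ (Finset.univ.image u).sym2 with ¬ e.IsDiag, I.weight e = I.tsum u := by
  rw [Finset.sym2_image, Finset.filter_image, Finset.sum_image
    fun x _ y _ h => Sym2.map.injective hu h]
  simp only [Sym2.isDiag_map hu]
  rw [Finset.sum_sym2_filter_not_isDiag]
  refine Finset.sum_congr ?_ fun P _ => rfl
  ext P
  simp only [Finset.mem_filter, Finset.mem_offDiag, Finset.mem_univ, true_and]
  exact ⟨fun h => h.2, fun h => ⟨h.ne, h⟩⟩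

theorem exists_of_adjT {t : Fin k → ℕ} (ht : (I.red N S R BK).AdjT t) :
    ∃ u : Fin k → Fin V, (∀ i, (u i : ℕ) = t i) ∧ ∀ i j, i ≠ j → I.graph.Adj (u i) (u j) := by
  refine ⟨fun i => ⟨t i, ht.1 i⟩, fun i => rfl, fun i j hij => ?_⟩
  rcases lt_or_gt_of_ne hij with h | h
  · exact (ht.2 i j h).2.2
  · exact (ht.2 j i h).2.2.symm

theorem abs_tsum_le {u : Fin k → Fin V} (hu : ∀ i j, i ≠ j → I.graph.Adj (u i) (u j)) :
    |I.tsum u| ≤ tri k * (V : ℤ) ^ (100 * k) := by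
  have h0 := (I.red 0 0 0 0).card_pairs_le
  rw [tsum]
  refine (Finset.abs_sum_le_sum_abs _ _).trans ?_
  refine (Finset.sum_le_card_nsmul _ _ ((V : ℤ) ^ (100 * k)) fun P hP => ?_).trans ?_
  · exact I.abs_weight_le _ (hu _ _ (Finset.mem_filter.1 hP).2.ne)
  · rw [nsmul_eq_mul]
    refine mul_le_mul_of_nonneg_right ?_ (by positivity)
    exact_mod_cast h0

theorem wsum_modEq (hM : 0 < R * BK) {u : Fin k → Fin V}
    (hu : ∀ i j, i ≠ j → I.graph.Adj (u i) (u j)) :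
    ((I.red N S R BK).wsum (fun i => (u i : ℕ)) : ℤ) ≡ I.tsum u [ZMOD (R * BK : ℕ)] := by
  rw [Red.wsum, tsum]
  push_cast
  refine (Int.ModEq.sum (fun P hP => ?_))
  have hP := (Finset.mem_filter.1 hP).2
  have hex : ∃ (ha : ((u P.1 : Fin V) : ℕ) < V) (hb : ((u P.2 : Fin V) : ℕ) < V),
      I.graph.Adj ⟨_, ha⟩ ⟨_, hb⟩ := ⟨Fin.is_lt _, Fin.is_lt _, hu _ _ hP.ne⟩
  simp only [red, hex, dif_pos]
  rw [← Nat.cast_mul, Int.toNat_of_nonneg (Int.emod_nonneg _ (by exact_mod_cast hM.ne'))]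
  exact Int.mod_modEq _ _

/-- The modulus exceeds the absolute value of every possible weight sum. -/
theorem wsum_mod_eq_zero_iff (hM : tri k * V ^ (100 * k) < R * BK) {u : Fin k → Fin V}
    (hu : ∀ i j, i ≠ j → I.graph.Adj (u i) (u j)) :
    (I.red N S R BK).wsum (fun i => (u i : ℕ)) % (R * BK) = 0 ↔ I.tsum u = 0 := by
  have h1 := wsum_modEq (N := N) (S := S) (by omega : 0 < R * BK) hu
  have h2 := abs_tsum_le hu
  rw [← Nat.dvd_iff_mod_eq_zero, ← Int.natCast_dvd_natCast, h1.dvd_iff]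
  constructor
  · intro h
    refine Int.eq_zero_of_abs_lt_dvd h (h2.trans_lt ?_)
    exact_mod_cast hM
  · intro h; rw [h]; exact dvd_zero _

theorem hasZeroClique_iff (hM : tri k * V ^ (100 * k) < R * BK) :
    I.HasZeroClique ↔ ∃ t, (I.red N S R BK).AdjT t ∧ (I.red N S R BK).wsum t % (R * BK) = 0 := by
  constructor
  · rintro ⟨Q, hQ, hz⟩
    set u := Q.orderEmbOfFin hQ.2
    have hQu : Q = Finset.univ.image u := (Finset.image_orderEmbOfFin_univ Q hQ.2).symm
    have hu : ∀ i j, i ≠ j → I.graph.Adj (u i) (u j) := fun i j hij =>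
      hQ.1 (Finset.orderEmbOfFin_mem _ _ _) (Finset.orderEmbOfFin_mem _ _ _)
        (u.injective.ne hij)
    refine ⟨fun i => (u i : ℕ), ⟨fun i => (u i).2, fun i j hij => ⟨(u i).2, (u j).2, hu i j hij.ne⟩⟩, ?_⟩
    rw [wsum_mod_eq_zero_iff hM hu, ← sum_sym2_image I u.injective, ← hQu]
    exact hz
  · rintro ⟨t, ht, hz⟩
    obtain ⟨u, hut, hu⟩ := exists_of_adjT ht
    obtain rfl : (fun i => (u i : ℕ)) = t := funext hut
    have hinj : Function.Injective u := fun i j hij => by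
      by_contra hne
      exact (hu i j hne).ne hij
    refine ⟨Finset.univ.image u, ⟨?_, ?_⟩, ?_⟩
    · intro x hx y hy hne
      simp only [Finset.coe_image, Finset.coe_univ, Set.image_univ, Set.mem_range] at hx hy
      obtain ⟨i, rfl⟩ := hx
      obtain ⟨j, rfl⟩ := hy
      exact hu i j fun h => hne (by rw [h])
    · rw [Finset.card_image_of_injective _ hinj, Finset.card_univ, Fintype.card_fin]
    · rw [sum_sym2_image I hinj]
      exact (wsum_mod_eq_zero_iff hM hu).1 hz

/-- The gcd is a power of two that divides the nonzero weight sum, whose absolute value is below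
`BK`. So it is a smaller power of two than `BK`, hence a divisor. -/
theorem gcd_wsum_dvd {c b : ℕ} (hR : R * BK = 2 ^ c) (hBK : BK = 2 ^ b)
    (hM : tri k * V ^ (100 * k) < BK) (t : Fin k → ℕ) (ht : (I.red N S R BK).AdjT t)
    (hz : (I.red N S R BK).wsum t % (R * BK) ≠ 0) :
    Nat.gcd (R * BK) ((I.red N S R BK).wsum t) ∣ BK := by
  obtain ⟨u, hut, hu⟩ := exists_of_adjT ht
  obtain rfl : (fun i => (u i : ℕ)) = t := funext hut
  have hRpos : 0 < R := Nat.pos_of_ne_zero fun h0 => by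
    rw [h0, zero_mul] at hR; exact absurd hR.symm (by positivity)
  have hM' : tri k * V ^ (100 * k) < R * BK := hM.trans_le (Nat.le_mul_of_pos_left _ hRpos)
  have h1 := wsum_modEq (N := N) (S := S) (by omega : 0 < R * BK) hu
  have h2 := abs_tsum_le hu
  have h0 : I.tsum u ≠ 0 := fun h => hz ((wsum_mod_eq_zero_iff hM' hu).2 h)
  obtain ⟨j, -, hj⟩ := (Nat.dvd_prime_pow Nat.prime_two).1
    ((Nat.gcd_dvd_left (R * BK) ((I.red N S R BK).wsum fun i => (u i : ℕ))).trans hR.dvd)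
  refine hj.dvd.trans ((Nat.pow_dvd_pow 2 ?_).trans hBK.symm.dvd)
  have hdvd : ((2 ^ j : ℕ) : ℤ) ∣ I.tsum u := by
    rw [← hj]
    exact (h1.of_dvd (by exact_mod_cast Nat.gcd_dvd_left _ _)).dvd_iff.1
      (by exact_mod_cast Nat.gcd_dvd_right _ _)
  have h3 : ((2 ^ j : ℕ) : ℤ) ≤ |I.tsum u| :=
    Int.le_of_dvd (abs_pos.2 h0) ((dvd_abs _ _).2 hdvd)
  have h4 : 2 ^ j < 2 ^ b := by
    rw [← hBK]
    have : ((2 ^ j : ℕ) : ℤ) ≤ (tri k * V ^ (100 * k) : ℕ) := h3.trans (by exact_mod_cast h2)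
    exact (by exact_mod_cast this : 2 ^ j ≤ tri k * V ^ (100 * k)).trans_lt hM
  exact ((Nat.pow_lt_pow_iff_right (by norm_num)).1 h4).le

end WeightedGraph

/-- Random words hit a set of tuples of digits with the right frequency. -/
theorem card_mul_le_card_digits {k Y M : ℕ} (Z : Finset (Fin k → ℕ)) (hZ : ∀ t ∈ Z, ∀ i, t i < Y)
    (hM : Y ^ k ∣ M) :
    Z.card * (M / Y ^ k) ≤
      ((Finset.range M).filter fun r => (fun i : Fin k => r / Y ^ (i : ℕ) % Y) ∈ Z).card := by
  classical
  rw [← Finset.card_range (M / Y ^ k), ← Finset.card_product]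
  set dg : (Fin k → ℕ) → ℕ → ℕ := fun t i => if hi : i < k then t ⟨i, hi⟩ else 0 with hdg
  have hY : Z.Nonempty → 0 < k → 0 < Y := fun ⟨t, ht⟩ hk => (Nat.zero_le _).trans_lt (hZ t ht ⟨0, hk⟩)
  have hlt : ∀ t ∈ Z, ∀ i, 0 < k → dg t i < Y := fun t ht i hk => by
    simp only [hdg]
    split_ifs with hi
    · exact hZ t ht _
    · exact hY ⟨t, ht⟩ hk
  have hsum : ∀ t ∈ Z, ∑ i ∈ Finset.range k, dg t i * Y ^ i < Y ^ k := fun t ht => by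
    rcases Nat.eq_zero_or_pos k with rfl | hk
    · simp
    · exact sum_digits_lt _ (fun i => hlt t ht i hk) k
  have hdig : ∀ t ∈ Z, ∀ q, ∀ i : Fin k,
      (∑ i ∈ Finset.range k, dg t i * Y ^ i + Y ^ k * q) / Y ^ (i : ℕ) % Y = t i := by
    intro t ht q i
    have hk : 0 < k := (Nat.zero_le _).trans_lt i.2
    obtain ⟨r, hr⟩ := Nat.exists_eq_add_of_lt i.2
    rw [show Y ^ k * q = Y ^ (i : ℕ) * (Y * (Y ^ r * q)) by
        rw [show Y ^ k = Y ^ ((i : ℕ) + r + 1) by rw [← hr]]; ring,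
      Nat.add_mul_div_left _ _ (pow_pos (hY ⟨t, ht⟩ hk) _), Nat.add_mul_mod_self_left,
      sum_digits_div_mod _ (fun i => hlt t ht i hk) i.2, hdg]
    simp
  refine Finset.card_le_card_of_injOn
    (fun p => ∑ i ∈ Finset.range k, dg p.1 i * Y ^ i + Y ^ k * p.2) ?_ ?_
  · rintro ⟨t, q⟩ hp
    rw [Finset.mem_coe, Finset.mem_product, Finset.mem_range] at hp
    have h1 := hsum t hp.1
    simp only at hp
    rw [Finset.mem_coe, Finset.mem_filter, Finset.mem_range]
    constructor
    · have h2 := Nat.mul_le_mul_left (Y ^ k) (Nat.succ_le_of_lt hp.2)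
      rw [Nat.mul_div_cancel' hM, Nat.mul_succ] at h2
      simp only
      omega
    · have : (fun i : Fin k => (∑ i ∈ Finset.range k, dg t i * Y ^ i + Y ^ k * q) / Y ^ (i : ℕ) % Y) = t :=
        funext fun i => hdig t hp.1 q i
      simp only [this]
      exact hp.1
  · rintro ⟨t, q⟩ hp ⟨t', q'⟩ hp' heq
    rw [Finset.mem_coe, Finset.mem_product] at hp hp'
    simp only at heq hp hp'
    have h1 : t = t' := funext fun i => by rw [← hdig t hp.1 q i, ← hdig t' hp'.1 q' i, heq]
    subst h1
    have h2 := hsum t hp.1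
    rw [Nat.add_left_cancel_iff] at heq
    rw [Nat.eq_of_mul_eq_mul_left (by omega) heq]

namespace WordRAM

/-! ## The length of the output -/

/-- Every nonzero cell of array `x` is in `F`. -/
def Supp (x : ℕ) (F : Finset ℕ) (s : State) : Prop := ∀ i, s.mem x i ≠ 0 → i ∈ F

/-- A step writes at most one cell. -/
theorem Supp.step {w x : ℕ} {F : Finset ℕ} {c c' : Config} (h : Supp x F c.2)
    (hc : c' ∈ (step w c).support) : ∃ F', F'.card ≤ F.card + 1 ∧ Supp x F' c'.2 := by
  obtain ⟨K, s⟩ := c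
  have hF : ∀ d : Config, d.2.mem = s.mem → ∃ F', F'.card ≤ F.card + 1 ∧ Supp x F' d.2 :=
    fun d hd => ⟨F, by omega, fun i hi => h i (by rwa [hd] at hi)⟩
  obtain _ | ⟨k, K⟩ := K
  · rw [WordRAM.step, PMF.mem_support_pure_iff] at hc
    exact hF _ (by rw [hc])
  · cases k <;> simp only [WordRAM.step, PMF.mem_support_pure_iff, PMF.support_map, Set.mem_image] at hc
    case store a i y =>
      refine ⟨insert (s.reg i) F, Finset.card_insert_le _ _, fun j hj => ?_⟩
      rw [hc] at hj
      simp only [State.setMem, Function.update_apply] at hj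
      rw [Finset.mem_insert]
      by_cases hj' : j = s.reg i
      · exact Or.inl hj'
      · right
        apply h
        by_cases hx : x = a
        · subst hx; simpa [hj'] using hj
        · simpa [hx] using hj
    case rand =>
      obtain ⟨r, -, hr⟩ := hc
      exact hF _ (by rw [← hr]; rfl)
    all_goals exact hF _ (congrArg (fun c : Config => c.2.mem) hc)

theorem Supp.run {w x T : ℕ} {F : Finset ℕ} {c c' : Config} (h : Supp x F c.2)
    (hc : c' ∈ (run w T c).support) : ∃ F', F'.card ≤ F.card + T ∧ Supp x F' c'.2 := by
  induction T generalizing F c with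
  | zero =>
    rw [WordRAM.run, PMF.mem_support_pure_iff] at hc
    exact ⟨F, le_rfl, hc ▸ h⟩
  | succ T ih =>
    rw [WordRAM.run, PMF.mem_support_bind_iff] at hc
    obtain ⟨d, hd, hc⟩ := hc
    obtain ⟨F1, h1, h2⟩ := h.step hd
    obtain ⟨F2, h3, h4⟩ := ih h2 hc
    exact ⟨F2, by omega, h4⟩

/-- A listed block contains `k` distinct vertices, hence a nonzero cell, and different blocks use
different cells. The specification permits repetitions, so this is what bounds the announced number
of blocks, by the running time. -/
theorem count_le_of_listsAllCliques {k n T : ℕ} (hk : 3 ≤ k) {G : SimpleGraph (Fin n)} {s : State}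
    (h : ListsAllCliques k G s) {F : Finset ℕ} (hF : Supp 1 F s) (hT : F.card ≤ T) :
    s.mem 1 0 ≤ T := by
  have key : ∀ i < s.mem 1 0, ∃ j < k, s.mem 1 (1 + i * k + j) ≠ 0 := by
    intro i hi
    by_contra hcon
    push Not at hcon
    obtain ⟨Q, hQ, hQe⟩ := (h _).1 ⟨i, hi, rfl⟩
    have h1 : ((Finset.range k).image fun j => s.mem 1 (1 + i * k + j)) ⊆ {0} := by
      intro x hx
      obtain ⟨j, hj, rfl⟩ := Finset.mem_image.1 hx
      rw [Finset.mem_singleton, hcon j (Finset.mem_range.1 hj)]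
    have h2 := Finset.card_le_card h1
    rw [hQe, Finset.card_map, hQ.2, Finset.card_singleton] at h2
    omega
  choose! j hj hne using key
  refine le_trans ?_ hT
  rw [← Finset.card_range (s.mem 1 0)]
  refine Finset.card_le_card_of_injOn (fun i => 1 + i * k + j i)
    (fun i hi => hF _ (hne i (Finset.mem_range.1 hi))) ?_
  intro i hi i' hi' heq
  have hi := hj i (Finset.mem_range.1 hi)
  have hi' := hj i' (Finset.mem_range.1 hi')
  have e1 : (i * k + j i) / k = i := by
    rw [mul_comm, Nat.mul_add_div (by omega), Nat.div_eq_of_lt hi, add_zero]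
  have e2 : (i' * k + j i') / k = i' := by
    rw [mul_comm, Nat.mul_add_div (by omega), Nat.div_eq_of_lt hi', add_zero]
  simp only at heq
  rw [← e1, ← e2]
  congr 1
  omega

theorem SucceedsWithin.count_le {k n w T : ℕ} (hk : 3 ≤ k) {G : SimpleGraph (Fin n)} {P : Cmd}
    (h : SucceedsWithin w P (encodeGraph G w) T (ListsAllCliques k G)) :
    2 / 3 ≤ Val w (fun s => ListsAllCliques k G s ∧ s.mem 1 0 ≤ T) T ([P], encodeGraph G w) := by
  refine h.trans ?_
  rw [Val, ← PMF.toOuterMeasure_apply_inter_support]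
  refine MeasureTheory.measure_mono ?_
  rintro c ⟨⟨h1, h2⟩, h3⟩
  have h0 : Supp 1 ∅ (encodeGraph G w) := fun i hi => absurd rfl hi
  obtain ⟨F, h4, h5⟩ := Supp.run (c := ([P], encodeGraph G w)) h0 h3
  exact ⟨h1, h2, count_le_of_listsAllCliques hk h2 h5 (by simpa using h4)⟩

end WordRAM

/-! ### The reduction as a word-RAM program -/

namespace WordRAM

/-! ## What expressions and straight-line code write -/

namespace Ex

theorem code_nwr {y : ℕ} (hy : y < 60 ∨ 100 ≤ y) (e : Ex) : ∀ d, 60 ≤ d → e.wf d = true →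
    (e.code d).1.nwr y = true := by
  induction e with
  | v x => intro d _ _; rfl
  | n c =>
    intro d hd hwf
    simp only [wf, decide_eq_true_eq] at hwf
    simp only [code, Cmd.nwr, bne_iff_ne]
    omega
  | o op e f he hf =>
    intro d hd hwf
    simp only [wf, Bool.and_eq_true, decide_eq_true_eq] at hwf
    simp only [code, Cmd.nwr, Bool.and_eq_true, bne_iff_ne]
    exact ⟨he d hd hwf.1.1, hf _ (by omega) hwf.1.2, by omega⟩
  | ld a e he =>
    intro d hd hwf
    simp only [wf, Bool.and_eq_true, decide_eq_true_eq] at hwf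
    simp only [code, Cmd.nwr, Bool.and_eq_true, bne_iff_ne]
    exact ⟨he d hd hwf.1, by omega⟩
  | rm x e he =>
    intro d hd hwf
    simp only [wf, Bool.and_eq_true, decide_eq_true_eq] at hwf
    simp only [code, Cmd.nwr, Bool.and_eq_true, bne_iff_ne]
    exact ⟨he d hd hwf.1.1, by omega⟩
  | ldm a e f he hf =>
    intro d hd hwf
    simp only [wf, Bool.and_eq_true, decide_eq_true_eq] at hwf
    simp only [code, Cmd.nwr, Bool.and_eq_true, bne_iff_ne]
    exact ⟨he d hd hwf.1.1, by omega, hf _ (by omega) hwf.1.2, by omega⟩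

theorem code_nwa (a : ℕ) (e : Ex) : ∀ d, (e.code d).1.nwa a = true := by
  induction e <;> intro d <;> simp_all [code, Cmd.nwa]

/-- The sum of a list of expressions. -/
def sumL : List Ex → Ex
  | [] => n 0
  | e :: l => o .add (sumL l) e

/-- The product of a list of expressions. -/
def prodL : List Ex → Ex
  | [] => n 1
  | e :: l => o .mul (prodL l) e

/-- A power of register `2`. -/
def zp : ℕ → Ex
  | 0 => n 1
  | m + 1 => o .mul (zp m) (v 2)

theorem ev_sumL (s : State) (l : List Ex) : (sumL l).ev s = (l.map (ev s)).sum := by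
  induction l with
  | nil => rfl
  | cons e l ih => simp [sumL, ev, idl, ih, add_comm]

theorem ev_prodL (s : State) (l : List Ex) : (prodL l).ev s = (l.map (ev s)).prod := by
  induction l with
  | nil => rfl
  | cons e l ih => simp [prodL, ev, idl, ih, mul_comm]

theorem ev_zp (s : State) (m : ℕ) : (zp m).ev s = s.reg 2 ^ m := by
  induction m with
  | zero => rfl
  | succ m ih => simp [zp, ev, idl, ih, pow_succ]

theorem ok_sumL {L : ℕ} {s : State} {l : List Ex} (h : ∀ e ∈ l, e.ok L s) : (sumL l).ok L s := by
  induction l with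
  | nil => exact Nat.zero_le _
  | cons e l ih =>
    exact ⟨ih fun e he => h e (List.mem_cons_of_mem _ he), h e List.mem_cons_self, trivial⟩

theorem ok_prodL {L : ℕ} {s : State} {l : List Ex} (h : ∀ e ∈ l, e.ok L s) : (prodL l).ok L s := by
  induction l with
  | nil => exact Nat.one_le_two_pow
  | cons e l ih =>
    exact ⟨ih fun e he => h e (List.mem_cons_of_mem _ he), h e List.mem_cons_self, trivial⟩

theorem ok_zp {L : ℕ} {s : State} (h : s.reg 2 ≤ 2 ^ L) (m : ℕ) : (zp m).ok L s := by
  induction m with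
  | zero => exact Nat.one_le_two_pow
  | succ m ih => exact ⟨ih, h, trivial⟩

theorem wf_sumL {d : ℕ} {l : List Ex} (hd : d < 100) (h : ∀ e ∈ l, e.wf (d + 1) = true) :
    (sumL l).wf d = true := by
  induction l with
  | nil => simp [sumL, wf, hd]
  | cons e l ih =>
    simp only [sumL, wf, Bool.and_eq_true, decide_eq_true_eq]
    exact ⟨⟨ih fun e he => h e (List.mem_cons_of_mem _ he), h e List.mem_cons_self⟩, hd⟩

theorem wf_prodL {d : ℕ} {l : List Ex} (hd : d < 100) (h : ∀ e ∈ l, e.wf (d + 1) = true) :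
    (prodL l).wf d = true := by
  induction l with
  | nil => simp [prodL, wf, hd]
  | cons e l ih =>
    simp only [prodL, wf, Bool.and_eq_true, decide_eq_true_eq]
    exact ⟨⟨ih fun e he => h e (List.mem_cons_of_mem _ he), h e List.mem_cons_self⟩, hd⟩

theorem wf_zp (d m : ℕ) : (zp m).wf d = decide (d < 100) := by
  induction m with
  | zero => rfl
  | succ m ih => simp [zp, wf, ih]

end Ex

namespace HL

/-- Register `y` is not assigned. -/
def nw (y : ℕ) : HL → Bool
  | nop => true
  | asg x _ => y != x
  | st _ _ _ => true
  | sq h h' => h.nw y && h'.nw y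
  | cond _ h h' => h.nw y && h'.nw y

/-- Array `a` is not written. -/
def na (a : ℕ) : HL → Bool
  | nop => true
  | asg _ _ => true
  | st b _ _ => a != b
  | sq h h' => h.na a && h'.na a
  | cond _ h h' => h.na a && h'.na a

theorem comp_nwr {y : ℕ} (hy : y < 60 ∨ 100 ≤ y) (h : HL) : h.wf = true → h.nw y = true →
    h.comp.nwr y = true := by
  induction h with
  | nop => intro _ _; rfl
  | asg x e =>
    intro hwf hnw
    simp only [wf, Bool.and_eq_true] at hwf
    simp only [comp, Cmd.nwr, e.code_nwr hy 61 (by norm_num) hwf.1, Bool.true_and]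
    exact hnw
  | st a i v =>
    intro hwf _
    simp only [wf, Bool.and_eq_true] at hwf
    simp only [comp, Cmd.nwr, i.code_nwr hy 61 (by norm_num) hwf.1,
      v.code_nwr hy 62 (by norm_num) hwf.2, Bool.true_and]
  | sq h h' ih ih' =>
    intro hwf hnw
    simp only [wf, nw, Bool.and_eq_true] at hwf hnw
    simp only [comp, Cmd.nwr, ih hwf.1 hnw.1, ih' hwf.2 hnw.2, Bool.true_and]
  | cond e h h' ih ih' =>
    intro hwf hnw
    simp only [wf, nw, Bool.and_eq_true] at hwf hnw
    simp only [comp, Cmd.nwr, e.code_nwr hy 61 (by norm_num) hwf.1.1, ih hwf.1.2 hnw.1,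
      ih' hwf.2 hnw.2, Bool.true_and]

theorem comp_nwa {a : ℕ} (h : HL) : h.na a = true → h.comp.nwa a = true := by
  induction h with
  | nop => intro _; rfl
  | asg x e => intro _; simp [comp, Cmd.nwa, Ex.code_nwa]
  | st b i v => intro h; simpa [comp, Cmd.nwa, Ex.code_nwa, na] using h
  | sq h h' ih ih' =>
    intro h
    simp only [na, Bool.and_eq_true] at h
    simp only [comp, Cmd.nwa, ih h.1, ih' h.2, Bool.true_and]
  | cond e h h' ih ih' =>
    intro h
    simp only [na, Bool.and_eq_true] at h
    simp only [comp, Cmd.nwa, Ex.code_nwa, ih h.1, ih' h.2, Bool.true_and]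

end HL

theorem forL_nwr {x z y : ℕ} {body : Cmd} (hx : x < 60) (hz : z < 60) (hy : y < 60 ∨ 100 ≤ y)
    (hyx : y ≠ x) (hb : body.nwr y = true) : (forL x z body).nwr y = true := by
  have h1 : (HL.asg x (.n 0)).comp.nwr y = true :=
    HL.comp_nwr hy _ (by simp [HL.wf, Ex.wf, hx]) (by simpa [HL.nw] using hyx)
  have h2 : (HL.asg x (.o .add (.v x) (.n 1))).comp.nwr y = true :=
    HL.comp_nwr hy _ (by simp [HL.wf, Ex.wf, hx]) (by simpa [HL.nw] using hyx)
  have h3 : (setT (.o .lt (.v x) (.v z))).nwr y = true := by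
    simp only [setT, Cmd.nwr, Bool.and_eq_true, bne_iff_ne]
    exact ⟨Ex.code_nwr hy _ _ (by norm_num) (by simp [Ex.wf, hx, hz]), by omega⟩
  simp only [forL, whl, Cmd.nwr, h1, h2, h3, hb, Bool.and_self]

theorem forL_nwa {x z a : ℕ} {body : Cmd} (hb : body.nwa a = true) :
    (forL x z body).nwa a = true := by
  simp only [forL, whl, setT, Cmd.nwa, HL.comp, Ex.code_nwa, hb, Bool.and_self]

end WordRAM

namespace WordRAM

/-! ## The program of the reduction: expressions -/

/-- Exponents: with `Z = 2 ^ x` the parameters of the reduction are `N = Z ^ p1`, `S = Z ^ p2`,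
`R = Z ^ 8`, `BK = Z ^ c1`; there are `Z ^ q` vertices, the clock stops at `Z ^ ck`, the simulated
arrays have `Z ^ cs` cells, and the simulated words have `cv * (q * x + 1)` bits. -/
structure Pm where
  k : ℕ
  p1 : ℕ
  p2 : ℕ
  q : ℕ
  c1 : ℕ
  ck : ℕ
  cs : ℕ
  cv : ℕ

namespace Pm

open Ex

variable (p : Pm)

/-- The reduction with these parameters. -/
noncomputable def red {V : ℕ} (I : WeightedGraph p.k V) (x : ℕ) : Red :=
  I.red ((2 ^ x) ^ p.p1) ((2 ^ x) ^ p.p2) ((2 ^ x) ^ 8) ((2 ^ x) ^ p.c1)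

def eKN : Ex := o .mul (n p.k) (zp p.p1)

def eInst (u : Ex) : Ex := o .div u p.eKN

def ePart (u : Ex) : Ex := o .mod (o .div u (zp p.p1)) (n p.k)

/-- `S` is a power of two, so dividing by its power with a variable exponent is a shift; register
`3` holds `x`, the logarithm of `Z`. The same device serves in `eDig`. -/
def eOrig (u : Ex) : Ex :=
  o .add (o .mul (o .mod (o .shr (p.eInst u) (o .mul (o .mul (n p.p2) (v 3)) (p.ePart u))) (zp p.p2))
    (zp p.p1)) (o .mod u (zp p.p1))

def eTri (u w : Ex) : Ex :=
  o .add (o .div (o .sub (o .mul (p.ePart w) (p.ePart w)) (p.ePart w)) (n 2)) (p.ePart u)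

def eDig (id π : Ex) : Ex :=
  o .mod (o .shr (o .mul (zp 8) (o .div id (zp (p.p2 * p.k)))) (o .mul (o .mul (n 8) (v 3)) π)) (zp 8)

def eIdx (a b : Ex) : Ex := o .add (o .mul a (v 1)) b

/-- The stored word may exceed the bound `2 ^ L` on atoms; `ldm` reduces it at once, so that only
the modulus is subject to that bound. -/
def eWt (a b : Ex) : Ex := ldm 2 (eIdx a b) (zp (8 + p.c1))

def eBkt (a b : Ex) : Ex :=
  o .div (o .mod (o .mul (v 6) (p.eWt a b)) (zp (8 + p.c1))) (zp p.c1)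

/-- A conjunction as a product; all factors are evaluated, even where the indices are meaningless.
Equality of the instances is not tested, since only pairs within an instance occur. -/
def eLink (u w : Ex) : Ex :=
  o .mul (o .mul (o .lt (p.ePart u) (p.ePart w))
      (o .mul (o .lt (p.eOrig u) (v 1)) (o .lt (p.eOrig w) (v 1))))
    (o .mul (ld 1 (eIdx (p.eOrig u) (p.eOrig w)))
      (o .eq (o .mod (o .add (p.eDig (p.eInst u) (o .add (p.eTri u w) (n 1)))
        (p.eBkt (p.eOrig u) (p.eOrig w))) (zp 8)) (p.eDig (p.eInst u) (p.eTri u w))))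

def eU : Ex := o .mul (n (tri p.k * p.k)) (zp (8 * (tri p.k - 1) + p.p2 * p.k + p.p1))

/-- What the expressions assume about the data. -/
structure Env {V : ℕ} (I : WeightedGraph p.k V) (L w x : ℕ) (s : State) : Prop where
  reg1 : s.reg 1 = V
  reg2 : s.reg 2 = 2 ^ x
  reg3 : s.reg 3 = x
  mem1 : s.mem 1 = (I.encode w).mem 1
  mem2 : s.mem 2 = (I.encode w).mem 2
  hL : 1 ≤ L
  hV : V ≤ 2 ^ L
  hx : 2 ^ x ≤ 2 ^ L
  hk : p.k ≤ 2 ^ L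
  hE : tri p.k * p.k ≤ 2 ^ L
  hp : p.p1 + p.p2 ≤ 2 ^ L
  hcv : 2 ^ p.cv ≤ 2 ^ L
  hc : 100 ≤ 2 ^ L
  hw : w ≠ 0
  hM : (2 ^ x) ^ (8 + p.c1) ∣ 2 ^ w

variable {p} {V L w x : ℕ} {I : WeightedGraph p.k V} {s s' : State}

theorem Env.congr (h : p.Env I L w x s) (h1 : s'.reg 1 = s.reg 1) (h2 : s'.reg 2 = s.reg 2)
    (h3 : s'.reg 3 = s.reg 3) (hm : s'.mem 1 = s.mem 1) (hm2 : s'.mem 2 = s.mem 2) :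
    p.Env I L w x s' :=
  ⟨by rw [h1, h.reg1], by rw [h2, h.reg2], by rw [h3, h.reg3], by rw [hm, h.mem1],
    by rw [hm2, h.mem2], h.hL, h.hV, h.hx, h.hk, h.hE, h.hp, h.hcv, h.hc, h.hw, h.hM⟩

theorem Env.ok1 (h : p.Env I L w x s) : s.reg 1 ≤ 2 ^ L := by rw [h.reg1]; exact h.hV
theorem Env.ok2 (h : p.Env I L w x s) : s.reg 2 ≤ 2 ^ L := by rw [h.reg2]; exact h.hx
theorem Env.ok3 (h : p.Env I L w x s) : s.reg 3 ≤ 2 ^ L := by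
  rw [h.reg3]; exact Nat.lt_two_pow_self.le.trans h.hx

/-- Cells outside of the matrix are 0, so reading array `1` at a meaningless index is harmless. -/
theorem Env.mem1_le (h : p.Env I L w x s) (i : ℕ) : s.mem 1 i ≤ 2 ^ L := by
  refine le_trans ?_ Nat.one_le_two_pow
  rw [h.mem1]
  simp only [WeightedGraph.encode]
  have := Nat.mod_le 1 (2 ^ w)
  split_ifs <;> simp_all

theorem ev_zp' (h : p.Env I L w x s) (m : ℕ) : (zp m).ev s = (2 ^ x) ^ m := by
  rw [ev_zp, h.reg2]

theorem ev_eKN (h : p.Env I L w x s) : p.eKN.ev s = (p.red I x).k * (p.red I x).N := by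
  simp only [eKN, ev, idl, ev_zp' h]; rfl

theorem ev_eInst (h : p.Env I L w x s) (u : Ex) :
    (p.eInst u).ev s = (p.red I x).inst (u.ev s) := by
  simp only [eInst, ev, idl, ev_eKN h]; rfl

theorem ev_ePart (h : p.Env I L w x s) (u : Ex) :
    (p.ePart u).ev s = (p.red I x).part (u.ev s) := by
  simp only [ePart, ev, idl, ev_zp' h]; rfl

theorem ev_eOrig (h : p.Env I L w x s) (u : Ex) :
    (p.eOrig u).ev s = (p.red I x).orig (u.ev s) := by
  simp only [eOrig, ev, idl, ev_zp' h, ev_eInst h, ev_ePart h, h.reg3, Red.orig]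
  rw [show (p.red I x).S = (2 ^ x) ^ p.p2 from rfl, show (p.red I x).N = (2 ^ x) ^ p.p1 from rfl,
    ← pow_mul, ← pow_mul, ← pow_mul, mul_comm x p.p2]

theorem ev_eTri (h : p.Env I L w x s) (u u' : Ex) :
    (p.eTri u u').ev s = tri ((p.red I x).part (u'.ev s)) + (p.red I x).part (u.ev s) := by
  simp only [eTri, ev, idl, ev_ePart h, tri, Nat.mul_sub, mul_one]

theorem ev_eDig (h : p.Env I L w x s) (id π : Ex) :
    (p.eDig id π).ev s = (p.red I x).dig (id.ev s) (π.ev s) := by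
  simp only [eDig, ev, idl, ev_zp' h, h.reg3, Red.dig]
  rw [show (p.red I x).S = (2 ^ x) ^ p.p2 from rfl, show (p.red I x).R = (2 ^ x) ^ 8 from rfl,
    show (p.red I x).k = p.k from rfl, ← pow_mul (2 ^ x) p.p2 p.k, ← pow_mul, ← pow_mul, ← pow_mul,
    mul_comm x 8]

theorem ev_eWt (h : p.Env I L w x s) {a b : Ex} (ha : a.ev s < V) (hb : b.ev s < V) :
    (p.eWt a b).ev s = (p.red I x).wt (a.ev s) (b.ev s) := by
  simp only [eWt, eIdx, ev, idl, ev_zp' h, h.reg1, h.mem2]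
  rw [pow_add]
  exact WeightedGraph.encode_mem_two I (by rw [← pow_add]; exact h.hM) ha hb

theorem ev_eBkt (h : p.Env I L w x s) {a b : Ex} (ha : a.ev s < V) (hb : b.ev s < V) :
    (p.eBkt a b).ev s = (p.red I x).bkt (s.reg 6) (a.ev s) (b.ev s) := by
  simp only [eBkt, ev, idl, ev_zp' h, ev_eWt h ha hb, Red.bkt]
  rw [pow_add]
  rfl

theorem ev_adj (h : p.Env I L w x s) {a b : Ex} (ha : a.ev s < V) (hb : b.ev s < V) :
    (ld 1 (eIdx a b)).ev s ≠ 0 ↔ (p.red I x).adj (a.ev s) (b.ev s) := by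
  classical
  simp only [eIdx, ev, idl, h.reg1, h.mem1]
  rw [WeightedGraph.encode_mem_one (N := (2 ^ x) ^ p.p1) (S := (2 ^ x) ^ p.p2) (R := (2 ^ x) ^ 8)
    (BK := (2 ^ x) ^ p.c1) I h.hw ha hb]
  simp only [red]
  split_ifs with h1 <;> simp [h1]

theorem ev_eLink (h : p.Env I L w x s) {u u' : Ex}
    (hi : (p.red I x).inst (u.ev s) = (p.red I x).inst (u'.ev s)) :
    (p.eLink u u').ev s ≠ 0 ↔ (p.red I x).link (s.reg 6) (u.ev s) (u'.ev s) := by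
  have e1 : ∀ a b : Ex, (o .lt a b).ev s ≠ 0 ↔ a.ev s < b.ev s := fun a b => by simp [ev, idl]
  have e2 : ∀ a b : Ex, (o .eq a b).ev s ≠ 0 ↔ a.ev s = b.ev s := fun a b => by simp [ev, idl]
  have e3 : ∀ a b : Ex, (o .mul a b).ev s ≠ 0 ↔ a.ev s ≠ 0 ∧ b.ev s ≠ 0 := fun a b => by
    simp [ev, idl]
  rw [eLink, e3, e3, e3, e3, e1, e1, e1, e2, ev_ePart h, ev_ePart h, ev_eOrig h, ev_eOrig h]
  simp only [Red.link]
  have h1 : (v 1).ev s = V := h.reg1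
  rw [h1, show (p.red I x).V = V from rfl]
  -- The factors that read the matrices are meaningful only for two original vertices below `V`; in
  -- the other cases both sides fail because of the range test.
  by_cases ha : (p.red I x).orig (u.ev s) < V
  · by_cases hb : (p.red I x).orig (u'.ev s) < V
    · have ha' : (p.eOrig u).ev s < V := by rwa [ev_eOrig h]
      have hb' : (p.eOrig u').ev s < V := by rwa [ev_eOrig h]
      rw [ev_adj h ha' hb', ev_eDig h, ev_eInst h, ev_eTri h,
        show ∀ a b : Ex, (o .mod a b).ev s = a.ev s % b.ev s from fun _ _ => rfl,
        show ∀ a b : Ex, (o .add a b).ev s = a.ev s + b.ev s from fun _ _ => rfl,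
        ev_eBkt h ha' hb', ev_eDig h, ev_zp' h, ev_eInst h,
        show ∀ a b : Ex, (o .add a b).ev s = a.ev s + b.ev s from fun _ _ => rfl, ev_eTri h,
        ev_eOrig h, ev_eOrig h, show (n 1).ev s = 1 from rfl,
        show (p.red I x).R = (2 ^ x) ^ 8 from rfl]
      tauto
    · tauto
  · tauto

theorem ev_eU (h : p.Env I L w x s) : p.eU.ev s = (p.red I x).U := by
  simp only [eU, ev, idl, ev_zp' h, Red.U, Red.num, Red.E]
  rw [show (p.red I x).S = (2 ^ x) ^ p.p2 from rfl, show (p.red I x).N = (2 ^ x) ^ p.p1 from rfl,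
    show (p.red I x).R = (2 ^ x) ^ 8 from rfl, show (p.red I x).k = p.k from rfl]
  ring

section ok

variable (h : p.Env I L w x s)
include h

theorem ok_eKN : p.eKN.ok L s := ⟨h.hk, ok_zp h.ok2 _, trivial⟩

theorem ok_eInst {u : Ex} (hu : u.ok L s) : (p.eInst u).ok L s := ⟨hu, ok_eKN h, trivial⟩

theorem ok_ePart {u : Ex} (hu : u.ok L s) : (p.ePart u).ok L s :=
  ⟨⟨hu, ok_zp h.ok2 _, trivial⟩, h.hk, trivial⟩

theorem ok_eOrig {u : Ex} (hu : u.ok L s) : (p.eOrig u).ok L s := by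
  have := h.hc; have := h.hk; have := h.hE; have := h.hp
  exact ⟨⟨⟨⟨ok_eInst h hu, ⟨⟨by simp only [ok]; omega, h.ok3, trivial⟩, ok_ePart h hu, trivial⟩,
    trivial⟩, ok_zp h.ok2 _, trivial⟩, ok_zp h.ok2 _, trivial⟩, ⟨hu, ok_zp h.ok2 _, trivial⟩, trivial⟩

theorem ok_eTri {u u' : Ex} (hu : u.ok L s) (hu' : u'.ok L s) : (p.eTri u u').ok L s := by
  have := h.hc; have := h.hk; have := h.hE; have := h.hp
  refine ⟨⟨⟨⟨ok_ePart h hu', ok_ePart h hu', trivial⟩, ok_ePart h hu', ?_⟩,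
    by simp only [ok]; omega, trivial⟩, ok_ePart h hu, trivial⟩
  simp only [side, ev, idl]
  exact Nat.le_mul_self _

theorem ok_eDig {u u' : Ex} (hu : u.ok L s) (hu' : u'.ok L s) : (p.eDig u u').ok L s := by
  have := h.hc; have := h.hk; have := h.hE; have := h.hp
  exact ⟨⟨⟨ok_zp h.ok2 _, ⟨hu, ok_zp h.ok2 _, trivial⟩, trivial⟩,
    ⟨⟨by simp only [ok]; omega, h.ok3, trivial⟩, hu', trivial⟩, trivial⟩, ok_zp h.ok2 _, trivial⟩

theorem ok_eIdx {u u' : Ex} (hu : u.ok L s) (hu' : u'.ok L s) : (eIdx u u').ok L s :=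
  ⟨⟨hu, h.ok1, trivial⟩, hu', trivial⟩

theorem zp_pos (m : ℕ) : 0 < (zp m).ev s := by rw [ev_zp' h]; positivity

theorem ok_eWt {u u' : Ex} (hu : u.ok L s) (hu' : u'.ok L s) : (p.eWt u u').ok L s :=
  ⟨ok_eIdx h hu hu', ok_zp h.ok2 _, zp_pos h _⟩

theorem ok_adj {u u' : Ex} (hu : u.ok L s) (hu' : u'.ok L s) : (ld 1 (eIdx u u')).ok L s :=
  ⟨ok_eIdx h hu hu', h.mem1_le _⟩

theorem ok_eBkt {u u' : Ex} (h6 : s.reg 6 ≤ 2 ^ L) (hu : u.ok L s) (hu' : u'.ok L s) :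
    (p.eBkt u u').ok L s :=
  ⟨⟨⟨h6, ok_eWt h hu hu', trivial⟩, ok_zp h.ok2 _, trivial⟩, ok_zp h.ok2 _, trivial⟩

theorem ok_eLink {u u' : Ex} (h6 : s.reg 6 ≤ 2 ^ L) (hu : u.ok L s) (hu' : u'.ok L s) :
    (p.eLink u u').ok L s := by
  have := h.hc; have := h.hk; have := h.hE; have := h.hp
  have h1 := ok_eOrig h hu
  have h2 := ok_eOrig h hu'
  exact ⟨⟨⟨ok_ePart h hu, ok_ePart h hu', trivial⟩, ⟨⟨h1, h.ok1, trivial⟩, ⟨h2, h.ok1, trivial⟩,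
    trivial⟩, trivial⟩, ⟨ok_adj h h1 h2, ⟨⟨⟨ok_eDig h (ok_eInst h hu) ⟨ok_eTri h hu hu',
    by simp only [ok]; omega, trivial⟩, ok_eBkt h h6 h1 h2, trivial⟩, ok_zp h.ok2 _, trivial⟩,
    ok_eDig h (ok_eInst h hu) (ok_eTri h hu hu'), trivial⟩, trivial⟩, trivial⟩

theorem ok_eU : p.eU.ok L s :=
  ⟨h.hE, ok_zp h.ok2 _, trivial⟩

end ok

/-- The first vertex of the pair in register `7`. -/
def eFst (p : Pm) : Ex := o .div (v 7) p.eKN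

/-- The second vertex of the pair in register `7`. -/
def eSnd (p : Pm) : Ex :=
  o .add (o .mul (o .div p.eFst p.eKN) p.eKN) (o .mod (v 7) p.eKN)

theorem wf_eLink : (p.eLink p.eFst p.eSnd).wf 61 = true := by
  simp [eLink, eFst, eSnd, eOrig, ePart, eInst, eDig, eTri, eBkt, eWt, eIdx, eKN, wf, wf_zp]

theorem wf_eOrig {u : Ex} {d : ℕ} (hd : d < 90) (hu : ∀ d < 95, u.wf d = true) :
    (p.eOrig u).wf d = true := by
  simp only [eOrig, ePart, eInst, eKN, wf, wf_zp, hu d (by omega), hu (d + 1) (by omega),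
    hu (d + 1 + 1) (by omega), Bool.and_eq_true, decide_eq_true_eq, true_and]
  omega

/-! ## The program of the reduction: checking a tuple -/

variable (p) in
/-- The tuple of vertices forms a clique. -/
def eAdj (t : ℕ → Ex) : Ex :=
  o .mul (prodL ((List.range p.k).map fun i => o .lt (t i) (v 1)))
    (prodL ((List.range p.k).map fun j => prodL ((List.range j).map fun i => ld 1 (eIdx (t i) (t j)))))

variable (p) in
/-- The sum of the weights of the tuple. -/
def eSum (t : ℕ → Ex) : Ex :=
  sumL ((List.range p.k).map fun j => sumL ((List.range j).map fun i => p.eWt (t i) (t j)))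

variable (p) in
/-- The tuple is a zero clique. -/
def eZero (t : ℕ → Ex) : Ex := o .mul (p.eAdj t) (o .eq (o .mod (p.eSum t) (zp (8 + p.c1))) (n 0))

variable (p) in
/-- Set the flag if the tuple is a zero clique. -/
def check (t : ℕ → Ex) : HL := .cond (p.eZero t) (.asg 0 (.n 1)) .nop

theorem ev_prodL_ne_zero {l : List Ex} : (prodL l).ev s ≠ 0 ↔ ∀ e ∈ l, e.ev s ≠ 0 := by
  rw [ev_prodL]
  simp [List.prod_eq_zero_iff]

theorem ev_eAdj (h : p.Env I L w x s) (t : ℕ → Ex) :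
    (p.eAdj t).ev s ≠ 0 ↔ (p.red I x).AdjT fun i => (t i).ev s := by
  have e3 : ∀ a b : Ex, (o .mul a b).ev s ≠ 0 ↔ a.ev s ≠ 0 ∧ b.ev s ≠ 0 := fun a b => by
    simp [ev, idl]
  rw [eAdj, e3, ev_prodL_ne_zero, ev_prodL_ne_zero, Red.AdjT]
  have h1 : (∀ e ∈ (List.range p.k).map fun i => o .lt (t i) (v 1), e.ev s ≠ 0) ↔
      ∀ i < p.k, (t i).ev s < V := by
    simp only [List.mem_map, List.mem_range, forall_exists_index, and_imp,
      forall_apply_eq_imp_iff₂]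
    refine forall₂_congr fun i _ => ?_
    simp [ev, idl, h.reg1]
  rw [h1]
  have h2 : (∀ i < p.k, (t i).ev s < V) ↔ ∀ i : Fin (p.red I x).k, (t i).ev s < (p.red I x).V :=
    ⟨fun H i => H i i.2, fun H i hi => H ⟨i, hi⟩⟩
  rw [h2]
  refine and_congr_right fun hlt => ?_
  have hlt' := h2.2 hlt
  simp only [List.mem_map, List.mem_range, forall_exists_index, and_imp,
    forall_apply_eq_imp_iff₂, ev_prodL_ne_zero]
  constructor
  · intro H i j hij
    exact (ev_adj h (hlt i) (hlt j)).1 (H j j.2 i hij)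
  · intro H j hj i hi
    exact (ev_adj h (hlt' i (hi.trans hj)) (hlt' j hj)).2 (H ⟨i, hi.trans hj⟩ ⟨j, hj⟩ hi)

theorem ev_eSum (h : p.Env I L w x s) (t : ℕ → Ex) (ht : ∀ i < p.k, (t i).ev s < V) :
    (p.eSum t).ev s = (p.red I x).wsum fun i => (t i).ev s := by
  rw [eSum, ev_sumL, List.map_map]
  have h1 : ∀ j ∈ List.range p.k, (Ex.ev s ∘ fun j => sumL ((List.range j).map fun i =>
      p.eWt (t i) (t j))) j = ∑ i ∈ Finset.range j, (p.red I x).wt ((t i).ev s) ((t j).ev s) := by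
    intro j hj
    rw [List.mem_range] at hj
    simp only [Function.comp, ev_sumL, List.map_map]
    rw [Finset.sum_range]
    rw [← List.sum_ofFn, List.ofFn_eq_map, ← List.map_coe_finRange_eq_range, List.map_map]
    congr 1
    refine List.map_congr_left fun i _ => ?_
    exact ev_eWt h (ht i (i.2.trans hj)) (ht j hj)
  rw [List.map_congr_left h1, ← List.map_coe_finRange_eq_range, List.map_map, ← List.ofFn_eq_map,
    List.sum_ofFn]
  have h2 : (p.red I x).wsum (fun i => (t i).ev s) = ∑ j : Fin p.k, ∑ i : Fin p.k,
      if i < j then (p.red I x).wt ((t i).ev s) ((t j).ev s) else 0 := by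
    rw [Red.wsum, Red.pairs, Finset.sum_filter, Finset.sum_comm]
    exact Fintype.sum_prod_type _
  rw [h2]
  refine Finset.sum_congr rfl fun j _ => ?_
  simp only [Function.comp, Fin.lt_def]
  rw [Fin.sum_univ_eq_sum_range (fun i => if i < (j : ℕ) then
    (p.red I x).wt ((t i).ev s) ((t j).ev s) else 0) p.k]
  rw [← Finset.sum_filter]
  refine Finset.sum_congr ?_ fun _ _ => rfl
  ext i
  simp only [Finset.mem_range, Finset.mem_filter]
  omega

theorem ev_eZero (h : p.Env I L w x s) (t : ℕ → Ex) :
    (p.eZero t).ev s ≠ 0 ↔ (p.red I x).AdjT (fun i => (t i).ev s) ∧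
      (p.red I x).wsum (fun i => (t i).ev s) % ((p.red I x).R * (p.red I x).BK) = 0 := by
  have e3 : ∀ a b : Ex, (o .mul a b).ev s ≠ 0 ↔ a.ev s ≠ 0 ∧ b.ev s ≠ 0 := fun a b => by
    simp [ev, idl]
  have e2 : ∀ a b : Ex, (o .eq a b).ev s ≠ 0 ↔ a.ev s = b.ev s := fun a b => by simp [ev, idl]
  rw [eZero, e3, ev_eAdj h, e2]
  refine and_congr_right fun hA => ?_
  rw [show ∀ a b : Ex, (o .mod a b).ev s = a.ev s % b.ev s from fun _ _ => rfl,
    ev_eSum h t fun i hi => hA.1 ⟨i, hi⟩, ev_zp' h, pow_add]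
  rfl

theorem ok_eZero (h : p.Env I L w x s) {t : ℕ → Ex} (ht : ∀ i, (t i).ok L s) :
    (p.eZero t).ok L s := by
  refine ⟨⟨ok_prodL ?_, ok_prodL ?_, trivial⟩, ⟨⟨ok_sumL ?_, ok_zp h.ok2 _, trivial⟩,
    Nat.zero_le _, trivial⟩, trivial⟩
  · simp only [List.mem_map, forall_exists_index, and_imp, forall_apply_eq_imp_iff₂]
    exact fun i _ => ⟨ht i, h.ok1, trivial⟩
  · simp only [List.mem_map, forall_exists_index, and_imp, forall_apply_eq_imp_iff₂]
    refine fun j _ => ok_prodL ?_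
    simp only [List.mem_map, forall_exists_index, and_imp, forall_apply_eq_imp_iff₂]
    exact fun i _ => ok_adj h (ht i) (ht j)
  · simp only [List.mem_map, forall_exists_index, and_imp, forall_apply_eq_imp_iff₂]
    refine fun j _ => ok_sumL ?_
    simp only [List.mem_map, forall_exists_index, and_imp, forall_apply_eq_imp_iff₂]
    exact fun i _ => ok_eWt h (ht i) (ht j)

theorem wf_eZero {t : ℕ → Ex} (ht : ∀ i, ∀ d < 75, (t i).wf d = true) :
    (p.eZero t).wf 61 = true := by
  have h1 : (prodL ((List.range p.k).map fun i => o .lt (t i) (v 1))).wf 61 = true := by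
    refine wf_prodL (by norm_num) ?_
    simp only [List.mem_map, forall_exists_index, and_imp, forall_apply_eq_imp_iff₂]
    intro i _
    simp [wf, ht]
  have h2 : (prodL ((List.range p.k).map fun j => prodL ((List.range j).map fun i =>
      ld 1 (eIdx (t i) (t j))))).wf 62 = true := by
    refine wf_prodL (by norm_num) ?_
    simp only [List.mem_map, forall_exists_index, and_imp, forall_apply_eq_imp_iff₂]
    intro j _
    refine wf_prodL (by norm_num) ?_
    simp only [List.mem_map, forall_exists_index, and_imp, forall_apply_eq_imp_iff₂]
    intro i _
    simp [wf, eIdx, ht]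
  have h3 : (p.eSum t).wf 62 = true := by
    refine wf_sumL (by norm_num) ?_
    simp only [List.mem_map, forall_exists_index, and_imp, forall_apply_eq_imp_iff₂]
    intro j _
    refine wf_sumL (by norm_num) ?_
    simp only [List.mem_map, forall_exists_index, and_imp, forall_apply_eq_imp_iff₂]
    intro i _
    simp [wf, eIdx, eWt, ht, wf_zp]
  simp [eZero, eAdj, wf, h1, h2, h3, wf_zp]

theorem wf_check {t : ℕ → Ex} (ht : ∀ i, ∀ d < 75, (t i).wf d = true) : (p.check t).wf = true := by
  simp [check, HL.wf, wf_eZero ht, wf]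

/-- The flag is set only for a verified zero clique. This makes the error one-sided: no output of
the listing program can cause a wrong positive answer. -/
theorem check_spec (h : p.Env I L w x s) {t : ℕ → Ex} (ht : ∀ i, ∀ d < 75, (t i).wf d = true)
    (hok : ∀ i, (t i).ok L s) (hw : L * (p.check t).size < w) :
    ∃ s', D w (p.check t).comp s (p.check t).cost s' ∧ (s' = s ∨ s' = s.setReg 0 1) ∧
      (s' ≠ s → ∃ t, (p.red I x).AdjT t ∧
        (p.red I x).wsum t % ((p.red I x).R * (p.red I x).BK) = 0) ∧
      ((p.red I x).AdjT (fun i => (t i).ev s) → (p.red I x).wsum (fun i => (t i).ev s) %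
        ((p.red I x).R * (p.red I x).BK) = 0 → s' = s.setReg 0 1) := by
  refine ⟨_, HL.D_comp h.hL (p.check t) s (wf_check ht) ⟨ok_eZero h hok, fun _ =>
    Nat.one_le_two_pow, fun _ => trivial⟩ hw, ?_, ?_, ?_⟩
  · simp only [check, HL.eff]
    split_ifs
    · exact Or.inr rfl
    · exact Or.inl rfl
  · intro hne
    refine ⟨_, (ev_eZero h t).1 fun h0 => hne ?_⟩
    simp only [check, HL.eff, h0]
    rfl
  · intro h1 h2
    simp only [check, HL.eff]
    rw [if_pos ((ev_eZero h t).2 ⟨h1, h2⟩)]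
    rfl

end Pm

end WordRAM

namespace WordRAM

namespace Ex

/-- The expression reads no array. -/
def nold : Ex → Bool
  | v _ => true
  | n _ => true
  | o _ e f => e.nold && f.nold
  | ld _ _ => false
  | rm _ e => e.nold
  | ldm _ _ _ => false

theorem nold_zp (m : ℕ) : (zp m).nold = true := by
  induction m with
  | zero => rfl
  | succ m ih => simp [zp, nold, ih]

theorem ev_of_nold {s s' : State} (h : s'.reg = s.reg) {e : Ex} (he : e.nold = true) :
    e.ev s' = e.ev s := by
  induction e with
  | v x => simp [ev, h]
  | n c => rfl
  | o op e f ihe ihf =>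
    simp only [nold, Bool.and_eq_true] at he
    simp only [ev, ihe he.1, ihf he.2]
  | ld a e => simp [nold] at he
  | rm x e ihe => simp only [ev, ihe he, h]
  | ldm a e f => simp [nold] at he

theorem ok_of_nold {L : ℕ} {s s' : State} (h : s'.reg = s.reg) {e : Ex} (he : e.nold = true) :
    e.ok L s' ↔ e.ok L s := by
  induction e with
  | v x => simp [ok, h]
  | n c => rfl
  | o op e f ihe ihf =>
    simp only [nold, Bool.and_eq_true] at he
    simp only [ok, ihe he.1, ihf he.2, ev_of_nold h he.1, ev_of_nold h he.2]
  | ld a e => simp [nold] at he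
  | rm x e ihe =>
    have he' : e.nold = true := he
    simp only [ok, ihe he', ev_of_nold h he']
  | ldm a e f => simp [nold] at he

end Ex

namespace Pm

open Ex

/-! ## The program of the reduction: writing the graph -/

/-- Append an edge to the list in array `10`. -/
def emit (u w : Ex) : HL :=
  .sq (.st 10 (o .add (v 11) (o .add (o .mul (n 2) (v 9)) (n 2))) (o .mod u (v 10)))
    (.sq (.st 10 (o .add (v 11) (o .add (o .mul (n 2) (v 9)) (n 3))) (o .mod w (v 10)))
      (.asg 9 (o .add (v 9) (n 1))))

/-- Array `10` from `b` on holds a number of vertices and a list of edges. -/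
def Lst (W b nn : ℕ) (l : List (ℕ × ℕ)) (s : State) : Prop :=
  s.reg 9 = l.length ∧ ∀ i, s.mem 10 (b + i) =
    if i = 0 then nn % W else if i = 1 then 0 else cells l (i - 2) % W

theorem Lst.congr {W b nn : ℕ} {l : List (ℕ × ℕ)} {s s' : State} (h : Lst W b nn l s)
    (h9 : s'.reg 9 = s.reg 9) (hm : s'.mem = s.mem) : Lst W b nn l s' :=
  ⟨h9.trans h.1, fun i => by rw [hm]; exact h.2 i⟩

theorem wf_emit {u w : Ex} (hu' : u.wf 62 = true) (hw' : w.wf 62 = true) : (emit u w).wf = true := by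
  simp [emit, HL.wf, wf, hu', hw']

/-- The second endpoint is evaluated after the first one has been stored; hence the condition `hwn`
that its expression reads no array. -/
theorem emit_spec {L W b nn : ℕ} {l : List (ℕ × ℕ)} {s : State} {u w : Ex}
    (hwn : w.nold = true) (hu : u.ok L s) (hw : w.ok L s)
    (h9 : s.reg 9 ≤ 2 ^ L) (h10 : s.reg 10 ≤ 2 ^ L) (h11 : s.reg 11 ≤ 2 ^ L) (hc : 100 ≤ 2 ^ L)
    (hW : s.reg 10 = W) (hb : s.reg 11 = b) (hl : Lst W b nn l s) :
    (emit u w).ok L s ∧ Lst W b nn (l ++ [(u.ev s, w.ev s)]) ((emit u w).eff s) := by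
  have h2 : 2 ≤ 2 ^ L := by omega
  have h3 : 3 ≤ 2 ^ L := by omega
  have h1 : 1 ≤ 2 ^ L := by omega
  have hok : ∀ m, w.ok L ⟨s.reg, m⟩ := fun m =>
    (ok_of_nold (s := s) (s' := ⟨s.reg, m⟩) rfl hwn).2 hw
  constructor
  · refine ⟨⟨⟨h11, ⟨⟨h2, h9, trivial⟩, h2, trivial⟩, trivial⟩, hu, h10, trivial⟩,
      ⟨⟨h11, ⟨⟨h2, h9, trivial⟩, h3, trivial⟩, trivial⟩, hok _, h10, trivial⟩,
      h9, h1, trivial⟩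
  · refine ⟨?_, fun i => ?_⟩
    · simp [emit, HL.eff, State.setMem, State.setReg, ev, idl, hl.1]
    · simp only [emit, HL.eff, State.setMem, State.setReg, ev, idl, hW, hb, hl.1,
        Function.update_self, cells_append]
      have hev : ∀ m, w.ev ⟨s.reg, m⟩ = w.ev s := fun m =>
        ev_of_nold (s := s) (s' := ⟨s.reg, m⟩) rfl hwn
      simp only [hev]
      simp only [Function.update_apply, Nat.add_left_cancel_iff]
      by_cases e1 : i = 2 * l.length + 3
      · rw [if_pos e1, if_neg (by omega), if_neg (by omega), if_pos (by omega)]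
      · rw [if_neg e1]
        by_cases e2 : i = 2 * l.length + 2
        · rw [if_pos e2, if_neg (by omega), if_neg (by omega), if_neg (by omega), if_pos (by omega)]
        · rw [if_neg e2, hl.2 i]
          by_cases e3 : i = 0
          · rw [if_pos e3, if_pos e3]
          · by_cases e4 : i = 1
            · rw [if_neg e3, if_pos e4, if_neg e3, if_pos e4]
            · rw [if_neg e3, if_neg e4, if_neg e3, if_neg e4, if_neg (by omega), if_neg (by omega)]

variable (p : Pm)

/-- Register `4` is the number of the round. Halving it makes each size occur in two rounds. -/
def eA : Ex := o .mul (o .div (v 4) (n 2)) (zp p.p1)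

def eB : Ex := o .sub (o .sub (zp p.q) p.eU) p.eA

def inner : HL := .cond (p.eLink p.eFst p.eSnd) (emit p.eFst p.eSnd) .nop

def eFst' : Ex := o .add p.eU (o .div (v 7) p.eB)

def eSnd' : Ex := o .add (o .add p.eU p.eA) (o .mod (v 7) p.eB)

def outer : HL := emit p.eFst' p.eSnd'

theorem wf_inner : p.inner.wf = true := by
  simp only [inner, HL.wf, wf_eLink, Bool.true_and, Bool.and_true]
  apply wf_emit <;> simp [eFst, eSnd, eKN, wf, wf_zp]

theorem wf_outer : p.outer.wf = true := by
  apply wf_emit <;> simp [eFst', eSnd', eU, eA, eB, wf, wf_zp]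

/-- The left part of the complete bipartite graph for register `4`. -/
def nA (x j : ℕ) : ℕ := j / 2 * (2 ^ x) ^ p.p1

variable {p} {V L w x W b nn j : ℕ} {I : WeightedGraph p.k V} {s : State}

theorem ev_eA (h : p.Env I L w x s) (h4 : s.reg 4 = j) : p.eA.ev s = p.nA x j := by
  simp only [eA, ev, idl, ev_zp' h, h4, nA]

theorem ok_eA (h : p.Env I L w x s) (h4 : s.reg 4 ≤ 2 ^ L) : p.eA.ok L s :=
  ⟨⟨h4, by have := h.hc; simp only [ok]; omega, trivial⟩, ok_zp h.ok2 _, trivial⟩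

theorem ev_eB (h : p.Env I L w x s) (h4 : s.reg 4 = j) :
    p.eB.ev s = (2 ^ x) ^ p.q - (p.red I x).U - p.nA x j := by
  simp only [eB, ev, idl, ev_zp' h, ev_eU h, ev_eA h h4]

theorem ok_eB (h : p.Env I L w x s) (h4 : s.reg 4 ≤ 2 ^ L)
    (hn : (p.red I x).U + p.nA x (s.reg 4) ≤ (2 ^ x) ^ p.q) : p.eB.ok L s := by
  refine ⟨⟨ok_zp h.ok2 _, ok_eU h, ?_⟩, ok_eA h h4, ?_⟩
  · simp only [side, ev_zp' h, ev_eU h]; omega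
  · simp only [side, ev_eA h rfl, ev, idl, ev_zp' h, ev_eU h]; omega

theorem nold_eSnd : p.eSnd.nold = true := by simp [eSnd, eFst, eKN, nold, nold_zp]
theorem nold_eSnd' : p.eSnd'.nold = true := by simp [eSnd', eU, eB, eA, nold, nold_zp]

theorem inner_step {z : ℕ} (h : p.Env I L w x s) (h6 : s.reg 6 ≤ 2 ^ L) (h7 : s.reg 7 = z)
    (h7L : z ≤ 2 ^ L) (h10 : s.reg 10 ≤ 2 ^ L) (h11 : s.reg 11 ≤ 2 ^ L)
    (hW : s.reg 10 = W) (hb : s.reg 11 = b) (hk : 0 < p.k)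
    (hl : Lst W b nn ((p.red I x).innerList (s.reg 6) z) s) (hw : L * p.inner.size < w) :
    ∃ s', D w p.inner.comp s p.inner.cost s' ∧
      Lst W b nn ((p.red I x).innerList (s.reg 6) (z + 1)) s' := by
  classical
  have hok7 : (v 7).ok L s := by rw [← h7] at h7L; exact h7L
  have hF : p.eFst.ok L s := ⟨hok7, ok_eKN h, trivial⟩
  have hS : p.eSnd.ok L s :=
    ⟨⟨⟨hF, ok_eKN h, trivial⟩, ok_eKN h, trivial⟩, ⟨hok7, ok_eKN h, trivial⟩, trivial⟩
  have evF : p.eFst.ev s = (p.red I x).fstU z := by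
    simp only [eFst, ev, idl, ev_eKN h, h7]; rfl
  have evS : p.eSnd.ev s = (p.red I x).sndU z := by
    simp only [eSnd, eFst, ev, idl, ev_eKN h, h7]; rfl
  have hkN : 0 < (p.red I x).k * (p.red I x).N := Nat.mul_pos hk (by
    change 0 < (2 ^ x) ^ p.p1; positivity)
  have h9 : s.reg 9 ≤ 2 ^ L := by
    rw [hl.1]; exact ((p.red I x).length_innerList_le _ _).trans h7L
  have hinst : (p.red I x).inst (p.eFst.ev s) = (p.red I x).inst (p.eSnd.ev s) := by
    rw [evF, evS, Red.inst, Red.inst, Red.fstU, Red.sndU, mul_comm (_ / _ / _), Nat.mul_add_div hkN,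
      Nat.div_eq_of_lt (Nat.mod_lt _ hkN), add_zero]
  obtain ⟨e1, e2⟩ := emit_spec (nn := nn) nold_eSnd hF hS h9 h10 h11 h.hc hW hb hl
  have hlink := ev_eLink h hinst
  rw [evF, evS] at hlink e2
  refine ⟨_, HL.D_comp h.hL p.inner s p.wf_inner ⟨ok_eLink h h6 hF hS, fun _ => e1,
    fun _ => trivial⟩ hw, ?_⟩
  rw [Red.innerList_succ]
  simp only [inner, HL.eff]
  by_cases hc : (p.red I x).link (s.reg 6) ((p.red I x).fstU z) ((p.red I x).sndU z)
  · rw [if_pos (hlink.2 hc), if_pos hc]; exact e2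
  · rw [if_neg (fun h0 => hc (hlink.1 h0)), if_neg hc, List.append_nil]; exact hl

theorem outer_step {z : ℕ} (h : p.Env I L w x s) (h4 : s.reg 4 = j) (h4L : j ≤ 2 ^ L)
    (hn : (p.red I x).U + p.nA x j ≤ (2 ^ x) ^ p.q) (h7 : s.reg 7 = z)
    (h7L : z ≤ 2 ^ L) (h10 : s.reg 10 ≤ 2 ^ L) (h11 : s.reg 11 ≤ 2 ^ L)
    (hW : s.reg 10 = W) (hb : s.reg 11 = b) {l : List (ℕ × ℕ)} (h9 : l.length + z ≤ 2 ^ L)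
    (hl : Lst W b nn (l ++ (p.red I x).outerList (p.nA x j)
      ((2 ^ x) ^ p.q - (p.red I x).U - p.nA x j) z) s) (hw : L * p.outer.size < w) :
    ∃ s', D w p.outer.comp s p.outer.cost s' ∧
      Lst W b nn (l ++ (p.red I x).outerList (p.nA x j)
      ((2 ^ x) ^ p.q - (p.red I x).U - p.nA x j) (z + 1)) s' := by
  have h4' : s.reg 4 ≤ 2 ^ L := by rw [h4]; exact h4L
  have hok7 : (v 7).ok L s := by rw [← h7] at h7L; exact h7L
  have hB := ok_eB h h4' (by rw [h4]; exact hn)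
  have hF : p.eFst'.ok L s := ⟨ok_eU h, ⟨hok7, hB, trivial⟩, trivial⟩
  have hS : p.eSnd'.ok L s := ⟨⟨ok_eU h, ok_eA h h4', trivial⟩, ⟨hok7, hB, trivial⟩, trivial⟩
  have h9' : s.reg 9 ≤ 2 ^ L := by
    rw [hl.1, List.length_append, Red.length_outerList]; exact h9
  obtain ⟨e1, e2⟩ := emit_spec (nn := nn) nold_eSnd' hF hS h9' h10 h11 h.hc hW hb hl
  refine ⟨_, HL.D_comp h.hL p.outer s p.wf_outer e1 hw, ?_⟩
  have evF : p.eFst'.ev s = (p.red I x).U + z / ((2 ^ x) ^ p.q - (p.red I x).U - p.nA x j) := by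
    simp only [eFst', ev, idl, ev_eU h, ev_eB h h4, h7]
  have evS : p.eSnd'.ev s =
      (p.red I x).U + p.nA x j + z % ((2 ^ x) ^ p.q - (p.red I x).U - p.nA x j) := by
    simp only [eSnd', ev, idl, ev_eU h, ev_eA h h4, ev_eB h h4, h7]
  rw [evF, evS] at e2
  rw [Red.outerList_succ, ← List.append_assoc]
  exact e2

end Pm

end WordRAM

namespace WordRAM

namespace Pm

open Ex

/-- Registers `100`, …, `100 + B - 1` become zero. -/
def reset : ℕ → HL
  | 0 => .nop
  | B + 1 => .sq (reset B) (.asg (100 + B) (n 0))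

theorem wf_reset (B : ℕ) : (reset B).wf = true := by
  induction B with
  | zero => rfl
  | succ B ih => simp [reset, HL.wf, ih, wf]

theorem nw_reset {y : ℕ} (hy : y < 100) (B : ℕ) : (reset B).nw y = true := by
  induction B with
  | zero => rfl
  | succ B ih =>
    simp only [reset, HL.nw, ih, Bool.true_and, bne_iff_ne]
    omega

theorem na_reset (a B : ℕ) : (reset B).na a = true := by
  induction B with
  | zero => rfl
  | succ B ih => simp [reset, HL.na, ih]

theorem ok_reset (L B : ℕ) (s : State) : (reset B).ok L s := by
  induction B with
  | zero => trivial
  | succ B ih => exact ⟨ih, Nat.zero_le _⟩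

theorem reset_eff (B : ℕ) (s : State) : ((reset B).eff s).mem = s.mem ∧
    (∀ y < B, ((reset B).eff s).reg (100 + y) = 0) ∧
    ∀ y < 100, ((reset B).eff s).reg y = s.reg y := by
  induction B with
  | zero => exact ⟨rfl, fun y hy => by omega, fun _ _ => rfl⟩
  | succ B ih =>
    refine ⟨ih.1, fun y hy => ?_, fun y hy => ?_⟩
    · simp only [reset, HL.eff, State.setReg, Function.update_apply, ev]
      split_ifs with h
      · rfl
      · exact ih.2.1 y (by omega)
    · simp only [reset, HL.eff, State.setReg]
      rw [Function.update_of_ne (by omega), ih.2.2 y hy]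

variable (p : Pm)

/-- Register `6` holds the random multiplier, `8` the number of pairs to enumerate, and `9` the
number of edges written so far. -/
def pre : HL :=
  .sq (.asg 6 (rm 6 (zp (8 + p.c1)))) (.sq (.st 10 (v 11) (o .mod (zp p.q) (v 10)))
    (.sq (.asg 9 (n 0)) (.asg 8 (o .mul p.eU p.eKN))))

def mid : HL := .asg 8 (o .mul p.eA p.eB)

/-- The number of edges, cell 1 of the encoding, is known only at the end. Register `13` is the
clock of the simulation. -/
def post : HL := .sq (.st 10 (o .add (v 11) (n 1)) (o .mod (v 9) (v 10))) (.asg 13 (n 0))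

/-- Write the graph into array `10`, from the address in register `11` on. -/
def build (B : ℕ) : Cmd :=
  .seq p.pre.comp (.seq (reset B).comp (.seq (forL 7 8 p.inner.comp)
    (.seq p.mid.comp (.seq (forL 7 8 p.outer.comp) post.comp))))

/-- The sizes of the words in the computation. -/
structure Num {V : ℕ} (p : Pm) (I : WeightedGraph p.k V) (L w x v : ℕ) : Prop where
  hk : 3 ≤ p.k
  hn : (p.red I x).U + 2 ^ x * (2 ^ x) ^ p.p1 ≤ (2 ^ x) ^ p.q
  hkN : p.k * (2 ^ x) ^ p.p1 ≤ (2 ^ x) ^ p.q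
  hsq : 2 + 4 * ((2 ^ x) ^ p.q * (2 ^ x) ^ p.q) ≤ (2 ^ x) ^ p.cs
  hslot : 2 ^ v ≤ (2 ^ x) ^ p.cs
  htot : 2 * 2 ^ x * (2 ^ x) ^ p.cs ≤ 2 ^ L
  hck : 1 + p.k * (2 ^ x) ^ p.ck ≤ (2 ^ x) ^ p.cs
  hLw : L < w
  hM1 : (2 ^ x) ^ (8 + p.c1) ≤ 2 ^ L

variable {p} {V L w x v B j : ℕ} {I : WeightedGraph p.k V} {s : State}

theorem Num.slot_le (h : p.Num I L w x v) : (2 ^ x) ^ p.cs ≤ 2 ^ L :=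
  le_trans (Nat.le_mul_of_pos_left _ (by positivity)) h.htot

theorem Num.nA_le (_h : p.Num I L w x v) (hj : j < 2 * 2 ^ x) :
    p.nA x j ≤ 2 ^ x * (2 ^ x) ^ p.p1 := Nat.mul_le_mul_right _ (by omega)

theorem Num.U_le (h : p.Num I L w x v) : (p.red I x).U ≤ (2 ^ x) ^ p.q := by
  have := h.hn; omega

theorem wf_pre : p.pre.wf = true := by
  simp [pre, eU, eKN, HL.wf, wf, wf_zp]

theorem wf_mid : p.mid.wf = true := by
  simp [mid, eU, eA, eB, HL.wf, wf, wf_zp]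

theorem build_nwr {y : ℕ} (hy : y < 60) (h6 : y ≠ 6) (h7 : y ≠ 7) (h8 : y ≠ 8) (h9 : y ≠ 9)
    (h13 : y ≠ 13) : (p.build B).nwr y = true := by
  simp only [build, Cmd.nwr, Bool.and_eq_true]
  refine ⟨HL.comp_nwr (.inl hy) _ wf_pre ?_, HL.comp_nwr (.inl hy) _ (wf_reset B)
    (nw_reset (by omega) B), forL_nwr (by norm_num) (by norm_num) (.inl hy) h7
    (HL.comp_nwr (.inl hy) _ p.wf_inner ?_), HL.comp_nwr (.inl hy) _ wf_mid ?_,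
    forL_nwr (by norm_num) (by norm_num) (.inl hy) h7 (HL.comp_nwr (.inl hy) _ p.wf_outer ?_),
    HL.comp_nwr (.inl hy) _ rfl ?_⟩ <;>
  simp [pre, inner, emit, mid, outer, post, HL.nw, h6, h8, h9, h13]

theorem build_nwa {a : ℕ} (ha : a ≠ 10) : (p.build B).nwa a = true := by
  simp only [build, Cmd.nwa, Bool.and_eq_true]
  refine ⟨HL.comp_nwa _ ?_, HL.comp_nwa _ (na_reset a B), forL_nwa (HL.comp_nwa _ ?_),
    HL.comp_nwa _ ?_, forL_nwa (HL.comp_nwa _ ?_), HL.comp_nwa _ ?_⟩ <;>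
  simp [pre, inner, emit, mid, outer, post, HL.na, ha]

variable (p) in
/-- A bound for the sizes of the straight-line parts. -/
def bsz (B : ℕ) : ℕ :=
  p.pre.size + (reset B).size + p.inner.size + p.mid.size + p.outer.size + post.size + 2

variable (p) in
/-- A bound for the time to write the graph. -/
def bcost (B : ℕ) : ℕ :=
  p.pre.cost + (reset B).cost + p.inner.cost + p.mid.cost + p.outer.cost + post.cost + 100

theorem pre_eff (h : p.Env I L w x s) (hN : p.Num I L w x v) (h10 : s.reg 10 = 2 ^ v)
    (h11 : s.reg 11 ≤ 2 ^ L) :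
    p.pre.ok L s ∧ (p.pre.eff s).reg 6 = s.reg 6 % ((p.red I x).R * (p.red I x).BK) ∧
      (p.pre.eff s).reg 8 = (p.red I x).U * ((p.red I x).k * (p.red I x).N) ∧
      (p.pre.eff s).reg 9 = 0 ∧
      (p.pre.eff s).mem = (s.setMem 10 (s.reg 11) ((2 ^ x) ^ p.q % 2 ^ v)).mem := by
  have hE : p.Env I L w x (p.pre.eff s) := h.congr rfl rfl rfl rfl rfl
  have h10L : s.reg 10 ≤ 2 ^ L := by rw [h10]; exact hN.hslot.trans hN.slot_le
  refine ⟨⟨⟨ok_zp h.ok2 _, zp_pos h _⟩, ⟨h11,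
    ok_zp (s := (HL.asg 6 (rm 6 (zp (8 + p.c1)))).eff s) h.ok2 _, h10L, trivial⟩, Nat.zero_le _,
    ?_, ?_, trivial⟩, ?_, ?_, rfl, ?_⟩
  · exact ok_eU (h.congr rfl rfl rfl rfl rfl)
  · exact ok_eKN (h.congr rfl rfl rfl rfl rfl)
  · simp only [pre, HL.eff, State.setReg, State.setMem, ev, ev_zp' h, pow_add]
    rfl
  · have e1 : (o .mul p.eU p.eKN).ev ((s.setReg 6 (s.reg 6 % (2 ^ x) ^ (8 + p.c1))).setMem 10
        (s.reg 11) ((2 ^ x) ^ p.q % 2 ^ v) |>.setReg 9 0) =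
        (p.red I x).U * ((p.red I x).k * (p.red I x).N) := by
      have h' : p.Env I L w x ((s.setReg 6 (s.reg 6 % (2 ^ x) ^ (8 + p.c1))).setMem 10
        (s.reg 11) ((2 ^ x) ^ p.q % 2 ^ v) |>.setReg 9 0) := h.congr rfl rfl rfl rfl rfl
      simp only [ev, idl, ev_eU h', ev_eKN h']
    have e2 : (o .mul p.eU p.eKN).nold = true := by simp [eU, eKN, nold, nold_zp]
    simp only [pre, HL.eff, State.setReg, State.setMem, Function.update_self, ev]
    have h' : ∀ s' : State, s'.reg 1 = s.reg 1 → s'.reg 2 = s.reg 2 → s'.reg 3 = s.reg 3 →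
        s'.mem 1 = s.mem 1 → s'.mem 2 = s.mem 2 → idl .mul (p.eU.ev s') (p.eKN.ev s') =
        (p.red I x).U * ((p.red I x).k * (p.red I x).N) := fun s' g1 g2 g3 g4 g5 => by
      have h' := h.congr g1 g2 g3 g4 g5
      simp only [idl, ev_eU h', ev_eKN h']
    exact h' _ rfl rfl rfl rfl rfl
  · simp only [pre, HL.eff, State.setReg, State.setMem, ev, idl]
    have h' : p.Env I L w x ⟨Function.update s.reg 6 (s.reg 6 % (zp (8 + p.c1)).ev s), s.mem⟩ :=
      h.congr rfl rfl rfl rfl rfl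
    rw [ev_zp' h', ← h10]
    rfl

/-- The cells from `j * Z ^ cs` on are still zero, so writing the list produces the full encoding.
The time is proportional to the number of pairs in instances plus the number of bipartite edges. -/
theorem build_spec (h : p.Env I L w x s) (hN : p.Num I L w x v) (hw : L * p.bsz B < w)
    (h4 : s.reg 4 = j) (hj : j < 2 * 2 ^ x) (h10 : s.reg 10 = 2 ^ v)
    (h11 : s.reg 11 = j * (2 ^ x) ^ p.cs)
    (hmem : ∀ i, j * (2 ^ x) ^ p.cs ≤ i → s.mem 10 i = 0) :
    ∃ s', D w (p.build B) s (p.bcost B * ((p.k + 2 ^ x) * (2 ^ x) ^ p.p1 * (2 ^ x) ^ p.q)) s' ∧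
      s'.reg 6 = s.reg 6 % ((p.red I x).R * (p.red I x).BK) ∧ s'.reg 13 = 0 ∧
      (∀ y < B, s'.reg (100 + y) = 0) ∧
      ∀ i, s'.mem 10 (j * (2 ^ x) ^ p.cs + i) =
        (encodeGraph ((p.red I x).graph (s.reg 6 % ((p.red I x).R * (p.red I x).BK)) (p.nA x j)
          ((2 ^ x) ^ p.q)) v).mem 0 i := by
  set b := j * (2 ^ x) ^ p.cs with hb
  set hh := s.reg 6 % ((p.red I x).R * (p.red I x).BK) with hhh
  set nn := (2 ^ x) ^ p.q with hnn
  set U := (p.red I x).U with hU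
  set a := p.nA x j with ha
  have hkN : 0 < (p.red I x).k * (p.red I x).N := Nat.mul_pos
    (show 0 < p.k by have := hN.hk; omega) (by change 0 < (2 ^ x) ^ p.p1; positivity)
  have hkNn : (p.red I x).k * (p.red I x).N ≤ nn := hN.hkN
  have haN := hN.nA_le hj
  rw [← ha] at haN
  have hUa : U + a ≤ nn := by have := hN.hn; omega
  have hm1 : U * ((p.red I x).k * (p.red I x).N) ≤ nn * nn := Nat.mul_le_mul (by omega) hkNn
  have hm2 : a * (nn - U - a) ≤ nn * nn := Nat.mul_le_mul (by omega) (by omega)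
  have hsq := hN.hsq.trans hN.slot_le
  rw [← hnn] at hsq
  have hbL : b ≤ 2 ^ L := by
    refine le_trans ?_ hN.htot
    exact Nat.mul_le_mul_right _ hj.le
  have hjL : j ≤ 2 ^ L := by
    refine hj.le.trans (le_trans ?_ hN.htot)
    exact Nat.le_mul_of_pos_right _ (by positivity)
  have hvL : 2 ^ v ≤ 2 ^ L := hN.hslot.trans hN.slot_le
  have hLw : ∀ m, m ≤ p.bsz B → L * m < w := fun m hm => (Nat.mul_le_mul_left _ hm).trans_lt hw
  obtain ⟨ok1, e6, e8, e9, em⟩ := pre_eff h hN h10 (by rw [h11]; exact hbL)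
  have D1 := HL.D_comp (w := w) h.hL p.pre s wf_pre ok1 (hLw _ (by unfold bsz; omega))
  set s1 := p.pre.eff s
  have D2 := HL.D_comp (w := w) h.hL (reset B) s1 (wf_reset B) (ok_reset L B s1)
    (hLw _ (by unfold bsz; omega))
  obtain ⟨f1, f2, f3⟩ := reset_eff B s1
  set s2 := (reset B).eff s1
  have r1 : ∀ y < 60, y ≠ 6 → y ≠ 8 → y ≠ 9 → s2.reg y = s.reg y := fun y hy h6 h8 h9 => by
    rw [f3 y (by omega), D1.fr.1 y (HL.comp_nwr (.inl hy) _ wf_pre (by simp [pre, HL.nw, *]))]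
  have E2 : p.Env I L w x s2 := h.congr (r1 1 (by norm_num) (by norm_num) (by norm_num) (by norm_num))
    (r1 2 (by norm_num) (by norm_num) (by norm_num) (by norm_num))
    (r1 3 (by norm_num) (by norm_num) (by norm_num) (by norm_num)) (by rw [f1, em]; rfl)
    (by rw [f1, em]; rfl)
  have h26 : s2.reg 6 = hh := by rw [f3 6 (by norm_num), e6]
  have hM : hh ≤ 2 ^ L := by
    refine le_trans (Nat.mod_lt _ ?_).le (le_trans (le_of_eq ?_) hN.hM1)
    · change 0 < (2 ^ x) ^ 8 * (2 ^ x) ^ p.c1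
      positivity
    · rw [pow_add]; rfl
  have L2 : Lst (2 ^ v) b nn ((p.red I x).innerList hh 0) s2 := by
    refine ⟨by rw [f3 9 (by norm_num), e9]; rfl, fun i => ?_⟩
    rw [f1, em]
    simp only [State.setMem, Function.update_self, h11]
    rw [show (p.red I x).innerList hh 0 = [] from rfl]
    by_cases hi : i = 0
    · rw [if_pos hi, hi, Nat.add_zero, Function.update_self]
    · rw [if_neg hi, Function.update_of_ne (by omega), hmem _ (by omega), cells_nil, Nat.zero_mod,
        ite_self]
  have nin : ∀ y, y < 60 ∨ 100 ≤ y → y ≠ 9 → p.inner.comp.nwr y = true := fun y hy h9 =>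
    HL.comp_nwr hy _ p.wf_inner (by simp [inner, emit, HL.nw, h9])
  have nout : ∀ y, y < 60 ∨ 100 ≤ y → y ≠ 9 → p.outer.comp.nwr y = true := fun y hy h9 =>
    HL.comp_nwr hy _ p.wf_outer (by simp [outer, emit, HL.nw, h9])
  obtain ⟨s3, D3, g7, g3⟩ := D.forL (w := w) h.hL (x := 7) (y := 8) (body := p.inner.comp)
    (m := U * ((p.red I x).k * (p.red I x).N)) (Tb := p.inner.cost)
    (Inv := fun z s => Lst (2 ^ v) b nn ((p.red I x).innerList hh z) s) (s0 := s2)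
    (hLw 2 (by unfold bsz; omega)) (by norm_num) (by norm_num) (by norm_num)
    (nin 7 (.inl (by norm_num)) (by norm_num)) (nin 8 (.inl (by norm_num)) (by norm_num))
    (by rw [f3 8 (by norm_num), e8]) (by omega) (L2.congr rfl rfl) (by
      intro z hz t hFr h7 hl
      have ht : ∀ y, y < 60 ∨ 100 ≤ y → y ≠ 7 → y ≠ 9 → t.reg y = s2.reg y := fun y hy h7 h9 =>
        hFr.1 y (forL_nwr (by norm_num) (by norm_num) hy h7 (nin y hy h9))
      have htm : ∀ a', a' ≠ 10 → t.mem a' = s2.mem a' := fun a' h10 =>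
        hFr.2 a' (forL_nwa (HL.comp_nwa _ (by simp [inner, emit, HL.na, h10])))
      have Et : p.Env I L w x t := E2.congr (ht 1 (.inl (by norm_num)) (by norm_num) (by norm_num))
        (ht 2 (.inl (by norm_num)) (by norm_num) (by norm_num))
        (ht 3 (.inl (by norm_num)) (by norm_num) (by norm_num)) (htm 1 (by norm_num)) (htm 2 (by norm_num))
      have t6 : t.reg 6 = hh := by rw [ht 6 (.inl (by norm_num)) (by norm_num) (by norm_num), h26]
      have t10 : t.reg 10 = 2 ^ v := by
        rw [ht 10 (.inl (by norm_num)) (by norm_num) (by norm_num), r1 10 (by norm_num) (by norm_num)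
          (by norm_num) (by norm_num), h10]
      have t11 : t.reg 11 = b := by
        rw [ht 11 (.inl (by norm_num)) (by norm_num) (by norm_num), r1 11 (by norm_num) (by norm_num)
          (by norm_num) (by norm_num), h11]
      rw [← t6] at hl
      obtain ⟨t', Dt, lt⟩ := inner_step Et (by rw [t6]; exact hM) h7 (by omega) (by rw [t10]; exact hvL)
        (by rw [t11]; exact hbL) t10 t11 (by have := hN.hk; omega) hl (hLw _ (by unfold bsz; omega))
      refine ⟨t', Dt, ?_⟩
      rw [t6] at lt
      exact lt.congr rfl rfl)
  have r3 : ∀ y, y < 60 ∨ 100 ≤ y → y ≠ 7 → y ≠ 9 → s3.reg y = s2.reg y := fun y hy h7 h9 =>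
    D3.fr.1 y (forL_nwr (by norm_num) (by norm_num) hy h7 (nin y hy h9))
  have m3 : ∀ a', a' ≠ 10 → s3.mem a' = s2.mem a' := fun a' h10 =>
    D3.fr.2 a' (forL_nwa (HL.comp_nwa _ (by simp [inner, emit, HL.na, h10])))
  have E3 : p.Env I L w x s3 := E2.congr (r3 1 (.inl (by norm_num)) (by norm_num) (by norm_num))
    (r3 2 (.inl (by norm_num)) (by norm_num) (by norm_num))
    (r3 3 (.inl (by norm_num)) (by norm_num) (by norm_num)) (m3 1 (by norm_num)) (m3 2 (by norm_num))
  have h34 : s3.reg 4 = j := by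
    rw [r3 4 (.inl (by norm_num)) (by norm_num) (by norm_num), r1 4 (by norm_num) (by norm_num)
          (by norm_num) (by norm_num), h4]
  have ok4 : p.mid.ok L s3 := ⟨ok_eA E3 (by rw [h34]; exact hjL), ok_eB E3 (by rw [h34]; exact hjL)
    (by rw [h34]; exact hUa), trivial⟩
  have D4 := HL.D_comp (w := w) h.hL p.mid s3 wf_mid ok4 (hLw _ (by unfold bsz; omega))
  have e4 : p.mid.eff s3 = s3.setReg 8 (a * (nn - U - a)) := by
    simp only [mid, HL.eff, ev, idl, ev_eA E3 h34, ev_eB E3 h34]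
    rfl
  rw [e4] at D4
  set s4 := s3.setReg 8 (a * (nn - U - a)) with hs4
  have r4 : ∀ y, y ≠ 8 → s4.reg y = s3.reg y := fun y hy => by
    simp only [hs4, State.setReg, Function.update_of_ne hy]
  have E4 : p.Env I L w x s4 := E3.congr (r4 1 (by norm_num)) (r4 2 (by norm_num))
    (r4 3 (by norm_num)) rfl rfl
  have L4 : Lst (2 ^ v) b nn ((p.red I x).innerList hh (U * ((p.red I x).k * (p.red I x).N)) ++
      (p.red I x).outerList a (nn - U - a) 0) s4 := by
    rw [show (p.red I x).outerList a (nn - U - a) 0 = [] from rfl, List.append_nil]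
    exact g3.congr (r4 9 (by norm_num)) rfl
  have hlen := (p.red I x).length_innerList_le hh (U * ((p.red I x).k * (p.red I x).N))
  obtain ⟨s5, D5, k7, k5⟩ := D.forL (w := w) h.hL (x := 7) (y := 8) (body := p.outer.comp)
    (m := a * (nn - U - a)) (Tb := p.outer.cost)
    (Inv := fun z s => Lst (2 ^ v) b nn ((p.red I x).innerList hh
      (U * ((p.red I x).k * (p.red I x).N)) ++ (p.red I x).outerList a (nn - U - a) z) s) (s0 := s4)
    (hLw 2 (by unfold bsz; omega)) (by norm_num) (by norm_num) (by norm_num)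
    (nout 7 (.inl (by norm_num)) (by norm_num)) (nout 8 (.inl (by norm_num)) (by norm_num))
    (by simp [hs4, State.setReg]) (by omega) (L4.congr rfl rfl) (by
      intro z hz t hFr h7 hl
      have ht : ∀ y, y < 60 ∨ 100 ≤ y → y ≠ 7 → y ≠ 9 → t.reg y = s4.reg y := fun y hy h7 h9 =>
        hFr.1 y (forL_nwr (by norm_num) (by norm_num) hy h7 (nout y hy h9))
      have htm : ∀ a', a' ≠ 10 → t.mem a' = s4.mem a' := fun a' h10 =>
        hFr.2 a' (forL_nwa (HL.comp_nwa _ (by simp [outer, emit, HL.na, h10])))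
      have Et : p.Env I L w x t := E4.congr (ht 1 (.inl (by norm_num)) (by norm_num) (by norm_num))
        (ht 2 (.inl (by norm_num)) (by norm_num) (by norm_num))
        (ht 3 (.inl (by norm_num)) (by norm_num) (by norm_num)) (htm 1 (by norm_num)) (htm 2 (by norm_num))
      have hc : ∀ y < 60, y ≠ 6 → y ≠ 7 → y ≠ 8 → y ≠ 9 → t.reg y = s.reg y := fun y hy h6 h7 h8 h9 => by
        rw [ht y (.inl hy) h7 h9, r4 y h8, r3 y (.inl hy) h7 h9, r1 y hy h6 h8 h9]
      have t10 : t.reg 10 = 2 ^ v := by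
        rw [hc 10 (by norm_num) (by norm_num) (by norm_num) (by norm_num) (by norm_num), h10]
      have t11 : t.reg 11 = b := by
        rw [hc 11 (by norm_num) (by norm_num) (by norm_num) (by norm_num) (by norm_num), h11]
      have t4 : t.reg 4 = j := by
        rw [hc 4 (by norm_num) (by norm_num) (by norm_num) (by norm_num) (by norm_num), h4]
      obtain ⟨t', Dt, lt⟩ := outer_step Et t4 hjL hUa h7 (by omega) (by rw [t10]; exact hvL)
        (by rw [t11]; exact hbL) t10 t11 (by omega) hl (hLw _ (by unfold bsz; omega))
      exact ⟨t', Dt, lt.congr rfl rfl⟩)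
  have r5 : ∀ y, y < 60 ∨ 100 ≤ y → y ≠ 7 → y ≠ 9 → s5.reg y = s4.reg y := fun y hy h7 h9 =>
    D5.fr.1 y (forL_nwr (by norm_num) (by norm_num) hy h7 (nout y hy h9))
  have c5 : ∀ y < 60, y ≠ 6 → y ≠ 7 → y ≠ 8 → y ≠ 9 → s5.reg y = s.reg y := fun y hy h6 h7 h8 h9 => by
    rw [r5 y (.inl hy) h7 h9, r4 y h8, r3 y (.inl hy) h7 h9, r1 y hy h6 h8 h9]
  have t10 : s5.reg 10 = 2 ^ v := by
    rw [c5 10 (by norm_num) (by norm_num) (by norm_num) (by norm_num) (by norm_num), h10]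
  have t11 : s5.reg 11 = b := by
    rw [c5 11 (by norm_num) (by norm_num) (by norm_num) (by norm_num) (by norm_num), h11]
  have hlen5 : s5.reg 9 ≤ 2 ^ L := by
    rw [k5.1, List.length_append, Red.length_outerList]; omega
  have hc := h.hc
  have ok6 : post.ok L s5 := ⟨⟨⟨by rw [ok, t11]; exact hbL, by simp only [ok]; omega, trivial⟩,
    hlen5, by rw [ok, t10]; exact hvL, trivial⟩, Nat.zero_le _⟩
  have D6 := HL.D_comp (w := w) h.hL post s5 rfl ok6 (hLw _ (by unfold bsz; omega))
  refine ⟨post.eff s5, (D1.seq (D2.seq (D3.seq (D4.seq (D5.seq D6))))).mono ?_, ?_, rfl, ?_, ?_⟩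
  · have hT1 : U * ((p.red I x).k * (p.red I x).N) ≤ (p.k + 2 ^ x) * (2 ^ x) ^ p.p1 * nn := by
      calc _ ≤ nn * (p.k * (2 ^ x) ^ p.p1) := Nat.mul_le_mul (by omega) le_rfl
        _ ≤ nn * ((p.k + 2 ^ x) * (2 ^ x) ^ p.p1) := by gcongr; omega
        _ = _ := mul_comm _ _
    have hT2 : a * (nn - U - a) ≤ (p.k + 2 ^ x) * (2 ^ x) ^ p.p1 * nn := by
      calc _ ≤ (2 ^ x * (2 ^ x) ^ p.p1) * nn := Nat.mul_le_mul haN (by omega)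
        _ ≤ _ := by gcongr; omega
    have hT0 : 1 ≤ (p.k + 2 ^ x) * (2 ^ x) ^ p.p1 * nn := Nat.succ_le_of_lt (by positivity)
    generalize (p.k + 2 ^ x) * (2 ^ x) ^ p.p1 * nn = T at *
    have g1 := Nat.mul_le_mul_right (p.inner.cost + 20) hT1
    have g2 := Nat.mul_le_mul_right (p.outer.cost + 20) hT2
    have g3 := Nat.mul_le_mul_left (p.pre.cost + (reset B).cost + p.mid.cost + post.cost + 60) hT0
    have g4 : p.bcost B * T = T * (p.inner.cost + 20) + T * (p.outer.cost + 20) +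
        (p.pre.cost + (reset B).cost + p.mid.cost + post.cost + 60) * T := by unfold bcost; ring
    omega
  · change s5.reg 6 = hh
    rw [r5 6 (.inl (by norm_num)) (by norm_num) (by norm_num), r4 6 (by norm_num),
      r3 6 (.inl (by norm_num)) (by norm_num) (by norm_num), h26]
  · intro y hy
    simp only [post, HL.eff, State.setReg, State.setMem]
    rw [Function.update_of_ne (by omega), r5 _ (.inr (by omega)) (by omega) (by omega),
      r4 _ (by omega), r3 _ (.inr (by omega)) (by omega) (by omega), f2 y hy]
  · intro i
    rw [encodeGraph_mem_zero, ← List.length_map (f := fun p : Fin nn × Fin nn => ((p.1 : ℕ), (p.2 : ℕ))),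
      Red.edgeList_graph (show 0 < (p.red I x).k by have := hN.hk; change 0 < p.k; omega)
        (by change 0 < (2 ^ x) ^ p.p1; positivity) hUa, ← hU]
    simp only [post, HL.eff, State.setReg, State.setMem, ev, idl, t10, t11, Function.update_self,
      Function.update_apply, Nat.add_left_cancel_iff]
    rw [k5.2 i, k5.1]
    by_cases h1 : i = 1
    · rw [if_pos h1, if_neg (by omega), if_pos h1]
    · rw [if_neg h1]
      split_ifs
      · rfl
      · rfl

end Pm

end WordRAM

namespace WeightedGraph

variable {k V N S R BK : ℕ} {I : WeightedGraph k V}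

/-- Zero cliques may be reordered. -/
theorem zero_comp (hM : tri k * V ^ (100 * k) < R * BK) {t : Fin k → ℕ}
    (ht : (I.red N S R BK).AdjT t) (hz : (I.red N S R BK).wsum t % (R * BK) = 0)
    {σ : Fin k → Fin k} (hσ : Function.Injective σ) : (I.red N S R BK).AdjT (fun i => t (σ i)) ∧
      (I.red N S R BK).wsum (fun i => t (σ i)) % (R * BK) = 0 := by
  obtain ⟨u, hut, hu⟩ := exists_of_adjT ht
  obtain rfl : (fun i => (u i : ℕ)) = t := funext hut
  have hinj : Function.Injective u := fun i j hij => by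
    by_contra hne
    exact (hu i j hne).ne hij
  have hu' : ∀ i j, i ≠ j → I.graph.Adj (u (σ i)) (u (σ j)) := fun i j h => hu _ _ (hσ.ne h)
  refine ⟨⟨fun i => (u (σ i)).2, fun i j hij => ⟨(u _).2, (u _).2, hu' i j hij.ne⟩⟩, ?_⟩
  refine (wsum_mod_eq_zero_iff (u := fun i => u (σ i)) hM hu').2 ?_
  have h1 := (wsum_mod_eq_zero_iff hM hu).1 hz
  rw [← sum_sym2_image I hinj] at h1
  rw [← sum_sym2_image I (u := fun i => u (σ i)) (hinj.comp hσ)]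
  have h2 : Finset.univ.image (fun i => u (σ i)) = Finset.univ.image u := by
    ext y
    simp only [Finset.mem_image, Finset.mem_univ, true_and]
    constructor
    · rintro ⟨i, rfl⟩; exact ⟨_, rfl⟩
    · rintro ⟨i, rfl⟩
      obtain ⟨j, rfl⟩ := Finite.surjective_of_injective hσ i
      exact ⟨j, rfl⟩
  rw [h2]
  exact h1

end WeightedGraph

namespace WordRAM

/-- If the sure outcome already implies `F`, the gain can be moved into the base value. -/
theorem Rnd.one_of {w : ℕ} {c : Cmd} {s : State} {T : ℕ} {I F F' : State → Prop} {q : ℝ≥0∞}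
    (h : Rnd w c s T I F' q) (hF : ∀ s, I s → F s) : Rnd w c s T I F 1 := by
  intro s0 h0 K g T' a d _ hd
  have := h s0 h0 K g T' (a + d) 0 (fun s' s1 h1 h2 => hd s' s1 h1 (hF _ h1) h2)
    (fun s' s1 h1 _ h2 => by rw [add_zero]; exact hd s' s1 h1 (hF _ h1) h2)
  simpa using this

namespace Pm

open Ex

variable (p : Pm)

/-! ## The program of the reduction: checking the output -/

/-- The vertices in the block with the number in register `7`. -/
def eNode (i : ℕ) : Ex :=
  ldm 11 (o .add (o .add (v 11) (n 1)) (o .add (o .mul (v 7) (n p.k)) (n (min i p.k)))) (zp p.q)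

def chk : HL := p.check fun i => p.eOrig (p.eNode i)

/-- The reduction limits the number of inspected blocks even if a failed simulation has left
garbage. -/
def cnt : HL := .asg 8 (ldm 11 (v 11) (zp p.ck))

/-- Check the listed cliques. -/
def tail : Cmd := .seq p.cnt.comp (forL 7 8 p.chk.comp)

variable {p} {V L w x v B j b : ℕ} {I : WeightedGraph p.k V} {s : State}

theorem wf_eNode (i d : ℕ) (hd : d < 95) : (p.eNode i).wf d = true := by
  simp only [eNode, wf, wf_zp, Bool.and_eq_true, decide_eq_true_eq]
  omega

theorem wf_chk : p.chk.wf = true :=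
  wf_check fun i d hd => wf_eOrig (by omega) fun d hd => wf_eNode i d hd

variable (p) in
theorem wf_cnt : p.cnt.wf = true := by simp [cnt, HL.wf, wf, wf_zp]

theorem nw_chk {y : ℕ} (hy : y ≠ 0) : p.chk.nw y = true := by
  simp [chk, check, HL.nw, hy]

theorem na_chk (a : ℕ) : p.chk.na a = true := rfl

variable (x b I) in
/-- The vertices in block `i` of the output are copies of the vertices of a zero clique. -/
def Found (s : State) (i : ℕ) : Prop :=
  (p.red I x).AdjT (fun c : Fin p.k => (p.red I x).orig
    (s.mem 11 (b + 1 + (i * p.k + c)) % (2 ^ x) ^ p.q)) ∧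
  (p.red I x).wsum (fun c : Fin p.k => (p.red I x).orig
    (s.mem 11 (b + 1 + (i * p.k + c)) % (2 ^ x) ^ p.q)) % ((p.red I x).R * (p.red I x).BK) = 0

variable (x I) in
/-- There is a zero clique. -/
def HasZero : Prop := ∃ t, (p.red I x).AdjT t ∧
  (p.red I x).wsum t % ((p.red I x).R * (p.red I x).BK) = 0

theorem tail_spec (h : p.Env I L w x s) (hN : p.Num I L w x v)
    (hw : L * (p.chk.size + p.cnt.size + 2) < w) (h11 : s.reg 11 = b) (hb : b ≤ 2 ^ L) :
    ∃ s', D w p.tail s ((2 ^ x) ^ p.ck * (p.chk.cost + 20) + p.cnt.cost + 21) s' ∧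
      (s'.reg 0 = s.reg 0 ∨ HasZero x I) ∧ (s.reg 0 ≠ 0 → s'.reg 0 ≠ 0) ∧
      ∀ i < s.mem 11 b % (2 ^ x) ^ p.ck, Found x b I s i → s'.reg 0 ≠ 0 := by
  have hLw : ∀ m, m ≤ p.chk.size + p.cnt.size + 2 → L * m < w := fun m hm =>
    (Nat.mul_le_mul_left _ hm).trans_lt hw
  have hck : (2 ^ x) ^ p.ck ≤ 2 ^ L := by
    have h1 := hN.hck.trans hN.slot_le
    have h2 : (2 ^ x) ^ p.ck ≤ p.k * (2 ^ x) ^ p.ck :=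
      Nat.le_mul_of_pos_left _ (by have := hN.hk; omega)
    omega
  set m := s.mem 11 b % (2 ^ x) ^ p.ck with hm
  have hmlt : m < (2 ^ x) ^ p.ck := Nat.mod_lt _ (by positivity)
  have D1 := HL.D_comp (w := w) h.hL p.cnt s p.wf_cnt ⟨by rw [ok, h11]; exact hb, ok_zp h.ok2 _,
    zp_pos h _⟩ (hLw _ (by omega))
  have e1 : p.cnt.eff s = s.setReg 8 m := by
    simp only [cnt, HL.eff, ev, ev_zp' h, h11]; rfl
  rw [e1] at D1
  set s1 := s.setReg 8 m with hs1
  have n1 : ∀ y, y < 60 ∨ 100 ≤ y → y ≠ 0 → p.chk.comp.nwr y = true := fun y hy h0 =>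
    HL.comp_nwr hy _ wf_chk (nw_chk h0)
  obtain ⟨s2, D2, -, g1, g2, g3⟩ := D.forL (w := w) h.hL (x := 7) (y := 8) (body := p.chk.comp)
    (m := m) (Tb := p.chk.cost)
    (Inv := fun z t => (t.reg 0 = s.reg 0 ∨ HasZero x I) ∧ (s.reg 0 ≠ 0 → t.reg 0 ≠ 0) ∧
      ∀ i < z, Found x b I s i → t.reg 0 ≠ 0) (s0 := s1)
    (hLw 2 (by omega)) (by norm_num) (by norm_num) (by norm_num)
    (n1 7 (.inl (by norm_num)) (by norm_num)) (n1 8 (.inl (by norm_num)) (by norm_num))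
    (by simp [hs1, State.setReg]) (by omega)
    ⟨Or.inl rfl, fun h => h, fun i hi => by omega⟩ (by
      intro z hz t hFr h7 hl
      have ht : ∀ y, y < 60 → y ≠ 7 → y ≠ 8 → y ≠ 0 → t.reg y = s.reg y := fun y hy h7 h8 h0 => by
        rw [hFr.1 y (forL_nwr (by norm_num) (by norm_num) (.inl hy) h7 (n1 y (.inl hy) h0))]
        simp [hs1, State.setReg, Function.update_of_ne h8]
      have htm : ∀ a', t.mem a' = s.mem a' := fun a' =>
        hFr.2 a' (forL_nwa (HL.comp_nwa _ (na_chk _)))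
      have Et : p.Env I L w x t := h.congr (ht 1 (by norm_num) (by norm_num) (by norm_num) (by norm_num))
        (ht 2 (by norm_num) (by norm_num) (by norm_num) (by norm_num))
        (ht 3 (by norm_num) (by norm_num) (by norm_num) (by norm_num)) (htm 1) (htm 2)
      have t11 : t.reg 11 = b := by rw [ht 11 (by norm_num) (by norm_num) (by norm_num) (by norm_num), h11]
      have hnode : ∀ i, (p.eNode i).ok L t := fun i => by
        have := Et.hc
        have := Et.hk
        refine ⟨⟨⟨by rw [ok, t11]; exact hb, by simp only [ok]; omega, trivial⟩,
          ⟨⟨by rw [ok, h7]; omega, Et.hk, trivial⟩, ?_, trivial⟩, trivial⟩, ok_zp Et.ok2 _, zp_pos Et _⟩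
        -- The cap in `eNode` bounds the constant for all natural indices; those that matter are
        -- below `k`.
        exact (min_le_right _ _).trans Et.hk
      obtain ⟨t', Dt, q1, q2, q3⟩ := check_spec Et (t := fun i => p.eOrig (p.eNode i))
        (fun i d hd => wf_eOrig (by omega) fun d hd => wf_eNode i d hd)
        (fun i => ok_eOrig Et (hnode i)) (hLw _ (by unfold chk; omega))
      have hev : (fun c : Fin p.k => (p.eOrig (p.eNode c)).ev t) = fun c : Fin p.k =>
          (p.red I x).orig (s.mem 11 (b + 1 + (z * p.k + c)) % (2 ^ x) ^ p.q) := by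
        funext c
        rw [ev_eOrig Et]
        simp only [eNode, ev, idl, t11, h7, htm, ev_zp' Et, min_eq_left c.2.le]
      refine ⟨t', Dt, ?_, ?_, ?_⟩
      · rcases q1 with rfl | rfl
        · exact hl.1
        · by_cases hne : t.setReg 0 1 = t
          · rw [hne]; exact hl.1
          · exact Or.inr (q2 hne)
      · intro h0
        have := hl.2.1 h0
        rcases q1 with rfl | rfl
        · exact this
        · exact one_ne_zero
      · intro i hi hf
        rcases Nat.lt_succ_iff_lt_or_eq.1 hi with hi | rfl
        · have := hl.2.2 i hi hf
          rcases q1 with rfl | rfl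
          · exact this
          · exact one_ne_zero
        · have h3 := q3
          rw [show (fun i : Fin (p.red I x).k => (p.eOrig (p.eNode i)).ev t) = _ from hev] at h3
          rw [h3 hf.1 hf.2]
          exact one_ne_zero)
  refine ⟨s2, (D1.seq D2).mono ?_, g1, g2, g3⟩
  have := Nat.mul_le_mul_right (p.chk.cost + 20) hmlt.le
  omega

theorem tail_nwr {y : ℕ} (hy : y < 60) (h0 : y ≠ 0) (h7 : y ≠ 7) (h8 : y ≠ 8) :
    p.tail.nwr y = true := by
  simp only [tail, Cmd.nwr, Bool.and_eq_true]
  exact ⟨HL.comp_nwr (.inl hy) _ p.wf_cnt (by simp [cnt, HL.nw, h8]), forL_nwr (by norm_num)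
    (by norm_num) (.inl hy) h7 (HL.comp_nwr (.inl hy) _ wf_chk (nw_chk h0))⟩

theorem tail_nwa (a : ℕ) : p.tail.nwa a = true := by
  simp only [tail, Cmd.nwa, Bool.and_eq_true]
  exact ⟨HL.comp_nwa _ rfl, forL_nwa (HL.comp_nwa _ (na_chk _))⟩

/-- A correct list contains a block with the vertices of a given zero clique. -/
theorem found_of_lists {h a CK slot T : ℕ} {t' : State}
    (hM : tri p.k * V ^ (100 * p.k) < (2 ^ x) ^ 8 * (2 ^ x) ^ p.c1) (hD : (p.red I x).Valid)
    (hz : HasZero x I) (hU : (p.red I x).U ≤ (2 ^ x) ^ p.q)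
    (hl : ListsAllCliques p.k ((p.red I x).graph h a ((2 ^ x) ^ p.q)) t')
    (hT : t'.mem 1 0 ≤ T) (hTC : T < CK) (hslot : 1 + p.k * CK ≤ slot)
    (hmem : ∀ i < slot, s.mem 11 (b + i) = t'.mem 1 i) :
    ∃ i < s.mem 11 b % CK, Found x b I s i := by
  obtain ⟨t0, ht0, hz0⟩ := hz
  have hkpos : 0 < p.k := by have : 2 ≤ p.k := hD.hk; omega
  obtain ⟨u, hu, huo⟩ := Red.exists_clique (h := h) hD ht0 (Red.cong_of_wsum hD hz0) (a := a) hU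
  obtain ⟨i, hi, hS⟩ := (hl _).2 ⟨_, hu, rfl⟩
  -- The block has `k` distinct entries, so it lists the vertices of the clique in some order `σ`;
  -- `zero_comp` absorbs the permutation.
  have hcard : ((Finset.range p.k).image fun j => t'.mem 1 (1 + i * p.k + j)).card = p.k := by
    rw [← hS, Finset.card_map]; exact hu.2
  have hinj : Set.InjOn (fun j => t'.mem 1 (1 + i * p.k + j)) (Finset.range p.k) := by
    rw [← Finset.card_image_iff, hcard, Finset.card_range]
  have hex : ∀ c : Fin p.k, ∃ σ : Fin p.k, ((u σ : Fin _) : ℕ) = t'.mem 1 (1 + i * p.k + c) := by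
    intro c
    have : t'.mem 1 (1 + i * p.k + c) ∈ (Finset.univ.image u).map Fin.valEmbedding := by
      rw [hS]; exact Finset.mem_image_of_mem _ (Finset.mem_range.2 c.2)
    obtain ⟨y, hy, hy2⟩ := Finset.mem_map.1 this
    obtain ⟨σ, -, rfl⟩ := Finset.mem_image.1 hy
    exact ⟨σ, hy2⟩
  choose σ hσ using hex
  have hσi : Function.Injective σ := fun c c' hc => by
    refine Fin.ext (hinj (Finset.mem_coe.2 (Finset.mem_range.2 c.2))
      (Finset.mem_coe.2 (Finset.mem_range.2 c'.2)) ?_)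
    simp only
    rw [← hσ, ← hσ, hc]
  have hmem0 : s.mem 11 b = t'.mem 1 0 := by
    have := hmem 0 (by omega)
    simpa using this
  refine ⟨i, ?_, ?_⟩
  -- The count is at most `T < CK`, so its reduction loses no block.
  · rw [hmem0, Nat.mod_eq_of_lt (by omega)]; exact hi
  · have key : (fun c : Fin p.k => (p.red I x).orig
        (s.mem 11 (b + 1 + (i * p.k + c)) % (2 ^ x) ^ p.q)) = fun c => t0 (σ c) := by
      funext c
      have hlt : i * p.k + c < p.k * CK := by
        have h1 : (i + 1) * p.k ≤ CK * p.k := Nat.mul_le_mul_right _ (by omega)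
        rw [Nat.succ_mul, mul_comm CK] at h1
        have := c.2
        omega
      rw [show b + 1 + (i * p.k + c) = b + (1 + i * p.k + c) by ring, hmem _ (by omega), ← hσ c,
        Nat.mod_eq_of_lt (u (σ c)).2]
      exact huo _
    obtain ⟨h1, h2⟩ := WeightedGraph.zero_comp hM ht0 hz0 hσi
    rw [Found, key]
    exact ⟨h1, h2⟩

end Pm

end WordRAM

namespace WordRAM

theorem length_edgeList_le {n : ℕ} (G : SimpleGraph (Fin n)) : (edgeList G).length ≤ n * n := by
  rw [edgeList]
  refine (List.length_filter_le _ _).trans_eq ?_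
  have : (List.finRange n ×ˢ List.finRange n).length =
      (List.finRange n).length * (List.finRange n).length := List.length_product _ _
  rw [this, List.length_finRange]

theorem encodeGraph_mem_eq_zero {n w i : ℕ} (G : SimpleGraph (Fin n)) (hi : 2 + 2 * (n * n) ≤ i) :
    (encodeGraph G w).mem 0 i = 0 := by
  have := length_edgeList_le G
  rw [encodeGraph_mem_zero, if_neg (by omega), if_neg (by omega), cells_eq_zero, Nat.zero_mod]
  rw [List.length_map]
  omega

namespace Pm

open Ex

/-! ## The program of the reduction: one graph -/

variable (p : Pm)

/-- Each round works in a fresh segment of the simulated arrays, so nothing has to be erased between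
rounds. -/
def bas : HL := .asg 11 (o .mul (v 4) (zp p.cs))

/-- Write a graph, run the listing program on it, and check the output. -/
def core (B : ℕ) (P : Cmd) : Cmd := .seq (p.build B) (.seq P.sim p.tail)

/-- The round with the number in register `4`. -/
def iter (B : ℕ) (P : Cmd) : Cmd := .seq p.bas.comp (.seq (.rand 6) (p.core B P))

variable {p} {V L w x v B j b : ℕ} {I : WeightedGraph p.k V} {s : State} {P : Cmd}

/-- The invariant of the rounds. -/
structure JInv (I : WeightedGraph p.k V) (L w x v j : ℕ) (s : State) : Prop where
  env : p.Env I L w x s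
  r10 : s.reg 10 = 2 ^ v
  r14 : s.reg 14 = (2 ^ x) ^ p.ck
  flag : s.reg 0 ≠ 0 → HasZero x I
  mem : ∀ a i, j * (2 ^ x) ^ p.cs ≤ i → s.mem (10 + a) i = 0

/-- What a round achieves surely. -/
def JPost (I : WeightedGraph p.k V) (L w x v j : ℕ) (s s' : State) : Prop :=
  s'.reg 4 = j ∧ s'.reg 5 = s.reg 5 ∧ JInv I L w x v (j + 1) (s'.setReg 4 (j + 1)) ∧
    (s.reg 0 ≠ 0 → s'.reg 0 ≠ 0)

variable (I x v) in
/-- The graph of a round. -/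
noncomputable def graphOf (j h : ℕ) : SimpleGraph (Fin ((2 ^ x) ^ p.q)) :=
  (p.red I x).graph h (p.nA x j) ((2 ^ x) ^ p.q)

variable (p) in
/-- A bound for the sizes of all straight-line parts. -/
def sz (B : ℕ) : ℕ := p.bsz B + p.chk.size + p.cnt.size + p.bas.size + 2

variable (p) in
/-- The time for a graph. -/
def coreT (x B : ℕ) (P : Cmd) : ℕ :=
  p.bcost B * ((p.k + 2 ^ x) * (2 ^ x) ^ p.p1 * (2 ^ x) ^ p.q) +
    (P.lag * (2 ^ x) ^ p.ck + P.lag + ((2 ^ x) ^ p.ck * (p.chk.cost + 20) + p.cnt.cost + 21) + 1) + 1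

/-- With `ps = 0` this says that the invariant survives whatever the listing program does. Otherwise
its correctness on this graph is assumed, and a zero clique is found with its probability of
success. -/
theorem core_spec (hJ : JInv I L w x v j s) (hN : p.Num I L w x v) (hw : L * p.sz B < w)
    (hP : P.bdd B) (hD : (p.red I x).Valid)
    (hM : tri p.k * V ^ (100 * p.k) < (2 ^ x) ^ 8 * (2 ^ x) ^ p.c1)
    (h4 : s.reg 4 = j) (hj : j < 2 * 2 ^ x) (h11 : s.reg 11 = j * (2 ^ x) ^ p.cs) {ps : ℝ≥0∞}
    (hps : ps = 0 ∨ HasZero x I ∧ ∃ T < (2 ^ x) ^ p.ck, SucceedsWithin v P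
      (encodeGraph (graphOf x I j (s.reg 6 % ((p.red I x).R * (p.red I x).BK))) v) T
      (ListsAllCliques p.k (graphOf x I j (s.reg 6 % ((p.red I x).R * (p.red I x).BK)))) ∧
        ps ≤ 2 / 3) :
    Rnd w (p.core B P) s (p.coreT x B P) (JPost I L w x v j s) (fun s' => s'.reg 0 ≠ 0) ps := by
  set b := j * (2 ^ x) ^ p.cs with hb
  set hh := s.reg 6 % ((p.red I x).R * (p.red I x).BK) with hhh
  set G := graphOf x I j hh with hG
  have hLw : ∀ m, m ≤ p.sz B → L * m < w := fun m hm => (Nat.mul_le_mul_left _ hm).trans_lt hw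
  have hbs : b + (2 ^ x) ^ p.cs ≤ 2 ^ L := by
    refine le_trans ?_ hN.htot
    rw [hb, ← Nat.succ_mul]
    exact Nat.mul_le_mul_right _ hj
  have hLw2 : 2 ^ L ≤ 2 ^ w := Nat.pow_le_pow_right (by norm_num) hN.hLw.le
  have hck : (2 ^ x) ^ p.ck < (2 ^ x) ^ p.cs := by
    have h1 := hN.hck
    have h2 : (2 ^ x) ^ p.ck ≤ p.k * (2 ^ x) ^ p.ck :=
      Nat.le_mul_of_pos_left _ (by have := hN.hk; omega)
    omega
  -- For `ps = 0` the goal of the simulation is `False`, so that one argument covers both cases.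
  obtain ⟨gP, T, hT, hle, hgP⟩ : ∃ (gP : State → Prop) (T : ℕ), T ≤ (2 ^ x) ^ p.ck ∧
      ps ≤ Val v gP T ([P], encodeGraph G v) ∧ ∀ t', gP t' → HasZero x I ∧
        ListsAllCliques p.k G t' ∧ ∃ T < (2 ^ x) ^ p.ck, t'.mem 1 0 ≤ T := by
    rcases hps with rfl | ⟨h1, T, h2, h3, h4⟩
    · exact ⟨fun _ => False, 0, Nat.zero_le _, zero_le, fun _ h => h.elim⟩
    · exact ⟨_, T, h2.le, h4.trans (h3.count_le hN.hk), fun t' h => ⟨h1, h.1, T, h2, h.2⟩⟩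
  obtain ⟨s2, D2, e6, e13, e100, emem⟩ := build_spec (B := B) hJ.env hN (hLw _ (by unfold sz; omega))
    h4 hj hJ.r10 h11 (fun i hi => hJ.mem 0 i hi)
  have r2 : ∀ y < 60, y ≠ 6 → y ≠ 7 → y ≠ 8 → y ≠ 9 → y ≠ 13 → s2.reg y = s.reg y :=
    fun y hy h6 h7 h8 h9 h13 => D2.fr.1 y (build_nwr hy h6 h7 h8 h9 h13)
  have m2 : ∀ a, a ≠ 10 → s2.mem a = s.mem a := fun a ha => D2.fr.2 a (build_nwa ha)
  have hSE : SimEnv w v ((2 ^ x) ^ p.cs) b ((2 ^ x) ^ p.ck) s2 :=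
    { hvw := by
        refine (Nat.pow_le_pow_iff_right (le_refl 2)).1 ?_
        exact (hN.hslot.trans (by omega)).trans hLw2
      hw := by have := hN.hLw; omega
      hslot := hN.hslot
      hb := hbs.trans hLw2
      hCK := by omega
      modulus := by
        rw [r2 10 (by norm_num) (by norm_num) (by norm_num) (by norm_num) (by norm_num) (by norm_num),
          hJ.r10]
      base := by
        rw [r2 11 (by norm_num) (by norm_num) (by norm_num) (by norm_num) (by norm_num) (by norm_num),
          h11]
      limit := by
        rw [r2 14 (by norm_num) (by norm_num) (by norm_num) (by norm_num) (by norm_num) (by norm_num),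
          hJ.r14]
      clk_le := by rw [e13]; exact Nat.zero_le _ }
  have hRel : Rel v ((2 ^ x) ^ p.cs) b B (encodeGraph G v) s2 :=
    { reg := fun y hy => e100 y hy
      reg_lt := fun y _ => by change 0 < _; positivity
      mem := fun a i hi => by
        rcases Nat.eq_zero_or_pos a with rfl | ha
        · exact emem i
        · rw [m2 _ (by omega), hJ.mem a _ (Nat.le_add_right _ _)]
          simp [encodeGraph, ha.ne']
      mem_lt := fun a i => by
        simp only [encodeGraph]
        split_ifs
        · exact Nat.mod_lt _ (by positivity)
        · positivity }
  have hsim := Rnd.sim (gP := gP) hP hSE hRel e13 hT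
  have key : ∀ s3, (SFr ((2 ^ x) ^ p.cs) b ((2 ^ x) ^ p.ck) s2 s3 ∧
      ∃ t', Rel v ((2 ^ x) ^ p.cs) b B t' s3) → ∃ s4, D w p.tail s3
        ((2 ^ x) ^ p.ck * (p.chk.cost + 20) + p.cnt.cost + 21) s4 ∧ JPost I L w x v j s s4 ∧
        ((∃ t', Rel v ((2 ^ x) ^ p.cs) b B t' s3 ∧ gP t') → s4.reg 0 ≠ 0) := by
    rintro s3 ⟨hS, -⟩
    have r3 : ∀ y < 60, y ≠ 6 → y ≠ 7 → y ≠ 8 → y ≠ 9 → y ≠ 13 → s3.reg y = s.reg y :=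
      fun y hy h6 h7 h8 h9 h13 => by rw [hS.reg y hy h13, r2 y hy h6 h7 h8 h9 h13]
    have E3 : p.Env I L w x s3 := hJ.env.congr
      (r3 1 (by norm_num) (by norm_num) (by norm_num) (by norm_num) (by norm_num) (by norm_num))
      (r3 2 (by norm_num) (by norm_num) (by norm_num) (by norm_num) (by norm_num) (by norm_num))
      (r3 3 (by norm_num) (by norm_num) (by norm_num) (by norm_num) (by norm_num) (by norm_num))
      (by rw [hS.low 1 (by norm_num), m2 1 (by norm_num)])
      (by rw [hS.low 2 (by norm_num), m2 2 (by norm_num)])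
    have h311 : s3.reg 11 = b := by
      rw [r3 11 (by norm_num) (by norm_num) (by norm_num) (by norm_num) (by norm_num) (by norm_num), h11]
    obtain ⟨s4, D4, q1, q2, q3⟩ := tail_spec E3 hN (hLw _ (by unfold sz; omega)) h311 (by omega)
    have h30 : s3.reg 0 = s.reg 0 :=
      r3 0 (by norm_num) (by norm_num) (by norm_num) (by norm_num) (by norm_num) (by norm_num)
    have r4 : ∀ y < 60, y ≠ 0 → y ≠ 6 → y ≠ 7 → y ≠ 8 → y ≠ 9 → y ≠ 13 → s4.reg y = s.reg y :=
      fun y hy h0 h6 h7 h8 h9 h13 => by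
        rw [D4.fr.1 y (tail_nwr hy h0 h7 h8), r3 y hy h6 h7 h8 h9 h13]
    have m4 : ∀ a, s4.mem a = s3.mem a := fun a => D4.fr.2 a (tail_nwa a)
    have c4 : ∀ y < 60, y ≠ 0 → y ≠ 4 → y ≠ 6 → y ≠ 7 → y ≠ 8 → y ≠ 9 → y ≠ 13 →
        (s4.setReg 4 (j + 1)).reg y = s.reg y := fun y hy h0 h4 h6 h7 h8 h9 h13 => by
      rw [← r4 y hy h0 h6 h7 h8 h9 h13]
      simp [State.setReg, Function.update_of_ne h4]
    refine ⟨s4, D4, ⟨?_, ?_, ⟨?_, ?_, ?_, ?_, ?_⟩, ?_⟩, ?_⟩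
    · rw [r4 4 (by norm_num) (by norm_num) (by norm_num) (by norm_num) (by norm_num) (by norm_num)
        (by norm_num), h4]
    · exact r4 5 (by norm_num) (by norm_num) (by norm_num) (by norm_num) (by norm_num) (by norm_num)
        (by norm_num)
    · refine hJ.env.congr ?_ ?_ ?_ ?_ ?_
      · exact c4 1 (by norm_num) (by norm_num) (by norm_num) (by norm_num) (by norm_num) (by norm_num) (by norm_num) (by norm_num)
      · exact c4 2 (by norm_num) (by norm_num) (by norm_num) (by norm_num) (by norm_num) (by norm_num) (by norm_num) (by norm_num)
      · exact c4 3 (by norm_num) (by norm_num) (by norm_num) (by norm_num) (by norm_num) (by norm_num) (by norm_num) (by norm_num)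
      · change s4.mem 1 = _
        rw [m4, hS.low 1 (by norm_num), m2 1 (by norm_num)]
      · change s4.mem 2 = _
        rw [m4, hS.low 2 (by norm_num), m2 2 (by norm_num)]
    · rw [c4 10 (by norm_num) (by norm_num) (by norm_num) (by norm_num) (by norm_num) (by norm_num) (by norm_num) (by norm_num), hJ.r10]
    · rw [c4 14 (by norm_num) (by norm_num) (by norm_num) (by norm_num) (by norm_num) (by norm_num) (by norm_num) (by norm_num), hJ.r14]
    · intro h0
      have h0' : s4.reg 0 ≠ 0 := h0
      rcases q1 with q1 | q1
      · exact hJ.flag (by rw [← h30, ← q1]; exact h0')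
      · exact q1
    · intro a i hi
      rw [Nat.succ_mul, ← hb] at hi
      change s4.mem (10 + a) i = 0
      rw [m4, hS.mem _ _ (Or.inr hi)]
      rcases Nat.eq_zero_or_pos a with rfl | ha
      · obtain ⟨i', rfl⟩ := Nat.exists_eq_add_of_le (show b ≤ i by omega)
        rw [emem i']
        apply encodeGraph_mem_eq_zero
        have := hN.hsq
        omega
      · rw [m2 _ (by omega)]
        exact hJ.mem a i (by omega)
    · rw [← h30]; exact q2
    · rintro ⟨t', hR, ht'⟩
      obtain ⟨z1, z2, T', z3, z4⟩ := hgP t' ht'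
      obtain ⟨i, hi, hf⟩ := found_of_lists (s := s3) (b := b) hM hD z1 hN.U_le z2 z4 z3 hN.hck
        (fun i hi => hR.mem 1 i hi)
      exact q3 i hi hf
  rw [← mul_one ps]
  refine Rnd.seq_left D2 (Rnd.seq (hsim.mono le_rfl (fun _ h => h) (fun _ _ h => h) hle) ?_ ?_)
  · intro s3 h3
    obtain ⟨s4, D4, h5, -⟩ := key s3 h3
    exact Rnd.of_D D4 h5
  · intro s3 h3 h3'
    obtain ⟨s4, D4, h5, h6⟩ := key s3 h3
    exact Rnd.of_D_one D4 h5 (h6 h3')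

theorem iter_spec (hJ : JInv I L w x v j s) (hN : p.Num I L w x v) (hw : L * p.sz B < w)
    (hP : P.bdd B) (hD : (p.red I x).Valid)
    (hM : tri p.k * V ^ (100 * p.k) < (2 ^ x) ^ 8 * (2 ^ x) ^ p.c1)
    (h4 : s.reg 4 = j) (hj : j < 2 * 2 ^ x) {pr ps : ℝ≥0∞} {Gd : ℕ → Prop} [DecidablePred Gd]
    (hpr : pr * 2 ^ w ≤ ((Finset.range (2 ^ w)).filter fun r =>
      Gd (r % ((p.red I x).R * (p.red I x).BK))).card)
    (hps : ∀ h, Gd h → HasZero x I ∧ ∃ T < (2 ^ x) ^ p.ck, SucceedsWithin v P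
      (encodeGraph (graphOf x I j h) v) T (ListsAllCliques p.k (graphOf x I j h)) ∧ ps ≤ 2 / 3) :
    Rnd w (p.iter B P) s (p.bas.cost + (1 + p.coreT x B P + 1) + 1) (JPost I L w x v j s)
      (fun s' => s'.reg 0 ≠ 0) (pr * ps) := by
  have hjL : j ≤ 2 ^ L := by
    refine hj.le.trans (le_trans ?_ hN.htot)
    exact Nat.le_mul_of_pos_right _ (by positivity)
  have D1 := HL.D_comp (w := w) hJ.env.hL p.bas s (by simp [bas, HL.wf, wf, wf_zp])
    ⟨by rw [ok, h4]; exact hjL, ok_zp hJ.env.ok2 _, trivial⟩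
    ((Nat.mul_le_mul_left _ (by unfold sz; omega)).trans_lt hw)
  have e1 : p.bas.eff s = s.setReg 11 (j * (2 ^ x) ^ p.cs) := by
    simp only [bas, HL.eff, ev, idl, ev_zp' hJ.env, h4]
  rw [e1] at D1
  have hJ' : ∀ r, JInv I L w x v j ((s.setReg 11 (j * (2 ^ x) ^ p.cs)).setReg 6 r) := fun r =>
    ⟨hJ.env.congr rfl rfl rfl rfl rfl, hJ.r10, hJ.r14, hJ.flag, hJ.mem⟩
  refine Rnd.seq_left D1 (Rnd.seq (I' := fun s' => ∃ r, s' = (s.setReg 11 (j * (2 ^ x) ^ p.cs)).setReg 6 r)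
    (F' := fun s' => Gd (s'.reg 6 % ((p.red I x).R * (p.red I x).BK)))
    (Rnd.rand (Finset.filter_subset _ _) (fun r _ => ⟨r, rfl⟩) (fun r hr => ?_) hpr) ?_ ?_)
  · exact (Finset.mem_filter.1 hr).2
  · rintro _ ⟨r, rfl⟩
    exact core_spec (hJ' r) hN hw hP hD hM h4 hj rfl (Or.inl rfl)
  · rintro _ ⟨r, rfl⟩ hF
    exact core_spec (hJ' r) hN hw hP hD hM h4 hj rfl (Or.inr (hps _ hF))

end Pm

end WordRAM

namespace WordRAM

namespace Pm

open Ex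

/-! ## The program of the reduction: sampling and the whole program -/

variable (p : Pm)

/-- A random word exceeds the bound on atoms, so `rm` first reduces it modulo the `k`-th power of `Z
^ (p1 + p2)`; its digits in that base are the sampled vertices. -/
def eSmp (i : ℕ) : Ex :=
  o .mod (o .shr (rm 6 (zp ((p.p1 + p.p2) * p.k)))
    (o .mul (o .mul (n (p.p1 + p.p2)) (v 3)) (n (min i p.k)))) (zp (p.p1 + p.p2))

/-- Check a random tuple. -/
def smp : Cmd := .seq (.rand 6) (p.check p.eSmp).comp

def ini : HL := .sq (.asg 1 (ld 0 (n 0))) (.sq (.asg 2 (n 1)) (.asg 3 (n 0)))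

/-- The loop with this guard stops at the least `x` with `V < Z ^ (p1 + p2)`; minimality later
bounds `Z` in terms of `V`. -/
def small : Ex := o .lt (zp (p.p1 + p.p2)) (o .add (v 1) (n 1))

def dbl : HL := .sq (.asg 2 (o .mul (n 2) (v 2))) (.asg 3 (o .add (v 3) (n 1)))

/-- Register `10` is the modulus of simulated words, `14` the limit of the clock, `16` the number of
samples, and `5` the number of rounds. -/
def cns : HL := .sq (.asg 10 (o .mul (n (2 ^ p.cv)) (zp (p.q * p.cv))))
  (.sq (.asg 14 (zp p.ck)) (.sq (.asg 16 (o .mul (n 2) (zp 6))) (.asg 5 (o .mul (n 2) (v 2)))))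

/-- The program that finds zero cliques with the help of the listing program `P`. -/
def main (B : ℕ) (P : Cmd) : Cmd :=
  .seq ini.comp (.seq (whl p.small dbl.comp) (.seq p.cns.comp
    (.seq (forL 15 16 p.smp) (forL 4 5 (p.iter B P)))))

/-- A bound for the sizes of all expressions. -/
def msz (B : ℕ) : ℕ :=
  p.sz B + (p.check p.eSmp).size + ini.size + p.small.size + dbl.size + p.cns.size

variable {p} {V L w x v B j : ℕ} {I : WeightedGraph p.k V} {s : State} {P : Cmd}

theorem _root_.Red.mem_zeroTuples {D : Red} {Y : ℕ} {t : Fin D.k → ℕ} :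
    t ∈ D.zeroTuples Y ↔ (∀ i, t i < Y) ∧ D.AdjT t ∧ D.wsum t % (D.R * D.BK) = 0 := by
  simp [Red.zeroTuples, Fintype.mem_piFinset]

theorem wf_eSmp (i d : ℕ) (hd : d < 95) : (p.eSmp i).wf d = true := by
  simp only [eSmp, wf, wf_zp, Bool.and_eq_true, decide_eq_true_eq]
  omega

theorem ev_eSmp (h : p.Env I L w x s) {i : ℕ} (hi : i < p.k) : (p.eSmp i).ev s =
    s.reg 6 / ((2 ^ x) ^ (p.p1 + p.p2)) ^ i % (2 ^ x) ^ (p.p1 + p.p2) := by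
  simp only [eSmp, ev, idl, ev_zp' h, h.reg3, min_eq_left hi.le]
  set Y := (2 ^ x) ^ (p.p1 + p.p2) with hY
  have h1 : (2 ^ x) ^ ((p.p1 + p.p2) * p.k) = Y ^ i * Y ^ (p.k - i) := by
    rw [← pow_add, hY, Nat.add_sub_cancel' hi.le, ← pow_mul, ← pow_mul, ← pow_mul]
  have h2 : 2 ^ ((p.p1 + p.p2) * x * i) = Y ^ i := by
    rw [hY, ← pow_mul, ← pow_mul, mul_comm (p.p1 + p.p2) x, mul_assoc]
  rw [h1, h2, Nat.mod_mul_right_div_self, Nat.mod_mod_of_dvd _ (dvd_pow_self _ (by omega))]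

/-- A round of sampling. -/
theorem smp_spec (hJ : JInv I L w x v 0 s) (hw : L * p.msz B < w) {c : ℕ} (hc : 0 < c)
    {q : ℝ≥0∞} (hq : q = 0 ∨ q = (c : ℝ≥0∞)⁻¹ ∧
      ((2 ^ x) ^ (p.p1 + p.p2)) ^ p.k ∣ 2 ^ w ∧ ((2 ^ x) ^ (p.p1 + p.p2)) ^ p.k ≤
        ((p.red I x).zeroTuples ((2 ^ x) ^ (p.p1 + p.p2))).card * c) :
    Rnd w p.smp s (1 + (p.check p.eSmp).cost + 1) (fun s' => JInv I L w x v 0 s' ∧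
      (∀ y < 60, y ≠ 0 → y ≠ 6 → s'.reg y = s.reg y) ∧ (s.reg 0 ≠ 0 → s'.reg 0 ≠ 0))
      (fun s' => s'.reg 0 ≠ 0) q := by
  classical
  obtain ⟨Z, hZ, hmem⟩ : ∃ Z : Finset (Fin p.k → ℕ), Z = (p.red I x).zeroTuples
      ((2 ^ x) ^ (p.p1 + p.p2)) ∧ ∀ t, t ∈ Z ↔ (∀ i, t i < (2 ^ x) ^ (p.p1 + p.p2)) ∧
      (p.red I x).AdjT t ∧ (p.red I x).wsum t % ((p.red I x).R * (p.red I x).BK) = 0 :=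
    ⟨_, rfl, fun t => Red.mem_zeroTuples (D := p.red I x)⟩
  obtain ⟨tup, htup⟩ : ∃ tup : ℕ → Fin p.k → ℕ, tup = fun (r : ℕ) (i : Fin p.k) =>
    r / ((2 ^ x) ^ (p.p1 + p.p2)) ^ (i : ℕ) % (2 ^ x) ^ (p.p1 + p.p2) := ⟨_, rfl⟩
  rw [← hZ] at hq
  have hJ' : ∀ r, JInv I L w x v 0 (s.setReg 6 r) := fun r =>
    ⟨hJ.env.congr rfl rfl rfl rfl rfl, hJ.r10, hJ.r14, hJ.flag, hJ.mem⟩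
  have key : ∀ r, ∃ s', D w (p.check p.eSmp).comp (s.setReg 6 r) (p.check p.eSmp).cost s' ∧
      (JInv I L w x v 0 s' ∧ (∀ y < 60, y ≠ 0 → y ≠ 6 → s'.reg y = s.reg y) ∧
        (s.reg 0 ≠ 0 → s'.reg 0 ≠ 0)) ∧
      (tup r ∈ Z → s'.reg 0 ≠ 0) := by
    intro r
    have E := (hJ' r).env
    have hok : ∀ i, (p.eSmp i).ok L (s.setReg 6 r) := fun i => by
      have h1 := E.hp
      exact ⟨⟨⟨ok_zp E.ok2 _, zp_pos E _⟩, ⟨⟨h1, E.ok3, trivial⟩, (min_le_right _ _).trans E.hk,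
        trivial⟩, trivial⟩, ok_zp E.ok2 _, trivial⟩
    obtain ⟨s', h1, h2, h3, h4⟩ := check_spec (t := p.eSmp) E (fun i d hd => wf_eSmp i d (by omega)) hok
      ((Nat.mul_le_mul_left _ (by unfold msz; omega)).trans_lt hw)
    refine ⟨s', h1, ?_, fun hz => ?_⟩
    · rcases h2 with rfl | rfl
      · refine ⟨hJ' r, fun y _ _ h6 => ?_, fun h => h⟩
        simp [State.setReg, Function.update_of_ne h6]
      · refine ⟨⟨E.congr rfl rfl rfl rfl rfl, hJ.r10, hJ.r14, fun h0 => ?_, hJ.mem⟩,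
          fun y _ h0 h6 => ?_, fun _ => one_ne_zero⟩
        · by_cases hne : (s.setReg 6 r).setReg 0 1 = s.setReg 6 r
          · rw [hne] at h0; exact (hJ' r).flag h0
          · exact h3 hne
        · simp [State.setReg, Function.update_of_ne h6, Function.update_of_ne h0]
    · have h5 := ((hmem _).1 hz).2
      have h6 : (fun i : Fin (p.red I x).k => (p.eSmp i).ev (s.setReg 6 r)) = tup r := by
        rw [htup]
        funext i
        rw [ev_eSmp E i.2]
        simp [State.setReg]
      rw [h6] at h4
      rw [h4 h5.1 h5.2]
      exact one_ne_zero
  rw [← mul_one q]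
  refine Rnd.seq (I' := fun s' => ∃ r, s' = s.setReg 6 r)
    (F' := fun s' => tup (s'.reg 6) ∈ Z)
    (Rnd.rand (Finset.filter_subset (fun r => tup r ∈ Z) _)
      (fun r _ => ⟨r, rfl⟩) (fun r hr => ?_) ?_) ?_ ?_
  · simpa [State.setReg] using (Finset.mem_filter.1 hr).2
  · rcases hq with rfl | ⟨rfl, h1, h2⟩
    · simp
    · have h3 := card_mul_le_card_digits (M := 2 ^ w) Z (fun t ht i => ((hmem t).1 ht).1 i) h1
      rw [htup]
      refine le_trans ?_ (Nat.cast_le.2 h3)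
      rw [mul_comm, ← div_eq_mul_inv, ENNReal.div_le_iff (by simpa using hc.ne') (by finiteness)]
      have h4 : 2 ^ w ≤ Z.card * (2 ^ w / ((2 ^ x) ^ (p.p1 + p.p2)) ^ p.k) * c := by
        calc 2 ^ w = ((2 ^ x) ^ (p.p1 + p.p2)) ^ p.k * (2 ^ w / ((2 ^ x) ^ (p.p1 + p.p2)) ^ p.k) :=
              (Nat.mul_div_cancel' h1).symm
          _ ≤ (Z.card * c) * (2 ^ w / ((2 ^ x) ^ (p.p1 + p.p2)) ^ p.k) :=
              Nat.mul_le_mul_right _ h2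
          _ = _ := by ring
      exact_mod_cast h4
  · rintro _ ⟨r, rfl⟩
    obtain ⟨s', h1, h2, -⟩ := key r
    exact Rnd.of_D h1 h2
  · rintro _ ⟨r, rfl⟩ hr
    obtain ⟨s', h1, h2, h3⟩ := key r
    refine Rnd.of_D_one h1 h2 (h3 ?_)
    simpa [State.setReg] using hr

/-- After `t` trials with success probability `1 / c`, success has probability at least `t / (c +
t)`, a rational substitute for `1 - (1 - 1 / c) ^ t`. For `t = 2 * c` it equals `2 / 3`. -/
theorem frac_step (c t : ℕ) (hc : 0 < c) : ((t + 1 : ℕ) : ℝ≥0∞) / (c + (t + 1 : ℕ) : ℕ) ≤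
    (t : ℝ≥0∞) / (c + t : ℕ) + (c : ℝ≥0∞)⁻¹ * (1 - (t : ℝ≥0∞) / (c + t : ℕ)) := by
  have hct : ((c + t : ℕ) : ℝ≥0∞) ≠ 0 := by simp; omega
  have h1 : (1 : ℝ≥0∞) - (t : ℝ≥0∞) / (c + t : ℕ) = (c : ℝ≥0∞) / (c + t : ℕ) := by
    refine ENNReal.sub_eq_of_eq_add (ENNReal.div_ne_top (by finiteness) hct) ?_
    rw [← ENNReal.add_div, ← Nat.cast_add, ENNReal.div_self hct (by finiteness)]
  rw [h1, ← mul_div_assoc, ENNReal.inv_mul_cancel (by simpa using hc.ne') (by finiteness),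
    ← ENNReal.add_div, ← Nat.cast_succ]
  refine ENNReal.div_le_div_left ?_ _
  exact_mod_cast (by omega)

theorem smp_loop (hJ : JInv I L w x v 0 s) (h5 : s.reg 5 = 2 * 2 ^ x)
    (hw : L * p.msz B < w) (h16 : s.reg 16 = 2 * (2 ^ x) ^ 6) (hL : 2 * (2 ^ x) ^ 6 ≤ 2 ^ L)
    {P0 : ℝ≥0∞} (hP0 : P0 = 0 ∨ P0 = 2 / 3 ∧
      ((2 ^ x) ^ (p.p1 + p.p2)) ^ p.k ∣ 2 ^ w ∧ ((2 ^ x) ^ (p.p1 + p.p2)) ^ p.k ≤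
        ((p.red I x).zeroTuples ((2 ^ x) ^ (p.p1 + p.p2))).card * (2 ^ x) ^ 6) :
    Rnd w (forL 15 16 p.smp) s (2 * (2 ^ x) ^ 6 * (1 + (p.check p.eSmp).cost + 1 + 20) + 20)
      (fun s' => JInv I L w x v 0 s' ∧ s'.reg 5 = 2 * 2 ^ x) (fun s' => s'.reg 0 ≠ 0) P0 := by
  set c := (2 ^ x) ^ 6 with hcdef
  have hc : 0 < c := by positivity
  obtain ⟨q, Pf, hq, hP1, hP2, hP3, hP4⟩ : ∃ (q : ℝ≥0∞) (Pf : ℕ → ℝ≥0∞), (q = 0 ∨ q = (c : ℝ≥0∞)⁻¹ ∧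
      ((2 ^ x) ^ (p.p1 + p.p2)) ^ p.k ∣ 2 ^ w ∧ ((2 ^ x) ^ (p.p1 + p.p2)) ^ p.k ≤
        ((p.red I x).zeroTuples ((2 ^ x) ^ (p.p1 + p.p2))).card * c) ∧ Pf (2 * c) = 0 ∧
      (∀ i, Pf i ≤ 1) ∧ (∀ i < 2 * c, Pf i ≤ Pf (i + 1) + q * (1 - Pf (i + 1))) ∧ P0 ≤ Pf 0 := by
    rcases hP0 with rfl | ⟨rfl, h1⟩
    · exact ⟨0, fun _ => 0, Or.inl rfl, rfl, fun _ => zero_le, fun _ _ => zero_le, le_rfl⟩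
    · refine ⟨(c : ℝ≥0∞)⁻¹, fun i => ((2 * c - i : ℕ) : ℝ≥0∞) / (c + (2 * c - i) : ℕ), Or.inr ⟨rfl, h1⟩,
        by simp, fun i => ENNReal.div_le_of_le_mul ?_, fun i hi => ?_, ?_⟩
      · rw [one_mul]; exact_mod_cast Nat.le_add_left _ _
      · simp only
        obtain ⟨t, ht⟩ := Nat.exists_eq_add_of_lt hi
        rw [show 2 * c - i = t + 1 by omega, show 2 * c - (i + 1) = t by omega]
        exact frac_step c t hc
      · rw [ENNReal.le_div_iff_mul_le (Or.inl (by simp; omega)) (Or.inl (by finiteness)),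
          Nat.sub_zero, show c + 2 * c = 3 * c by ring]
        push_cast
        rw [← mul_assoc, ENNReal.div_mul_cancel (by norm_num) (by norm_num)]
  have hL2 : L * 2 < w := by
    refine (Nat.mul_le_mul_left _ ?_).trans_lt hw
    unfold msz sz; omega
  have := (Rnd.forL (w := w) hJ.env.hL (x := 15) (y := 16) (body := p.smp) (m := 2 * c)
    (Tb := 1 + (p.check p.eSmp).cost + 1) (F := fun s' => s'.reg 0 ≠ 0) (s := s)
    (Inv := fun _ s' => JInv I L w x v 0 s' ∧ s'.reg 5 = 2 * 2 ^ x) hL2 (by norm_num) (by norm_num)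
    (by norm_num) hL (p := fun _ => q) (P := Pf) hP1 hP2 hP3
    (fun s v h => h) h16
    ⟨⟨hJ.env.congr rfl rfl rfl rfl rfl, hJ.r10, hJ.r14, hJ.flag, hJ.mem⟩, h5⟩ ?_).1
  · exact this.mono le_rfl (fun _ h => h) (fun _ _ h => h) hP4
  · intro i hi s' h15 h16 ⟨hJ', h5'⟩
    have main := smp_spec (B := B) hJ' hw hc hq
    have himp : ∀ s'', (JInv I L w x v 0 s'' ∧ (∀ y < 60, y ≠ 0 → y ≠ 6 → s''.reg y = s'.reg y) ∧
        (s'.reg 0 ≠ 0 → s''.reg 0 ≠ 0)) → s''.reg 15 = i ∧ s''.reg 16 = 2 * c ∧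
        JInv I L w x v 0 (s''.setReg 15 (i + 1)) ∧ (s''.setReg 15 (i + 1)).reg 5 = 2 * 2 ^ x := by
      rintro s'' ⟨h1, h2, -⟩
      refine ⟨by rw [h2 15 (by norm_num) (by norm_num) (by norm_num), h15],
        by rw [h2 16 (by norm_num) (by norm_num) (by norm_num), h16],
        ⟨h1.env.congr rfl rfl rfl rfl rfl, h1.r10, h1.r14, h1.flag, h1.mem⟩, ?_⟩
      change s''.reg 5 = _
      rw [h2 5 (by norm_num) (by norm_num) (by norm_num), h5']
    refine ⟨main.mono le_rfl himp (fun _ _ h => h) le_rfl, fun h0 => ?_⟩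
    exact (main.one_of (F := fun s' => s'.reg 0 ≠ 0) fun s'' h => h.2.2 h0).mono le_rfl himp
      (fun _ _ h => h) le_rfl

variable (p) in
/-- The time for a round. -/
def iterT (x B : ℕ) (P : Cmd) : ℕ := p.bas.cost + (1 + p.coreT x B P + 1) + 1

/-- The round `j` finds zero cliques with probability `1 / 2`. -/
def Good (I : WeightedGraph p.k V) (w x v : ℕ) (P : Cmd) (j : ℕ) : Prop :=
  HasZero x I ∧ ∃ Gd : Set ℕ, (3 / 4 : ℝ≥0∞) * 2 ^ w ≤ {r | r < 2 ^ w ∧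
      r % ((p.red I x).R * (p.red I x).BK) ∈ Gd}.ncard ∧
    ∀ h ∈ Gd, ∃ T < (2 ^ x) ^ p.ck, SucceedsWithin v P
      (encodeGraph (graphOf x I j h) v) T (ListsAllCliques p.k (graphOf x I j h))

/-- A good round finds a zero clique with probability `3/4 * 2/3 = 1/2`, from a good multiplier and
a correct list. One such round would fall short of `2/3`; two give `3/4`. -/
theorem iter_loop (hJ : JInv I L w x v 0 s) (h5 : s.reg 5 = 2 * 2 ^ x) (hN : p.Num I L w x v)
    (hw : L * p.sz B < w) (hP : P.bdd B) (hD : (p.red I x).Valid)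
    (hM : tri p.k * V ^ (100 * p.k) < (2 ^ x) ^ 8 * (2 ^ x) ^ p.c1) {P0 : ℝ≥0∞}
    (hP0 : P0 = 0 ∨ P0 ≤ 3 / 4 ∧ ∃ j0, j0 + 1 < 2 * 2 ^ x ∧ Good I w x v P j0 ∧
      Good I w x v P (j0 + 1)) :
    Rnd w (forL 4 5 (p.iter B P)) s (2 * 2 ^ x * (p.iterT x B P + 20) + 20)
      (fun s' => s'.reg 0 ≠ 0 → HasZero x I) (fun s' => s'.reg 0 ≠ 0) P0 ∧
    (s.reg 0 ≠ 0 → Rnd w (forL 4 5 (p.iter B P)) s (2 * 2 ^ x * (p.iterT x B P + 20) + 20)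
      (fun s' => s'.reg 0 ≠ 0 → HasZero x I) (fun s' => s'.reg 0 ≠ 0) 1) := by
  classical
  obtain ⟨q, Pf, hq, hP1, hP2, hP3, hP4⟩ : ∃ (q Pf : ℕ → ℝ≥0∞),
      (∀ j, q j = 0 ∨ q j = 3 / 4 * (2 / 3) ∧ Good I w x v P j) ∧ Pf (2 * 2 ^ x) = 0 ∧
      (∀ i, Pf i ≤ 1) ∧ (∀ i < 2 * 2 ^ x, Pf i ≤ Pf (i + 1) + q i * (1 - Pf (i + 1))) ∧
      P0 ≤ Pf 0 := by
    rcases hP0 with rfl | ⟨h0, j0, h1, h2, h3⟩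
    · exact ⟨fun _ => 0, fun _ => 0, fun _ => Or.inl rfl, rfl, fun _ => zero_le, fun _ _ => zero_le,
        le_rfl⟩
    · have e1 : (3 / 4 * (2 / 3) : ℝ≥0∞) = 1 / 2 := by
        have : (3 / 4 * (2 / 3) : ℝ≥0∞) = ENNReal.ofReal (3 / 4 * (2 / 3)) := by
          rw [ENNReal.ofReal_mul (by norm_num), ENNReal.ofReal_div_of_pos (by norm_num),
            ENNReal.ofReal_div_of_pos (by norm_num)]
          norm_num
        rw [this, show (3 / 4 * (2 / 3) : ℝ) = 1 / 2 by norm_num,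
          ENNReal.ofReal_div_of_pos (by norm_num)]
        norm_num
      have e2 : (1 / 2 + 1 / 2 * (1 - 1 / 2) : ℝ≥0∞) = 3 / 4 := by
        rw [show (1 : ℝ≥0∞) - 1 / 2 = 1 / 2 by
          rw [one_div, ENNReal.one_sub_inv_two]]
        have : (1 / 2 + 1 / 2 * (1 / 2) : ℝ≥0∞) = ENNReal.ofReal (1 / 2 + 1 / 2 * (1 / 2)) := by
          rw [ENNReal.ofReal_add (by norm_num) (by norm_num), ENNReal.ofReal_mul (by norm_num),
            ENNReal.ofReal_div_of_pos (by norm_num)]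
          norm_num
        rw [this, show (1 / 2 + 1 / 2 * (1 / 2) : ℝ) = 3 / 4 by norm_num,
          ENNReal.ofReal_div_of_pos (by norm_num)]
        norm_num
      have l1 : (3 / 4 : ℝ≥0∞) ≤ 1 := ENNReal.div_le_of_le_mul (by norm_num)
      have l2 : (1 / 2 : ℝ≥0∞) ≤ 1 := ENNReal.div_le_of_le_mul (by norm_num)
      -- Success from round `i` on: `3/4` while both good rounds are ahead, `1/2` while one is, and
      -- 0 afterwards.
      refine ⟨fun j => if j = j0 ∨ j = j0 + 1 then 3 / 4 * (2 / 3) else 0,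
        fun i => if i ≤ j0 then 3 / 4 else if i ≤ j0 + 1 then 1 / 2 else 0, fun j => ?_, ?_, ?_, ?_, ?_⟩
      · by_cases hj : j = j0 ∨ j = j0 + 1
        · refine Or.inr ⟨if_pos hj, ?_⟩
          rcases hj with rfl | rfl
          · exact h2
          · exact h3
        · exact Or.inl (if_neg hj)
      · simp only
        rw [if_neg (by omega), if_neg (by omega)]
      · intro i
        simp only
        split_ifs
        · exact l1
        · exact l2
        · exact zero_le
      · intro i _
        simp only [e1]
        rcases lt_trichotomy i j0 with h | rfl | h
        · rw [if_pos (by omega), if_pos (by omega : i + 1 ≤ j0)]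
          exact le_self_add
        · rw [if_pos le_rfl, if_neg (by omega : ¬ i + 1 ≤ i), if_pos le_rfl, if_pos (Or.inl rfl), e2]
        · by_cases h' : i = j0 + 1
          · subst h'
            rw [if_neg (by omega : ¬ j0 + 1 ≤ j0), if_pos le_rfl, if_neg (by omega : ¬ j0 + 1 + 1 ≤ j0),
              if_neg (by omega : ¬ j0 + 1 + 1 ≤ j0 + 1), if_pos (Or.inr rfl), zero_add, tsub_zero,
              mul_one]
          · rw [if_neg (by omega : ¬ i ≤ j0), if_neg (by omega : ¬ i ≤ j0 + 1)]
            exact zero_le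
      · simpa using h0
  have hmL : 2 * 2 ^ x ≤ 2 ^ L := le_trans (Nat.le_mul_of_pos_right _ (by positivity)) hN.htot
  have hL2 : L * 2 < w := by
    refine (Nat.mul_le_mul_left _ ?_).trans_lt hw
    unfold sz; omega
  have main := Rnd.forL (w := w) hJ.env.hL (x := 4) (y := 5) (body := p.iter B P) (m := 2 * 2 ^ x)
    (Tb := p.iterT x B P) (F := fun s' => s'.reg 0 ≠ 0) (s := s)
    (Inv := fun j s' => JInv I L w x v j s') hL2 (by norm_num) (by norm_num)
    (by norm_num) hmL (p := q) (P := Pf) hP1 hP2 hP3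
    (fun s v h => h) h5
    ⟨hJ.env.congr rfl rfl rfl rfl rfl, hJ.r10, hJ.r14, hJ.flag, hJ.mem⟩ ?_
  · exact ⟨main.1.mono le_rfl (fun s' h => h.flag) (fun _ _ h => h) hP4,
      fun h0 => (main.2 h0).mono le_rfl (fun s' h => h.flag) (fun _ _ h => h) le_rfl⟩
  · intro j hj s' h4 h5' hJ'
    have hit : Rnd w (p.iter B P) s' (p.iterT x B P) (JPost I L w x v j s')
        (fun s' => s'.reg 0 ≠ 0) (q j) := by
      rcases hq j with h | ⟨h, hz, Gd, g1, g2⟩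
      · have := iter_spec (pr := 0) (ps := 0) (Gd := fun _ => False) hJ' hN hw hP hD hM h4 hj
          (by simp) (fun h hh => hh.elim)
        rwa [mul_zero, ← h] at this
      · rw [h]
        refine iter_spec (Gd := fun r => r ∈ Gd) hJ' hN hw hP hD hM h4 hj (g1.trans ?_) ?_
        · rw [← Set.ncard_coe_finset]
          refine Nat.cast_le.2 (le_of_eq ?_)
          congr 1
          ext r
          simp
        · intro h hh
          obtain ⟨T, hT, hS⟩ := g2 h hh
          exact ⟨hz, T, hT, hS, le_rfl⟩
    have himp : ∀ s'', JPost I L w x v j s' s'' → s''.reg 4 = j ∧ s''.reg 5 = 2 * 2 ^ x ∧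
        JInv I L w x v (j + 1) (s''.setReg 4 (j + 1)) := fun s'' h => ⟨h.1, h.2.1.trans h5', h.2.2.1⟩
    refine ⟨hit.mono le_rfl himp (fun _ _ h => h) le_rfl, fun h0 => ?_⟩
    exact (hit.one_of (F := fun s' => s'.reg 0 ≠ 0) fun s'' h => h.2.2.2 h0).mono le_rfl himp
      (fun _ _ h => h) le_rfl

end Pm

end WordRAM

namespace WordRAM

namespace Pm

open Ex

variable {p : Pm} {V L w x v B : ℕ} {I : WeightedGraph p.k V} {s : State} {P : Cmd}

/-- The data of the machine after the initialization. -/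
noncomputable def start (I : WeightedGraph p.k V) (w x : ℕ) : State where
  reg := fun y => if y = 1 then V else if y = 2 then 2 ^ x else if y = 3 then x else 0
  mem := (I.encode w).mem

variable (p) in
/-- The time for the initialization. -/
def startT (x : ℕ) : ℕ :=
  ini.cost + (x * (dbl.cost + p.small.cost + 4) + p.small.cost + 4 + p.cns.cost + 1) + 1

theorem encode_mem_large (a i : ℕ) : (I.encode w).mem (10 + a) i = 0 := by
  simp only [WeightedGraph.encode]
  split_ifs <;> omega

theorem init_spec (hE : p.Env I L w x (start I w x)) (hw : L * p.msz B < w)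
    (hx1 : V < (2 ^ x) ^ (p.p1 + p.p2)) (hx2 : ∀ i < x, (2 ^ i) ^ (p.p1 + p.p2) ≤ V) :
    ∃ s, D w ini.comp (I.encode w) ini.cost ((I.encode w).setReg 1 V |>.setReg 2 1 |>.setReg 3 0) ∧
      D w (whl p.small dbl.comp) ((I.encode w).setReg 1 V |>.setReg 2 1 |>.setReg 3 0)
        (x * (dbl.cost + p.small.cost + 4) + p.small.cost + 4) s ∧
      s = start I w x := by
  have hLw : ∀ m, m ≤ p.msz B → L * m < w := fun m hm => (Nat.mul_le_mul_left _ hm).trans_lt hw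
  have hV : V % 2 ^ w = V := by
    refine Nat.mod_eq_of_lt (hE.hV.trans_lt (Nat.pow_lt_pow_right (by norm_num) ?_))
    have := hLw 1 (by unfold msz sz; omega)
    omega
  have h1L : 1 ≤ 2 ^ L := Nat.one_le_two_pow
  have D1 := HL.D_comp (w := w) hE.hL ini (I.encode w) (by simp [ini, HL.wf, wf])
    ⟨⟨Nat.zero_le _, by
      simp only [ev]
      have : (I.encode w).mem 0 0 = V % 2 ^ w := I.encode_mem_zero w
      rw [this, hV]
      exact hE.hV⟩, h1L, Nat.zero_le _⟩ (hLw _ (by unfold msz; omega))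
  have e1 : ini.eff (I.encode w) =
      ((I.encode w).setReg 1 V |>.setReg 2 1 |>.setReg 3 0) := by
    have : (I.encode w).mem 0 0 = V % 2 ^ w := I.encode_mem_zero w
    simp only [ini, HL.eff, ev, this, hV]
  rw [e1] at D1
  have hst : ∀ i, ((start I w i).setReg 2 (2 * 2 ^ i)).setReg 3 (i + 1) = start I w (i + 1) := by
    intro i
    simp only [start, State.setReg, State.mk.injEq, and_true]
    funext y
    simp only [Function.update_apply]
    split_ifs <;> omega
  have hz : ∀ i, (zp (p.p1 + p.p2)).ev (start I w i) = (2 ^ i) ^ (p.p1 + p.p2) := fun i => by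
    rw [ev_zp]; simp [start]
  have hev : ∀ i, p.small.ev (start I w i) = if (2 ^ i) ^ (p.p1 + p.p2) < V + 1 then 1 else 0 := by
    intro i
    simp only [small, ev, hz, idl]
    simp [start]
  have hok : ∀ i ≤ x, p.small.ok L (start I w i) := by
    intro i hi
    refine ⟨ok_zp ?_ _, ⟨?_, h1L, trivial⟩, trivial⟩
    · simpa [start] using (Nat.pow_le_pow_right (by norm_num) hi).trans hE.hx
    · simpa [start, ok] using hE.hV
  obtain ⟨s2, D2, e2⟩ := D.whl (w := w) hE.hL (e := p.small) (body := dbl.comp) (m := x)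
    (Tb := dbl.cost) (Inv := fun i s => s = start I w i)
    (s := (I.encode w).setReg 1 V |>.setReg 2 1 |>.setReg 3 0)
    (by simp [small, wf, wf_zp]) (hLw _ (by unfold msz; omega))
    (by
      rintro i hi _ rfl
      refine ⟨hok i hi.le, ?_, _, HL.D_comp (w := w) hE.hL dbl (start I w i)
        (by simp [dbl, HL.wf, wf]) ?_ (hLw _ (by unfold msz; omega)), ?_⟩
      · rw [hev, if_pos (by have := hx2 i hi; omega)]; norm_num
      · have h2 : (2:ℕ) ≤ 2 ^ L := by
          calc 2 = 2 ^ 1 := rfl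
            _ ≤ 2 ^ L := Nat.pow_le_pow_right (by norm_num) hE.hL
        refine ⟨⟨h2, ?_, trivial⟩, ⟨?_, h1L, trivial⟩⟩
        · simpa [start, ok] using (Nat.pow_le_pow_right (by norm_num) hi.le).trans hE.hx
        · have : i ≤ 2 ^ L := hi.le.trans (Nat.lt_two_pow_self.le.trans hE.hx)
          simpa [start, ok, HL.eff, State.setReg] using this
      · rw [← hst i]
        simp [dbl, HL.eff, ev, idl, start, State.setReg])
    (by
      rintro _ rfl
      refine ⟨hok x le_rfl, ?_⟩
      rw [hev, if_neg (by omega)])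
    (by
      simp only [start, State.setReg, State.mk.injEq, and_true]
      funext y
      simp only [Function.update_apply, WeightedGraph.encode]
      split_ifs <;> omega)
  exact ⟨s2, D1, D2, e2⟩

theorem start_spec (hE : p.Env I L w x (start I w x)) (hw : L * p.msz B < w)
    (hv : 2 ^ v = 2 ^ p.cv * (2 ^ x) ^ (p.q * p.cv)) (c : Cmd) {T : ℕ} {J F : State → Prop}
    {pr : ℝ≥0∞} (hx1 : V < (2 ^ x) ^ (p.p1 + p.p2))
    (hx2 : ∀ i < x, (2 ^ i) ^ (p.p1 + p.p2) ≤ V)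
    (h : ∀ s, JInv I L w x v 0 s → s.reg 5 = 2 * 2 ^ x → s.reg 16 = 2 * (2 ^ x) ^ 6 →
      Rnd w c s T J F pr) :
    Rnd w (.seq ini.comp (.seq (whl p.small dbl.comp) (.seq p.cns.comp c))) (I.encode w)
      (p.startT x + T + 2) J F pr := by
  have hLw : ∀ m, m ≤ p.msz B → L * m < w := fun m hm => (Nat.mul_le_mul_left _ hm).trans_lt hw
  obtain ⟨_, D1, D2, rfl⟩ := init_spec hE hw hx1 hx2
  have h2 : (2:ℕ) ≤ 2 ^ L := by
    calc 2 = 2 ^ 1 := rfl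
      _ ≤ 2 ^ L := Nat.pow_le_pow_right (by norm_num) hE.hL
  have hz : ∀ m, (zp m).ev (start I w x) = (2 ^ x) ^ m := fun m => ev_zp' hE m
  have hE1 : p.Env I L w x ((start I w x).setReg 10 (2 ^ v)) := hE.congr rfl rfl rfl rfl rfl
  have hE2 : p.Env I L w x (((start I w x).setReg 10 (2 ^ v)).setReg 14 ((2 ^ x) ^ p.ck)) :=
    hE.congr rfl rfl rfl rfl rfl
  have hE3 : p.Env I L w x ((((start I w x).setReg 10 (2 ^ v)).setReg 14 ((2 ^ x) ^ p.ck)).setReg 16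
    (2 * (2 ^ x) ^ 6)) := hE.congr rfl rfl rfl rfl rfl
  have e1 : HL.eff (.asg 10 (o .mul (n (2 ^ p.cv)) (zp (p.q * p.cv)))) (start I w x) =
      (start I w x).setReg 10 (2 ^ v) := by
    simp only [HL.eff, ev, idl, hz, hv]
  have e2 : HL.eff (.asg 14 (zp p.ck)) ((start I w x).setReg 10 (2 ^ v)) =
      ((start I w x).setReg 10 (2 ^ v)).setReg 14 ((2 ^ x) ^ p.ck) := by
    simp only [HL.eff, ev_zp' hE1]
  have e3 : HL.eff (.asg 16 (o .mul (n 2) (zp 6)))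
      (((start I w x).setReg 10 (2 ^ v)).setReg 14 ((2 ^ x) ^ p.ck)) =
      (((start I w x).setReg 10 (2 ^ v)).setReg 14 ((2 ^ x) ^ p.ck)).setReg 16
        (2 * (2 ^ x) ^ 6) := by
    simp only [HL.eff, ev, idl, ev_zp' hE2]
  have e4 : HL.eff (.asg 5 (o .mul (n 2) (Ex.v 2)))
      ((((start I w x).setReg 10 (2 ^ v)).setReg 14 ((2 ^ x) ^ p.ck)).setReg 16
        (2 * (2 ^ x) ^ 6)) = ((((start I w x).setReg 10 (2 ^ v)).setReg 14 ((2 ^ x) ^ p.ck)).setReg 16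
        (2 * (2 ^ x) ^ 6)).setReg 5 (2 * 2 ^ x) := by
    simp only [HL.eff, ev, idl, hE3.reg2]
  have D3 := HL.D_comp (w := w) hE.hL p.cns (start I w x) (by simp [cns, HL.wf, wf, wf_zp])
    (by
      refine ⟨⟨hE.hcv, ok_zp hE.ok2 _, trivial⟩, ?_⟩
      rw [e1]
      refine ⟨ok_zp hE1.ok2 _, ?_⟩
      rw [e2]
      refine ⟨⟨h2, ok_zp hE2.ok2 _, trivial⟩, ?_⟩
      rw [e3]
      exact ⟨h2, hE3.ok2, trivial⟩)
    (hLw _ (by unfold msz; omega))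
  have e : p.cns.eff (start I w x) = ((((start I w x).setReg 10 (2 ^ v)).setReg 14
      ((2 ^ x) ^ p.ck)).setReg 16 (2 * (2 ^ x) ^ 6)).setReg 5 (2 * 2 ^ x) := by
    rw [cns, HL.eff, e1, HL.eff, e2, HL.eff, e3, e4]
  rw [e] at D3
  refine (Rnd.seq_left D1 (Rnd.seq_left D2 (Rnd.seq_left D3 (h _
    ⟨hE3.congr rfl rfl rfl rfl rfl, rfl, rfl, fun h0 => absurd rfl h0,
      fun a i _ => encode_mem_large a i⟩ rfl rfl)))).mono ?_ (fun _ h => h) (fun _ _ h => h) le_rfl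
  unfold startT
  omega

variable (p) in
/-- The time of the whole program. -/
def mainT (x B : ℕ) (P : Cmd) : ℕ :=
  p.startT x + (2 * (2 ^ x) ^ 6 * (1 + (p.check p.eSmp).cost + 1 + 20) + 20 +
    (2 * 2 ^ x * (p.iterT x B P + 20) + 20) + 1) + 2

theorem succeedsWithin_of_rnd {T : ℕ} {c : Cmd} {s : State} {J F : State → Prop} {g : State → Prop}
    (h : Rnd w c s T J F (2 / 3)) (hg : ∀ s s1, J s → F s → Eqv s1 s → g s1) :
    SucceedsWithin w c s T g := by
  have := h s ⟨rfl, fun _ _ => rfl⟩ [] g 0 0 1 (fun _ _ _ _ => zero_le)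
    (fun s' s1 hJ hF hs => by rw [zero_add, Val_nil_of 0 (hg s' s1 hJ hF hs)])
  simpa [SucceedsWithin, Val] using this

/-- Without a zero clique the flag is surely never set. Otherwise either the sampling or the rounds
succeed, by `hcase`; after successful sampling the rounds only have to preserve the flag. -/
theorem main_spec (hE : p.Env I L w x (start I w x)) (hN : p.Num I L w x v)
    (hw : L * p.msz B < w) (hP : P.bdd B) (hD : (p.red I x).Valid)
    (hv : 2 ^ v = 2 ^ p.cv * (2 ^ x) ^ (p.q * p.cv)) (hx1 : V < (2 ^ x) ^ (p.p1 + p.p2))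
    (hx2 : ∀ i < x, (2 ^ i) ^ (p.p1 + p.p2) ≤ V)
    (hM : tri p.k * V ^ (100 * p.k) < (2 ^ x) ^ 8 * (2 ^ x) ^ p.c1)
    (h6 : 2 * (2 ^ x) ^ 6 ≤ 2 ^ L) (hY : ((2 ^ x) ^ (p.p1 + p.p2)) ^ p.k ∣ 2 ^ w)
    (hcase : HasZero x I → ((2 ^ x) ^ (p.p1 + p.p2)) ^ p.k ≤
        ((p.red I x).zeroTuples ((2 ^ x) ^ (p.p1 + p.p2))).card * (2 ^ x) ^ 6 ∨
      ∃ j0, j0 + 1 < 2 * 2 ^ x ∧ Good I w x v P j0 ∧ Good I w x v P (j0 + 1)) :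
    SucceedsWithin w (p.main B P) (I.encode w) (p.mainT x B P)
      (fun s => s.reg 0 ≠ 0 ↔ I.HasZeroClique) := by
  have hiff : I.HasZeroClique ↔ HasZero x I := WeightedGraph.hasZeroClique_iff hM
  have hw' : L * p.sz B < w := (Nat.mul_le_mul_left _ (by unfold msz; omega)).trans_lt hw
  have h0 : ∀ {s s1 : State}, Eqv s1 s → s1.reg 0 = s.reg 0 := fun h => h.2 0 (by norm_num)
  by_cases hz : HasZero x I
  · refine succeedsWithin_of_rnd (J := fun s => s.reg 0 ≠ 0 → HasZero x I)
      (F := fun s => s.reg 0 ≠ 0) ?_ (fun s s1 _ h1 h2 => ?_)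
    · refine start_spec hE hw hv _ hx1 hx2 fun s hJ h5 h16 => ?_
      rcases hcase hz with h | h
      · rw [← mul_one (2 / 3 : ℝ≥0∞)]
        exact Rnd.seq (smp_loop hJ h5 hw h16 h6 (Or.inr ⟨rfl, hY, h⟩))
          (fun s' h' => (iter_loop h'.1 h'.2 hN hw' hP hD hM (Or.inl rfl)).1)
          (fun s' h' hf => (iter_loop h'.1 h'.2 hN hw' hP hD hM (Or.inl rfl)).2 hf)
      · rw [← one_mul (2 / 3 : ℝ≥0∞)]
        have hle : (2 / 3 : ℝ≥0∞) ≤ 3 / 4 := by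
          rw [ENNReal.div_le_iff (by norm_num) (by norm_num), mul_comm, ← mul_div_assoc,
            ENNReal.le_div_iff_mul_le (by norm_num) (by norm_num)]
          norm_num
        refine Rnd.seq ((smp_loop hJ h5 hw h16 h6 (Or.inl rfl)).one_of (F := fun _ => True)
          fun _ _ => trivial) (fun s' h' => (iter_loop h'.1 h'.2 hN hw' hP hD hM (Or.inl rfl)).1)
          (fun s' h' _ => (iter_loop h'.1 h'.2 hN hw' hP hD hM (Or.inr ⟨hle, h⟩)).1)
    · rw [h0 h2, hiff]
      exact ⟨fun _ => hz, fun _ => h1⟩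
  · refine succeedsWithin_of_rnd (J := fun s => s.reg 0 ≠ 0 → HasZero x I)
      (F := fun s => True) ?_ (fun s s1 h1 _ h2 => ?_)
    · have : (2 / 3 : ℝ≥0∞) ≤ 1 := ENNReal.div_le_of_le_mul (by norm_num)
      refine start_spec hE hw hv _ hx1 hx2 fun s hJ h5 h16 => ?_
      have := Rnd.seq (smp_loop hJ h5 hw h16 h6 (Or.inl rfl))
        (fun s' h' => (iter_loop h'.1 h'.2 hN hw' hP hD hM (Or.inl rfl)).1)
        (fun s' h' hf => ((iter_loop h'.1 h'.2 hN hw' hP hD hM (Or.inl rfl)).2 hf))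
      exact (this.one_of (F := fun _ => True) fun _ _ => trivial).mono le_rfl (fun _ h => h)
        (fun _ _ h => h) (by assumption)
    · rw [h0 h2, hiff]
      exact ⟨h1, fun h => absurd h hz⟩

end Pm

end WordRAM

/-! ### Word length, running time and the choice of exponents -/

namespace WordRAM

namespace Pm

/-! ## Word lengths -/

/-- The requirements on the exponents for the program to run. -/
structure Fits (p : Pm) : Prop where
  hk : 3 ≤ p.k
  hU : 8 * (tri p.k - 1) + p.p2 * p.k + p.p1 + 1 ≤ p.q
  hp : 1 ≤ p.p1
  hc1 : p.c1 = 100 * p.k * (p.p1 + p.p2) + tri p.k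
  hcs : p.cs = 2 * p.q + p.cv + p.q * p.cv + p.ck + p.k + 4

variable {p : Pm} {V L w x v B : ℕ} {I : WeightedGraph p.k V} {P : Cmd}

theorem Fits.three_le_tri (h : p.Fits) : 3 ≤ tri p.k := tri_mono h.hk

theorem le_two_pow_pow {a b : ℕ} (hx : 1 ≤ x) (h : a ≤ b) : a ≤ (2 ^ x) ^ b :=
  (Nat.lt_pow_self (by have := Nat.lt_two_pow_self (n := x); omega)).le.trans
    (Nat.pow_le_pow_right (by positivity) h)

theorem red_U :
    (p.red I x).U = tri p.k * p.k * (2 ^ x) ^ (8 * (tri p.k - 1) + p.p2 * p.k + p.p1) := by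
  have : (p.red I x).U = tri p.k * ((2 ^ x) ^ 8) ^ (tri p.k - 1) * ((2 ^ x) ^ p.p2) ^ p.k *
      (p.k * (2 ^ x) ^ p.p1) := rfl
  rw [this, pow_add, pow_add, pow_mul, pow_mul]
  ring

theorem Fits.valid (h : p.Fits) (hx : tri p.k * p.k + 6 ≤ 2 ^ x)
    (hV : V < (2 ^ x) ^ (p.p1 + p.p2)) : (p.red I x).Valid where
  hk := (by have := h.hk; omega : 2 ≤ p.k)
  hN := by change 0 < (2 ^ x) ^ p.p1; positivity
  hS := by change 0 < (2 ^ x) ^ p.p2; positivity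
  hBK := by change 0 < (2 ^ x) ^ p.c1; positivity
  hE := by
    change tri p.k ≤ (2 ^ x) ^ 8
    have h1 : tri p.k ≤ tri p.k * p.k := Nat.le_mul_of_pos_right _ (by have := h.hk; omega)
    calc tri p.k ≤ (2 ^ x) ^ 1 := by rw [pow_one]; omega
      _ ≤ _ := Nat.pow_le_pow_right (by positivity) (by norm_num)
  hV := by
    change V ≤ (2 ^ x) ^ p.p2 * (2 ^ x) ^ p.p1
    rw [← pow_add, add_comm]
    exact hV.le

/-- The exponent `c1` is chosen for this. A bucket wider than all weight sums is what `gcd_wsum_dvd`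
needs. -/
theorem Fits.modulus (h : p.Fits) (hx : 1 ≤ x) (hV : V < (2 ^ x) ^ (p.p1 + p.p2)) :
    tri p.k * V ^ (100 * p.k) < (2 ^ x) ^ p.c1 := by
  have h1 : V ^ (100 * p.k) < ((2 ^ x) ^ (p.p1 + p.p2)) ^ (100 * p.k) :=
    Nat.pow_lt_pow_left hV (by have := h.hk; omega)
  have h2 := h.three_le_tri
  calc tri p.k * V ^ (100 * p.k) < tri p.k * ((2 ^ x) ^ (p.p1 + p.p2)) ^ (100 * p.k) :=
        Nat.mul_lt_mul_of_pos_left h1 (by omega)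
    _ ≤ (2 ^ x) ^ tri p.k * ((2 ^ x) ^ (p.p1 + p.p2)) ^ (100 * p.k) :=
        Nat.mul_le_mul_right _ (le_two_pow_pow hx le_rfl)
    _ = _ := by
      rw [h.hc1, ← pow_mul (2 ^ x) (p.p1 + p.p2), ← pow_add]; congr 1; ring

/-- All atoms are bounded by `2 ^ (K * x)`, a fixed power of `Z`, and no fragment has more than
`msz` of them; so slightly more than `K * x * msz` bits suffice. By minimality `x` is at most
`Nat.log 2 V + 1`, so this is a word length with a constant factor. -/
theorem main_correct (h : p.Fits) (hP : P.bdd B) : ∃ c, ∀ x V (I : WeightedGraph p.k V),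
    tri p.k * p.k + 6 ≤ 2 ^ x → V < (2 ^ x) ^ (p.p1 + p.p2) →
    (∀ i < x, (2 ^ i) ^ (p.p1 + p.p2) ≤ V) →
    (HasZero x I → ∀ w, (2 ^ x) ^ (8 + p.c1) ∣ 2 ^ w → ((2 ^ x) ^ (p.p1 + p.p2)) ^ p.k ≤
        ((p.red I x).zeroTuples ((2 ^ x) ^ (p.p1 + p.p2))).card * (2 ^ x) ^ 6 ∨
      ∃ j0, j0 + 1 < 2 * 2 ^ x ∧ Good I w x (wordLength p.cv ((2 ^ x) ^ p.q)) P j0 ∧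
        Good I w x (wordLength p.cv ((2 ^ x) ^ p.q)) P (j0 + 1)) →
    SucceedsWithin (wordLength c V) (p.main B P) (I.encode (wordLength c V)) (p.mainT x B P)
      (fun s => s.reg 0 ≠ 0 ↔ I.HasZeroClique) := by
  set K := p.cs + 2 + (8 + p.c1) + (p.p1 + p.p2) * p.k + 7 + tri p.k * p.k + p.k + p.cv + p.p1 + p.p2
    with hK
  refine ⟨K * p.msz B + 1, fun x V I hx hV hV2 hcase => ?_⟩
  have hk := h.hk
  have hE3 := h.three_le_tri
  have hx1 : 1 ≤ x := by
    rcases Nat.eq_zero_or_pos x with rfl | h0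
    · simp at hx
    · exact h0
  set w := wordLength (K * p.msz B + 1) V with hw
  set v := wordLength p.cv ((2 ^ x) ^ p.q) with hv
  have hlog : x ≤ Nat.log 2 V + 1 := by
    have h1 := hV2 (x - 1) (by omega)
    have h2 : 2 ^ (x - 1) ≤ V := by
      refine le_trans ?_ h1
      calc 2 ^ (x - 1) = (2 ^ (x - 1)) ^ 1 := (pow_one _).symm
        _ ≤ _ := Nat.pow_le_pow_right (by positivity) (by have := h.hp; omega)
    have h3 := Nat.le_log_of_pow_le (b := 2) (by norm_num) h2
    omega
  have hw1 : K * x * p.msz B + x ≤ w := by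
    calc K * x * p.msz B + x = (K * p.msz B + 1) * x := by ring
      _ ≤ _ := Nat.mul_le_mul_left _ hlog
  have hm1 : 1 ≤ p.msz B := by unfold msz sz; omega
  have hKw : K * x < w := by
    have := Nat.le_mul_of_pos_right (K * x) hm1
    omega
  have hpow : ∀ m, m ≤ K → (2 ^ x) ^ m ≤ 2 ^ (K * x) := fun m hm => by
    rw [mul_comm K, pow_mul]
    exact Nat.pow_le_pow_right (by positivity) hm
  have hdvd : ∀ m, m ≤ K → (2 ^ x) ^ m ∣ 2 ^ w := fun m hm => by
    rw [← pow_mul]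
    refine pow_dvd_pow _ (le_trans ?_ hKw.le)
    rw [mul_comm K]
    exact Nat.mul_le_mul_left _ hm
  have hself : ∀ m, m ≤ K → m ≤ 2 ^ (K * x) := fun m hm =>
    (le_two_pow_pow hx1 le_rfl).trans (hpow m hm)
  have hvv : 2 ^ v = 2 ^ p.cv * (2 ^ x) ^ (p.q * p.cv) := by
    rw [hv, wordLength, ← pow_mul, Nat.log_pow (by norm_num), ← pow_mul, ← pow_add]
    congr 1
    ring
  have hE : p.Env I (K * x) w x (start I w x) :=
    { reg1 := rfl, reg2 := rfl, reg3 := rfl, mem1 := rfl, mem2 := rfl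
      hL := Nat.mul_pos (by omega) hx1
      hV := hV.le.trans (hpow _ (by omega))
      hx := by simpa using hpow 1 (by omega)
      hk := hself _ (by omega)
      hE := hself _ (by omega)
      hp := hself _ (by omega)
      hcv := (Nat.pow_le_pow_left (by omega) p.cv).trans (hpow p.cv (by omega))
      hc := (show 100 ≤ 2 ^ 7 by norm_num).trans ((Nat.pow_le_pow_left (by omega) _).trans
        (hpow 7 (by omega)))
      hw := by omega
      hM := hdvd _ (by omega) }
  have hZ : 0 < 2 ^ x := by positivity
  have hN : p.Num I (K * x) w x v :=
    { hk := hk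
      hn := by
        rw [red_U]
        have h1 : 2 ^ x * (2 ^ x) ^ p.p1 ≤ (2 ^ x) ^ (p.q - 1) := by
          rw [← pow_succ']
          exact Nat.pow_le_pow_right hZ (by have := h.hU; omega)
        have h2 : (2 ^ x) ^ (8 * (tri p.k - 1) + p.p2 * p.k + p.p1) ≤ (2 ^ x) ^ (p.q - 1) :=
          Nat.pow_le_pow_right hZ (by have := h.hU; omega)
        calc _ ≤ tri p.k * p.k * (2 ^ x) ^ (p.q - 1) + (2 ^ x) ^ (p.q - 1) :=
              Nat.add_le_add (Nat.mul_le_mul_left _ h2) h1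
          _ = (tri p.k * p.k + 1) * (2 ^ x) ^ (p.q - 1) := by ring
          _ ≤ 2 ^ x * (2 ^ x) ^ (p.q - 1) := Nat.mul_le_mul_right _ (by omega)
          _ = (2 ^ x) ^ p.q := by rw [← pow_succ']; congr 1; have := h.hU; omega
      hkN := by
        have h1 : p.k ≤ tri p.k * p.k := Nat.le_mul_of_pos_left _ (by omega)
        calc p.k * (2 ^ x) ^ p.p1 ≤ 2 ^ x * (2 ^ x) ^ p.p1 := Nat.mul_le_mul_right _ (by omega)
          _ = (2 ^ x) ^ (p.p1 + 1) := (pow_succ' _ _).symm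
          _ ≤ _ := Nat.pow_le_pow_right hZ (by have := h.hU; omega)
      hsq := by
        have h1 : 1 ≤ (2 ^ x) ^ p.q * (2 ^ x) ^ p.q := Nat.mul_pos (by positivity) (by positivity)
        calc 2 + 4 * ((2 ^ x) ^ p.q * (2 ^ x) ^ p.q) ≤ 6 * ((2 ^ x) ^ p.q * (2 ^ x) ^ p.q) := by omega
          _ ≤ 2 ^ x * ((2 ^ x) ^ p.q * (2 ^ x) ^ p.q) := Nat.mul_le_mul_right _ (by omega)
          _ = (2 ^ x) ^ (2 * p.q + 1) := by ring
          _ ≤ _ := Nat.pow_le_pow_right hZ (by rw [h.hcs]; omega)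
      hslot := by
        rw [hvv]
        calc 2 ^ p.cv * (2 ^ x) ^ (p.q * p.cv) ≤ (2 ^ x) ^ p.cv * (2 ^ x) ^ (p.q * p.cv) :=
              Nat.mul_le_mul_right _ (Nat.pow_le_pow_left (by omega) _)
          _ = (2 ^ x) ^ (p.cv + p.q * p.cv) := (pow_add _ _ _).symm
          _ ≤ _ := Nat.pow_le_pow_right hZ (by rw [h.hcs]; omega)
      htot := by
        calc 2 * 2 ^ x * (2 ^ x) ^ p.cs ≤ 2 ^ x * 2 ^ x * (2 ^ x) ^ p.cs :=
              Nat.mul_le_mul_right _ (Nat.mul_le_mul_right _ (by omega))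
          _ = (2 ^ x) ^ (p.cs + 2) := by ring
          _ ≤ _ := hpow _ (by omega)
      hck := by
        have h1 : 1 ≤ (2 ^ x) ^ p.ck := Nat.one_le_pow _ _ hZ
        calc 1 + p.k * (2 ^ x) ^ p.ck ≤ (p.k + 1) * (2 ^ x) ^ p.ck := by rw [Nat.succ_mul]; omega
          _ ≤ (2 ^ x) ^ (p.k + 1) * (2 ^ x) ^ p.ck :=
              Nat.mul_le_mul_right _ (le_two_pow_pow hx1 le_rfl)
          _ = (2 ^ x) ^ (p.k + 1 + p.ck) := (pow_add _ _ _).symm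
          _ ≤ _ := Nat.pow_le_pow_right hZ (by rw [h.hcs]; omega)
      hLw := hKw
      hM1 := hpow _ (by omega) }
  refine main_spec hE hN (by omega) hP (h.valid hx hV) hvv hV hV2 ?_ ?_ ?_ (fun hz => hcase hz w hE.hM)
  · exact (h.modulus hx1 hV).trans_le (Nat.le_mul_of_pos_left _ (by positivity))
  · calc 2 * (2 ^ x) ^ 6 ≤ 2 ^ x * (2 ^ x) ^ 6 := Nat.mul_le_mul_right _ (by omega)
      _ = (2 ^ x) ^ 7 := by ring
      _ ≤ _ := hpow _ (by omega)
  · rw [← pow_mul]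
    exact hdvd _ (by omega)

end Pm

end WordRAM

namespace WordRAM

namespace Pm

/-! ## Running time -/

variable {p : Pm} {V x B : ℕ} {P : Cmd}

/-- There are `2 * Z` rounds. Writing a graph takes O(Z^(p1+q+1)) steps and the simulation O(Z^ck),
so `h1` and `h2` keep the rounds within O(Z^(e-1)), e = (p1+p2)·k. The `2 * Z ^ 6` samples fit by
`h7`. -/
theorem exists_mainT_le (p : Pm) (B : ℕ) (P : Cmd) (h1 : p.p1 + p.q + 3 ≤ (p.p1 + p.p2) * p.k)
    (h2 : p.ck + 3 = (p.p1 + p.p2) * p.k) (h7 : 7 ≤ (p.p1 + p.p2) * p.k) :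
    ∃ C, ∀ x, p.mainT x B P ≤ C * (2 ^ x) ^ ((p.p1 + p.p2) * p.k - 1) := by
  set e := (p.p1 + p.p2) * p.k - 1 with he
  set c1 := dbl.cost + p.small.cost + 4 with hc1
  set c2 := 2 * (1 + (p.check p.eSmp).cost + 1 + 20) with hc2
  set c3 := 2 * p.bcost B with hc3
  set c4 := 2 * (P.lag + p.chk.cost + 20) with hc4
  set c5 := 2 * (p.bas.cost + 1 + P.lag + p.cnt.cost + 21 + 24) with hc5
  set c6 := ini.cost + (p.small.cost + 4 + p.cns.cost + 1) + 1 + 43 with hc6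
  refine ⟨c1 + c2 + c3 * (p.k + 1) + c4 + c5 + c6, fun x => ?_⟩
  have hZ : 1 ≤ 2 ^ x := Nat.one_le_two_pow
  have hle : ∀ m, m ≤ e → (2 ^ x) ^ m ≤ (2 ^ x) ^ e := fun m hm => Nat.pow_le_pow_right hZ hm
  have a0 : 1 ≤ (2 ^ x) ^ e := Nat.one_le_pow _ _ hZ
  have a1 : 2 ^ x ≤ (2 ^ x) ^ e := by simpa using hle 1 (by omega)
  have a2 : x ≤ (2 ^ x) ^ e := Nat.lt_two_pow_self.le.trans a1
  have a3 : (2 ^ x) ^ 6 ≤ (2 ^ x) ^ e := hle 6 (by omega)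
  have a4 : 2 ^ x * (2 ^ x) ^ p.ck ≤ (2 ^ x) ^ e := by
    rw [← pow_succ']
    exact hle _ (by omega)
  have a5 : 2 ^ x * ((p.k + 2 ^ x) * (2 ^ x) ^ p.p1 * (2 ^ x) ^ p.q) ≤ (p.k + 1) * (2 ^ x) ^ e := by
    have h3 : p.k + 2 ^ x ≤ (p.k + 1) * 2 ^ x := by
      have := Nat.le_mul_of_pos_right p.k hZ
      rw [Nat.succ_mul]; omega
    calc 2 ^ x * ((p.k + 2 ^ x) * (2 ^ x) ^ p.p1 * (2 ^ x) ^ p.q)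
        ≤ 2 ^ x * (((p.k + 1) * 2 ^ x) * (2 ^ x) ^ p.p1 * (2 ^ x) ^ p.q) := by gcongr
      _ = (p.k + 1) * (2 ^ x) ^ (p.p1 + p.q + 2) := by ring
      _ ≤ _ := Nat.mul_le_mul_left _ (hle _ (by omega))
  have heq : p.mainT x B P = c1 * x + c2 * (2 ^ x) ^ 6 +
      c3 * (2 ^ x * ((p.k + 2 ^ x) * (2 ^ x) ^ p.p1 * (2 ^ x) ^ p.q)) +
      c4 * (2 ^ x * (2 ^ x) ^ p.ck) + c5 * 2 ^ x + c6 * 1 := by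
    simp only [mainT, startT, iterT, coreT, hc1, hc2, hc3, hc4, hc5, hc6]
    ring
  rw [heq]
  calc _ ≤ c1 * (2 ^ x) ^ e + c2 * (2 ^ x) ^ e + c3 * ((p.k + 1) * (2 ^ x) ^ e) +
        c4 * (2 ^ x) ^ e + c5 * (2 ^ x) ^ e + c6 * (2 ^ x) ^ e := by gcongr
    _ = _ := by ring

/-- Minimality of `x` means `(Z / 2) ^ p ≤ V`; the saved factor `Z` becomes the saving `V ^ (1 /
p)`. -/
theorem pow_le_rpow {p k : ℕ} (hp : 1 ≤ p) (hk : 1 ≤ k) (hx : 1 ≤ x) (hV : (2 ^ (x - 1)) ^ p ≤ V) :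
    ((2 ^ x) ^ (p * k - 1) : ℝ) ≤ 2 ^ (p * k - 1) * (V : ℝ) ^ ((k : ℝ) - 1 / p) := by
  obtain ⟨x, rfl⟩ := Nat.exists_eq_add_of_le' hx
  rw [Nat.add_sub_cancel] at hV
  have hp0 : (0 : ℝ) < p := by exact_mod_cast hp
  have hpk : 1 ≤ p * k := Nat.mul_pos hp hk
  have h1 : (((2 : ℝ) ^ x) ^ p) ^ ((k : ℝ) - 1 / p) ≤ (V : ℝ) ^ ((k : ℝ) - 1 / p) := by
    refine Real.rpow_le_rpow (by positivity) (by exact_mod_cast hV) ?_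
    have h2 : (1 : ℝ) ≤ k := by exact_mod_cast hk
    have h3 : 1 / (p : ℝ) ≤ 1 := by
      rw [div_le_one hp0]
      exact_mod_cast hp
    linarith
  have h2 : (((2 : ℝ) ^ x) ^ p) ^ ((k : ℝ) - 1 / p) = (2 ^ x) ^ (p * k - 1) := by
    rw [← Real.rpow_natCast ((2 : ℝ) ^ x) p, ← Real.rpow_mul (by positivity),
      ← Real.rpow_natCast ((2 : ℝ) ^ x) (p * k - 1), Nat.cast_sub hpk]
    congr 1
    push_cast
    field_simp
  calc ((2 : ℝ) ^ (x + 1)) ^ (p * k - 1) = 2 ^ (p * k - 1) * (2 ^ x) ^ (p * k - 1) := by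
        rw [pow_succ, mul_pow, mul_comm]
    _ ≤ _ := by rw [← h2]; exact mul_le_mul_of_nonneg_left h1 (by positivity)

end Pm

end WordRAM

namespace WordRAM

/-! ## Exponents -/

/-- Exponents for `n = Z ^ q`, `N = Z ^ p1`, `S = Z ^ p2` in dependence of `k` and `δ`. -/
theorem exists_exponents {k : ℕ} (hk : 3 ≤ k) {δ : ℝ} (h0 : 0 < δ) (h1 : δ < 1) :
    ∃ q p1 p2 : ℕ, 1 ≤ p1 ∧ (p1 : ℝ) < q * (1 - δ) ∧ q * (1 - δ) ≤ p1 + 1 ∧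
      8 * (tri k - 1) + p2 * k + p1 + 1 ≤ q ∧ p1 + q + 3 ≤ (p1 + p2) * k ∧
      7 ≤ (p1 + p2) * k ∧
      q * ((k - δ) * (1 - δ)) ≤ (((p1 + p2) * k : ℕ) : ℝ) - 4 ∧
      (((p1 + p2) * k : ℕ) : ℝ) - 4 ≤ q * (1 + (k - 1) * (1 - δ)) := by
  have hE : 3 ≤ tri k := tri_mono hk
  set b := 8 * tri k + 2 * k + 20 with hb
  have hd : 0 < δ * (1 - δ) := mul_pos h0 (by linarith)
  -- So large that both `q * δ` and `q * (1 - δ)` exceed `b`, which collects all rounding losses.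
  obtain ⟨q, hq⟩ := exists_nat_ge ((b : ℝ) / (δ * (1 - δ)))
  rw [div_le_iff₀ hd] at hq
  have hq0 : (0 : ℝ) ≤ q := Nat.cast_nonneg _
  have hb0 : (20 : ℝ) ≤ b := by exact_mod_cast (by omega)
  have hq1 : (b : ℝ) ≤ q * (1 - δ) := by nlinarith [mul_nonneg hq0 hd.le, mul_nonneg hq0 (by linarith : 0 ≤ 1 - δ)]
  have hq2 : (b : ℝ) ≤ q * δ := by nlinarith [mul_nonneg hq0 hd.le, mul_nonneg hq0 h0.le]
  -- The largest `p1` strictly below `q * (1 - δ)`: then `N` is of smaller order than `n ^ (1 - δ)`,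
  -- which in turn is at most `Z * N`.
  obtain ⟨p1, hp1⟩ : ∃ p1, ⌈(q : ℝ) * (1 - δ)⌉₊ = p1 + 1 := by
    refine Nat.exists_eq_succ_of_ne_zero (Nat.ceil_pos.2 (by linarith)).ne'
  have e1 : (q : ℝ) * (1 - δ) ≤ p1 + 1 := by
    have := Nat.le_ceil ((q : ℝ) * (1 - δ))
    rw [hp1] at this
    exact_mod_cast this
  have e2 : (p1 : ℝ) < q * (1 - δ) := by
    have := Nat.ceil_lt_add_one (a := (q : ℝ) * (1 - δ)) (by linarith)
    rw [hp1] at this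
    push_cast at this
    linarith
  have e3 : b ≤ p1 + 1 := by
    have : (b : ℝ) ≤ (p1 + 1 : ℕ) := by push_cast; linarith
    exact_mod_cast this
  have e4 : p1 + b ≤ q := by
    have : ((p1 + b : ℕ) : ℝ) ≤ q := by push_cast; linarith
    exact_mod_cast this
  set r := q - p1 - 8 * (tri k - 1) - 1 with hr
  have e5 := Nat.div_add_mod r k
  have e6 := Nat.mod_lt r (show 0 < k by omega)
  have e7 : r / k * k = k * (r / k) := mul_comm _ _
  have e8 : (p1 + r / k) * k = p1 * k + k * (r / k) := by ring
  have e9 : p1 * 3 ≤ p1 * k := Nat.mul_le_mul_left _ hk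
  refine ⟨q, p1, r / k, by omega, e2, e1, by omega, by omega, by omega, ?_, ?_⟩
  · have h5 : p1 * k + q ≤ (p1 + r / k) * k + p1 + (8 * tri k + k) := by omega
    have h6 : (p1 * k + q : ℝ) ≤ ((p1 + r / k) * k : ℕ) + p1 + (8 * tri k + k : ℕ) := by
      exact_mod_cast h5
    have h7 : ((8 * tri k + k : ℕ) : ℝ) + k + 20 ≤ q * δ := by
      refine le_trans (le_of_eq ?_) hq2
      rw [hb]; push_cast; ring
    have hk' : (3 : ℝ) ≤ k := by exact_mod_cast hk
    have h8 : (q * (1 - δ) - 1) * ((k : ℝ) - 1) ≤ p1 * (k - 1) :=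
      mul_le_mul_of_nonneg_right (by linarith) (by linarith)
    have h9 : 0 ≤ q * δ * (1 - δ) := mul_nonneg (mul_nonneg hq0 h0.le) (by linarith)
    -- Without rounding, `(p1 + p2) * k` would be `q * (1 + (k - 1) * (1 - δ))`. This exceeds the
    -- required value by `q * δ * (2 - δ)`, which pays for the rounding.
    have h10 : q * ((k - δ) * (1 - δ)) = (q * (1 - δ) - 1) * ((k : ℝ) - 1) + (k - 1) + q -
        q * δ - q * δ * (1 - δ) := by ring
    linarith
  · have h5 : (p1 + r / k) * k + p1 ≤ p1 * k + q := by omega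
    have h6 : (((p1 + r / k) * k : ℕ) : ℝ) + p1 ≤ p1 * k + q := by exact_mod_cast h5
    have hk' : (3 : ℝ) ≤ k := by exact_mod_cast hk
    nlinarith [mul_nonneg (by linarith : (0 : ℝ) ≤ k - 1) (sub_nonneg.2 e2.le)]

/-- The bounds for the size and the arboricity of a graph. -/
theorem near_of_bounds {n t a U m α η : ℝ} (hn : 0 < n) (ht : 0 < t) (h0 : 0 < η) (h1 : η ≤ 1 / 4)
    (ha1 : (1 - η) * t ≤ a) (ha2 : a ≤ t) (hU : U + a ≤ η * n) (hm : a * (n - U - a) ≤ m)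
    (hm2 : m ≤ n * α) (hα : α ≤ a) :
    (1 - 2 * η) * t ≤ α ∧ α ≤ t ∧ (1 - 2 * η) * (n * t) ≤ m ∧ m ≤ n * t := by
  have h2 : (1 - 2 * η) * (n * t) ≤ a * (n - U - a) := by
    have h3 : (1 - η) * t * ((1 - η) * n) ≤ a * (n - U - a) :=
      mul_le_mul ha1 (by linarith) (mul_nonneg (by linarith) hn.le)
        ((mul_nonneg (by linarith) ht.le).trans ha1)
    nlinarith [mul_nonneg (mul_pos h0 h0).le (mul_pos hn ht).le]
  refine ⟨?_, hα.trans ha2, h2.trans hm, hm2.trans (mul_le_mul_of_nonneg_left (hα.trans ha2) hn.le)⟩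
  have h3 := h2.trans (hm.trans hm2)
  have h4 : n * ((1 - 2 * η) * t) ≤ n * α := by linarith
  exact le_of_mul_le_mul_left h4 hn

/-- The bound for the running time up to constants. -/
theorem bound_near {n t m α u : ℝ} {l : ℕ} (hn : 0 < n) (ht : 0 < t) (hu0 : 0 ≤ u) (hu1 : u ≤ 1)
    (h1 : t / 2 ≤ α) (h2 : α ≤ t) (h3 : n * t / 2 ≤ m) (h4 : m ≤ n * t) :
    (n * t) ^ u * t ^ l / 2 ^ (l + 1) ≤ m ^ u * α ^ l ∧ m ^ u * α ^ l ≤ (n * t) ^ u * t ^ l := by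
  have hnt : 0 < n * t := mul_pos hn ht
  have hm : 0 ≤ m := (by positivity : (0 : ℝ) ≤ n * t / 2).trans h3
  have hα : 0 ≤ α := (by positivity : (0 : ℝ) ≤ t / 2).trans h1
  constructor
  · have h5 : (n * t) ^ u / 2 ≤ m ^ u := by
      calc (n * t) ^ u / 2 ≤ (n * t) ^ u / 2 ^ u := by
            refine div_le_div_of_nonneg_left (by positivity) (by positivity) ?_
            calc (2 : ℝ) ^ u ≤ 2 ^ (1 : ℝ) := Real.rpow_le_rpow_of_exponent_le (by norm_num) hu1
              _ = 2 := Real.rpow_one 2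
        _ = (n * t / 2) ^ u := (Real.div_rpow hnt.le (by norm_num) u).symm
        _ ≤ m ^ u := Real.rpow_le_rpow (by positivity) h3 hu0
    have h6 : t ^ l / 2 ^ l ≤ α ^ l := by
      rw [← div_pow]
      exact pow_le_pow_left₀ (by positivity) h1 l
    calc (n * t) ^ u * t ^ l / 2 ^ (l + 1) = ((n * t) ^ u / 2) * (t ^ l / 2 ^ l) := by
          rw [pow_succ]; field_simp
      _ ≤ _ := mul_le_mul h5 h6 (by positivity) (by positivity)
  · exact mul_le_mul (Real.rpow_le_rpow hm h4 hu0) (pow_le_pow_left₀ hα h2 l) (by positivity)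
      (by positivity)

end WordRAM

namespace WordRAM

/-! ## The graphs belong to the class -/

theorem _root_.Red.graph_bounds {D : Red} (hD : D.Valid) {n a h : ℕ} {t η γ : ℝ} (hn : 0 < n)
    (ht : 0 < t) (hη0 : 0 < η) (hη1 : η ≤ 1 / 4) (hkN : D.k * D.N ≤ a) (ha1 : (1 - η) * t ≤ a)
    (ha2 : a ≤ t) (hU : (D.U : ℝ) + a ≤ η * n) (hγ0 : 0 ≤ γ) (hγ1 : γ ≤ 1) (k : ℕ) :
    (1 - 2 * η) * t ≤ arboricity (D.graph h a n) ∧ (arboricity (D.graph h a n) : ℝ) ≤ t ∧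
      (n * t) ^ (1 - γ) * t ^ (k - 2) / 2 ^ (k - 2 + 1) ≤ listingBound k γ n (D.graph h a n) ∧
      listingBound k γ n (D.graph h a n) ≤ (n * t) ^ (1 - γ) * t ^ (k - 2) := by
  have hn' : (0 : ℝ) < n := by exact_mod_cast hn
  have h1 := D.arboricity_graph_le (h := h) (n := n) hkN (Nat.mul_pos (by have := hD.hk; omega) hD.hN)
  have hUn : D.U + a ≤ n := by
    have : ((D.U + a : ℕ) : ℝ) ≤ n := by push_cast; nlinarith
    exact_mod_cast this
  have h2 := D.le_edgeCount_graph (h := h) hUn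
  have h3 : (a : ℝ) * (n - D.U - a) ≤ edgeCount (D.graph h a n) := by
    refine le_trans (le_of_eq ?_) (Nat.cast_le.2 h2)
    rw [Nat.sub_sub, Nat.cast_mul, Nat.cast_sub hUn]
    push_cast
    ring
  obtain ⟨b1, b2, b3, b4⟩ := near_of_bounds (α := (arboricity (D.graph h a n) : ℝ)) hn' ht hη0 hη1 ha1 ha2 hU h3
    (by exact_mod_cast h1.2) (by exact_mod_cast h1.1)
  have hnt : 0 < n * t := mul_pos hn' ht
  refine ⟨b1, b2, ?_⟩
  exact bound_near hn' ht (by linarith) (by linarith) (by nlinarith) b2 (by nlinarith) b4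

/-- Comparison of exponents: `N = Z ^ p1` is negligible against `t = n ^ (1 - δ)`, and both `t` and
the number of instance vertices, of order `Z ^ (q - 1)`, against `n`. -/
theorem eventually_sizes {q p1 : ℕ} {δ : ℝ} (h0 : 0 < δ) (hq : 0 < q)
    (hp1 : (p1 : ℝ) < q * (1 - δ)) (c M : ℝ) {η : ℝ} (hη : 0 < η) :
    ∀ᶠ x : ℕ in atTop, M * ((2 : ℝ) ^ x) ^ p1 ≤ ((2 ^ x) ^ q) ^ (1 - δ) ∧
      c * (2 ^ x) ^ (q - 1) + ((2 ^ x) ^ q) ^ (1 - δ) ≤ η * (2 ^ x) ^ q := by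
  have hZ : Tendsto (fun x : ℕ => (2 : ℝ) ^ x) atTop atTop :=
    tendsto_pow_atTop_atTop_of_one_lt (by norm_num)
  have hq0 : (0 : ℝ) < q := by exact_mod_cast hq
  have t1 : Tendsto (fun x : ℕ => ((2 : ℝ) ^ x) ^ (q * (1 - δ) - p1)) atTop atTop :=
    (tendsto_rpow_atTop (by linarith)).comp hZ
  have t2 : Tendsto (fun x : ℕ => c * ((2 : ℝ) ^ x) ^ (-(1 : ℝ)) + ((2 : ℝ) ^ x) ^ (-(q * δ)))
      atTop (𝓝 (c * 0 + 0)) :=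
    (((tendsto_rpow_neg_atTop one_pos).comp hZ).const_mul c).add
      ((tendsto_rpow_neg_atTop (mul_pos hq0 h0)).comp hZ)
  rw [mul_zero, add_zero] at t2
  filter_upwards [t1.eventually_ge_atTop M, t2.eventually (ge_mem_nhds hη)] with x h1 h2
  have hx : (0 : ℝ) < 2 ^ x := by positivity
  have e1 : (((2 : ℝ) ^ x) ^ q) ^ (1 - δ) = ((2 : ℝ) ^ x) ^ (q * (1 - δ)) := by
    rw [← Real.rpow_natCast ((2 : ℝ) ^ x) q, ← Real.rpow_mul hx.le]
  constructor
  · rw [e1]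
    calc M * ((2 : ℝ) ^ x) ^ p1 ≤ ((2 : ℝ) ^ x) ^ (q * (1 - δ) - p1) * (2 ^ x) ^ p1 :=
          mul_le_mul_of_nonneg_right h1 (by positivity)
      _ = _ := by
          rw [← Real.rpow_natCast ((2 : ℝ) ^ x) p1, ← Real.rpow_add hx]
          congr 1; ring
  · refine le_trans (le_of_eq ?_) (mul_le_mul_of_nonneg_right h2 (by positivity))
    rw [e1, add_mul, mul_assoc, ← Real.rpow_natCast ((2 : ℝ) ^ x) q,
      ← Real.rpow_natCast ((2 : ℝ) ^ x) (q - 1), ← Real.rpow_add hx, ← Real.rpow_add hx,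
      Nat.cast_sub hq]
    congr 3
    · push_cast; ring
    · ring

/-- A multiple of `N` that is close to `t`. -/
theorem exists_multiple {t η : ℝ} {N Z k : ℕ} (hN : 0 < N) (h1 : N ≤ η * t) (h2 : (k + 1) * N ≤ t)
    (h3 : t ≤ Z * N) :
    ∃ i, i < Z ∧ k ≤ i ∧ (1 - η) * t ≤ (i * N : ℕ) ∧ ((i * N : ℕ) : ℝ) ≤ t := by
  have hN' : (0 : ℝ) < N := by exact_mod_cast hN
  have h4 : (k : ℝ) + 1 ≤ t / N := (le_div_iff₀ hN').2 h2
  have h5 : t / N ≤ Z := (div_le_iff₀ hN').2 h3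
  have hk : (0 : ℝ) ≤ k := Nat.cast_nonneg k
  obtain ⟨i, hi⟩ : ∃ i, ⌈t / N⌉₊ = i + 1 :=
    Nat.exists_eq_succ_of_ne_zero (Nat.ceil_pos.2 (by linarith)).ne'
  have e1 := Nat.le_ceil (t / N)
  have e2 := Nat.ceil_lt_add_one (a := t / N) (by linarith)
  rw [hi] at e1 e2
  push_cast at e1 e2
  have e3 : t ≤ (i + 1) * N := (div_le_iff₀ hN').1 e1
  have e4 : (i : ℝ) * N ≤ t := (le_div_iff₀ hN').1 (by linarith)
  refine ⟨i, ?_, ?_, ?_, ?_⟩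
  · have : i + 1 ≤ Z := by rw [← hi]; exact Nat.ceil_le.2 h5
    omega
  · have : (k : ℝ) ≤ i := by linarith
    exact_mod_cast this
  · push_cast; linarith
  · push_cast; exact e4

end WordRAM

namespace WordRAM

namespace Pm

variable {p : Pm} {P : Cmd}

/-- For large inputs, the promise for the listing program holds with good probability. -/
theorem eventually_good (hF : p.Fits) {δ γ τ A : ℝ} (h0 : 0 < δ) (hγ0 : 0 ≤ γ) (hγ1 : γ ≤ 1)
    (hτ : 0 < τ) (hp1 : (p.p1 : ℝ) < p.q * (1 - δ)) (hp2 : p.q * (1 - δ) ≤ p.p1 + 1)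
    (hck : p.ck + 3 = (p.p1 + p.p2) * p.k) (h7 : 7 ≤ (p.p1 + p.p2) * p.k)
    (hβ : p.q * ((2 - δ) * (1 - γ) + (p.k - 2 : ℕ) * (1 - δ)) = (((p.p1 + p.p2) * p.k : ℕ) : ℝ) - 4)
    {n₀ : ℕ} (hP : ∀ n ≥ n₀, ∀ G : SimpleGraph (Fin n), (ArboricityNear δ τ n G ∧
      (cliqueCount p.k G : ℝ) ≤ (n : ℝ) ^ (-(1 / p.q : ℝ)) * listingBound p.k γ n G) →
      ∃ T : ℕ, (T : ℝ) ≤ A * listingBound p.k γ n G ∧ SucceedsWithin (wordLength p.cv n) P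
        (encodeGraph G (wordLength p.cv n)) T (ListsAllCliques p.k G)) :
    ∀ᶠ x : ℕ in atTop, ∀ V (I : WeightedGraph p.k V), V < (2 ^ x) ^ (p.p1 + p.p2) →
      HasZero x I → ∀ w, (2 ^ x) ^ (8 + p.c1) ∣ 2 ^ w → ((2 ^ x) ^ (p.p1 + p.p2)) ^ p.k ≤
        ((p.red I x).zeroTuples ((2 ^ x) ^ (p.p1 + p.p2))).card * (2 ^ x) ^ 6 ∨
      ∃ j0, j0 + 1 < 2 * 2 ^ x ∧ Good I w x (wordLength p.cv ((2 ^ x) ^ p.q)) P j0 ∧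
        Good I w x (wordLength p.cv ((2 ^ x) ^ p.q)) P (j0 + 1) := by
  -- The arboricity will lie between `(1 - 2 * η) * t` and `t`.
  set η : ℝ := min (1 / 4) (τ / 2) with hη
  have hη0 : 0 < η := lt_min (by norm_num) (by linarith)
  have hη1 : η ≤ 1 / 4 := min_le_left _ _
  have hη2 : 2 * η ≤ τ := by have := min_le_right (1 / 4 : ℝ) (τ / 2); linarith
  have hU := hF.hU
  have hk := hF.hk
  have hE3 := hF.three_le_tri
  have hq : 0 < p.q := by omega
  have hq0 : (0 : ℝ) < p.q := by exact_mod_cast hq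
  have hZ : Tendsto (fun x : ℕ => (2 : ℝ) ^ x) atTop atTop :=
    tendsto_pow_atTop_atTop_of_one_lt (by norm_num)
  have hZn : Tendsto (fun x : ℕ => 2 ^ x) atTop atTop :=
    tendsto_pow_atTop_atTop_of_one_lt (by norm_num)
  filter_upwards [eventually_sizes h0 hq hp1 ((tri p.k * p.k : ℕ) : ℝ) (p.k + 1) hη0,
    eventually_sizes h0 hq hp1 0 (1 / η) hη0, hZ.eventually_gt_atTop A,
    hZn.eventually_ge_atTop (tri p.k * p.k + 6), hZn.eventually_ge_atTop (8 * tri p.k),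
    hZn.eventually_ge_atTop (2 * 2 ^ (p.k - 2 + 1)), hZn.eventually_ge_atTop n₀] with
    x s1 s2 s3 s4 s5 s6 s7 V I hV hz w hw
  obtain ⟨s1, s8⟩ := s1
  have s2 := s2.1
  have hD : (p.red I x).Valid := hF.valid s4 hV
  have hZ1 : 1 ≤ 2 ^ x := Nat.one_le_two_pow
  have hx1 : 1 ≤ x := by
    rcases Nat.eq_zero_or_pos x with rfl | h0
    · simp at s4
    · exact h0
  set e := (p.p1 + p.p2) * p.k with he
  rw [or_iff_not_imp_left, ← pow_mul, ← he]
  intro hsmall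
  -- With more zero tuples than this the first alternative, sampling, would apply.
  have hzt : ((p.red I x).zeroTuples ((2 ^ x) ^ (p.p1 + p.p2))).card ≤ (2 ^ x) ^ (e - 6) := by
    by_contra hcon
    refine hsmall ?_
    calc (2 ^ x) ^ e = (2 ^ x) ^ (e - 6) * (2 ^ x) ^ 6 := by rw [← pow_add]; congr 1; omega
      _ ≤ _ := Nat.mul_le_mul_right _ (by omega)
  set Z : ℝ := 2 ^ x with hZdef
  have hZ0 : 0 < Z := by positivity
  have hZr : 1 ≤ Z := one_le_pow₀ (by norm_num)
  set t : ℝ := (Z ^ p.q) ^ (1 - δ) with ht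
  have ht0 : 0 < t := by positivity
  -- The left side will have `i * N` vertices: `k ≤ i` provides the labels for the instances, and `i
  -- < Z` puts this size among those tried.
  obtain ⟨i, hi1, hi2, hi3, hi4⟩ := exists_multiple (t := t) (η := η) (N := (2 ^ x) ^ p.p1)
    (Z := 2 ^ x) (k := p.k) (by positivity)
    (by
      push_cast
      rw [← hZdef]
      rw [one_div, inv_mul_le_iff₀ hη0] at s2
      exact s2)
    (by push_cast; exact s1)
    (by
      push_cast
      rw [← hZdef, ← pow_succ', ht, ← Real.rpow_natCast Z p.q, ← Real.rpow_mul hZ0.le,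
        ← Real.rpow_natCast Z (p.p1 + 1)]
      refine Real.rpow_le_rpow_of_exponent_le hZr (by push_cast; exact hp2))
  have hn : (((2 ^ x) ^ p.q : ℕ) : ℝ) = Z ^ p.q := by push_cast; rfl
  -- Here `γ` enters: `hβ` makes the bound at `m = n * t`, `α = t` an exact power of `Z`.
  have hW : (Z ^ p.q * t) ^ (1 - γ) * t ^ (p.k - 2) = Z ^ (e - 4) := by
    rw [ht, ← Real.rpow_natCast (_ ^ (1 - δ)) (p.k - 2), ← Real.rpow_mul (by positivity),
      Real.mul_rpow (by positivity) (by positivity), ← Real.rpow_mul (by positivity),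
      ← Real.rpow_add (by positivity), ← Real.rpow_add (by positivity), ← Real.rpow_natCast Z p.q,
      ← Real.rpow_mul hZ0.le, ← Real.rpow_natCast Z (e - 4), Nat.cast_sub (by omega : 4 ≤ e)]
    congr 1
    rw [Nat.cast_ofNat, ← hβ]
    ring
  have key : ∀ j, j / 2 = i → Good I w x (wordLength p.cv ((2 ^ x) ^ p.q)) P j := by
    intro j hj
    have hmod := hF.modulus hx1 hV
    -- The number `Z ^ (e - 7)` of tolerated false tuples suits Markov's inequality: times `R = Z ^
    -- 8` it is `Z ^ (e + 1)`, which exceeds the `Z ^ e` tuples by the factor `Z ≥ 8 * tri k`.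
    refine ⟨hz, {h | ((p.red I x).hashed h ((2 ^ x) ^ (p.p1 + p.p2))).card ≤
      ((p.red I x).zeroTuples ((2 ^ x) ^ (p.p1 + p.p2))).card + (2 ^ x) ^ (e - 7)}, ?_, ?_⟩
    · refine (Red.good_hash hD (Y := (2 ^ x) ^ (p.p1 + p.p2)) (B := (2 ^ x) ^ (e - 7)) (w := w) ?_
        (by positivity) ?_ ?_).trans ?_
      · change 8 * tri p.k * ((2 ^ x) ^ (p.p1 + p.p2)) ^ p.k ≤ (2 ^ x) ^ (e - 7) * (2 ^ x) ^ 8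
        rw [← pow_mul, ← he]
        calc 8 * tri p.k * (2 ^ x) ^ e ≤ 2 ^ x * (2 ^ x) ^ e := Nat.mul_le_mul_right _ s5
          _ = (2 ^ x) ^ (e + 1) := (pow_succ' _ _).symm
          _ = _ := by rw [← pow_add]; congr 1; omega
      · change (2 ^ x) ^ 8 * (2 ^ x) ^ p.c1 ∣ 2 ^ w
        rwa [← pow_add]
      · exact WeightedGraph.gcd_wsum_dvd (c := x * (8 + p.c1)) (b := x * p.c1)
          (by rw [pow_mul, pow_add]) (by rw [pow_mul]) hmod
      · rw [← Set.ncard_coe_finset]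
        refine Nat.cast_le.2 (le_of_eq ?_)
        congr 1
        ext r
        simp
    · intro h hh
      have hh : ((p.red I x).hashed h ((2 ^ x) ^ (p.p1 + p.p2))).card ≤
        ((p.red I x).zeroTuples ((2 ^ x) ^ (p.p1 + p.p2))).card + (2 ^ x) ^ (e - 7) := hh
      have hcc := (Red.cliqueCount_le hD hk (a := i * (2 ^ x) ^ p.p1) (n := (2 ^ x) ^ p.q) (h := h)
        (Y := (2 ^ x) ^ (p.p1 + p.p2)) hV.le)
      have hG : graphOf x I j h = (p.red I x).graph h (i * (2 ^ x) ^ p.p1) ((2 ^ x) ^ p.q) := by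
        rw [graphOf, nA, hj]
      rw [← hG] at hcc
      obtain ⟨b1, b2, b3, b4⟩ := Red.graph_bounds hD (n := (2 ^ x) ^ p.q)
        (a := i * (2 ^ x) ^ p.p1) (h := h) (t := t) (η := η) (γ := γ) (by positivity) ht0 hη0 hη1
        (Nat.mul_le_mul_right _ hi2) hi3 hi4
        (by
          refine le_trans (add_le_add ?_ hi4) (s8.trans (le_of_eq ?_))
          · rw [red_U]
            push_cast
            rw [← hZdef]
            refine mul_le_mul_of_nonneg_left ?_ (by positivity)
            exact pow_le_pow_right₀ hZr (by omega)
          · rw [hn]) hγ0 hγ1 p.k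
      rw [← hG] at b1 b2 b3 b4
      rw [hn, hW] at b3 b4
      obtain ⟨T, hT1, hT2⟩ := hP ((2 ^ x) ^ p.q) (s7.trans (by
          calc 2 ^ x = (2 ^ x) ^ 1 := (pow_one _).symm
            _ ≤ _ := Nat.pow_le_pow_right hZ1 hq)) (graphOf x I j h) (by
        refine ⟨⟨?_, ?_⟩, ?_⟩
        · rw [hn]
          exact (mul_le_mul_of_nonneg_right (by linarith) ht0.le).trans b1
        · rw [hn]
          exact b2.trans (le_mul_of_one_le_left ht0.le (by linarith))
        -- Two powers of `Z` below the bound: one is spent on `f(n) = 1 / Z`, the other on the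
        -- constants.
        · have e1 : cliqueCount p.k (graphOf x I j h) ≤ 2 * (2 ^ x) ^ (e - 6) := by
            have : (2 ^ x) ^ (e - 7) ≤ (2 ^ x) ^ (e - 6) := Nat.pow_le_pow_right hZ1 (by omega)
            have hcc' : cliqueCount p.k (graphOf x I j h) ≤ _ := hcc
            omega
          have e2 : (cliqueCount p.k (graphOf x I j h) : ℝ) ≤ 2 * Z ^ (e - 6) := by
            rw [hZdef]; exact_mod_cast e1
          have e3 : (((2 ^ x) ^ p.q : ℕ) : ℝ) ^ (-(1 / p.q : ℝ)) = Z⁻¹ := by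
            rw [hn, ← Real.rpow_natCast Z p.q, ← Real.rpow_mul hZ0.le,
              show (p.q : ℝ) * -(1 / p.q) = -1 by field_simp, Real.rpow_neg_one]
          rw [e3]
          refine e2.trans (le_trans ?_ (mul_le_mul_of_nonneg_left b3 (by positivity)))
          have e4 : (2 : ℝ) * 2 ^ (p.k - 2 + 1) ≤ Z := by rw [hZdef]; exact_mod_cast s6
          rw [show e - 4 = (e - 6) + 1 + 1 by omega, pow_succ, pow_succ, ← mul_div_assoc,
            le_div_iff₀ (by positivity)]
          calc 2 * Z ^ (e - 6) * 2 ^ (p.k - 2 + 1) = Z ^ (e - 6) * (2 * 2 ^ (p.k - 2 + 1)) := by ring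
            _ ≤ Z ^ (e - 6) * Z := mul_le_mul_of_nonneg_left e4 (by positivity)
            _ = _ := by field_simp)
      refine ⟨T, ?_, hT2⟩
      have hb0 : 0 ≤ listingBound p.k γ _ (graphOf x I j h) := le_trans (by positivity) b3
      -- The clock allows `Z ^ (e - 3)` ticks, and `Z` exceeds the constant `A`.
      have hT3 : (T : ℝ) < Z ^ p.ck := by
        rcases le_or_gt A 0 with hA | hA
        · exact (hT1.trans (mul_nonpos_of_nonpos_of_nonneg hA hb0)).trans_lt (by positivity)
        · calc (T : ℝ) ≤ A * Z ^ (e - 4) := hT1.trans (mul_le_mul_of_nonneg_left b4 hA.le)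
            _ < Z * Z ^ (e - 4) := mul_lt_mul_of_pos_right s3 (by positivity)
            _ = Z ^ p.ck := by rw [← pow_succ']; congr 1; omega
      rw [hZdef] at hT3
      exact_mod_cast hT3
  -- The rounds `2 * i` and `2 * i + 1` use the same left side.
  exact ⟨2 * i, by omega, key _ (by omega), key _ (by omega)⟩

end Pm

end WordRAM

/-! ### From a listing algorithm to Exact-k-Clique -/

namespace WordRAM

/-- The exponent `x` for inputs of size `V`. -/
theorem exists_size {e V : ℕ} (he : 1 ≤ e) :
    ∃ x, V < (2 ^ x) ^ e ∧ ∀ i < x, (2 ^ i) ^ e ≤ V := by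
  classical
  have h : ∃ x, V < (2 ^ x) ^ e := ⟨V, Nat.lt_two_pow_self.trans_le
    (by simpa using Nat.pow_le_pow_right (Nat.one_le_two_pow (n := V)) he)⟩
  exact ⟨Nat.find h, Nat.find_spec h, fun i hi => not_lt.1 (Nat.find_min h hi)⟩

theorem tendsto_natCast_rpow_neg {q : ℕ} (hq : 0 < q) :
    Tendsto (fun n : ℕ => (n : ℝ) ^ (-(1 / q : ℝ))) atTop (𝓝 0) :=
  (tendsto_rpow_neg_atTop (one_div_pos.2 (by exact_mod_cast hq))).comp
    tendsto_natCast_atTop_atTop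

/-- A listing algorithm for the graphs of the reduction decides Exact-`k`-Clique. -/
theorem exactClique_of_listing {k q p1 p2 : ℕ} (hk : 3 ≤ k) {δ γ τ : ℝ} (h0 : 0 < δ) (hγ0 : 0 ≤ γ)
    (hγ1 : γ ≤ 1) (hτ : 0 < τ) (hp : 1 ≤ p1) (hp1 : (p1 : ℝ) < q * (1 - δ))
    (hp2 : q * (1 - δ) ≤ p1 + 1) (hU : 8 * (tri k - 1) + p2 * k + p1 + 1 ≤ q)
    (ht : p1 + q + 3 ≤ (p1 + p2) * k) (h7 : 7 ≤ (p1 + p2) * k)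
    (hβ : q * ((2 - δ) * (1 - γ) + (k - 2 : ℕ) * (1 - δ)) = (((p1 + p2) * k : ℕ) : ℝ) - 4)
    (h : CliqueListingInTime k (fun n G => ArboricityNear δ τ n G ∧
      (cliqueCount k G : ℝ) ≤ (n : ℝ) ^ (-(1 / q : ℝ)) * listingBound k γ n G) (listingBound k γ)) :
    ExactCliqueInTime k (fun n => (n : ℝ) ^ ((k : ℝ) - 1 / (p1 + p2 : ℕ))) := by
  obtain ⟨P, cv, A, n₀, hP⟩ := h
  obtain ⟨B, hB⟩ := P.exists_bdd
  -- One power of `Z` above the listing time, and two below the time that is aimed at, as there are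
  -- `2 * Z` rounds.
  set ck := (p1 + p2) * k - 3 with hck
  let p : Pm := ⟨k, p1, p2, q, 100 * k * (p1 + p2) + tri k, ck, 2 * q + cv + q * cv + ck + k + 4, cv⟩
  have hF : p.Fits := ⟨hk, hU, hp, rfl, rfl⟩
  obtain ⟨c, hc⟩ := Pm.main_correct hF hB
  obtain ⟨C, hC⟩ := Pm.exists_mainT_le p B P ht (show ck + 3 = (p1 + p2) * k by omega) h7
  obtain ⟨x0, hx0⟩ := eventually_atTop.1 ((Pm.eventually_good hF h0 hγ0 hγ1 hτ hp1 hp2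
    (show ck + 3 = (p1 + p2) * k by omega) h7 hβ hP).and
    ((tendsto_pow_atTop_atTop_of_one_lt (r := 2) (by norm_num)).eventually_ge_atTop
      (tri k * k + 6)))
  -- Inputs of at least this size have `x > x0`, so all asymptotic statements apply to them.
  refine ⟨p.main B P, c, C * 2 ^ ((p1 + p2) * k - 1), (2 ^ x0) ^ (p1 + p2), fun V hV I => ?_⟩
  obtain ⟨x, hx1, hx2⟩ := exists_size (e := p1 + p2) (V := V) (by omega)
  have hx : x0 < x := by
    by_contra hcon
    have h1 : 2 ^ x ≤ 2 ^ x0 := Nat.pow_le_pow_right (by norm_num) (by omega)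
    have h2 := Nat.pow_le_pow_left h1 (p1 + p2)
    omega
  obtain ⟨hg, hs⟩ := hx0 x hx.le
  refine ⟨p.mainT x B P, ?_, hc x V I hs hx1 hx2 (hg V I hx1)⟩
  have e1 : (p.mainT x B P : ℝ) ≤ C * (2 ^ x) ^ ((p1 + p2) * k - 1) := by exact_mod_cast hC x
  have e2 := Pm.pow_le_rpow (V := V) (x := x) (p := p1 + p2) (k := k) (by omega) (by omega) (by omega)
    (hx2 (x - 1) (by omega))
  refine e1.trans ?_
  rw [mul_assoc]
  exact mul_le_mul_of_nonneg_left e2 (Nat.cast_nonneg _)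

end WordRAM

theorem mainTheorem2 (k : ℕ) (hk : 3 ≤ k) (hyp : ExactCliqueHypothesis k) :
    ∃ C : ℝ, 0 < C ∧ ∀ δ : ℝ, 0 < δ → δ < 1 →
      ∃ γ : ℝ, 0 ≤ γ ∧ γ ≤ C * δ ∧
      ∃ f : ℕ → ℝ, Tendsto f atTop (𝓝 0) ∧
      ∀ τ : ℝ, 0 < τ → τ < 1 →
        ¬ CliqueListingInTime k (ArboricityNear δ τ) (listingBound k γ) ∧
        ¬ CliqueListingInTime k
            (fun n G => ArboricityNear δ τ n G ∧
              (cliqueCount k G : ℝ) ≤ f n * listingBound k γ n G)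
            (listingBound k γ) := by
  refine ⟨1, one_pos, fun δ h0 h1 => ?_⟩
  obtain ⟨q, p1, p2, hp, hp1, hp2, hU, ht, h7, hlo, hhi⟩ := WordRAM.exists_exponents hk h0 h1
  have hq : 0 < q := by omega
  have hq0 : (0 : ℝ) < q := by exact_mod_cast hq
  have hδ : (0 : ℝ) < 2 - δ := by linarith
  set e : ℝ := (((p1 + p2) * k : ℕ) : ℝ) - 4 with he
  have hk2 : ((k - 2 : ℕ) : ℝ) = k - 2 := by rw [Nat.cast_sub (by omega)]; norm_num
  -- The value of `1 - γ` for which the listing bound is `Z ^ e` with this `e`, already diminished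
  -- by 4. The bounds `hlo` and `hhi` say exactly that `1 - δ ≤ u ≤ 1`, so that `γ ≤ δ` and `C = 1`
  -- works.
  set u : ℝ := (e / q - (k - 2) * (1 - δ)) / (2 - δ) with hu
  have hu0 : 1 - δ ≤ u := by
    rw [hu, le_div_iff₀ hδ]
    have : (k - δ) * (1 - δ) ≤ e / q := by rw [le_div_iff₀ hq0]; linarith
    linarith
  have hu1 : u ≤ 1 := by
    rw [hu, div_le_one hδ]
    have : e / q ≤ 1 + (k - 1) * (1 - δ) := by rw [div_le_iff₀ hq0]; linarith
    linarith
  have hβ : q * ((2 - δ) * (1 - (1 - u)) + (k - 2 : ℕ) * (1 - δ)) = e := by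
    rw [hk2, sub_sub_cancel, hu]
    field_simp
    ring
  refine ⟨1 - u, by linarith, by linarith, fun n => (n : ℝ) ^ (-(1 / q : ℝ)),
    WordRAM.tendsto_natCast_rpow_neg hq, fun τ hτ _ => ?_⟩
  have main := fun h => hyp _ (one_div_pos.2 (show (0 : ℝ) < (p1 + p2 : ℕ) by exact_mod_cast (by omega)))
    (WordRAM.exactClique_of_listing hk h0 (by linarith) (by linarith) hτ hp hp1 hp2 hU ht h7 hβ h)
  -- An algorithm for all graphs of the given arboricity also works on those with few cliques.
  refine ⟨fun h => main ?_, main⟩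
  obtain ⟨P, c, A, n₀, hP⟩ := h
  exact ⟨P, c, A, n₀, fun n hn G hG => hP n hn G hG.1⟩
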